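/- For a positive integer $n$ write $[n]=\{0,\dots,n-1\}$, and let $\log$ denote $\log_2$. A finite family $\mathcal F$ of functions from $[u]$ to $[r]$ is $k$-independent if for every $l\le k$, all distinct keys $x_1,\dots,x_l\in[u]$ and all values $y_1,\dots,y_l\in[r]$, a uniformly random $f\in\mathcal F$ satisfies $\Pr[f(x_1)=y_1\wedge\dots\wedge f(x_l)=y_l]=r^{-l}$. The model is the word RAM with word size $w\ge 1$, whose unit-cost instructions on words are addition, subtraction, bitwise operations, shifts, comparisons, and generating a uniformly random independent integer in $[s]$ for a given $s\le 2^w$ (no multiplication or division). Input and output numbers may occupy several words and are kept in separate read-only input and write-only output arrays; space is the number of memory words. There is a randomized data structure (fixed programs for selecting a family, for turning it into a member of the family, and for evaluating that member) with the following property. For all constants $A,B\in\mathbb N$ there is a constant $C$ such that the following holds for all positive integers $u\ge 2$, $r\le u^{A}$, $t$, $k\le u^{B/t}$ and every word size $w$ that is large enough to address the space used, that is, $2^w\ge C\,(1+ku^{1/t}\,t\,(\log u)/w)$. On input $u,r,t,k$ the data structure randomly selects a family $\mathcal F$ of functions from $[u]$ to $[r]$, consisting of the functions that the second program can produce, such that: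 1. The space used to represent $\mathcal F$, as well as any $f\in\mathcal F$ (working space included), is at most $C\,(1+ku^{1/t}\,t\,(\log u)/w)$ words. 2. Each evaluation of a represented function $f\in\mathcal F$ on a key of $[u]$ takes at most $C\,(1+t\log t+t(\log u)/w)$ steps, and evaluations can be repeated any number of times. 3. With probability at least $1-u^{-1/t}$ over the selection, $\mathcal F$ is a $k$-independent family. Moreover, selecting $\mathcal F$ and producing a member of it take at most $C\,(ku^{1/t}\,t\,(1+(\log u)/w)+w)$ steps each, and if $r\le 2^w$ or $r$ is a power of two, then the member produced is uniformly distributed in $\mathcal F$. -/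

import Mathlib

namespace WordRAM

/-! A randomized word RAM with word size `w` and a memory of `S` words. Only the instructions of the
restricted model are available: addition, subtraction, bitwise operations, shifts and comparisons,
but no multiplication and no division. Programs are written in a structured form; they refer to
finitely many registers, and each executed instruction or test takes one step. -/

/-- The unit-cost operations on words. -/
inductive BinOp : Type
  | add
  | sub
  | and
  | or
  | xor
  | shl
  | shr

/-- The value of an operation; arithmetic is modulo `2 ^ w`, shifts are logical. -/
def BinOp.eval {w : ℕ} : BinOp → BitVec w → BitVec w → BitVec w
  | .add, a, b => a + b
  | .sub, a, b => a - b
  | .and, a, b => a &&& b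
  | .or, a, b => a ||| b
  | .xor, a, b => a ^^^ b
  | .shl, a, b => a <<< b.toNat
  | .shr, a, b => a >>> b.toNat

/-- Tests on the contents of two registers. -/
inductive Test : Type
  | lt (a b : ℕ)
  | eq (a b : ℕ)

/-- Programs. All arguments `d a b` are names of registers. -/
inductive Cmd : Type
  /-- `d := n mod 2 ^ w`, for a constant `n` of the program -/
  | const (d n : ℕ)
  /-- `d := a o b` -/
  | op (o : BinOp) (d a b : ℕ)
  /-- `d := memory[a]` -/
  | load (d a : ℕ)
  /-- `memory[a] := b` -/
  | store (a b : ℕ)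
  /-- `d :=` word number `a` of the input number with index `p` -/
  | input (d p a : ℕ)
  /-- word number `a` of the output `:= b` -/
  | output (a b : ℕ)
  /-- `d :=` a fresh uniformly random integer in `[a]`, where `a = 0` stands for `2 ^ w` -/
  | rand (d a : ℕ)
  | seq (c₁ c₂ : Cmd)
  | branch (b : Test) (c₁ c₂ : Cmd)
  | loop (b : Test) (c : Cmd)

/-- The memory: `S` words. -/
abbrev Mem (w S : ℕ) : Type := Fin S → BitVec w

/-- The state of the machine: registers, memory and output array. -/
structure State (w S : ℕ) : Type where
  reg : ℕ → BitVec w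
  mem : Mem w S
  out : ℕ → BitVec w

/-- A configuration: the commands still to be executed, and the state. The machine has halted when
no command is left. -/
structure Config (w S : ℕ) : Type where
  todo : List Cmd
  state : State w S

/-- Truth value of a test. -/
def Test.holds {w S : ℕ} (s : State w S) : Test → Prop
  | .lt a b => (s.reg a).toNat < (s.reg b).toNat
  | .eq a b => s.reg a = s.reg b

/-- Assignment to a register. -/
def State.setReg {w S : ℕ} (s : State w S) (d : ℕ) (v : BitVec w) : State w S :=
  { s with reg := Function.update s.reg d v }

/-- Word number `i` of the natural number `x` (little-endian, zero-extended). -/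
def wordOf (w x i : ℕ) : BitVec w := BitVec.ofNat w (x / 2 ^ (w * i))

/-- Number of `w`-bit words of the natural number `x`. -/
def wordLen (w x : ℕ) : ℕ := (Nat.digits (2 ^ w) x).length

/-- The size of the range of a random integer, given the argument of the instruction `rand`. -/
def randRange {w : ℕ} (v : BitVec w) : ℕ := if v.toNat = 0 then 2 ^ w else v.toNat

theorem randRange_pos {w : ℕ} (v : BitVec w) : 0 < randRange v := by
  unfold randRange
  split_ifs with h
  · positivity
  · exact Nat.pos_of_ne_zero h

open Classical in
/-- One step of the machine; `inp` lists the input numbers. An access outside of the memory makes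
the machine hang. -/
noncomputable def step {w S : ℕ} (inp : ℕ → ℕ) : Config w S → PMF (Config w S)
  | ⟨[], s⟩ => PMF.pure ⟨[], s⟩
  | ⟨.const d n :: K, s⟩ => PMF.pure ⟨K, s.setReg d (BitVec.ofNat w n)⟩
  | ⟨.op o d a b :: K, s⟩ => PMF.pure ⟨K, s.setReg d (o.eval (s.reg a) (s.reg b))⟩
  | ⟨.load d a :: K, s⟩ =>
      if h : (s.reg a).toNat < S then
        PMF.pure ⟨K, s.setReg d (s.mem ⟨(s.reg a).toNat, h⟩)⟩
      else PMF.pure ⟨.load d a :: K, s⟩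
  | ⟨.store a b :: K, s⟩ =>
      if h : (s.reg a).toNat < S then
        PMF.pure ⟨K, { s with mem := Function.update s.mem ⟨(s.reg a).toNat, h⟩ (s.reg b) }⟩
      else PMF.pure ⟨.store a b :: K, s⟩
  | ⟨.input d p a :: K, s⟩ => PMF.pure ⟨K, s.setReg d (wordOf w (inp p) (s.reg a).toNat)⟩
  | ⟨.output a b :: K, s⟩ =>
      PMF.pure ⟨K, { s with out := Function.update s.out (s.reg a).toNat (s.reg b) }⟩
  | ⟨.rand d a :: K, s⟩ =>
      (PMF.uniformOfFinset (Finset.range (randRange (s.reg a)))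
        (Finset.nonempty_range_iff.2 (randRange_pos (s.reg a)).ne')).map
        (fun n => ⟨K, s.setReg d (BitVec.ofNat w n)⟩)
  | ⟨.seq c₁ c₂ :: K, s⟩ => PMF.pure ⟨c₁ :: c₂ :: K, s⟩
  | ⟨.branch b c₁ c₂ :: K, s⟩ => PMF.pure ⟨(if b.holds s then c₁ else c₂) :: K, s⟩
  | ⟨.loop b c :: K, s⟩ => PMF.pure ⟨if b.holds s then c :: .loop b c :: K else K, s⟩

/-- The distribution of the configuration after `T` steps. -/
noncomputable def stepN {w S : ℕ} (inp : ℕ → ℕ) : ℕ → Config w S → PMF (Config w S)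
  | 0, c => PMF.pure c
  | T + 1, c => (step inp c).bind (stepN inp T)

/-- The distribution of the configuration after running the program `P` for `T` steps on the input
`inp`, starting with the memory `m` and the first registers filled with the numbers in `args`. -/
noncomputable def run {w S : ℕ} (P : Cmd) (inp : ℕ → ℕ) (args : List ℕ) (m : Mem w S) (T : ℕ) :
    PMF (Config w S) :=
  stepN inp T ⟨[P], ⟨fun i => BitVec.ofNat w (args.getD i 0), m, fun _ => 0⟩⟩

/-- Whatever the random choices are, the configuration has halted. -/
def AlwaysHalted {w S : ℕ} (p : PMF (Config w S)) : Prop := ∀ c ∈ p.support, c.todo = []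

/-- The distribution of the contents of the memory. -/
noncomputable def memLaw {w S : ℕ} (p : PMF (Config w S)) : PMF (Mem w S) :=
  p.map fun c => c.state.mem

/-- A data structure for families of hash functions: a program that selects (a representation of) a
family, a program that turns it into a representation of a member of the family, and a program that
evaluates the represented member. -/
structure HashProgram : Type where
  select : Cmd
  sample : Cmd
  eval : Cmd

variable {w S : ℕ}

/-- The program `select` run for `T` steps on the parameters `u r t k`, which are read as multi-word
input numbers. Initially the memory is zero, and the first registers hold the word size and the
numbers of words of the parameters. -/
noncomputable def HashProgram.runSelect (D : HashProgram) (w S u r t k T : ℕ) :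
    PMF (Config w S) :=
  run D.select (fun p => [u, r, t, k].getD p 0)
    [w, wordLen w u, wordLen w r, wordLen w t, wordLen w k] (fun _ => 0) T

/-- The program `sample` run for `T` steps on the memory `m`. -/
noncomputable def HashProgram.runSample (D : HashProgram) (m : Mem w S) (T : ℕ) :
    PMF (Config w S) :=
  run D.sample (fun _ => 0) [] m T

/-- The program `eval` run for `T` steps on the memory `m` and the key `x`. -/
noncomputable def HashProgram.runEval (D : HashProgram) (m : Mem w S) (x T : ℕ) :
    PMF (Config w S) :=
  run D.eval (fun _ => x) [] m T

/-- The memory `m` represents the function `f` with evaluation time `T`: in every sequence of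
evaluations that starts with the memory `m`, each evaluation on a key `x` halts within `T` steps
and outputs `f x`. -/
def HashProgram.Represents (D : HashProgram) (T : ℕ) {u r : ℕ} (m : Mem w S)
    (f : Fin u → Fin r) : Prop :=
  ∃ R : Set (Mem w S), m ∈ R ∧ ∀ m' ∈ R, ∀ x : Fin u, ∀ c ∈ (D.runEval m' x T).support,
    c.todo = [] ∧ (∀ i : ℕ, c.state.out i = wordOf w (f x) i) ∧ c.state.mem ∈ R

/-- The family of functions from `[u]` to `[r]` represented by the memory `m`: its members are the
functions that `sample` can produce from `m` within `T` steps, with evaluation time `T'`. -/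
def HashProgram.family (D : HashProgram) (T T' u r : ℕ) (m : Mem w S) : Set (Fin u → Fin r) :=
  {f | ∃ m' ∈ (memLaw (D.runSample m T)).support, D.Represents T' m' f}

end WordRAM

/-- A (finite) family `F` of functions is `k`-independent: for `f` uniformly random in `F`, the
values on any `l ≤ k` distinct keys are independent and uniformly distributed. -/
def KIndependent {U R : Type*} [Fintype R] (k : ℕ) (F : Set (U → R)) : Prop :=
  ∀ l ≤ k, ∀ x : Fin l → U, Function.Injective x → ∀ y : Fin l → R,
    ({f ∈ F | ∀ i, f (x i) = y i}.ncard : ℝ) / (F.ncard : ℝ) = ((Fintype.card R : ℝ) ^ l)⁻¹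

/-- The space bound, in words of `w` bits, without the leading constant. -/
noncomputable def spaceBound (u t k w : ℕ) : ℝ :=
  1 + (k : ℝ) * (u : ℝ) ^ (1 / (t : ℝ)) * t * Real.logb 2 u / w

/-- The bound on the evaluation time, without the leading constant. -/
noncomputable def evalBound (u t w : ℕ) : ℝ :=
  1 + (t : ℝ) * Real.logb 2 t + (t : ℝ) * Real.logb 2 u / w

/-- The bound on the initialization time, without the leading constant. -/
noncomputable def initBound (u t k w : ℕ) : ℝ :=
  (k : ℝ) * (u : ℝ) ^ (1 / (t : ℝ)) * t * (1 + Real.logb 2 u / w) + w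

/-! The hash function is a tree of tabulation steps. A key is cut into `2 ^ τ = O(t)` characters of
`s = 2 ^ α` bits, where `s` is of the order of `log u / t` (or 1), and the characters are the leaves
of a complete binary tree. A node of height `h` carries a vector of `2 ^ (h + δ)` fields of `M`
bits. The vector of a leaf is looked up by its character. At an inner node, every coordinate of the
two child vectors gives one index, with low bits from the left child and high bits from the right
child (`mux`), and the vector of the node is the xor of the table entries selected in this way
(`Par.vec`). The root does the same with a table of residues modulo `r`, and the negated sum is the
hash value.

Independence rests on peeling: every nonempty set of at most `k` keys contains a key that uses a
table entry which no other key of the set uses (`Peel`, `Peel.cells`). The contents of the tables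
can then be solved for key by key, so any values on `k` keys can be prescribed
(`exists_sum_cell_eq`). For fixed inner tables the hash function is a homomorphic image of the last
table, and a homomorphic image in which any values on `k` keys can be prescribed is a
`k`-independent family (`kIndependent_range_homFun`).

That peeling works at all heights is shown by induction on the height. If it works below, the
vectors of at most `k` keys are independent and uniform (`Par.card_vec_mem`), because the tables of
a height are disjoint from the lower tables that determine the indices. For uniform vectors, an
exponential moment of the number of repeated values shows that it is very unlikely that more than
half of a set `A` of keys fail to be isolated in most coordinates (`card_many_collisions`). The
probability is at most `ω ^ #A` with a tiny `ω`, which is good enough for a union bound over all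
sets `A` (`Par.card_not_spread`).

To go from children to pairs, consider a set `S` of at most `k` pairs with about `2 ^ (s * i)` first
components. Isolating a first component takes about `s * i` bits. Some isolated first component `x`
has at most about `k / 2 ^ (s * i)` partners, and isolating a partner takes the remaining bits.
Hence an index of `log k + O(s)` bits suffices, provided that it is split at the right place. As `i`
is not known in advance, the coordinates are divided into `2 ^ ℓ` scales with different splits
(`Par.mb`). In the right scale, `x` and a suitable partner are each isolated in more than half of
the coordinates, hence both in a common one (`Par.peel_slot`). The failure probabilities of all
scales and heights add up to at most `2 ^ (-64 * s)`, which is at most `u ^ (-1 / t)`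
(`Par.card_not_peels`, `Admissible.error_le`).

For the costs, `2 ^ g` fields are packed into a word, with `2 ^ τ / 2 ^ g = O(log u / w)`
(`ParBounds.Xg`). Each of the `O(log t)` heights has `O(t)` coordinates with constant overhead,
which gives `t * log t`; the numbers of words touched grow geometrically with the height and sum to
`O(t * log u / w)` (`ParBounds.levels`). Since `k ≤ u ^ (B / t)`, the number of scales, and with it
`2 ^ δ`, is bounded by a constant.

The programs are verified on states of natural numbers: weakest preconditions for loop-free code,
invariants for loops, and exact laws for loops that draw random numbers (`RDet`, `tape`). A value of
several words is drawn word by word and only its leading word is restricted, so it can exceed `r -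
1`, but not `2 * (r - 1)`. Only its residue matters, so the family is the full homomorphic image;
and the draw is uniform if the restriction on the leading word describes `[r]` exactly, as in the
cases of the last claim. -/

set_option linter.unusedSimpArgs false
set_option linter.unnecessarySeqFocus false

/-! ### Program logic for deterministic and for randomized commands. -/

namespace WordRAM

/-- A state of the machine given by natural numbers; a word is represented by any natural number
congruent to it. -/
structure NS : Type where
  reg : ℕ → ℕ
  mem : ℕ → ℕ
  out : ℕ → ℕ

namespace NS

/-- The machine state represented by natural numbers. -/
def toState (w S : ℕ) (s : NS) : State w S :=
  ⟨fun i => BitVec.ofNat w (s.reg i), fun i => BitVec.ofNat w (s.mem i),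
    fun i => BitVec.ofNat w (s.out i)⟩

/-- Assignment to a register. -/
def set (s : NS) (d v : ℕ) : NS := { s with reg := fun i => if i = d then v else s.reg i }

/-- Assignment to a memory word. -/
def put (s : NS) (a v : ℕ) : NS := { s with mem := fun i => if i = a then v else s.mem i }

/-- Assignment to an output word. -/
def emit (s : NS) (a v : ℕ) : NS := { s with out := fun i => if i = a then v else s.out i }

variable (s : NS) (d v i : ℕ)

@[simp] theorem set_reg : (s.set d v).reg i = if i = d then v else s.reg i := rfl
@[simp] theorem set_mem : (s.set d v).mem = s.mem := rfl
@[simp] theorem set_out : (s.set d v).out = s.out := rfl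
@[simp] theorem put_reg : (s.put d v).reg = s.reg := rfl
@[simp] theorem put_mem : (s.put d v).mem = fun i => if i = d then v else s.mem i := rfl
@[simp] theorem put_out : (s.put d v).out = s.out := rfl
@[simp] theorem emit_reg : (s.emit d v).reg = s.reg := rfl
@[simp] theorem emit_mem : (s.emit d v).mem = s.mem := rfl
@[simp] theorem emit_out : (s.emit d v).out = fun i => if i = d then v else s.out i := rfl

theorem toState_set {w S : ℕ} :
    (s.set d v).toState w S = (s.toState w S).setReg d (BitVec.ofNat w v) := by
  unfold toState State.setReg set
  congr 1
  funext i
  by_cases h : i = d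
  · subst h; simp
  · simp [h]

end NS

/-- Two states agree on the registers below `b`. -/
def Same (b : ℕ) (s s' : NS) : Prop := ∀ i < b, s'.reg i = s.reg i

theorem Same.refl (b : ℕ) (s : NS) : Same b s s := fun _ _ => rfl

theorem Same.trans {b : ℕ} {s t u : NS} (h : Same b s t) (h' : Same b t u) : Same b s u :=
  fun i hi => (h' i hi).trans (h i hi)

theorem Same.mono {b c : ℕ} {s t : NS} (h : Same b s t) (hc : c ≤ b) : Same c s t :=
  fun i hi => h i (lt_of_lt_of_le hi hc)

theorem Same.set {b d v : ℕ} {s t : NS} (h : Same b s t) (hd : b ≤ d) : Same b s (t.set d v) := by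
  intro i hi
  rw [NS.set_reg, if_neg (by omega)]
  exact h i hi

/-- Truth of a test on natural number states. -/
def Test.truth (s : NS) : Test → Prop
  | .lt a b => s.reg a < s.reg b
  | .eq a b => s.reg a = s.reg b

/-- The tested registers hold reduced values. -/
def Test.ok (w : ℕ) (s : NS) : Test → Prop
  | .lt a b => s.reg a < 2 ^ w ∧ s.reg b < 2 ^ w
  | .eq a b => s.reg a < 2 ^ w ∧ s.reg b < 2 ^ w

theorem Test.holds_iff {w S : ℕ} (s : NS) (b : Test) (h : b.ok w s) :
    b.holds (s.toState w S) ↔ b.truth s := by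
  cases b with
  | lt a b =>
    simp only [Test.holds, Test.truth, NS.toState, BitVec.toNat_ofNat]
    rw [Nat.mod_eq_of_lt h.1, Nat.mod_eq_of_lt h.2]
  | eq a b =>
    simp only [Test.holds, Test.truth, NS.toState]
    constructor
    · intro e
      have := congrArg BitVec.toNat e
      simpa only [BitVec.toNat_ofNat, Nat.mod_eq_of_lt h.1, Nat.mod_eq_of_lt h.2] using this
    · intro e; rw [e]

theorem stepN_add {w S : ℕ} (inp : ℕ → ℕ) (a b : ℕ) (c : Config w S) :
    stepN inp (a + b) c = (stepN inp a c).bind (stepN inp b) := by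
  induction a generalizing c with
  | zero => simp [stepN]
  | succ a ih =>
    rw [Nat.succ_add]
    simp only [stepN, PMF.bind_bind]
    congr 1
    funext c'
    exact ih c'

theorem stepN_nil {w S : ℕ} (inp : ℕ → ℕ) (T : ℕ) (s : State w S) :
    stepN inp T ⟨[], s⟩ = PMF.pure ⟨[], s⟩ := by
  induction T with
  | zero => rfl
  | succ T ih => simp [stepN, step, ih]

/-- The command `c` leads deterministically from `s` to `s'` in `j` steps. -/
def Det (w S : ℕ) (inp : ℕ → ℕ) (c : Cmd) (s s' : NS) (j : ℕ) : Prop :=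
  ∀ K, stepN inp j (⟨c :: K, s.toState w S⟩ : Config w S) = PMF.pure ⟨K, s'.toState w S⟩

/-- Total correctness with a time bound: from the state `s`, the command `c` leads within `n` steps
to a state that satisfies `Q`. -/
def Tri (w S : ℕ) (inp : ℕ → ℕ) (c : Cmd) (s : NS) (n : ℕ) (Q : NS → Prop) : Prop :=
  ∃ j ≤ n, ∃ s', Q s' ∧ Det w S inp c s s' j

section rules

variable {w S : ℕ} {inp : ℕ → ℕ} {s : NS} {n : ℕ} {Q Q' : NS → Prop}

theorem Tri.mono {c : Cmd} {m : ℕ} (h : Tri w S inp c s m Q) (hn : m ≤ n)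
    (hQ : ∀ s', Q s' → Q' s') : Tri w S inp c s n Q' := by
  obtain ⟨j, hj, s', hs, hd⟩ := h
  exact ⟨j, hj.trans hn, s', hQ _ hs, hd⟩

theorem Tri.imp {c : Cmd} (h : Tri w S inp c s n Q) (hQ : ∀ s', Q s' → Q' s') :
    Tri w S inp c s n Q' := h.mono le_rfl hQ

theorem Tri.le {c : Cmd} {m : ℕ} (h : Tri w S inp c s m Q) (hn : m ≤ n) :
    Tri w S inp c s n Q := h.mono hn fun _ h => h

theorem Tri.of_step {c : Cmd} {s' : NS} (h : ∀ K,
    step inp (⟨c :: K, s.toState w S⟩ : Config w S) = PMF.pure ⟨K, s'.toState w S⟩)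
    (hQ : Q s') : Tri w S inp c s 1 Q := by
  refine ⟨1, le_rfl, s', hQ, fun K => ?_⟩
  simp [stepN, h K]

/-- The postcondition of the first command is a triple for the second one, so no intermediate
assertion has to be named. The extra step unfolds `seq`. -/
theorem Tri.seq {c₁ c₂ : Cmd} {n₁ n₂ : ℕ}
    (h : Tri w S inp c₁ s n₁ fun s₁ => Tri w S inp c₂ s₁ n₂ Q) :
    Tri w S inp (.seq c₁ c₂) s (n₁ + n₂ + 1) Q := by
  obtain ⟨j, hj, s', ⟨j', hj', s'', hQ, hd'⟩, hd⟩ := h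
  refine ⟨1 + (j + j'), by omega, s'', hQ, fun K => ?_⟩
  rw [stepN_add]
  simp only [stepN, step, PMF.bind_pure, PMF.pure_bind]
  rw [stepN_add, hd, PMF.pure_bind, hd' K]

open Classical in
theorem Tri.branch {b : Test} {c₁ c₂ : Cmd} (hb : b.ok w s)
    (h₁ : b.truth s → Tri w S inp c₁ s n Q) (h₂ : ¬ b.truth s → Tri w S inp c₂ s n Q) :
    Tri w S inp (.branch b c₁ c₂) s (n + 1) Q := by
  have hs : ∀ K, step inp (⟨.branch b c₁ c₂ :: K, s.toState w S⟩ : Config w S) =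
      PMF.pure ⟨(if b.holds (s.toState w S) then c₁ else c₂) :: K, s.toState w S⟩ := by
    intro K
    simp only [step]
  by_cases h : b.truth s
  · obtain ⟨j, hj, s', hQ, hd⟩ := h₁ h
    refine ⟨1 + j, by omega, s', hQ, fun K => ?_⟩
    rw [stepN_add]
    simp [stepN, hs, if_pos ((Test.holds_iff s b hb).2 h), hd K]
  · obtain ⟨j, hj, s', hQ, hd⟩ := h₂ h
    refine ⟨1 + j, by omega, s', hQ, fun K => ?_⟩
    rw [stepN_add]
    simp [stepN, hs, if_neg (mt (Test.holds_iff s b hb).1 h), hd K]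

open Classical in
theorem step_loop (b : Test) (c : Cmd) (K : List Cmd) (hb : b.ok w s) :
    step inp (⟨.loop b c :: K, s.toState w S⟩ : Config w S) =
      PMF.pure ⟨if b.truth s then c :: .loop b c :: K else K, s.toState w S⟩ := by
  simp only [step]
  by_cases h : b.truth s
  · rw [if_pos h, if_pos ((Test.holds_iff s b hb).2 h)]
  · rw [if_neg h, if_neg (mt (Test.holds_iff s b hb).1 h)]

-- Every round has its own time bound `f i`: the levels of the tree have costs that depend on the
-- height, and a uniform bound would lose the geometric decay.
open Classical in
theorem Tri.loop_sum {b : Test} {c : Cmd} (I : ℕ → NS → Prop) (N : ℕ) (f : ℕ → ℕ)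
    (h₀ : I 0 s)
    (hI : ∀ i < N, ∀ s, I i s → b.ok w s ∧ b.truth s ∧ Tri w S inp c s (f i) (I (i + 1)))
    (hN : ∀ s, I N s → b.ok w s ∧ ¬ b.truth s ∧ Q s) :
    Tri w S inp (.loop b c) s (∑ i ∈ Finset.range N, (f i + 1) + 1) Q := by
  -- Induction on the number of rounds that are left: the start changes, the end stays fixed.
  suffices H : ∀ m ≤ N, ∀ s, I (N - m) s →
      Tri w S inp (.loop b c) s (∑ i ∈ Finset.Ico (N - m) N, (f i + 1) + 1) Q by
    have := H N le_rfl s (by simpa using h₀)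
    rwa [Nat.sub_self, ← Finset.range_eq_Ico] at this
  intro m
  induction m with
  | zero =>
    intro _ s hs
    obtain ⟨hok, ht, hQ⟩ := hN s (by simpa using hs)
    refine (Tri.of_step (s' := s) (fun K => ?_) hQ).le (by omega)
    rw [step_loop b c K hok, if_neg ht]
  | succ m ih =>
    intro hm s hs
    obtain ⟨hok, ht, j, hj, s₁, hs₁, hd⟩ := hI (N - (m + 1)) (by omega) s hs
    have e : N - (m + 1) + 1 = N - m := by omega
    rw [e] at hs₁
    obtain ⟨j', hj', s₂, hQ, hd'⟩ := ih (by omega) s₁ hs₁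
    refine ⟨1 + (j + j'), ?_, s₂, hQ, fun K => ?_⟩
    · rw [Finset.sum_eq_sum_Ico_succ_bot (by omega), e]
      omega
    · rw [stepN_add]
      simp only [stepN, step_loop b c K hok, if_pos ht, PMF.bind_pure, PMF.pure_bind]
      rw [stepN_add, hd, PMF.pure_bind, hd' K]

theorem Tri.loop {b : Test} {c : Cmd} (I : ℕ → NS → Prop) (N m : ℕ)
    (h₀ : I 0 s)
    (hI : ∀ i < N, ∀ s, I i s → b.ok w s ∧ b.truth s ∧ Tri w S inp c s m (I (i + 1)))
    (hN : ∀ s, I N s → b.ok w s ∧ ¬ b.truth s ∧ Q s) :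
    Tri w S inp (.loop b c) s (N * (m + 1) + 1) Q := by
  simpa using Tri.loop_sum I N (fun _ => m) h₀ hI hN

end rules

/-- The command that does nothing of interest. -/
def skip : Cmd := .const 99 0

/-- A sequence of commands. -/
def blk : List Cmd → Cmd
  | [] => skip
  | c :: cs => .seq c (blk cs)

/-- Copying a register. -/
def mov (d a : ℕ) : Cmd := .op .or d a a

/-- The running time of loop-free commands. -/
def Cmd.cost : Cmd → ℕ
  | .seq c₁ c₂ => c₁.cost + c₂.cost + 1
  | .branch _ c₁ c₂ => max c₁.cost c₂.cost + 1
  | _ => 1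

/-- Weakest preconditions of loop-free commands without random numbers. -/
def wp (w S : ℕ) (inp : ℕ → ℕ) : Cmd → NS → (NS → Prop) → Prop
  | .const d n, s, Q => Q (s.set d n)
  | .op .add d a b, s, Q => Q (s.set d (s.reg a + s.reg b))
  | .op .sub d a b, s, Q => s.reg b ≤ s.reg a ∧ Q (s.set d (s.reg a - s.reg b))
  | .op .and d a b, s, Q => Q (s.set d (s.reg a &&& s.reg b))
  | .op .or d a b, s, Q => Q (s.set d (s.reg a ||| s.reg b))
  | .op .xor d a b, s, Q => Q (s.set d (s.reg a ^^^ s.reg b))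
  | .op .shl d a b, s, Q => s.reg b < 2 ^ w ∧ Q (s.set d (s.reg a * 2 ^ s.reg b))
  | .op .shr d a b, s, Q => s.reg a < 2 ^ w ∧ s.reg b < 2 ^ w ∧ Q (s.set d (s.reg a / 2 ^ s.reg b))
  | .load d a, s, Q => s.reg a < S ∧ Q (s.set d (s.mem (s.reg a)))
  | .store a b, s, Q => s.reg a < S ∧ Q (s.put (s.reg a) (s.reg b))
  | .input d p a, s, Q => s.reg a < 2 ^ w ∧ Q (s.set d (inp p / 2 ^ (w * s.reg a) % 2 ^ w))
  | .output a b, s, Q => s.reg a < 2 ^ w ∧ Q (s.emit (s.reg a) (s.reg b))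
  | .rand _ _, _, _ => False
  | .seq c₁ c₂, s, Q => wp w S inp c₁ s fun s₁ => wp w S inp c₂ s₁ Q
  | .branch b c₁ c₂, s, Q =>
      b.ok w s ∧ (b.truth s → wp w S inp c₁ s Q) ∧ (¬ b.truth s → wp w S inp c₂ s Q)
  | .loop _ _, _, _ => False

theorem ofNat_sub_ofNat {w a b : ℕ} (h : b ≤ a) :
    BitVec.ofNat w a - BitVec.ofNat w b = BitVec.ofNat w (a - b) := by
  rw [sub_eq_iff_eq_add, ← BitVec.ofNat_add, Nat.sub_add_cancel h]

theorem ofNat_mod {w a : ℕ} : BitVec.ofNat w (a % 2 ^ w) = BitVec.ofNat w a := by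
  apply BitVec.eq_of_toNat_eq; simp

/-- Because `S ≤ 2 ^ w`, a valid address is a reduced word, so loads and stores hit the word named
by the natural number. Elsewhere `wp` asks for reduced operands only where the result depends on the
representative: shift amounts, right shifts, tests, input and output indices. -/
theorem Tri.of_wp {w S : ℕ} (hS : S ≤ 2 ^ w) {inp : ℕ → ℕ} {c : Cmd} {s : NS} {Q : NS → Prop}
    (h : wp w S inp c s Q) : Tri w S inp c s c.cost Q := by
  induction c generalizing s Q with
  | seq c₁ c₂ h₁ h₂ => exact Tri.seq ((h₁ h).imp fun s hs => h₂ hs)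
  | branch b c₁ c₂ h₁ h₂ =>
    exact Tri.branch h.1 (fun hb => (h₁ (h.2.1 hb)).le (le_max_left _ _))
      (fun hb => (h₂ (h.2.2 hb)).le (le_max_right _ _))
  | const d n =>
    exact Tri.of_step (fun K => by rw [NS.toState_set]; rfl) h
  | op o d a b =>
    cases o <;> simp only [wp] at h
    case add =>
      refine Tri.of_step (fun K => ?_) h
      rw [NS.toState_set, BitVec.ofNat_add]; rfl
    case sub =>
      refine Tri.of_step (fun K => ?_) h.2
      rw [NS.toState_set, ← ofNat_sub_ofNat h.1]; rfl
    case and =>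
      refine Tri.of_step (fun K => ?_) h
      rw [NS.toState_set, BitVec.ofNat_and]; rfl
    case or =>
      refine Tri.of_step (fun K => ?_) h
      rw [NS.toState_set, BitVec.ofNat_or]; rfl
    case xor =>
      refine Tri.of_step (fun K => ?_) h
      rw [NS.toState_set, BitVec.ofNat_xor]; rfl
    case shl =>
      refine Tri.of_step (fun K => ?_) h.2
      rw [NS.toState_set]
      simp only [step, BinOp.eval, NS.toState, BitVec.toNat_ofNat, Nat.mod_eq_of_lt h.1]
      congr 4
      apply BitVec.eq_of_toNat_eq
      simp [BitVec.toNat_shiftLeft, Nat.shiftLeft_eq]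
    case shr =>
      refine Tri.of_step (fun K => ?_) h.2.2
      rw [NS.toState_set]
      simp only [step, BinOp.eval, NS.toState, BitVec.toNat_ofNat, Nat.mod_eq_of_lt h.2.1]
      congr 4
      apply BitVec.eq_of_toNat_eq
      simp only [BitVec.toNat_ushiftRight, BitVec.toNat_ofNat, Nat.shiftRight_eq_div_pow,
        Nat.mod_eq_of_lt h.1]
      rw [Nat.mod_eq_of_lt (lt_of_le_of_lt (Nat.div_le_self _ _) h.1)]
  | load d a =>
    refine Tri.of_step (fun K => ?_) h.2
    have e : s.reg a % 2 ^ w = s.reg a := Nat.mod_eq_of_lt (h.1.trans_le hS)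
    rw [NS.toState_set]
    simp only [step, NS.toState, BitVec.toNat_ofNat, e, h.1, dif_pos]
  | store a b =>
    refine Tri.of_step (fun K => ?_) h.2
    have e : s.reg a % 2 ^ w = s.reg a := Nat.mod_eq_of_lt (h.1.trans_le hS)
    simp only [step, NS.toState, BitVec.toNat_ofNat, e, h.1, dif_pos, NS.put_reg, NS.put_out,
      NS.put_mem]
    congr 3
    funext i
    by_cases hi : i.1 = s.reg a
    · have : i = ⟨s.reg a, h.1⟩ := Fin.ext hi
      subst this; simp
    · have : i ≠ ⟨s.reg a, h.1⟩ := fun h => hi (congrArg Fin.val h)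
      simp [hi, this]
  | input d p a =>
    refine Tri.of_step (fun K => ?_) h.2
    rw [NS.toState_set, ofNat_mod]
    simp only [step, NS.toState, BitVec.toNat_ofNat, Nat.mod_eq_of_lt h.1, wordOf]
  | output a b =>
    refine Tri.of_step (fun K => ?_) h.2
    simp only [step, NS.toState, BitVec.toNat_ofNat, Nat.mod_eq_of_lt h.1, NS.emit_reg, NS.emit_out,
      NS.emit_mem]
    congr 3
    funext i
    by_cases hi : i = s.reg a
    · subst hi; simp
    · simp [hi]
  | rand => exact h.elim
  | loop => exact h.elim

/-- Running a loop-free command first. -/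
theorem Tri.wp_seq {w S : ℕ} (hS : S ≤ 2 ^ w) {inp : ℕ → ℕ} {c₁ c₂ : Cmd} {s : NS} {n : ℕ}
    {Q : NS → Prop} (h : wp w S inp c₁ s fun s₁ => Tri w S inp c₂ s₁ n Q) :
    Tri w S inp (.seq c₁ c₂) s (c₁.cost + n + 1) Q := Tri.seq (Tri.of_wp hS h)

/-- The randomized analogue of `Det`: from `s`, the command takes exactly `n` steps, and `p` is the
distribution of the state reached. -/
def RDet (w S : ℕ) (inp : ℕ → ℕ) (c : Cmd) (s : NS) (n : ℕ) (p : PMF NS) : Prop :=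
  ∀ K T, stepN inp (n + T) (⟨c :: K, s.toState w S⟩ : Config w S) =
    p.bind fun s' => stepN inp T ⟨K, s'.toState w S⟩

theorem Det.rdet {w S : ℕ} {inp : ℕ → ℕ} {c : Cmd} {s s' : NS} {n : ℕ}
    (h : Det w S inp c s s' n) : RDet w S inp c s n (PMF.pure s') := by
  intro K T
  rw [stepN_add, h K]
  simp

/-- The second command must take the same number of steps for every outcome of the first; otherwise
the law after a fixed number of steps would mix different stages. This is why the randomized
programs have balanced branches. -/
theorem RDet.seq {w S : ℕ} {inp : ℕ → ℕ} {c₁ c₂ : Cmd} {s : NS} {n₁ n₂ : ℕ} {p : PMF NS}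
    {q : NS → PMF NS} (h₁ : RDet w S inp c₁ s n₁ p)
    (h₂ : ∀ s' ∈ p.support, RDet w S inp c₂ s' n₂ (q s')) :
    RDet w S inp (.seq c₁ c₂) s (1 + (n₁ + n₂)) (p.bind q) := by
  intro K T
  rw [add_assoc, stepN_add, add_assoc]
  simp only [stepN, step, PMF.bind_pure, PMF.pure_bind]
  rw [h₁, PMF.bind_bind]
  refine PMF.ext fun x => ?_
  rw [PMF.bind_apply, PMF.bind_apply]
  refine tsum_congr fun s' => ?_
  by_cases hs : s' ∈ p.support
  · rw [h₂ s' hs]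
  · rw [PMF.mem_support_iff, not_not] at hs
    simp [hs]

theorem RDet.rand {w S : ℕ} {inp : ℕ → ℕ} {d a N : ℕ} {s : NS}
    (h : randRange (BitVec.ofNat w (s.reg a)) = N) (hN : (Finset.range N).Nonempty) :
    RDet w S inp (.rand d a) s 1
      ((PMF.uniformOfFinset (Finset.range N) hN).map fun v => s.set d v) := by
  intro K T
  subst h
  rw [stepN_add]
  simp only [stepN, step, PMF.bind_pure, PMF.bind_map]
  congr 1
  funext v
  rw [Function.comp_apply, Function.comp_apply, NS.toState_set]

/-- The uniform distribution on sequences with given ranges, extended by zero. -/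
noncomputable def tape (rng : ℕ → ℕ) : ℕ → PMF (ℕ → ℕ)
  | 0 => PMF.pure fun _ => 0
  | n + 1 => (tape rng n).bind fun f =>
      if h : (Finset.range (rng n)).Nonempty then
        (PMF.uniformOfFinset (Finset.range (rng n)) h).map fun v i => if i = n then v else f i
      else PMF.pure f

theorem tape_succ {rng : ℕ → ℕ} {n : ℕ} (h : (Finset.range (rng n)).Nonempty) :
    tape rng (n + 1) = (tape rng n).bind fun f =>
        (PMF.uniformOfFinset (Finset.range (rng n)) h).map fun v i => if i = n then v else f i := by
  simp only [tape, dif_pos h]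

-- The state after `i` rounds has to be a function of the numbers drawn so far. Loop bodies
-- therefore reset their temporary registers.
open Classical in
theorem RDet.loop {w S : ℕ} {inp : ℕ → ℕ} {b : Test} {c : Cmd} (rng : ℕ → ℕ) (N : ℕ)
    (st : ℕ → (ℕ → ℕ) → NS) (f : ℕ → ℕ) (hr : ∀ i < N, (Finset.range (rng i)).Nonempty)
    (hI : ∀ i, ∀ hi : i < N, ∀ φ ∈ (tape rng i).support, b.ok w (st i φ) ∧ b.truth (st i φ) ∧
      RDet w S inp c (st i φ) (f i) ((PMF.uniformOfFinset (Finset.range (rng i)) (hr i hi)).map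
        fun v => st (i + 1) fun j => if j = i then v else φ j))
    (hN : ∀ φ ∈ (tape rng N).support, b.ok w (st N φ) ∧ ¬ b.truth (st N φ)) :
    RDet w S inp (.loop b c) (st 0 fun _ => 0) (∑ i ∈ Finset.range N, (f i + 1) + 1)
      ((tape rng N).map (st N)) := by
  have H : ∀ m ≤ N, ∀ K T, stepN inp (∑ i ∈ Finset.range m, (f i + 1) + T)
      (⟨.loop b c :: K, (st 0 fun _ => 0).toState w S⟩ : Config w S) =
      (tape rng m).bind fun φ => stepN inp T ⟨.loop b c :: K, (st m φ).toState w S⟩ := by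
    intro m
    induction m with
    | zero => intro _ K T; simp [tape]
    | succ m ih =>
      intro hm K T
      rw [Finset.sum_range_succ, add_assoc, ih (by omega), tape_succ (hr m (by omega)),
        PMF.bind_bind]
      refine PMF.ext fun x => ?_
      rw [PMF.bind_apply, PMF.bind_apply]
      refine tsum_congr fun φ => ?_
      by_cases hs : φ ∈ (tape rng m).support
      · obtain ⟨hok, ht, hd⟩ := hI m (by omega) φ hs
        have e : f m + 1 + T = 1 + (f m + T) := by ring
        rw [e, stepN_add]
        simp only [stepN, step_loop b c K hok, if_pos ht, PMF.bind_pure, PMF.pure_bind]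
        rw [hd, PMF.bind_map, PMF.bind_map]
        rfl
      · rw [PMF.mem_support_iff, not_not] at hs
        simp [hs]
  intro K T
  rw [add_assoc, H N le_rfl K (1 + T), PMF.bind_map]
  refine PMF.ext fun x => ?_
  rw [PMF.bind_apply, PMF.bind_apply]
  refine tsum_congr fun φ => ?_
  by_cases hs : φ ∈ (tape rng N).support
  · obtain ⟨hok, ht⟩ := hN φ hs
    rw [stepN_add]
    simp [stepN, step_loop b c K hok, if_neg ht]
  · rw [PMF.mem_support_iff, not_not] at hs
    simp [hs]

end WordRAM

/-! ### Parameters, memory layout, and reading packed fields. -/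

namespace WordRAM

/-- The numerical parameters of the data structure, as computed by the program `select`. -/
structure Par : Type where
  /-- word size -/
  w : ℕ
  /-- `2 ^ τ` characters -/
  τ : ℕ
  /-- `2 ^ δ` fields per leaf -/
  δ : ℕ
  /-- bits per field -/
  M : ℕ
  /-- a field occupies `2 ^ μ` bits -/
  μ : ℕ
  /-- `2 ^ g` fields per word -/
  g : ℕ
  /-- `2 ^ α` bits per character -/
  α : ℕ
  /-- `2 ^ π` characters per word of the key -/
  π : ℕ
  /-- `2 ^ ℓ` scales -/
  ℓ : ℕ
  /-- `2 ^ q` words reserved for a value -/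
  q : ℕ
  /-- words of a value -/
  nr : ℕ
  /-- a packed value occupies `2 ^ ρ` bits -/
  ρ : ℕ
  /-- `2 ^ gr` packed values per word -/
  gr : ℕ
  /-- largest value -/
  R : ℕ

namespace Par

variable (p : Par)

/-- Bits per character. -/
def s : ℕ := 2 ^ p.α
/-- Words per buffer. -/
def BW : ℕ := 2 ^ (p.τ + p.δ - p.g)
/-- Words of the tables of the tree. -/
def TW : ℕ := 2 ^ (p.τ + p.τ - 2 + p.δ + p.δ + p.M - p.g)
/-- Number of words (before packing) of the last table. -/
def NV : ℕ := 2 ^ (p.τ + p.δ + p.M + p.q - 1)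
/-- Words of the last table. -/
def VW : ℕ := 2 ^ (p.τ + p.δ + p.M + p.q - 1 - p.gr)
-- After the header of 24 words the memory holds the largest value `R`, the accumulator, two buffers
-- for node vectors, the tables of the tree and the last table, in this order. Evaluation writes
-- only to the addresses from `bA` up to `bT`.
def bR (_ : Par) : ℕ := 24
def bA : ℕ := p.bR + 2 ^ p.q
def b0 : ℕ := p.bA + 2 ^ p.q
def b1 : ℕ := p.b0 + p.BW
def bT : ℕ := p.b1 + p.BW
def bV : ℕ := p.bT + p.TW
/-- Words of memory. -/
def S : ℕ := p.bV + p.VW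

/-- The header kept in memory. -/
def hdr : ℕ → ℕ
  | 0 => p.τ
  | 1 => p.δ
  | 2 => p.M
  | 3 => p.μ
  | 4 => p.g
  | 5 => p.s
  | 6 => p.α
  | 7 => p.π
  | 8 => 2 ^ p.ℓ - 1
  | 9 => 8 + 2 * p.s
  | 10 => p.q
  | 11 => p.nr
  | 12 => p.ρ
  | 13 => p.gr
  | 14 => p.bR
  | 15 => p.bA
  | 16 => p.b0
  | 17 => p.b1
  | 18 => p.bT
  | 19 => p.bV
  | 20 => p.BW
  | 21 => 2 ^ p.M - 1
  | 22 => 1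
  | _ => 0

/-- The relations between the parameters that the programs rely on. -/
structure Valid : Prop where
  hS : p.S ≤ 2 ^ p.w
  hw : 7 ≤ p.w
  hτ : 1 ≤ p.τ
  hM : p.M ≤ p.w
  hM1 : 1 ≤ p.M
  hMμ : p.M ≤ 2 ^ p.μ
  hμ : 2 ^ p.μ < 2 ^ p.w
  hg : 0 < p.g → 2 ^ (p.g + p.μ) ≤ p.w
  hidx : p.τ + p.δ + p.M < p.w
  hs : p.s < p.M
  hb : 8 + 2 * p.s + p.s * 2 ^ p.ℓ < 2 ^ p.w
  hπ : p.π < p.τ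
  hρ : 2 ^ p.ρ < 2 ^ p.w
  hgr : 0 < p.gr → 2 ^ (p.gr + p.ρ) ≤ p.w
  hqg : 0 < p.q → p.gr = 0
  hnr : 1 ≤ p.nr
  hq : p.nr ≤ 2 ^ p.q
  hNV : p.NV < 2 ^ p.w
  hR : p.R < 2 ^ (p.w * p.nr)
  hR' : 2 ^ (p.w * (p.nr - 1)) ≤ p.R + 1
  hRρ : p.nr = 1 → p.R < 2 ^ 2 ^ p.ρ
  hwρ : p.nr ≠ 1 → p.w ≤ 2 ^ p.ρ

end Par

/-- The registers below 24 hold the header. -/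
structure Regs (p : Par) (s : NS) : Prop where
  r0 : s.reg 0 = p.τ
  r1 : s.reg 1 = p.δ
  r2 : s.reg 2 = p.M
  r3 : s.reg 3 = p.μ
  r4 : s.reg 4 = p.g
  r5 : s.reg 5 = p.s
  r6 : s.reg 6 = p.α
  r7 : s.reg 7 = p.π
  r8 : s.reg 8 = 2 ^ p.ℓ - 1
  r9 : s.reg 9 = 8 + 2 * p.s
  r10 : s.reg 10 = p.q
  r11 : s.reg 11 = p.nr
  r12 : s.reg 12 = p.ρ
  r13 : s.reg 13 = p.gr
  r14 : s.reg 14 = p.bR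
  r15 : s.reg 15 = p.bA
  r16 : s.reg 16 = p.b0
  r17 : s.reg 17 = p.b1
  r18 : s.reg 18 = p.bT
  r19 : s.reg 19 = p.bV
  r20 : s.reg 20 = p.BW
  r21 : s.reg 21 = 2 ^ p.M - 1
  r22 : s.reg 22 = 1
  r23 : s.reg 23 = 0

theorem Regs.of_hdr {p : Par} {s : NS} (h : ∀ i < 24, s.reg i = p.hdr i) : Regs p s := by
  constructor <;> exact h _ (by norm_num)

theorem Regs.hdr {p : Par} {s : NS} (h : Regs p s) : ∀ i < 24, s.reg i = p.hdr i := by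
  intro i hi
  cases h
  interval_cases i <;> assumption

theorem Regs.same {p : Par} {s s' : NS} (h : Regs p s) {b : ℕ} (hs : Same b s s')
    (hb : 24 ≤ b := by norm_num) : Regs p s' :=
  Regs.of_hdr fun i hi => (hs i (by omega)).trans (h.hdr i hi)

/-- The field number `n` of an array of fields that starts at the address `base`. -/
def fld (p : Par) (m : ℕ → ℕ) (base n : ℕ) : ℕ :=
  m (base + n / 2 ^ p.g) / 2 ^ (n % 2 ^ p.g * 2 ^ p.μ) % 2 ^ p.M

/-- The memory is given by reduced words. -/
def Red (w : ℕ) (m : ℕ → ℕ) : Prop := ∀ i, m i < 2 ^ w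

theorem Par.Valid.off_lt {p : Par} (hp : p.Valid) (n : ℕ) :
    n % 2 ^ p.g * 2 ^ p.μ < p.w := by
  rcases Nat.eq_zero_or_pos p.g with h | h
  · have := hp.hw
    simp [h, Nat.mod_one]; omega
  · refine lt_of_lt_of_le ?_ (hp.hg h)
    rw [pow_add]
    exact Nat.mul_lt_mul_of_pos_right (Nat.mod_lt _ (by positivity)) (by positivity)

@[simp] theorem same_self (b : ℕ) (s : NS) : Same b s s := Same.refl b s

@[simp] theorem same_set {b d v : ℕ} {s t : NS} (hd : b ≤ d) :
    Same b s (t.set d v) ↔ Same b s t := by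
  refine ⟨fun h i hi => ?_, fun h => h.set hd⟩
  have := h i hi
  rwa [NS.set_reg, if_neg (by omega)] at this

@[simp] theorem same_put {b a v : ℕ} {s t : NS} : Same b s (t.put a v) ↔ Same b s t := Iff.rfl

@[simp] theorem same_emit {b a v : ℕ} {s t : NS} : Same b s (t.emit a v) ↔ Same b s t := Iff.rfl

/-- Reading the field of the array at register 30 whose number is in register 50 into
register 51. -/
def getField : Cmd := blk [
  .op .shr 52 50 4, .op .add 52 30 52, .load 53 52,
  .op .shl 54 22 4, .op .sub 54 54 22, .op .and 54 50 54, .op .shl 54 54 3,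
  .op .shr 53 53 54, .op .and 51 53 21]

theorem Par.Valid.μ_lt {p : Par} (hp : p.Valid) : p.μ < 2 ^ p.w := Nat.lt_two_pow_self.trans hp.hμ

theorem Par.Valid.g_lt {p : Par} (hp : p.Valid) : p.g < 2 ^ p.w := by
  rcases Nat.eq_zero_or_pos p.g with h | h
  · rw [h]; positivity
  · exact lt_trans ((Nat.lt_two_pow_self).trans_le ((Nat.pow_le_pow_right (by norm_num)
      (Nat.le_add_right _ _)).trans (hp.hg h))) Nat.lt_two_pow_self

theorem wp_getField {p : Par} (hp : p.Valid) {S : ℕ} {inp : ℕ → ℕ} {s : NS} (hr : Regs p s)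
    (hm : Red p.w s.mem) (hn : s.reg 50 < 2 ^ p.w) (ha : s.reg 30 + s.reg 50 / 2 ^ p.g < S)
    {Q : NS → Prop}
    (hQ : ∀ s', Same 50 s s' → s'.mem = s.mem → s'.out = s.out →
      s'.reg 51 = fld p s.mem (s.reg 30) (s.reg 50) → Q s') :
    wp p.w S inp getField s Q := by
  have h1 := hp.off_lt (s.reg 50)
  have h2 : p.w < 2 ^ p.w := Nat.lt_two_pow_self
  simp only [getField, blk, wp, skip, NS.set_reg, NS.set_mem, hr.r4, hr.r22, hr.r3, hr.r21]
  simp [hn, hp.g_lt, hp.μ_lt, ha, Nat.and_two_pow_sub_one_eq_mod, h1.trans h2, hm _,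
    Nat.one_le_two_pow]
  apply hQ <;> simp [fld]

/-- The low `b` bits of `x` combined with the other bits of `y`. -/
def mux (b x y : ℕ) : ℕ := y ^^^ ((x ^^^ y) &&& (2 ^ b - 1))

/-- The number of bits taken from the first child in coordinate `j`. -/
def Par.mb (p : Par) (j : ℕ) : ℕ := 8 + 2 * p.s + j % 2 ^ p.ℓ * p.s

/-- The index of the table entry for the coordinate in register 36 of the node in register 35,
computed into register 40; register 24 holds the logarithm of the number of fields of the node,
register 34 half of this number. -/
def getIdx : Cmd := blk [
  .op .shl 41 35 24, .op .add 41 41 36, mov 50 41, getField, mov 42 51,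
  .op .add 50 41 34, getField, .op .and 43 36 8, .op .shl 43 43 6, .op .add 43 9 43,
  .op .shl 43 22 43, .op .sub 43 43 22, .op .xor 44 42 51, .op .and 44 44 43, .op .xor 40 51 44]

theorem Par.Valid.mb_lt {p : Par} (hp : p.Valid) (j : ℕ) : p.mb j < 2 ^ p.w := by
  refine lt_of_le_of_lt ?_ hp.hb
  have := (Nat.mod_lt j (show 0 < 2 ^ p.ℓ by positivity)).le
  unfold Par.mb
  nlinarith

theorem Par.Valid.α_lt {p : Par} (hp : p.Valid) : p.α < 2 ^ p.w := by
  have h1 : p.α < 2 ^ p.α := Nat.lt_two_pow_self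
  have h2 := hp.hs
  have h3 := hp.hM
  have h4 : p.w < 2 ^ p.w := Nat.lt_two_pow_self
  simp only [Par.s] at h2
  omega

/-- No multiplication is needed: the scale of `j` is obtained by masking, its product with `s = 2 ^
α` is a shift, and the two fields are merged by xoring the masked difference to the second one. -/
theorem wp_getIdx {p : Par} (hp : p.Valid) {S : ℕ} {inp : ℕ → ℕ} {s : NS} (hr : Regs p s)
    (hm : Red p.w s.mem) {N i j E H : ℕ} (hN : N < 2 ^ p.w)
    (ha : ∀ n < N, s.reg 30 + n / 2 ^ p.g < S) (h35 : s.reg 35 = i)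
    (h36 : s.reg 36 = j) (h24 : s.reg 24 = E) (h34 : s.reg 34 = H)
    (hE : E < 2 ^ p.w) (hn : i * 2 ^ E + j + H < N) {Q : NS → Prop}
    (hQ : ∀ s', Same 40 s s' → s'.mem = s.mem → s'.out = s.out →
      s'.reg 40 = mux (p.mb j) (fld p s.mem (s.reg 30) (i * 2 ^ E + j))
        (fld p s.mem (s.reg 30) (i * 2 ^ E + j + H)) → Q s') :
    wp p.w S inp getIdx s Q := by
  have h1 : i * 2 ^ E + j < 2 ^ p.w := by omega
  have h2 : i * 2 ^ E + j + H < 2 ^ p.w := by omega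
  have h3 := hp.mb_lt j
  simp only [getIdx, blk, wp, skip, mov, NS.set_reg, NS.set_mem, h35, h24, h36, h34]
  simp only [Nat.reduceEqDiff, if_true, if_false, Nat.or_self, hE, true_and]
  apply wp_getField hp (hr.same (b := 40) (by simp)) (by simpa using hm) (by simpa using h1)
  · simpa using ha _ (by omega)
  intro s1 hs1 hm1 ho1 h51
  apply wp_getField hp ((hr.same (s' := s1) (b := 40) ?_).same (b := 40) (by simp))
    (by simpa [hm1] using hm)
  · simpa [hs1 41, hs1 34, h34] using h2
  · simpa [hs1 41, hs1 34, hs1 30, h34] using ha _ (by omega)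
  · intro s2 hs2 hm2 ho2 h52
    have q43 : ∀ k < 50, k ≠ 42 → s2.reg k = s1.reg k := fun k hk hk' => by
      rw [hs2 k hk]; simp [hk', show k ≠ 50 by omega]
    have q36 : s2.reg 36 = j := by rw [q43 _ (by norm_num) (by norm_num), hs1 _ (by norm_num)]; simp [h36]
    have q42 : s2.reg 42 = fld p s.mem (s.reg 30) (i * 2 ^ E + j) := by
      rw [hs2 _ (by norm_num)]; simp [h51]
    have q51 : s2.reg 51 = fld p s.mem (s.reg 30) (i * 2 ^ E + j + H) := by
      rw [h52]; simp [hs1 41, hs1 34, hs1 30, h34, hm1]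
    have hr2 : Regs p s2 := Regs.of_hdr fun k hk => by
      rw [q43 k (by omega) (by omega), hs1 k (by omega)]
      simp [hr.hdr k hk, show k ≠ 41 by omega, show k ≠ 50 by omega]
    simp only [Par.mb, Par.s] at h3
    simp only [wp, NS.set_reg, NS.set_mem, hr2.r8, hr2.r6, hr2.r9, hr2.r22, q36, q42, q51]
    simp [hp.α_lt, Nat.and_two_pow_sub_one_eq_mod, h3, Par.s, Nat.one_le_two_pow]
    apply hQ
    · simp only [same_set, Nat.reduceLeDiff]
      intro k hk
      rw [q43 k (by omega) (by omega), hs1 k (by omega)]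
      simp [show k ≠ 41 by omega, show k ≠ 50 by omega]
    · simp [hm2, hm1]
    · simp [ho2, ho1]
    · simp [mux, Par.mb, Par.s, Nat.and_two_pow_sub_one_eq_mod]
  · exact (Same.mono hs1 (by norm_num : 40 ≤ 50)) |> fun h => Same.trans (by simp) h

end WordRAM

/-! ### Xoring table entries to nodes, word by word. -/

namespace WordRAM

/-- Shift amounts and masks for entries of `2 ^ E` fields, where `E` is in register 24. -/
def setup : Cmd := blk [
  .branch (.lt 24 4) (.const 25 0) (.op .sub 25 24 4),
  .branch (.lt 4 24) (.const 26 0) (.op .sub 26 4 24),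
  .branch (.lt 24 4) (.op .add 27 24 3) (.op .add 27 4 3),
  .op .shl 28 22 27, .op .shl 28 22 28, .op .sub 28 28 22,
  .op .shl 29 22 26, .op .sub 29 29 22]

/-- The effect of `setup` for entries of `2 ^ E` fields. -/
structure Level (p : Par) (E : ℕ) (s : NS) : Prop where
  r24 : s.reg 24 = E
  r25 : s.reg 25 = E - p.g
  r26 : s.reg 26 = p.g - E
  r27 : s.reg 27 = min E p.g + p.μ
  r28 : s.reg 28 = 2 ^ 2 ^ (min E p.g + p.μ) - 1
  r29 : s.reg 29 = 2 ^ (p.g - E) - 1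

theorem Level.same {p : Par} {E : ℕ} {s s' : NS} (h : Level p E s) {b : ℕ} (hs : Same b s s')
    (hb : 30 ≤ b := by norm_num) : Level p E s' := by
  cases h
  constructor <;> rw [hs _ (by omega)] <;> assumption

theorem Par.Valid.sh_lt {p : Par} (hp : p.Valid) (E : ℕ) : 2 ^ (min E p.g + p.μ) < 2 ^ p.w := by
  rcases Nat.eq_zero_or_pos p.g with h | h
  · simpa [h] using hp.hμ
  · have h1 : p.w < 2 ^ p.w := Nat.lt_two_pow_self
    have h2 := hp.hg h
    have h3 : 2 ^ (min E p.g + p.μ) ≤ 2 ^ (p.g + p.μ) :=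
      Nat.pow_le_pow_right (by norm_num) (by omega)
    omega

/-- An entry of `2 ^ E` fields either shares its word with other entries (`E < g`) or fills `2 ^ (E
- g)` words. With truncated subtraction both cases obey the same formulas, so later code needs no
case distinction. -/
theorem wp_setup {p : Par} (hp : p.Valid) {S : ℕ} {inp : ℕ → ℕ} {s : NS} (hr : Regs p s)
    {E : ℕ} (h24 : s.reg 24 = E) (hE : E < 2 ^ p.w) {Q : NS → Prop}
    (hQ : ∀ s', Same 24 s s' → (∀ i, 30 ≤ i → i ≠ 99 → s'.reg i = s.reg i) → s'.mem = s.mem →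
      s'.out = s.out → Level p E s' → Q s') :
    wp p.w S inp setup s Q := by
  have h1 := hp.g_lt
  have h2 := hp.sh_lt E
  have h3 : min E p.g + p.μ < 2 ^ p.w := Nat.lt_two_pow_self.trans h2
  have h4 : p.g - E < 2 ^ p.w := by omega
  simp only [setup, blk, wp, skip, Test.ok, Test.truth, NS.set_reg, h24, hr.r4, hr.r3, hr.r22]
  rcases lt_trichotomy E p.g with h | h | h
  · rw [min_eq_left h.le] at h2 h3
    simp [hr.r4, hr.r3, hr.r22, h24, h1, hE, h, h.le, h.not_gt, h2, h3, h4, Nat.one_le_two_pow,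
      h.not_ge]
    apply hQ
    · simp
    · intro i hi h99
      simp [h99, show i ≠ 25 by omega, show i ≠ 26 by omega, show i ≠ 27 by omega,
        show i ≠ 28 by omega, show i ≠ 29 by omega]
    · simp
    · simp
    · constructor <;> simp [h24, h.le, Nat.sub_eq_zero_of_le h.le]
  · subst h
    rw [min_self] at h2 h3
    simp [hr.r4, hr.r3, hr.r22, h24, h1, hE, h2, h3, h4, Nat.one_le_two_pow]
    apply hQ
    · simp
    · intro i hi h99
      simp [h99, show i ≠ 25 by omega, show i ≠ 26 by omega, show i ≠ 27 by omega,
        show i ≠ 28 by omega, show i ≠ 29 by omega]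
    · simp
    · simp
    · constructor <;> simp [h24]
  · rw [min_eq_right h.le] at h2 h3
    simp [hr.r4, hr.r3, hr.r22, h24, h1, hE, h, h.le, h.not_gt, h2, h3, h4, Nat.one_le_two_pow,
      h.not_ge]
    apply hQ
    · simp
    · intro i hi h99
      simp [h99, show i ≠ 25 by omega, show i ≠ 26 by omega, show i ≠ 27 by omega,
        show i ≠ 28 by omega, show i ≠ 29 by omega]
    · simp
    · simp
    · constructor <;> simp [h24, h.le, Nat.sub_eq_zero_of_le h.le]

/-- Xoring an entry, given by its word addresses and offsets, to a node. -/
def xorMem (src so dst dof K n : ℕ) (m : ℕ → ℕ) (a : ℕ) : ℕ :=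
  if dst ≤ a ∧ a < dst + n then
    m a ^^^ (m (src + (a - dst)) / 2 ^ so % 2 ^ K * 2 ^ dof)
  else m a

/-- Xoring the entry with the number in register 45 of the tables to the fields of the node in
register 35 of the buffer at register 31. -/
def xorEntry : Cmd := .seq (blk [
    .op .shl 60 45 25, .op .shr 60 60 26, .op .add 60 60 18, .op .and 61 45 29, .op .shl 61 61 27,
    .op .shl 62 35 25, .op .shr 62 62 26, .op .add 62 62 31, .op .and 63 35 29, .op .shl 63 63 27,
    .const 64 0, .op .shl 65 22 25])
  (.loop (.lt 64 65) (blk [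
    .load 66 60, .op .shr 66 66 61, .op .and 66 66 28, .op .shl 66 66 63, .load 67 62,
    .op .xor 67 67 66, .store 62 67, .op .add 60 60 22, .op .add 62 62 22, .op .add 64 64 22]))

theorem Par.Valid.sub_off_lt {p : Par} (hp : p.Valid) (E n : ℕ) :
    n % 2 ^ (p.g - E) * 2 ^ (min E p.g + p.μ) < 2 ^ p.w := by
  rcases Nat.lt_or_ge E p.g with h | h
  · rw [min_eq_left h.le]
    have h1 : p.w < 2 ^ p.w := Nat.lt_two_pow_self
    have h2 := hp.hg (by omega)
    have h3 : n % 2 ^ (p.g - E) < 2 ^ (p.g - E) := Nat.mod_lt _ (by positivity)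
    have h4 : 2 ^ (p.g - E) * 2 ^ (E + p.μ) = 2 ^ (p.g + p.μ) := by
      rw [← pow_add]; congr 1; omega
    have := Nat.mul_lt_mul_of_pos_right h3 (show 0 < 2 ^ (E + p.μ) by positivity)
    omega
  · simp [Nat.sub_eq_zero_of_le h, Nat.mod_one]

/-- The entry with number `n` of a table or buffer starts at this word. -/
def Par.word (p : Par) (E n : ℕ) : ℕ := n * 2 ^ (E - p.g) / 2 ^ (p.g - E)

/-- The offset of the entry in this word. -/
def Par.off (p : Par) (E n : ℕ) : ℕ := n % 2 ^ (p.g - E) * 2 ^ (min E p.g + p.μ)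

/-- The effect of `xorEntry`. -/
def Par.xorMem (p : Par) (E ob n i : ℕ) (m : ℕ → ℕ) : ℕ → ℕ :=
  WordRAM.xorMem (p.word E n + p.bT) (p.off E n) (p.word E i + ob) (p.off E i)
    (2 ^ (min E p.g + p.μ)) (2 ^ (E - p.g)) m

theorem Par.le_bT (p : Par) : 24 ≤ p.bT := by
  have : 0 < 2 ^ p.q := by positivity
  unfold Par.bT Par.b1 Par.b0 Par.bA Par.bR
  omega

theorem xorMem_succ {src so dst dof K j : ℕ} {m : ℕ → ℕ} :
    (fun a => if a = dst + j then xorMem src so dst dof K j m (dst + j) ^^^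
      (m (src + j) / 2 ^ so % 2 ^ K * 2 ^ dof) else xorMem src so dst dof K j m a) =
    xorMem src so dst dof K (j + 1) m := by
  funext a
  by_cases h : a = dst + j
  · subst h
    simp [xorMem]
  · have e : (a < dst + (j + 1)) ↔ (a < dst + j) := by omega
    simp [xorMem, h, e]

/-- The tables begin at `bT` and the destination ends there at the latest, so each source word still
has its original value when it is read. -/
theorem tri_xorEntry {p : Par} (hp : p.Valid) {inp : ℕ → ℕ} {s : NS} (hr : Regs p s)
    {E n i ob : ℕ} (hl : Level p E s) (hm : Red p.w s.mem) (h45 : s.reg 45 = n) (h35 : s.reg 35 = i)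
    (h31 : s.reg 31 = ob) (hn : n * 2 ^ (E - p.g) < 2 ^ p.w) (hi : i * 2 ^ (E - p.g) < 2 ^ p.w)
    (hsrc : p.word E n + p.bT + 2 ^ (E - p.g) ≤ p.S)
    (hdst : p.word E i + ob + 2 ^ (E - p.g) ≤ p.bT) {Q : NS → Prop}
    (hQ : ∀ s', Same 60 s s' → s'.out = s.out → s'.mem = p.xorMem E ob n i s.mem → Q s') :
    Tri p.w p.S inp xorEntry s (27 + 2 ^ (E - p.g) * 22) Q := by
  have h2 := hp.hS
  refine (Tri.wp_seq h2 ?_).le (n := 27 + 2 ^ (E - p.g) * 22)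
    (m := 25 + (2 ^ (E - p.g) * (21 + 1) + 1) + 1) (by omega)
  have e1 : E - p.g < 2 ^ p.w := by
    have h3 : E - p.g < 2 ^ (E - p.g) := Nat.lt_two_pow_self
    omega
  have e2 : p.g - E < 2 ^ p.w := lt_of_le_of_lt (Nat.sub_le _ _) hp.g_lt
  have e3 := hp.sub_off_lt E
  have e4 : min E p.g + p.μ < 2 ^ p.w := Nat.lt_two_pow_self.trans (hp.sh_lt E)
  have e5 : 2 ^ (E - p.g) < 2 ^ p.w := by
    have := p.le_bT
    omega
  simp only [blk, wp, skip, NS.set_reg, NS.set_mem, h45, h35, h31, hl.r25, hl.r26, hl.r27, hl.r29,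
    hr.r18, hr.r22]
  simp [h45, h35, h31, hl.r25, hl.r26, hl.r27, hl.r29, hr.r18, hr.r22,
    Nat.and_two_pow_sub_one_eq_mod, e1, e2, e4, hn, hi]
  refine Tri.loop (fun j s' => Same 60 s s' ∧ s'.out = s.out ∧ s'.reg 60 = p.word E n + p.bT + j ∧
    s'.reg 61 = p.off E n ∧ s'.reg 62 = p.word E i + ob + j ∧ s'.reg 63 = p.off E i ∧
    s'.reg 64 = j ∧ s'.reg 65 = 2 ^ (E - p.g) ∧ s'.mem = WordRAM.xorMem (p.word E n + p.bT)
      (p.off E n) (p.word E i + ob) (p.off E i) (2 ^ (min E p.g + p.μ)) j s.mem)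
    (2 ^ (E - p.g)) 21 ?_ ?_ ?_
  · refine ⟨by simp, by simp, by simp [Par.word], by simp [Par.off], by simp [Par.word],
      by simp [Par.off], by simp, by simp, ?_⟩
    funext a
    simp [WordRAM.xorMem]
  · rintro j hj s' ⟨i1, i2, i3, i4, i5, i6, i7, i8, i9⟩
    refine ⟨⟨by omega, by omega⟩, by simp only [Test.truth]; omega, ?_⟩
    refine (Tri.of_wp h2 ?_).le (m := 21) le_rfl
    have q1 : s'.mem (p.word E n + p.bT + j) = s.mem (p.word E n + p.bT + j) := by
      rw [i9, WordRAM.xorMem, if_neg (by omega)]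
    have hl' : Level p E s' := hl.same i1
    have hr' : Regs p s' := hr.same i1
    have q2 : p.word E n + p.bT + j < p.S := by omega
    have q3 : p.word E i + ob + j < p.S := by omega
    have q4 := hm (p.word E n + p.bT + j)
    have q5 : p.off E n < 2 ^ p.w := e3 n
    have q6 : p.off E i < 2 ^ p.w := e3 i
    simp only [blk, wp, skip, NS.set_reg, NS.set_mem, NS.put_reg, NS.put_mem, i3, i4, i5, i6, i7,
      hl'.r28, hr'.r22]
    simp [i3, i4, i5, i6, i7, i8, q1, q2, q3, q4, q5, q6, hl'.r28, hr'.r22, i2,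
      Nat.and_two_pow_sub_one_eq_mod, i1, ← add_assoc]
    rw [i9] at q1 ⊢
    rw [← xorMem_succ]
  · rintro s' ⟨i1, i2, i3, i4, i5, i6, i7, i8, i9⟩
    refine ⟨⟨by omega, by omega⟩, by simp only [Test.truth]; omega, ?_⟩
    exact hQ _ i1 i2 i9

/-- Clearing the buffer at register 31. -/
def clearBuf : Cmd := .seq (blk [mov 60 31, .op .add 61 31 20])
  (.loop (.lt 60 61) (blk [.store 60 23, .op .add 60 60 22]))

theorem tri_clearBuf {p : Par} (hp : p.Valid) {inp : ℕ → ℕ} {s : NS} (hr : Regs p s)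
    {ob : ℕ} (h31 : s.reg 31 = ob) (hS : ob + p.BW < p.S) {Q : NS → Prop}
    (hQ : ∀ s', Same 60 s s' → s'.out = s.out →
      s'.mem = (fun a => if ob ≤ a ∧ a < ob + p.BW then 0 else s.mem a) → Q s') :
    Tri p.w p.S inp clearBuf s (7 + p.BW * 6) Q := by
  have h2 := hp.hS
  refine (Tri.wp_seq h2 ?_).le (m := 5 + (p.BW * (5 + 1) + 1) + 1) (by omega)
  simp only [blk, wp, skip, mov, NS.set_reg, NS.set_mem, h31]
  simp [h31, hr.r20]
  refine Tri.loop (fun j s' => Same 60 s s' ∧ s'.out = s.out ∧ s'.reg 60 = ob + j ∧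
    s'.reg 61 = ob + p.BW ∧
    s'.mem = fun a => if ob ≤ a ∧ a < ob + j then 0 else s.mem a) p.BW 5 ?_ ?_ ?_
  · refine ⟨by simp, by simp, by simp, by simp, ?_⟩
    funext a
    simp
  · rintro j hj s' ⟨i1, i2, i3, i4, i5⟩
    refine ⟨⟨by omega, by omega⟩, by simp only [Test.truth]; omega, ?_⟩
    refine (Tri.of_wp h2 ?_).le (m := 5) le_rfl
    have hr' : Regs p s' := hr.same i1
    have q2 : ob + j < p.S := by omega
    simp only [blk, wp, skip, NS.set_reg, NS.set_mem, NS.put_reg, NS.put_mem, i3]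
    simp [i1, i2, i3, i4, q2, hr'.r22, hr'.r23, i5, ← add_assoc]
    funext a
    by_cases h : a = ob + j
    · simp [h]
    · have e : (a ≤ ob + j) ↔ (a < ob + j) := by omega
      simp [h, e]
  · rintro s' ⟨i1, i2, i3, i4, i5⟩
    refine ⟨⟨by omega, by omega⟩, by simp only [Test.truth]; omega, ?_⟩
    exact hQ _ i1 i2 i5

end WordRAM

/-! ### Effect of word operations on packed fields. -/

namespace WordRAM

/-- Bitwise: bit `i` of the field sits at position `dof + z + i`, and the bit xored to it comes from
position `so + z + i` of the source. The mask of `K` bits keeps it since `z + M ≤ K`. -/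
theorem xor_shift_inside {x y so K dof z M : ℕ} (h : z + M ≤ K) :
    (x ^^^ (y / 2 ^ so % 2 ^ K * 2 ^ dof)) / 2 ^ (dof + z) % 2 ^ M =
      (x / 2 ^ (dof + z) % 2 ^ M) ^^^ (y / 2 ^ (so + z) % 2 ^ M) := by
  apply Nat.eq_of_testBit_eq
  intro i
  simp only [Nat.testBit_mod_two_pow, Nat.testBit_div_two_pow, Nat.testBit_xor,
    Nat.testBit_mul_two_pow]
  by_cases hi : i < M
  · have h1 : dof ≤ i + (dof + z) := by omega
    have h2 : i + (dof + z) - dof < K := by omega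
    have h3 : i + (dof + z) - dof + so = i + (so + z) := by omega
    simp [hi, h1, h2, h3]
  · simp [hi]

theorem xor_shift_outside {x y K dof o M : ℕ} (h : dof + K ≤ o ∨ o + M ≤ dof) :
    (x ^^^ (y % 2 ^ K * 2 ^ dof)) / 2 ^ o % 2 ^ M = x / 2 ^ o % 2 ^ M := by
  apply Nat.eq_of_testBit_eq
  intro i
  simp only [Nat.testBit_mod_two_pow, Nat.testBit_div_two_pow, Nat.testBit_xor,
    Nat.testBit_mul_two_pow]
  by_cases hi : i < M
  · rcases h with h | h
    · have h2 : ¬ i + o - dof < K := by omega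
      simp [hi, h2]
    · have h2 : ¬ dof ≤ i + o := by omega
      simp [hi, h2]
  · simp [hi]

theorem div_two_pow_of_ge {E g i j : ℕ} (h : g ≤ E) :
    (i * 2 ^ E + j) / 2 ^ g = i * 2 ^ (E - g) + j / 2 ^ g ∧ (i * 2 ^ E + j) % 2 ^ g = j % 2 ^ g := by
  have e : i * 2 ^ E = 2 ^ g * (i * 2 ^ (E - g)) := by
    rw [mul_left_comm, ← pow_add]; congr 2; omega
  rw [e]
  exact ⟨by rw [Nat.mul_add_div (by positivity)], by simp [Nat.mul_add_mod]⟩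

theorem div_two_pow_of_le {E g i j : ℕ} (h : E ≤ g) (hj : j < 2 ^ E) :
    (i * 2 ^ E + j) / 2 ^ g = i / 2 ^ (g - E) ∧
      (i * 2 ^ E + j) % 2 ^ g = i % 2 ^ (g - E) * 2 ^ E + j := by
  have e : 2 ^ g = 2 ^ E * 2 ^ (g - E) := by rw [← pow_add]; congr 1; omega
  have h0 : (i * 2 ^ E + j) / 2 ^ E = i := by
    rw [mul_comm, Nat.mul_add_div (by positivity), Nat.div_eq_of_lt hj, add_zero]
  have h1 : (i * 2 ^ E + j) % 2 ^ E = j := by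
    rw [mul_comm, Nat.mul_add_mod, Nat.mod_eq_of_lt hj]
  constructor
  · rw [e, ← Nat.div_div_eq_div_mul, h0]
  · rw [e, Nat.mod_mul, h0, h1, mul_comm, add_comm]

theorem Par.Valid.slot {p : Par} (hp : p.Valid) (j c : ℕ) :
    j % 2 ^ c * 2 ^ p.μ + p.M ≤ 2 ^ (c + p.μ) := by
  have h1 : j % 2 ^ c + 1 ≤ 2 ^ c := Nat.mod_lt _ (by positivity)
  have h2 := Nat.mul_le_mul_right (2 ^ p.μ) h1
  have := hp.hMμ
  rw [pow_add]
  nlinarith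

/-- Where the fields of an entry are found. -/
theorem Par.fld_pos {p : Par} (E i j : ℕ) (hj : j < 2 ^ E) :
    (i * 2 ^ E + j) / 2 ^ p.g = p.word E i + j / 2 ^ p.g ∧
      (i * 2 ^ E + j) % 2 ^ p.g * 2 ^ p.μ = p.off E i + j % 2 ^ min E p.g * 2 ^ p.μ := by
  rcases le_total p.g E with h | h
  · obtain ⟨h1, h2⟩ := div_two_pow_of_ge (i := i) (j := j) h
    simp [h1, h2, Par.word, Par.off, Nat.sub_eq_zero_of_le h, Nat.mod_one, h]
  · obtain ⟨h1, h2⟩ := div_two_pow_of_le (i := i) h hj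
    have h3 : j < 2 ^ p.g := hj.trans_le (Nat.pow_le_pow_right (by norm_num) h)
    rw [h1, h2, min_eq_left h, Nat.mod_eq_of_lt hj]
    simp only [Par.word, Par.off, Nat.sub_eq_zero_of_le h, pow_zero, mul_one,
      Nat.div_eq_of_lt h3, add_zero, true_and]
    rw [min_eq_left h, pow_add]
    ring

theorem Par.div_lt {p : Par} {E j : ℕ} (hj : j < 2 ^ E) : j / 2 ^ p.g < 2 ^ (E - p.g) := by
  rw [Nat.div_lt_iff_lt_mul (by positivity), ← pow_add]
  exact hj.trans_le (Nat.pow_le_pow_right (by norm_num) (by omega))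

theorem Par.Valid.fld_xorMem_same {p : Par} (hp : p.Valid) {E ob n i j : ℕ} (m : ℕ → ℕ)
    (hj : j < 2 ^ E) : fld p (p.xorMem E ob n i m) ob (i * 2 ^ E + j) =
      fld p m ob (i * 2 ^ E + j) ^^^ fld p m p.bT (n * 2 ^ E + j) := by
  obtain ⟨h1, h2⟩ := Par.fld_pos (p := p) E i j hj
  obtain ⟨h3, h4⟩ := Par.fld_pos (p := p) E n j hj
  have h5 := Par.div_lt (p := p) hj
  have h6 := hp.slot j (min E p.g)
  have h7 := Nat.zero_le (j / 2 ^ p.g)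
  unfold fld
  rw [h1, h2, h3, h4, Par.xorMem, WordRAM.xorMem, if_pos (by omega), xor_shift_inside h6]
  have e : p.word E n + p.bT + (ob + (p.word E i + j / 2 ^ p.g) - (p.word E i + ob)) =
      p.bT + (p.word E n + j / 2 ^ p.g) := by omega
  rw [e]

theorem Par.Valid.fld_xorMem_ne {p : Par} (hp : p.Valid) {E ob n i f : ℕ} (m : ℕ → ℕ)
    (hf : f / 2 ^ E ≠ i) : fld p (p.xorMem E ob n i m) ob f = fld p m ob f := by
  set k := f / 2 ^ E with hk
  set j := f % 2 ^ E with hj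
  have hj' : j < 2 ^ E := Nat.mod_lt _ (by positivity)
  have e : f = k * 2 ^ E + j := by rw [mul_comm]; exact (Nat.div_add_mod _ _).symm
  obtain ⟨h1, h2⟩ := Par.fld_pos (p := p) E k j hj'
  unfold fld
  rw [e, h1, h2, Par.xorMem, WordRAM.xorMem]
  split_ifs with hif
  -- If nodes consist of whole words, a changed word belongs to node `i`, so `k = i`, a
  -- contradiction.
  · rcases le_total p.g E with h | h
    · exfalso
      simp only [Par.word, Nat.sub_eq_zero_of_le h, pow_zero, Nat.div_one] at hif
      have h5 := Par.div_lt (p := p) hj'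
      have h7 := Nat.zero_le (j / 2 ^ p.g)
      rcases lt_or_gt_of_ne hf with h6 | h6
      · have := Nat.mul_le_mul_right (2 ^ (E - p.g)) (Nat.succ_le_of_lt h6)
        rw [Nat.succ_mul] at this
        omega
      · have := Nat.mul_le_mul_right (2 ^ (E - p.g)) (Nat.succ_le_of_lt h6)
        rw [Nat.succ_mul] at this
        omega
    · have h3 : j < 2 ^ p.g := hj'.trans_le (Nat.pow_le_pow_right (by norm_num) h)
      have hw : p.word E k = p.word E i := by
        simp only [Par.word, Nat.sub_eq_zero_of_le h, pow_zero, mul_one, Nat.div_eq_of_lt h3] at hif ⊢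
        omega
      -- Several nodes share the word, and different nodes occupy disjoint bit intervals in it.
      apply xor_shift_outside
      have hmod : k % 2 ^ (p.g - E) ≠ i % 2 ^ (p.g - E) := by
        intro hm
        apply hf
        simp only [Par.word, Nat.sub_eq_zero_of_le h, pow_zero, mul_one] at hw
        rw [← Nat.div_add_mod k (2 ^ (p.g - E)), ← Nat.div_add_mod i (2 ^ (p.g - E)), hw, hm]
      have h6 := hp.slot j E
      simp only [Par.off, min_eq_left h]
      rcases lt_or_gt_of_ne hmod with h7 | h7
      · right
        have := Nat.mul_le_mul_right (2 ^ (E + p.μ)) (Nat.succ_le_of_lt h7)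
        rw [Nat.succ_mul] at this
        omega
      · left
        have := Nat.mul_le_mul_right (2 ^ (E + p.μ)) (Nat.succ_le_of_lt h7)
        rw [Nat.succ_mul] at this
        omega
  · rfl

theorem Par.Valid.red_xorMem {p : Par} (hp : p.Valid) {E ob n i : ℕ} {m : ℕ → ℕ}
    (hm : Red p.w m) : Red p.w (p.xorMem E ob n i m) := by
  intro a
  unfold Par.xorMem WordRAM.xorMem
  split_ifs with h
  · refine Nat.xor_lt_two_pow (hm a) ?_
    set y := m (p.word E n + p.bT + (a - (p.word E i + ob)))
    have hy : y < 2 ^ p.w := hm _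
    rcases Nat.eq_zero_or_pos p.g with h0 | h0
    · have e : p.off E i = 0 := by simp [Par.off, h0, Nat.mod_one]
      rw [e, pow_zero, mul_one]
      exact lt_of_le_of_lt ((Nat.mod_le _ _).trans (Nat.div_le_self _ _)) hy
    · have h1 : y / 2 ^ p.off E n % 2 ^ 2 ^ (min E p.g + p.μ) < 2 ^ 2 ^ (min E p.g + p.μ) :=
        Nat.mod_lt _ (by positivity)
      have h2 := Nat.mul_lt_mul_of_pos_right h1 (show 0 < 2 ^ p.off E i by positivity)
      refine h2.trans_le ?_
      rw [← pow_add]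
      refine Nat.pow_le_pow_right (by norm_num) (le_trans ?_ (hp.hg h0))
      have h3 : i % 2 ^ (p.g - E) + 1 ≤ 2 ^ (p.g - E) := Nat.mod_lt _ (by positivity)
      have h4 := Nat.mul_le_mul_right (2 ^ (min E p.g + p.μ)) h3
      have h5 : 2 ^ (p.g - E) * 2 ^ (min E p.g + p.μ) = 2 ^ (p.g + p.μ) := by
        rw [← pow_add]; congr 1; omega
      rw [h5, Nat.succ_mul] at h4
      simp only [Par.off]
      omega
  · exact hm a

theorem Par.xorMem_of_not_mem {p : Par} {E ob n i : ℕ} {m : ℕ → ℕ} {a : ℕ}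
    (h : a < ob ∨ ob + p.word E i + 2 ^ (E - p.g) ≤ a) : p.xorMem E ob n i m a = m a := by
  unfold Par.xorMem WordRAM.xorMem
  rw [if_neg (by omega)]

theorem fld_congr {p : Par} {m m' : ℕ → ℕ} {base n : ℕ}
    (h : m' (base + n / 2 ^ p.g) = m (base + n / 2 ^ p.g)) : fld p m' base n = fld p m base n := by
  unfold fld
  rw [h]

theorem fld_zero {p : Par} {m : ℕ → ℕ} {base n : ℕ} (h : m (base + n / 2 ^ p.g) = 0) :
    fld p m base n = 0 := by
  unfold fld
  simp [h]

theorem fld_lt (p : Par) (m : ℕ → ℕ) (base n : ℕ) : fld p m base n < 2 ^ p.M :=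
  Nat.mod_lt _ (by positivity)

theorem testBit_mux (b x y i : ℕ) :
    (mux b x y).testBit i = if i < b then x.testBit i else y.testBit i := by
  unfold mux
  rw [Nat.and_two_pow_sub_one_eq_mod]
  simp only [Nat.testBit_xor, Nat.testBit_mod_two_pow]
  by_cases h : i < b
  · simp only [h, decide_true, Bool.true_and, if_true]
    cases x.testBit i <;> cases y.testBit i <;> rfl
  · simp [h]

theorem mux_lt {b x y M : ℕ} (hx : x < 2 ^ M) (hy : y < 2 ^ M) : mux b x y < 2 ^ M := by
  unfold mux
  refine Nat.xor_lt_two_pow hy (lt_of_le_of_lt Nat.and_le_left (Nat.xor_lt_two_pow hx hy))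

/-- Together with `mux_div` this says that equal combined words agree on the part of either child,
which is how a collision of pairs is reduced to a collision of components. -/
theorem mux_mod (b x y : ℕ) : mux b x y % 2 ^ b = x % 2 ^ b := by
  apply Nat.eq_of_testBit_eq
  intro i
  simp only [Nat.testBit_mod_two_pow, testBit_mux]
  by_cases h : i < b <;> simp [h]

theorem mux_div (b x y : ℕ) : mux b x y / 2 ^ b = y / 2 ^ b := by
  apply Nat.eq_of_testBit_eq
  intro i
  simp only [Nat.testBit_div_two_pow, testBit_mux]
  simp

end WordRAM

/-! ### The recursive function, and one coordinate of an inner node. -/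

namespace WordRAM

/-- Bitwise sum of the numbers `f 0, …, f (n - 1)`. -/
def xsum : ℕ → (ℕ → ℕ) → ℕ
  | 0, _ => 0
  | n + 1, f => xsum n f ^^^ f n

namespace Par

variable (p : Par)

/-- Index, in the table of a node of height `h + 1`, of the entry for coordinate `j`. -/
def entry (h j v : ℕ) : ℕ := (2 ^ (h + p.δ) + j) * 2 ^ p.M + v

/-- The field number `j` of the node number `i` at height `h`, for the tables `F` and the
characters `c`. -/
def nodeVal (F c : ℕ → ℕ) : ℕ → ℕ → ℕ → ℕ
  | 0, i, j => F ((2 ^ p.s + c i) * 2 ^ p.δ + j)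
  | h + 1, i, j => xsum (2 ^ (h + p.δ)) fun j' =>
      F (p.entry h j' (mux (p.mb j') (nodeVal F c h (2 * i) j') (nodeVal F c h (2 * i + 1) j')) *
        2 ^ (h + 1 + p.δ) + j)

/-- The characters of a key. -/
def char (x n : ℕ) : ℕ :=
  x / 2 ^ (p.w * (n / 2 ^ p.π)) % 2 ^ p.w / 2 ^ (n % 2 ^ p.π * p.s) % 2 ^ p.s

end Par

/-- The memory outside of the working space is the same. -/
def MemEq (p : Par) (m m' : ℕ → ℕ) : Prop := ∀ a, a < p.bA ∨ p.bT ≤ a → m' a = m a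

/-- The value of the table entry of coordinate `j` at a node of height `h + 1`. -/
def Par.term (p : Par) (F c : ℕ → ℕ) (h i j' j : ℕ) : ℕ :=
  F (p.entry h j' (mux (p.mb j') (p.nodeVal F c h (2 * i) j') (p.nodeVal F c h (2 * i + 1) j')) *
        2 ^ (h + 1 + p.δ) + j)

theorem Par.nodeVal_succ (p : Par) (F c : ℕ → ℕ) (h i j : ℕ) :
    p.nodeVal F c (h + 1) i j = xsum (2 ^ (h + p.δ)) fun j' => p.term F c h i j' j := rfl

/-- The number of coordinates already processed for the node `n`. -/
def cnt (N i j n : ℕ) : ℕ := if n < i then N else if n = i then j else 0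

theorem Par.word_le (p : Par) {E n ν : ℕ} (h : (n + 1) * 2 ^ E ≤ 2 ^ ν) :
    p.word E n + 2 ^ (E - p.g) ≤ 2 ^ (ν - p.g) := by
  have hEν : E ≤ ν := by
    by_contra hc
    have h1 : 2 ^ ν < 2 ^ E := Nat.pow_lt_pow_right (by norm_num) (by omega)
    nlinarith [Nat.zero_le (n * 2 ^ E)]
  rcases le_total p.g E with hg | hg
  · have e : p.word E n + 2 ^ (E - p.g) = (n + 1) * 2 ^ (E - p.g) := by
      simp [Par.word, Nat.sub_eq_zero_of_le hg]; ring
    rw [e]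
    have h2 : 2 ^ E = 2 ^ (E - p.g) * 2 ^ p.g := by rw [← pow_add]; congr 1; omega
    have h3 : 2 ^ ν = 2 ^ (ν - p.g) * 2 ^ p.g := by rw [← pow_add]; congr 1; omega
    rw [h2, h3, ← mul_assoc] at h
    exact Nat.le_of_mul_le_mul_right h (by positivity)
  · have e : p.word E n + 2 ^ (E - p.g) = n / 2 ^ (p.g - E) + 1 := by
      simp [Par.word, Nat.sub_eq_zero_of_le hg]
    rw [e]
    have h3 : 2 ^ ν = 2 ^ (ν - E) * 2 ^ E := by rw [← pow_add]; congr 1; omega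
    rw [h3] at h
    have h4 : n < 2 ^ (ν - E) := Nat.le_of_mul_le_mul_right h (by positivity)
    rw [Nat.add_one_le_iff, Nat.div_lt_iff_lt_mul (by positivity), ← pow_add]
    exact h4.trans_le (Nat.pow_le_pow_right (by norm_num) (by omega))

theorem Par.mul_lt (p : Par) {E n ν : ℕ} (h : (n + 1) * 2 ^ E ≤ 2 ^ ν)
    (hν : 2 ^ (ν - p.g) < 2 ^ p.w) (hn : n < 2 ^ p.w) : n * 2 ^ (E - p.g) < 2 ^ p.w := by
  have h1 := p.word_le h
  have h2 : 0 < 2 ^ (E - p.g) := by positivity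
  rcases le_total p.g E with hg | hg
  · simp only [Par.word, Nat.sub_eq_zero_of_le hg, pow_zero, Nat.div_one] at h1
    omega
  · simpa [Nat.sub_eq_zero_of_le hg] using hn

theorem Par.TW_lt (p : Par) : p.bT + p.TW < p.S := by
  have : 0 < 2 ^ (p.τ + p.δ + p.M + p.q - 1 - p.gr) := by positivity
  unfold Par.S Par.bV Par.VW
  omega

/-- The two buffers. -/
def Par.Bufs (p : Par) (ib ob : ℕ) : Prop := (ib = p.b0 ∧ ob = p.b1) ∨ (ib = p.b1 ∧ ob = p.b0)

theorem Par.Bufs.bounds {p : Par} {ib ob : ℕ} (h : p.Bufs ib ob) :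
    p.bA ≤ ib ∧ p.bA ≤ ob ∧ ib + p.BW ≤ p.bT ∧ ob + p.BW ≤ p.bT ∧
      (ib + p.BW ≤ ob ∨ ob + p.BW ≤ ib) := by
  have : 0 < 2 ^ p.q := by positivity
  rcases h with ⟨rfl, rfl⟩ | ⟨rfl, rfl⟩ <;> unfold Par.bT Par.b1 Par.b0 <;> omega

theorem Par.div_lt_BW (p : Par) {f : ℕ} (hf : f < 2 ^ (p.τ + p.δ)) : f / 2 ^ p.g < p.BW :=
  Par.div_lt hf

/-- Processing one coordinate of a node. -/
def coordBody : Cmd := .seq getIdx (.seq (blk [.op .add 45 34 36, .op .shl 45 45 2,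
  .op .add 45 45 40]) (.seq xorEntry (.op .add 36 36 22)))

/-- The invariant while the nodes of height `h + 1` are evaluated. -/
structure LevInv (p : Par) (c m₀ o₀ : ℕ → ℕ) (h ib ob i j : ℕ) (s : NS) : Prop where
  regs : Regs p s
  lev : Level p (h + 1 + p.δ) s
  r30 : s.reg 30 = ib
  r31 : s.reg 31 = ob
  r33 : s.reg 33 = 2 ^ (p.τ - h - 1)
  r34 : s.reg 34 = 2 ^ (h + p.δ)
  r35 : s.reg 35 = i
  r38 : s.reg 38 = p.τ + p.δ
  red : Red p.w s.mem
  out : s.out = o₀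
  eq : MemEq p m₀ s.mem
  inb : ∀ f < 2 ^ (p.τ + p.δ), fld p s.mem ib f =
    p.nodeVal (fld p m₀ p.bT) c h (f / 2 ^ (h + p.δ)) (f % 2 ^ (h + p.δ))
  outb : ∀ f < 2 ^ (p.τ + p.δ), fld p s.mem ob f =
    xsum (cnt (2 ^ (h + p.δ)) i j (f / 2 ^ (h + 1 + p.δ))) fun j' =>
      p.term (fld p m₀ p.bT) c h (f / 2 ^ (h + 1 + p.δ)) j' (f % 2 ^ (h + 1 + p.δ))

/-- The summand `2 ^ (h + δ)` in `Par.entry` gives the tables a heap layout: the entry numbers of a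
height fill the upper half of an initial segment whose length is a power of two. All heights share
one array, and no table offsets have to be computed. -/
theorem Par.Valid.tables_le {p : Par} (hp : p.Valid) {h j v : ℕ} (hh : h + 1 < p.τ)
    (hj : j < 2 ^ (h + p.δ)) (hv : v < 2 ^ p.M) :
    (p.entry h j v + 1) * 2 ^ (h + 1 + p.δ) ≤ 2 ^ (p.τ + p.τ - 2 + p.δ + p.δ + p.M) ∧
      p.entry h j v < 2 ^ p.w := by
  have h1 : p.entry h j v + 1 ≤ 2 ^ (h + 1 + p.δ + p.M) := by
    unfold Par.entry
    have : 2 ^ (h + 1 + p.δ + p.M) = (2 ^ (h + p.δ) + 2 ^ (h + p.δ)) * 2 ^ p.M := by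
      rw [pow_add, show h + 1 + p.δ = h + p.δ + 1 by ring, pow_succ]; ring
    rw [this]
    have h2 : (2 ^ (h + p.δ) + j + 1) * 2 ^ p.M ≤ (2 ^ (h + p.δ) + 2 ^ (h + p.δ)) * 2 ^ p.M :=
      Nat.mul_le_mul_right _ (by omega)
    rw [Nat.succ_mul] at h2
    omega
  constructor
  · refine (Nat.mul_le_mul_right _ h1).trans ?_
    rw [← pow_add]
    exact Nat.pow_le_pow_right (by norm_num) (by omega)
  · refine lt_of_lt_of_le (Nat.lt_of_succ_le h1) (Nat.pow_le_pow_right (by norm_num) ?_)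
    have := hp.hidx
    omega

theorem LevInv.same {p : Par} {c m₀ o₀ : ℕ → ℕ} {h ib ob i j : ℕ} {s s' : NS}
    (hI : LevInv p c m₀ o₀ h ib ob i j s) (hs : Same 36 s s') (h38 : s'.reg 38 = s.reg 38)
    (hm : s'.mem = s.mem) (ho : s'.out = s.out) : LevInv p c m₀ o₀ h ib ob i j s' where
  regs := hI.regs.same hs
  lev := hI.lev.same hs
  r30 := (hs _ (by norm_num)).trans hI.r30
  r31 := (hs _ (by norm_num)).trans hI.r31
  r33 := (hs _ (by norm_num)).trans hI.r33
  r34 := (hs _ (by norm_num)).trans hI.r34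
  r35 := (hs _ (by norm_num)).trans hI.r35
  r38 := h38.trans hI.r38
  red := hm ▸ hI.red
  out := ho.trans hI.out
  eq := hm ▸ hI.eq
  inb := hm ▸ hI.inb
  outb := hm ▸ hI.outb

theorem node_lt {p : Par} {h i E : ℕ} (hh : h + 1 < p.τ) (hE : E = h + 1 + p.δ)
    (hi : i < 2 ^ (p.τ - h - 1)) : (i + 1) * 2 ^ E ≤ 2 ^ (p.τ + p.δ) := by
  refine (Nat.mul_le_mul_right _ (Nat.succ_le_of_lt hi)).trans ?_
  rw [← pow_add]
  exact Nat.pow_le_pow_right (by norm_num) (by omega)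

theorem Par.Valid.BW_lt {p : Par} (hp : p.Valid) : p.BW < 2 ^ p.w := by
  have h1 := p.TW_lt
  have h2 := hp.hS
  have : p.BW ≤ p.bT := by unfold Par.bT; omega
  omega

theorem Par.Valid.two_pow_τδ {p : Par} (hp : p.Valid) : 2 ^ (p.τ + p.δ) < 2 ^ p.w :=
  Nat.pow_lt_pow_right (by norm_num) (by have := hp.hidx; omega)

/-- Only node `i` receives a further term of its xor sum. Fields of other nodes are untouched, and
the children are read from the other buffer. -/
theorem tri_coordBody {p : Par} (hp : p.Valid) {inp c m₀ o₀ : ℕ → ℕ} {h ib ob i j : ℕ} {s : NS}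
    (hh : h + 1 < p.τ) (hi : i < 2 ^ (p.τ - h - 1)) (hj : j < 2 ^ (h + p.δ)) (hb : p.Bufs ib ob)
    (hI : LevInv p c m₀ o₀ h ib ob i j s) (h36 : s.reg 36 = j) :
    Tri p.w p.S inp coordBody s (105 + 2 ^ (h + 1 + p.δ - p.g) * 22)
      fun s' => LevInv p c m₀ o₀ h ib ob i (j + 1) s' ∧ s'.reg 36 = j + 1 := by
  have hS := hp.hS
  obtain ⟨hb1, hb2, hb3, hb4, hb5⟩ := hb.bounds
  have hTW := p.TW_lt
  have hnode := node_lt hh rfl hi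
  have hτδ := hp.two_pow_τδ
  have hE2 : 2 ^ (h + 1 + p.δ) = 2 * 2 ^ (h + p.δ) := by
    rw [show h + 1 + p.δ = h + p.δ + 1 by ring, pow_succ]; ring
  have hfl : i * 2 ^ (h + 1 + p.δ) + j + 2 ^ (h + p.δ) < 2 ^ (p.τ + p.δ) := by
    rw [Nat.succ_mul] at hnode; omega
  refine (Tri.wp_seq hS (n := 37 + 2 ^ (h + 1 + p.δ - p.g) * 22) ?_).le (by
    simp [Cmd.cost, blk, skip, mov, getIdx, getField] <;> omega)
  refine wp_getIdx hp hI.regs hI.red hτδ (fun n hn => ?_) hI.r35 h36 hI.lev.r24 hI.r34 ?_ hfl ?_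
  · have := p.div_lt_BW hn
    rw [hI.r30]; omega
  · have : h + 1 + p.δ < 2 ^ (h + 1 + p.δ) := Nat.lt_two_pow_self
    rw [Nat.succ_mul] at hnode
    omega
  intro s1 hs1 hm1 ho1 h40
  have hI1 := hI.same (s' := s1) (hs1.mono (by norm_num)) (hs1 _ (by norm_num)) hm1 ho1
  set F := fld p m₀ p.bT with hF
  have e40 : s1.reg 40 = mux (p.mb j) (p.nodeVal F c h (2 * i) j)
      (p.nodeVal F c h (2 * i + 1) j) := by
    rw [h40, hI.r30, hI.inb _ hfl, hI.inb _ (by omega)]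
    -- As vectors double in length with the height, node `i` covers the same field positions as its
    -- children `2 * i` and `2 * i + 1` in the other buffer.
    have a1 : i * 2 ^ (h + 1 + p.δ) + j = 2 ^ (h + p.δ) * (2 * i) + j := by rw [hE2]; ring
    have a2 : i * 2 ^ (h + 1 + p.δ) + j + 2 ^ (h + p.δ) = 2 ^ (h + p.δ) * (2 * i + 1) + j := by
      rw [hE2]; ring
    rw [a2, a1, Nat.mul_add_div (by positivity), Nat.mul_add_div (by positivity),
      Nat.mul_add_mod, Nat.mul_add_mod, Nat.div_eq_of_lt hj, Nat.mod_eq_of_lt hj]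
    rfl
  have hv : s1.reg 40 < 2 ^ p.M := by
    rw [h40]
    exact mux_lt (fld_lt p _ _ _) (fld_lt p _ _ _)
  obtain ⟨ht1, ht2⟩ := hp.tables_le hh hj hv
  set v := s1.reg 40 with hvdef
  have h36' : s1.reg 36 = j := (hs1 _ (by norm_num)).trans h36
  have hMw : p.M < 2 ^ p.w := lt_of_le_of_lt hp.hM Nat.lt_two_pow_self
  refine (Tri.wp_seq hS (n := 29 + 2 ^ (h + 1 + p.δ - p.g) * 22) ?_).le (by
    simp [Cmd.cost, blk, skip, mov] <;> omega)
  simp only [blk, wp, skip, NS.set_reg, NS.set_mem]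
  simp only [Nat.reduceEqDiff, if_true, if_false, hI1.r34, hI1.regs.r2, h36', hMw, true_and,
    ← hvdef]
  have hI2 : LevInv p c m₀ o₀ h ib ob i j ((((s1.set 45 (2 ^ (h + p.δ) + j)).set 45
      ((2 ^ (h + p.δ) + j) * 2 ^ p.M)).set 45 ((2 ^ (h + p.δ) + j) * 2 ^ p.M + v)).set 99 0) :=
    hI1.same (by simp) (by simp) (by simp) (by simp)
  have hob : p.word (h + 1 + p.δ) i + ob + 2 ^ (h + 1 + p.δ - p.g) ≤ p.bT := by
    have : p.word (h + 1 + p.δ) i + 2 ^ (h + 1 + p.δ - p.g) ≤ p.BW := p.word_le hnode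
    omega
  have hsrc := p.word_le ht1
  have hTWl : 2 ^ (p.τ + p.τ - 2 + p.δ + p.δ + p.M - p.g) = p.TW := rfl
  have hBWl : 2 ^ (p.τ + p.δ - p.g) = p.BW := rfl
  have hnd := p.word_le hnode
  refine (Tri.seq (n₂ := 1) (tri_xorEntry hp hI2.regs hI2.lev hI2.red (n := p.entry h j v)
    (by simp [Par.entry]) hI2.r35 hI2.r31 (p.mul_lt ht1 (by rw [hTWl]; omega) ht2)
    (p.mul_lt hnode (hBWl ▸ hp.BW_lt) ?_) (by omega) hob ?_)).le (by omega)
  · have h1 : 0 < 2 ^ (h + 1 + p.δ) := by positivity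
    have h2 := Nat.le_mul_of_pos_right (i + 1) h1
    omega
  intro s3 hs3 ho3 hm3
  refine Tri.of_wp hS ?_
  simp only [wp]
  have hs13 : Same 40 s1 s3 := Same.trans (by simp) (hs3.mono (by norm_num))
  refine ⟨?_, by simp [hI1.regs.same hs13 |>.r22, hs13 36, h36']⟩
  have e3 : ∀ k < 40, s3.reg k = s1.reg k := hs13
  have hs13' : Same 36 s1 (s3.set 36 (s3.reg 36 + s3.reg 22)) := by
    simpa using hs13.mono (by norm_num)
  refine ⟨hI1.regs.same hs13', hI1.lev.same hs13', (hs13' _ (by norm_num)).trans hI1.r30,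
    (hs13' _ (by norm_num)).trans hI1.r31, (hs13' _ (by norm_num)).trans hI1.r33,
    (hs13' _ (by norm_num)).trans hI1.r34, (hs13' _ (by norm_num)).trans hI1.r35,
    by simpa using (e3 38 (by norm_num)).trans hI1.r38, ?_, ?_, ?_, ?_, ?_⟩
  · simp only [NS.set_mem, hm3]
    exact hp.red_xorMem hI2.red
  · simpa [ho3] using hI1.out
  · intro a ha
    simp only [NS.set_mem, hm3]
    rw [Par.xorMem_of_not_mem (by omega)]
    exact hI2.eq a ha
  · intro f hf
    simp only [NS.set_mem, hm3]
    rw [fld_congr, hI2.inb f hf]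
    have := p.div_lt_BW hf
    have h0 := Nat.zero_le (f / 2 ^ p.g)
    exact Par.xorMem_of_not_mem (by omega)
  · intro f hf
    simp only [NS.set_mem, hm3]
    set k := f / 2 ^ (h + 1 + p.δ) with hk
    have hf' : f = k * 2 ^ (h + 1 + p.δ) + f % 2 ^ (h + 1 + p.δ) := by
      rw [mul_comm]; exact (Nat.div_add_mod _ _).symm
    have hfm : f % 2 ^ (h + 1 + p.δ) < 2 ^ (h + 1 + p.δ) := Nat.mod_lt _ (by positivity)
    by_cases hki : k = i
    · have e : fld p (p.xorMem (h + 1 + p.δ) ob (p.entry h j v) i s1.mem) ob f =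
          fld p s1.mem ob f ^^^ F (p.entry h j v * 2 ^ (h + 1 + p.δ) + f % 2 ^ (h + 1 + p.δ)) := by
        rw [hf', hki, hp.fld_xorMem_same _ hfm, hF, Nat.mul_add_mod', Nat.mod_eq_of_lt hfm]
        congr 1
        refine fld_congr (hI1.eq _ (Or.inr ?_))
        exact Nat.le_add_right _ _
      simp only [NS.set_mem] at *
      rw [e, hI1.outb f hf, ← hk, hki]
      simp [cnt, xsum, Par.term, e40, hF]
    · simp only [NS.set_mem] at *
      rw [hp.fld_xorMem_ne _ (by rwa [← hk]), hI1.outb f hf, ← hk]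
      simp [cnt, hki]

end WordRAM

/-! ### Nodes and levels of the tree. -/

namespace WordRAM

/-- Evaluating one node of the tree. -/
def nodeBody : Cmd := .seq (.const 36 0) (.seq (.loop (.lt 36 34) coordBody) (.op .add 35 35 22))

/-- A bound for the time that is needed to evaluate a node of height `h + 1`. -/
def Par.nodeTime (p : Par) (h : ℕ) : ℕ :=
  2 ^ (h + p.δ) * (106 + 2 ^ (h + 1 + p.δ - p.g) * 22) + 5

theorem tri_nodeBody {p : Par} (hp : p.Valid) {inp c m₀ o₀ : ℕ → ℕ} {h ib ob i : ℕ} {s : NS}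
    (hh : h + 1 < p.τ) (hi : i < 2 ^ (p.τ - h - 1)) (hb : p.Bufs ib ob)
    (hI : LevInv p c m₀ o₀ h ib ob i 0 s) :
    Tri p.w p.S inp nodeBody s (p.nodeTime h)
      fun s' => LevInv p c m₀ o₀ h ib ob (i + 1) 0 s' := by
  have hS := hp.hS
  have hlt : 2 ^ (h + p.δ) < 2 ^ p.w :=
    Nat.pow_lt_pow_right (by norm_num) (by have := hp.hidx; omega)
  refine (Tri.wp_seq hS (n := 2 ^ (h + p.δ) * (106 + 2 ^ (h + 1 + p.δ - p.g) * 22) + 3) ?_).le (by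
    simp [Cmd.cost, Par.nodeTime] <;> omega)
  refine (Tri.seq (n₁ := 2 ^ (h + p.δ) * (106 + 2 ^ (h + 1 + p.δ - p.g) * 22) + 1) (n₂ := 1)
    ((Tri.loop (fun j s' => LevInv p c m₀ o₀ h ib ob i j s' ∧ s'.reg 36 = j) (2 ^ (h + p.δ))
      (105 + 2 ^ (h + 1 + p.δ - p.g) * 22) ?_ ?_ ?_).le (le_of_eq ?_))).le (by omega)
  · exact ⟨hI.same (by simp) (by simp) (by simp) (by simp), by simp⟩
  · rintro j hj s' ⟨h1, h2⟩
    refine ⟨⟨by omega, by rw [h1.r34]; exact hlt⟩, by simp only [Test.truth, h2, h1.r34, hj], ?_⟩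
    exact tri_coordBody hp hh hi hj hb h1 h2
  · rintro s' ⟨h1, h2⟩
    refine ⟨⟨by omega, by rw [h1.r34]; exact hlt⟩, by simp only [Test.truth, h2, h1.r34, lt_irrefl, not_false_eq_true], ?_⟩
    refine Tri.of_wp hS ?_
    simp only [wp]
    have hs : Same 35 s' (s'.set 35 (s'.reg 35 + s'.reg 22)) := by simp
    refine ⟨h1.regs.same hs, h1.lev.same hs, h1.r30, h1.r31, h1.r33, h1.r34, ?_, h1.r38, h1.red,
      h1.out, h1.eq, h1.inb, ?_⟩
    · simp [h1.r35, h1.regs.r22]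
    · intro f hf
      rw [NS.set_mem, h1.outb f hf]
      -- Having finished all coordinates of node `i` is the same count as having finished none of
      -- node `i + 1`.
      congr 1
      unfold cnt
      split_ifs <;> omega
  · ring

/-- The state between the evaluation of different heights. -/
structure LevPre (p : Par) (c m₀ o₀ : ℕ → ℕ) (h ib ob : ℕ) (s : NS) : Prop where
  regs : Regs p s
  r24 : s.reg 24 = h + 1 + p.δ
  r30 : s.reg 30 = ib
  r31 : s.reg 31 = ob
  r33 : s.reg 33 = 2 ^ (p.τ - h)
  r38 : s.reg 38 = p.τ + p.δ
  red : Red p.w s.mem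
  out : s.out = o₀
  eq : MemEq p m₀ s.mem
  inb : ∀ f < 2 ^ (p.τ + p.δ), fld p s.mem ib f =
    p.nodeVal (fld p m₀ p.bT) c h (f / 2 ^ (h + p.δ)) (f % 2 ^ (h + p.δ))

/-- Evaluating the nodes of one height. -/
def levelBody : Cmd := .seq setup (.seq clearBuf (.seq
  (blk [.op .shr 33 33 22, .op .sub 34 24 22, .op .shl 34 22 34, .const 35 0])
  (.seq (.loop (.lt 35 33) nodeBody)
    (blk [mov 46 30, mov 30 31, mov 31 46, .op .add 24 24 22]))))

theorem Par.Bufs.swap {p : Par} {ib ob : ℕ} (h : p.Bufs ib ob) : p.Bufs ob ib := by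
  rcases h with ⟨rfl, rfl⟩ | ⟨rfl, rfl⟩
  · exact Or.inr ⟨rfl, rfl⟩
  · exact Or.inl ⟨rfl, rfl⟩

/-- A bound for the time that is needed to evaluate all nodes of height `h + 1`. -/
def Par.levelTime (p : Par) (h : ℕ) : ℕ :=
  70 + p.BW * 6 + 2 ^ (p.τ - h - 1) * (p.nodeTime h + 1)

/-- The cleared output buffer represents the empty xor sums. Afterwards the two buffers change
roles. -/
theorem tri_levelBody {p : Par} (hp : p.Valid) {inp c m₀ o₀ : ℕ → ℕ} {h ib ob : ℕ} {s : NS}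
    (hh : h + 1 < p.τ) (hb : p.Bufs ib ob) (hI : LevPre p c m₀ o₀ h ib ob s) :
    Tri p.w p.S inp levelBody s (p.levelTime h)
      fun s' => LevPre p c m₀ o₀ (h + 1) ob ib s' := by
  have hS := hp.hS
  have hidx := hp.hidx
  have hlt : ∀ k ≤ p.τ + p.δ, 2 ^ k < 2 ^ p.w := fun k hk =>
    Nat.pow_lt_pow_right (by norm_num) (by omega)
  have hklt : ∀ k ≤ p.τ + p.δ, k < 2 ^ p.w := fun k hk => Nat.lt_two_pow_self.trans (hlt k hk)
  obtain ⟨hb1, hb2, hb3, hb4, hb5⟩ := hb.bounds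
  have hTW := p.TW_lt
  have h1w : 1 < 2 ^ p.w := Nat.one_lt_two_pow (by have := hp.hw; omega)
  refine (Tri.wp_seq hS (n := 40 + p.BW * 6 + 2 ^ (p.τ - h - 1) * (p.nodeTime h + 1)) ?_).le (by
    simp [Cmd.cost, setup, blk, skip, Par.levelTime] <;> omega)
  refine wp_setup hp hI.regs hI.r24 (hklt _ (by omega)) fun s1 hs1 hk1 hm1 ho1 hl1 => ?_
  refine (Tri.seq (n₂ := 30 + 2 ^ (p.τ - h - 1) * (p.nodeTime h + 1)) (tri_clearBuf hp
    (hI.regs.same hs1) ((hk1 31 (by norm_num) (by norm_num)).trans hI.r31) (by omega)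
      fun s2 hs2 ho2 hm2 => ?_)).le (by omega)
  have e2 : ∀ k, 30 ≤ k → k < 60 → s2.reg k = s.reg k := fun k hk hk' => by
    rw [hs2 k hk', hk1 k hk (by omega)]
  have hr2 : Regs p s2 := (hI.regs.same hs1).same hs2
  have hl2 : Level p (h + 1 + p.δ) s2 := hl1.same hs2
  refine (Tri.wp_seq hS (n := 11 + 2 ^ (p.τ - h - 1) * (p.nodeTime h + 1)) ?_).le (by
    simp [Cmd.cost, setup, blk, skip] <;> omega)
  have hpow : 2 ^ (p.τ - h) / 2 = 2 ^ (p.τ - h - 1) := by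
    rw [show p.τ - h = p.τ - h - 1 + 1 by omega, pow_succ]; simp
  have e33 : s2.reg 33 = 2 ^ (p.τ - h) := (e2 _ (by norm_num) (by norm_num)).trans hI.r33
  have hsub : h + 1 + p.δ - 1 = h + p.δ := by omega
  simp only [blk, wp, skip, NS.set_reg, NS.set_mem, e33, hr2.r22, hl2.r24]
  simp only [Nat.reduceEqDiff, if_true, if_false, pow_one, one_mul, hpow, hr2.r22, hl2.r24, hsub,
    h1w, hlt _ (show p.τ - h ≤ p.τ + p.δ by omega), hklt _ (show h + p.δ ≤ p.τ + p.δ by omega),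
    true_and]
  refine ⟨by omega, ?_⟩
  refine (Tri.seq (n₁ := 2 ^ (p.τ - h - 1) * (p.nodeTime h + 1) + 1) (n₂ := 9)
    (Tri.loop (fun i s' => LevInv p c m₀ o₀ h ib ob i 0 s') (2 ^ (p.τ - h - 1))
      (p.nodeTime h) ?_ ?_ ?_)).le (by omega)
  · have hsm : Same 30 s2 (((((s2.set 33 (2 ^ (p.τ - h - 1))).set 34 (h + p.δ)).set 34
        (2 ^ (h + p.δ))).set 35 0).set 99 0) := by simp
    have hmem : ∀ a, s2.mem a = if ob ≤ a ∧ a < ob + p.BW then 0 else s.mem a := fun a => by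
      rw [hm2, hm1]
    refine ⟨hr2.same hsm, hl2.same hsm, by simpa [e2] using hI.r30, by simpa [e2] using hI.r31,
      by simp, by simp, by simp, by simpa [e2] using hI.r38, ?_, ?_, ?_, ?_, ?_⟩
    · intro a
      simp only [NS.set_mem, hmem]
      split_ifs
      · positivity
      · exact hI.red a
    · simp [ho2, ho1, hI.out]
    · intro a ha
      simp only [NS.set_mem, hmem]
      rw [if_neg (by omega)]
      exact hI.eq a ha
    · intro f hf
      have := p.div_lt_BW hf
      have h0 := Nat.zero_le (f / 2 ^ p.g)
      simp only [NS.set_mem]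
      rw [← hI.inb f hf]
      refine fld_congr ?_
      rw [hmem, if_neg (by omega)]
    · intro f hf
      have := p.div_lt_BW hf
      have h0 := Nat.zero_le (f / 2 ^ p.g)
      simp only [NS.set_mem]
      rw [fld_zero]
      · unfold cnt
        simp [xsum]
      · rw [hmem, if_pos (by omega)]
  · intro i hi s' h1
    have := hlt (p.τ - h - 1) (by omega)
    refine ⟨⟨by rw [h1.r35]; omega, by rw [h1.r33]; omega⟩, by
      simp only [Test.truth, h1.r35, h1.r33, hi], tri_nodeBody hp hh hi hb h1⟩
  · intro s' h1
    have := hlt (p.τ - h - 1) (by omega)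
    refine ⟨⟨by rw [h1.r35]; omega, by rw [h1.r33]; omega⟩, by
      simp only [Test.truth, h1.r35, h1.r33, lt_irrefl, not_false_eq_true], ?_⟩
    refine (Tri.of_wp hS ?_).le (m := 9) le_rfl
    simp only [blk, wp, skip, mov, NS.set_reg, NS.set_mem, Nat.or_self, h1.r30, h1.r31, h1.lev.r24,
      h1.regs.r22]
    refine ⟨(h1.regs).same (b := 24) (by simp), ?_, ?_, ?_, ?_, ?_, h1.red, h1.out, h1.eq, ?_⟩
    · simp [h1.lev.r24, h1.regs.r22]; omega
    · simp [h1.r31]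
    · simp [h1.r30]
    · simp [h1.r33, Nat.sub_sub]
    · simp [h1.r38]
    · intro f hf
      simp only [NS.set_mem]
      rw [h1.outb f hf, Par.nodeVal_succ]
      have : f / 2 ^ (h + 1 + p.δ) < 2 ^ (p.τ - h - 1) := by
        rw [Nat.div_lt_iff_lt_mul (by positivity), ← pow_add]
        convert hf using 2
        omega
      rw [cnt, if_pos this]

/-- Evaluating all inner nodes below the root. -/
def levels : Cmd := .seq (blk [mov 30 16, mov 31 17, .op .add 24 1 22, .op .shl 33 22 0,
  .op .add 38 0 1]) (.loop (.lt 24 38) levelBody)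

/-- The loop stops at the two children of the root. The root is treated separately, as its table has
values in `[r]` instead of bit vectors. -/
theorem tri_levels {p : Par} (hp : p.Valid) {inp c m₀ o₀ : ℕ → ℕ} {s : NS} (hr : Regs p s)
    (hred : Red p.w s.mem) (ho : s.out = o₀) (hm : MemEq p m₀ s.mem)
    (hin : ∀ f < 2 ^ (p.τ + p.δ), fld p s.mem p.b0 f =
      p.nodeVal (fld p m₀ p.bT) c 0 (f / 2 ^ p.δ) (f % 2 ^ p.δ)) :
    Tri p.w p.S inp levels s (13 + ∑ h ∈ Finset.range (p.τ - 1), (p.levelTime h + 1))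
      fun s' => ∃ ib ob, p.Bufs ib ob ∧ LevPre p c m₀ o₀ (p.τ - 1) ib ob s' := by
  have hS := hp.hS
  have hidx := hp.hidx
  have hτ := hp.hτ
  have hlt : ∀ k ≤ p.τ + p.δ, k < 2 ^ p.w := fun k hk => Nat.lt_two_pow_self.trans
    (Nat.pow_lt_pow_right (by norm_num) (by omega))
  refine (Tri.wp_seq hS (n := ∑ h ∈ Finset.range (p.τ - 1), (p.levelTime h + 1) + 1) ?_).le (by
    simp [Cmd.cost, blk, skip, mov] <;> omega)
  simp only [blk, wp, skip, mov, NS.set_reg, NS.set_mem, hr.r0, hr.r1, hr.r16, hr.r17, hr.r22]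
  simp only [Nat.reduceEqDiff, if_true, if_false, Nat.or_self, hr.r0, hr.r1, hr.r16, hr.r17, hr.r22,
    hlt _ (show p.τ ≤ p.τ + p.δ by omega), true_and, one_mul]
  refine Tri.loop_sum (fun h s' => ∃ ib ob, p.Bufs ib ob ∧ LevPre p c m₀ o₀ h ib ob s')
    (p.τ - 1) p.levelTime ?_ ?_ ?_
  · refine ⟨p.b0, p.b1, Or.inl ⟨rfl, rfl⟩, hr.same (b := 24) (by simp), by simp; omega, by simp,
      by simp, by simp, by simp, hred, ho, hm, ?_⟩
    intro f hf
    simpa using hin f hf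
  · rintro h hh s' ⟨ib, ob, hb, hI⟩
    have h1 := hlt (h + 1 + p.δ) (by omega)
    have h2 := hlt (p.τ + p.δ) le_rfl
    refine ⟨⟨by rw [hI.r24]; exact h1, by rw [hI.r38]; exact h2⟩, ?_,
      (tri_levelBody hp (by omega) hb hI).imp fun s'' h'' => ⟨ob, ib, hb.swap, h''⟩⟩
    simp only [Test.truth, hI.r24, hI.r38]
    omega
  · rintro s' ⟨ib, ob, hb, hI⟩
    have h1 := hlt (p.τ - 1 + 1 + p.δ) (by omega)
    have h2 := hlt (p.τ + p.δ) le_rfl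
    refine ⟨⟨by rw [hI.r24]; exact h1, by rw [hI.r38]; exact h2⟩, ?_, ib, ob, hb, hI⟩
    simp only [Test.truth, hI.r24, hI.r38]
    omega

end WordRAM

/-! ### The leaves: cutting the key into characters. -/

namespace WordRAM

/-- Evaluating one leaf. -/
def leafBody : Cmd := .seq (blk [.op .and 46 35 30,
  .branch (.eq 46 23) (.seq (.op .shr 46 35 7) (.input 37 0 46)) skip,
  .op .and 45 37 34, .op .add 45 45 33, .op .shr 37 37 5]) (.seq xorEntry (.op .add 35 35 22))

/-- Evaluating the leaves. -/
def leaves : Cmd := .seq (blk [mov 24 1, mov 31 16]) (.seq setup (.seq clearBuf (.seq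
  (blk [.const 35 0, .op .shl 32 22 0, .op .shl 33 22 5, .op .sub 34 33 22, .op .shl 30 22 7,
    .op .sub 30 30 22]) (.loop (.lt 35 32) leafBody))))

/-- The invariant while the leaves are evaluated. -/
structure LeafInv (p : Par) (x : ℕ) (m₀ o₀ : ℕ → ℕ) (i : ℕ) (s : NS) : Prop where
  regs : Regs p s
  lev : Level p p.δ s
  r30 : s.reg 30 = 2 ^ p.π - 1
  r31 : s.reg 31 = p.b0
  r32 : s.reg 32 = 2 ^ p.τ
  r33 : s.reg 33 = 2 ^ p.s
  r34 : s.reg 34 = 2 ^ p.s - 1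
  r35 : s.reg 35 = i
  r37 : i % 2 ^ p.π ≠ 0 →
    s.reg 37 = x / 2 ^ (p.w * (i / 2 ^ p.π)) % 2 ^ p.w / 2 ^ (i % 2 ^ p.π * p.s)
  red : Red p.w s.mem
  out : s.out = o₀
  eq : MemEq p m₀ s.mem
  outb : ∀ f < 2 ^ (p.τ + p.δ), fld p s.mem p.b0 f =
    if f / 2 ^ p.δ < i then
      p.nodeVal (fld p m₀ p.bT) (p.char x) 0 (f / 2 ^ p.δ) (f % 2 ^ p.δ) else 0

theorem Par.Valid.s_lt {p : Par} (hp : p.Valid) : p.s < p.w := by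
  have := hp.hs
  have := hp.hM
  omega

theorem mod_succ {i a : ℕ} (h : (i + 1) % a ≠ 0) (ha : 0 < a) :
    (i + 1) % a = i % a + 1 ∧ (i + 1) / a = i / a := by
  have hn : ¬ a ∣ i + 1 := fun hd => h (Nat.mod_eq_zero_of_dvd hd)
  refine ⟨?_, Nat.succ_div_of_not_dvd hn⟩
  have h1 := Nat.div_add_mod (i + 1) a
  have h2 := Nat.div_add_mod i a
  rw [Nat.succ_div_of_not_dvd hn] at h1
  omega

theorem Par.Valid.leaf_le {p : Par} (hp : p.Valid) (x i : ℕ) :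
    (2 ^ p.s + p.char x i + 1) * 2 ^ p.δ ≤ 2 ^ (p.τ + p.τ - 2 + p.δ + p.δ + p.M) ∧
      2 ^ p.s + p.char x i < 2 ^ p.w := by
  have h1 : p.char x i < 2 ^ p.s := Nat.mod_lt _ (by positivity)
  have h2 : 2 ^ (p.s + 1) = 2 ^ p.s + 2 ^ p.s := by rw [pow_succ]; ring
  have h3 := hp.hs
  have h4 := hp.hτ
  have h5 : 2 ^ (p.s + 1) ≤ 2 ^ p.w := Nat.pow_le_pow_right (by norm_num) (by have := hp.hM; omega)
  refine ⟨(Nat.mul_le_mul_right _ (show _ ≤ 2 ^ (p.s + 1) by omega)).trans ?_, by omega⟩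
  rw [← pow_add]
  exact Nat.pow_le_pow_right (by norm_num) (by omega)

/-- Register 37 holds the rest of the current word of the key. The invariant speaks about it only
inside a group of `2 ^ π` characters, since at the start of a group the next word is read. -/
theorem tri_leafBody {p : Par} (hp : p.Valid) {inp m₀ o₀ : ℕ → ℕ} {i : ℕ} {s : NS}
    (hi : i < 2 ^ p.τ) (hI : LeafInv p (inp 0) m₀ o₀ i s) :
    Tri p.w p.S inp leafBody s (50 + 2 ^ (p.δ - p.g) * 22)
      fun s' => LeafInv p (inp 0) m₀ o₀ (i + 1) s' := by
  have hS := hp.hS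
  have hidx := hp.hidx
  have hτδ := hp.two_pow_τδ
  have hb : p.Bufs p.b0 p.b1 := Or.inl ⟨rfl, rfl⟩
  obtain ⟨hb1, hb2, hb3, hb4, hb5⟩ := hb.bounds
  have hTW := p.TW_lt
  have hlt : ∀ k ≤ p.τ + p.δ, 2 ^ k < 2 ^ p.w := fun k hk =>
    Nat.pow_lt_pow_right (by norm_num) (by omega)
  have hiw : i < 2 ^ p.w := hi.trans (hlt _ (by omega))
  have hπ : p.π < 2 ^ p.w := Nat.lt_two_pow_self.trans (hlt _ (by have := hp.hπ; omega))
  have hsw : p.s < 2 ^ p.w := hp.s_lt.trans Nat.lt_two_pow_self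
  set W := inp 0 / 2 ^ (p.w * (i / 2 ^ p.π)) % 2 ^ p.w with hW
  have hWlt : W < 2 ^ p.w := Nat.mod_lt _ (by positivity)
  set cur := W / 2 ^ (i % 2 ^ p.π * p.s) with hcur
  have hcurlt : cur < 2 ^ p.w := lt_of_le_of_lt (Nat.div_le_self _ _) hWlt
  have hchar : cur % 2 ^ p.s = p.char (inp 0) i := rfl
  refine (Tri.wp_seq hS (n := 29 + 2 ^ (p.δ - p.g) * 22) (Q := fun s' =>
    LeafInv p (inp 0) m₀ o₀ (i + 1) s') ?_).le (by
    simp [Cmd.cost, blk, skip] <;> omega)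
  -- Whether a new word was read or not, the same continuation applies.
  have key : ∀ s2 : NS, Same 35 s s2 → s2.reg 35 = i → s2.mem = s.mem → s2.out = s.out →
      s2.reg 45 = p.char (inp 0) i + 2 ^ p.s → s2.reg 37 = cur / 2 ^ p.s →
      Tri p.w p.S inp (.seq xorEntry (.op .add 35 35 22)) s2 (29 + 2 ^ (p.δ - p.g) * 22)
        fun s' => LeafInv p (inp 0) m₀ o₀ (i + 1) s' := by
    intro s2 hs2 h35 hm2 ho2 h45 h37
    obtain ⟨ht1, ht2⟩ := hp.leaf_le (inp 0) i
    have hnode : (i + 1) * 2 ^ p.δ ≤ 2 ^ (p.τ + p.δ) := by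
      rw [pow_add]; exact Nat.mul_le_mul_right _ hi
    have hsrc := p.word_le ht1
    have hTWl : 2 ^ (p.τ + p.τ - 2 + p.δ + p.δ + p.M - p.g) = p.TW := rfl
    have hBWl : 2 ^ (p.τ + p.δ - p.g) = p.BW := rfl
    have hnd := p.word_le hnode
    refine (Tri.seq (n₂ := 1) (tri_xorEntry hp (hI.regs.same hs2) (hI.lev.same hs2)
      (hm2 ▸ hI.red) (n := 2 ^ p.s + p.char (inp 0) i) (by rw [h45, add_comm]) h35
      ((hs2 _ (by norm_num)).trans hI.r31)
      (p.mul_lt ht1 (by rw [hTWl]; omega) ht2) (p.mul_lt hnode (hBWl ▸ hp.BW_lt) hiw) (by omega)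
      (by omega) ?_)).le (by omega)
    intro s3 hs3 ho3 hm3
    refine Tri.of_wp hS ?_
    simp only [wp]
    rw [hm2] at hm3
    have hs13 : Same 35 s s3 := hs2.trans (hs3.mono (by norm_num))
    have hs13' : Same 35 s (s3.set 35 (s3.reg 35 + s3.reg 22)) := by simpa using hs13
    refine ⟨hI.regs.same hs13', hI.lev.same hs13', (hs13' _ (by norm_num)).trans hI.r30,
      (hs13' _ (by norm_num)).trans hI.r31, (hs13' _ (by norm_num)).trans hI.r32,
      (hs13' _ (by norm_num)).trans hI.r33, (hs13' _ (by norm_num)).trans hI.r34, ?_, ?_, ?_, ?_,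
      ?_, ?_⟩
    · simp [hs3 35, h35, (hI.regs.same hs13).r22]
    · intro hne
      obtain ⟨q1, q2⟩ := mod_succ hne (by positivity)
      simp only [NS.set_reg]
      rw [if_neg (by norm_num), hs3 37 (by norm_num), h37, q1, q2, ← hW, hcur, Nat.div_div_eq_div_mul,
        ← pow_add]
      congr 2
      ring
    · simp only [NS.set_mem, hm3]
      exact hp.red_xorMem hI.red
    · simp [ho3, ho2, hI.out]
    · intro a ha
      simp only [NS.set_mem, hm3]
      rw [Par.xorMem_of_not_mem (by omega)]
      exact hI.eq a ha
    · intro f hf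
      simp only [NS.set_mem, hm3]
      set k := f / 2 ^ p.δ with hk
      have hf' : f = k * 2 ^ p.δ + f % 2 ^ p.δ := by
        rw [mul_comm]; exact (Nat.div_add_mod _ _).symm
      have hfm : f % 2 ^ p.δ < 2 ^ p.δ := Nat.mod_lt _ (by positivity)
      by_cases hki : k = i
      · have e : fld p (p.xorMem p.δ p.b0 (2 ^ p.s + p.char (inp 0) i) i s.mem) p.b0 f =
            fld p s.mem p.b0 f ^^^
              fld p m₀ p.bT ((2 ^ p.s + p.char (inp 0) i) * 2 ^ p.δ + f % 2 ^ p.δ) := by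
          rw [hf', hki, hp.fld_xorMem_same _ hfm, Nat.mul_add_mod', Nat.mod_eq_of_lt hfm]
          congr 1
          exact fld_congr (hI.eq _ (Or.inr (Nat.le_add_right _ _)))
        rw [e, hI.outb f hf, ← hk, hki]
        simp [Par.nodeVal]
      · rw [hp.fld_xorMem_ne _ (by rwa [← hk]), hI.outb f hf, ← hk]
        have : k < i + 1 ↔ k < i := by omega
        simp [this]
  have h0w : 0 < 2 ^ p.w := by positivity
  have hand : i % 2 ^ p.π < 2 ^ p.w := lt_of_le_of_lt (Nat.mod_le _ _) hiw
  have hdiv : i / 2 ^ p.π < 2 ^ p.w := lt_of_le_of_lt (Nat.div_le_self _ _) hiw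
  simp only [blk, wp, skip, Test.ok, Test.truth, NS.set_reg, NS.set_mem]
  simp only [Nat.reduceEqDiff, if_true, if_false, hI.r35, hI.r30, hI.regs.r23, hI.regs.r7,
    hI.r34, hI.r33, hI.regs.r5, Nat.and_two_pow_sub_one_eq_mod, h0w, hand, hπ, hiw, hdiv, hsw,
    true_and, ← hW]
  refine ⟨fun h => ⟨hWlt, key _ (by simp) (by simp [hI.r35]) (by simp) (by simp) ?_ ?_⟩, fun h => ?_⟩
  · simp only [NS.set_reg, Nat.reduceEqDiff, if_true, if_false]
    rw [← hchar, hcur, h]; simp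
  · simp only [NS.set_reg, Nat.reduceEqDiff, if_true, if_false]
    rw [hcur, h]; simp
  · have h37 := hI.r37 h
    rw [← hW, ← hcur] at h37
    rw [h37]
    refine ⟨hcurlt, key _ (by simp) (by simp [hI.r35]) (by simp) (by simp) ?_ ?_⟩
    · simp only [NS.set_reg, Nat.reduceEqDiff, if_true, if_false, hchar]
    · simp only [NS.set_reg, Nat.reduceEqDiff, if_true, if_false]

theorem tri_leaves {p : Par} (hp : p.Valid) {inp : ℕ → ℕ} {s : NS} (hr : Regs p s)
    (hred : Red p.w s.mem) {Q : NS → Prop}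
    (hQ : ∀ s', Regs p s' → Red p.w s'.mem → s'.out = s.out → MemEq p s.mem s'.mem →
      (∀ f < 2 ^ (p.τ + p.δ), fld p s'.mem p.b0 f =
        p.nodeVal (fld p s.mem p.bT) (p.char (inp 0)) 0 (f / 2 ^ p.δ) (f % 2 ^ p.δ)) → Q s') :
    Tri p.w p.S inp leaves s (60 + p.BW * 6 + 2 ^ p.τ * (51 + 2 ^ (p.δ - p.g) * 22)) Q := by
  have hS := hp.hS
  have hidx := hp.hidx
  have hb : p.Bufs p.b0 p.b1 := Or.inl ⟨rfl, rfl⟩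
  obtain ⟨hb1, hb2, hb3, hb4, hb5⟩ := hb.bounds
  have hTW := p.TW_lt
  have hlt : ∀ k ≤ p.τ + p.δ, 2 ^ k < 2 ^ p.w := fun k hk =>
    Nat.pow_lt_pow_right (by norm_num) (by omega)
  have hklt : ∀ k ≤ p.τ + p.δ, k < 2 ^ p.w := fun k hk => Nat.lt_two_pow_self.trans (hlt k hk)
  have hπ := hp.hπ
  have hsw : p.s < 2 ^ p.w := hp.s_lt.trans Nat.lt_two_pow_self
  refine (Tri.wp_seq hS (n := 50 + p.BW * 6 + 2 ^ p.τ * (51 + 2 ^ (p.δ - p.g) * 22)) ?_).le (by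
    simp [Cmd.cost, blk, skip, mov] <;> omega)
  simp only [blk, wp, skip, mov, NS.set_reg, Nat.or_self, Nat.reduceEqDiff, if_false]
  refine (Tri.wp_seq hS (n := 24 + p.BW * 6 + 2 ^ p.τ * (51 + 2 ^ (p.δ - p.g) * 22)) ?_).le (by
    simp [Cmd.cost, setup, blk, skip] <;> omega)
  refine wp_setup hp (hr.same (b := 24) (by simp)) (E := p.δ) (by simp [hr.r1])
    (hklt _ (by omega)) fun s1 hs1 hk1 hm1 ho1 hl1 => ?_
  have hr1 : Regs p s1 := (hr.same (b := 24) (by simp)).same hs1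
  refine (Tri.seq (n₂ := 16 + 2 ^ p.τ * (51 + 2 ^ (p.δ - p.g) * 22)) (tri_clearBuf hp
    hr1 (ob := p.b0) ((hk1 31 (by norm_num) (by norm_num)).trans (by simp [hr.r16])) (by omega)
      fun s2 hs2 ho2 hm2 => ?_)).le (by omega)
  have hr2 : Regs p s2 := hr1.same hs2
  have hl2 : Level p p.δ s2 := hl1.same hs2
  have e31 : s2.reg 31 = p.b0 := (hs2 31 (by norm_num)).trans ((hk1 31 (by norm_num) (by norm_num)).trans (by simp [hr.r16]))
  refine (Tri.wp_seq hS (n := 2 ^ p.τ * (51 + 2 ^ (p.δ - p.g) * 22) + 1) ?_).le (by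
    simp [Cmd.cost, setup, blk, skip] <;> omega)
  simp only [blk, wp, skip, NS.set_reg, NS.set_mem]
  simp only [Nat.reduceEqDiff, if_true, if_false, one_mul, hr2.r22, hr2.r0, hr2.r5, hr2.r7, hsw,
    hklt _ (show p.τ ≤ p.τ + p.δ by omega), hklt _ (show p.π ≤ p.τ + p.δ by omega),
    Nat.one_le_two_pow, true_and]
  have hmem : ∀ a, s2.mem a = if p.b0 ≤ a ∧ a < p.b0 + p.BW then 0 else s.mem a := fun a => by
    rw [hm2, hm1]; simp
  refine (Tri.loop (fun i s' => LeafInv p (inp 0) s.mem s.out i s') (2 ^ p.τ)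
      (50 + 2 ^ (p.δ - p.g) * 22) ?_ ?_ ?_).le (le_of_eq (by ring))
  · refine ⟨hr2.same (b := 30) (by simp), hl2.same (b := 30) (by simp), by simp, by simp [e31],
      by simp, by simp, by simp, by simp, by simp, ?_, ?_, ?_, ?_⟩
    · intro a
      simp only [NS.set_mem, hmem]
      split_ifs
      · positivity
      · exact hred a
    · simp [ho2, ho1]
    · intro a ha
      simp only [NS.set_mem, hmem]
      rw [if_neg (by omega)]
    · intro f hf
      have := p.div_lt_BW hf
      have h0 := Nat.zero_le (f / 2 ^ p.g)
      simp only [NS.set_mem]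
      rw [fld_zero]
      · simp
      · rw [hmem, if_pos (by omega)]
  · intro i hi s' h1
    have := hlt p.τ (by omega)
    refine ⟨⟨by rw [h1.r35]; omega, by rw [h1.r32]; omega⟩, by
      simp only [Test.truth, h1.r35, h1.r32, hi], tri_leafBody hp hi h1⟩
  · intro s' h1
    have := hlt p.τ (by omega)
    refine ⟨⟨by rw [h1.r35]; omega, by rw [h1.r32]; omega⟩, by
      simp only [Test.truth, h1.r35, h1.r32, lt_irrefl, not_false_eq_true],
      hQ s' h1.regs h1.red h1.out h1.eq fun f hf => ?_⟩
    rw [h1.outb f hf, if_pos]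
    rw [Nat.div_lt_iff_lt_mul (by positivity), ← pow_add]
    exact hf

end WordRAM

/-! ### Arithmetic with numbers of several words. -/

namespace WordRAM

/-- The number with the `n` words at the address `b`. -/
def big (w : ℕ) (m : ℕ → ℕ) (b n : ℕ) : ℕ := ∑ i ∈ Finset.range n, m (b + i) * 2 ^ (w * i)

theorem big_succ (w : ℕ) (m : ℕ → ℕ) (b n : ℕ) :
    big w m b (n + 1) = big w m b n + m (b + n) * 2 ^ (w * n) := Finset.sum_range_succ _ _

theorem big_congr {w b n : ℕ} {m m' : ℕ → ℕ} (h : ∀ i < n, m (b + i) = m' (b + i)) :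
    big w m b n = big w m' b n :=
  Finset.sum_congr rfl fun i hi => by rw [h i (Finset.mem_range.1 hi)]

theorem big_lt {w b : ℕ} {m : ℕ → ℕ} (hm : Red w m) (n : ℕ) : big w m b n < 2 ^ (w * n) := by
  induction n with
  | zero => simp [big]
  | succ n ih =>
    rw [big_succ, Nat.mul_succ, pow_add]
    have h1 : m (b + n) + 1 ≤ 2 ^ w := hm _
    have h2 := Nat.mul_le_mul_right (2 ^ (w * n)) h1
    nlinarith

theorem big_digit {w b : ℕ} {m : ℕ → ℕ} (hm : Red w m) {i n : ℕ} (hi : i < n) :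
    big w m b n / 2 ^ (w * i) % 2 ^ w = m (b + i) := by
  induction n with
  | zero => omega
  | succ n ih =>
    rw [big_succ]
    rcases Nat.lt_succ_iff_lt_or_eq.1 hi with h | h
    · have e : 2 ^ (w * n) = 2 ^ (w * i) * (2 ^ w * 2 ^ (w * (n - i - 1))) := by
        rw [← pow_add, ← pow_add]; congr 1
        have h1 : n = i + 1 + (n - i - 1) := by omega
        conv_lhs => rw [h1]
        ring
      rw [← ih h]
      have e2 : m (b + n) * 2 ^ (w * n) = 2 ^ (w * i) * (2 ^ w * (m (b + n) * 2 ^ (w * (n - i - 1)))) := by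
        rw [e]; ring
      rw [e2, Nat.add_mul_div_left _ _ (by positivity), Nat.add_mul_mod_self_left]
    · subst h
      rw [Nat.add_mul_div_right _ _ (by positivity), Nat.div_eq_of_lt (big_lt hm i), zero_add,
        Nat.mod_eq_of_lt (hm _)]

theorem big_digit_ge {w b : ℕ} {m : ℕ → ℕ} (hm : Red w m) {i n : ℕ} (hi : n ≤ i) :
    big w m b n / 2 ^ (w * i) = 0 :=
  Nat.div_eq_of_lt ((big_lt hm n).trans_le
    (Nat.pow_le_pow_right (by norm_num) (Nat.mul_le_mul_left _ hi)))

/-- Complementing words turns the addition program into a subtraction program. -/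
theorem xor_ones {w d : ℕ} (h : d < 2 ^ w) : d ^^^ (2 ^ w - 1) = 2 ^ w - 1 - d := by
  apply Nat.eq_of_testBit_eq
  intro i
  have e : 2 ^ w - 1 - d = 2 ^ w - (d + 1) := by omega
  rw [e, Nat.testBit_two_pow_sub_succ h, Nat.testBit_xor, Nat.testBit_two_pow_sub_one]
  by_cases hi : i < w
  · simp [hi]
  · have : d.testBit i = false := Nat.testBit_lt_two_pow (h.trans_le
      (Nat.pow_le_pow_right (by norm_num) (by omega)))
    simp [hi, this]

/-- `wp` admits subtraction only without borrow. The all-ones word is obtained from `0 - 1` modulo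
`2 ^ w`, which needs a rule of its own. -/
theorem tri_ones {w S : ℕ} {inp : ℕ → ℕ} {s : NS} {d a b : ℕ} {Q : NS → Prop}
    (ha : s.reg a = 0) (hb : s.reg b = 1) (hQ : Q (s.set d (2 ^ w - 1))) :
    Tri w S inp (.op .sub d a b) s 1 Q := by
  refine Tri.of_step (fun K => ?_) hQ
  rw [NS.toState_set, ← ofNat_sub_ofNat (Nat.one_le_two_pow)]
  simp only [step, BinOp.eval, NS.toState, ha, hb]
  congr 4
  apply BitVec.eq_of_toNat_eq
  simp only [BitVec.toNat_ofNat, Nat.mod_self, Nat.zero_mod]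

/-- The sum of the digit `d` and the word at register 71, with carry. -/
def addStep : Cmd := blk [
  .load 78 74, .op .shr 78 78 75, .op .and 78 78 76, .op .xor 78 78 77,
  .load 79 71, .op .add 79 79 78, .op .and 79 79 73, .const 87 0,
  .branch (.lt 79 78) (.const 87 1) skip, .op .add 79 79 72, .op .and 79 79 73,
  .branch (.lt 79 72) (.const 87 1) skip, mov 72 87, .store 71 79, .op .add 71 71 22,
  .op .add 74 74 22, .op .add 70 70 22]

/-- Adding the number at register 74 to the accumulator. -/
def addAcc : Cmd := .seq (blk [.const 70 0, mov 71 15]) (.loop (.lt 70 11) addStep)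

/-- At most one of the two additions, of `d` and of the carry, overflows. An overflow shows by a sum
that is smaller than the summand just added. -/
theorem carry_spec {W a d c : ℕ} (ha : a < W) (hd : d < W) (hc : c ≤ 1) :
    ((a + d) % W + c) % W + (if ((a + d) % W + c) % W < c then 1
      else if (a + d) % W < d then 1 else 0) * W = a + d + c := by
  rcases Nat.lt_or_ge (a + d) W with h | h
  · rw [Nat.mod_eq_of_lt h]
    rw [if_neg (show ¬ a + d < d by omega)]
    rcases Nat.lt_or_ge (a + d + c) W with h' | h'
    · rw [Nat.mod_eq_of_lt h', if_neg (by omega)]; omega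
    · have e : a + d + c = W := by omega
      rw [e, Nat.mod_self, if_pos (by omega)]; omega
  · have e : (a + d) % W = a + d - W := by
      rw [Nat.mod_eq_sub_mod h, Nat.mod_eq_of_lt (by omega)]
    rw [e, Nat.mod_eq_of_lt (show a + d - W + c < W by omega), if_neg (by omega),
      if_pos (by omega)]
    omega

/-- Sums in natural number states are not reduced by themselves. Masking with the all-ones word in
register 73 reduces them, as the comparisons that detect carries require. -/
theorem wp_addStep {p : Par} (hp : p.Valid) {inp : ℕ → ℕ} {s : NS} (hr : Regs p s) {ad ac off K xm : ℕ}
    {x a : ℕ} (h71 : s.reg 71 = ac) (h74 : s.reg 74 = ad) (h75 : s.reg 75 = off)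
    (h76 : s.reg 76 = 2 ^ K - 1) (h77 : s.reg 77 = xm) (h72 : s.reg 72 ≤ 1)
    (h73 : s.reg 73 = 2 ^ p.w - 1) (hoff : off < 2 ^ p.w) (hxm : xm < 2 ^ p.w)
    (q1 : s.mem ad = x) (q2 : s.mem ac = a) (q3 : ad < p.S) (q4 : ac < p.S) (q5 : x < 2 ^ p.w)
    {d z : ℕ} (hd : d = (x / 2 ^ off % 2 ^ K) ^^^ xm) (hz : z = ((a + d) % 2 ^ p.w + s.reg 72) % 2 ^ p.w)
    {Q : NS → Prop} (hQ : ∀ s' : NS, Same 70 s s' → s'.out = s.out → s'.reg 70 = s.reg 70 + 1 →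
        s'.reg 71 = ac + 1 → s'.reg 74 = ad + 1 →
        s'.reg 75 = s.reg 75 → s'.reg 76 = s.reg 76 → s'.reg 77 = s.reg 77 →
        s'.reg 73 = s.reg 73 → (s'.mem = fun x => if x = ac then z else s.mem x) →
        s'.reg 72 = (if z < s.reg 72 then 1 else if (a + d) % 2 ^ p.w < d then 1 else 0) → Q s') :
    wp p.w p.S inp addStep s Q := by
  have hdlt : d < 2 ^ p.w := hd ▸ Nat.xor_lt_two_pow (lt_of_le_of_lt ((Nat.mod_le _ _).trans
      (Nat.div_le_self _ _)) q5) hxm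
  have hz1 : (a + d) % 2 ^ p.w < 2 ^ p.w := Nat.mod_lt _ (by positivity)
  have hz' : z < 2 ^ p.w := hz ▸ Nat.mod_lt _ (by positivity)
  have hc1 : s.reg 72 < 2 ^ p.w := lt_of_le_of_lt h72 (Nat.one_lt_two_pow (by
      have := hp.hw; omega))
  simp only [addStep, blk, wp, skip, mov, NS.set_reg, NS.set_mem, NS.put_reg, NS.put_mem,
    Test.ok, Test.truth]
  simp only [Nat.reduceEqDiff, if_true, if_false, Nat.or_self, h71, h74, h75, h76, h77, h73, q1, q2,
    q3, q4, q5, hoff, true_and, hr.r22, Nat.and_two_pow_sub_one_eq_mod, ← hd, hz1, hdlt,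
    ← hz, hz', hc1]
  refine ⟨fun c1 => ⟨fun c2 => ?_, fun c2 => ?_⟩, fun c1 => ⟨fun c2 => ?_, fun c2 => ?_⟩⟩ <;>
  · apply hQ <;> simp [c1, c2]

/-- The number of steps of `addAcc`. -/
def Par.addTime (p : Par) : ℕ := 7 + p.nr * 38

/-- One program serves two purposes: with `xm = 0` it adds a number, and with `xm = 2 ^ w - 1` and
initial carry 1 it subtracts one. The hypothesis `hdis` ensures that the number read is not changed
by the writes to the accumulator. -/
theorem tri_addAcc {p : Par} (hp : p.Valid) {inp : ℕ → ℕ} {s : NS} (hr : Regs p s)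
    (hm : Red p.w s.mem) {ad off K xm c : ℕ} (h74 : s.reg 74 = ad) (h75 : s.reg 75 = off)
    (h76 : s.reg 76 = 2 ^ K - 1) (h77 : s.reg 77 = xm) (h72 : s.reg 72 = c)
    (h73 : s.reg 73 = 2 ^ p.w - 1) (hoff : off < 2 ^ p.w) (hxm : xm < 2 ^ p.w) (hc : c ≤ 1)
    (had : ad + p.nr ≤ p.S) (hdis : ad + p.nr ≤ p.bA ∨ p.bA + p.nr ≤ ad) {Q : NS → Prop}
    (hQ : ∀ s' c', Same 70 s s' → s'.out = s.out → (∀ a, a < p.bA ∨ p.bA + p.nr ≤ a →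
      s'.mem a = s.mem a) → Red p.w s'.mem → s'.reg 72 = c' → c' ≤ 1 →
      big p.w s'.mem p.bA p.nr + c' * 2 ^ (p.w * p.nr) = big p.w s.mem p.bA p.nr +
        ∑ i ∈ Finset.range p.nr, ((s.mem (ad + i) / 2 ^ off % 2 ^ K) ^^^ xm) * 2 ^ (p.w * i) + c →
      Q s') :
    Tri p.w p.S inp addAcc s p.addTime Q := by
  have hS := hp.hS
  have hTW := p.TW_lt
  have hq := hp.hq
  have hAT : p.bA + p.nr ≤ p.bT := by
    unfold Par.bT Par.b1 Par.b0; omega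
  have hnr : p.nr < 2 ^ p.w := by omega
  refine (Tri.wp_seq hS (n := p.nr * 38 + 1) ?_).le (by
    simp [Cmd.cost, blk, skip, mov, Par.addTime] <;> omega)
  simp only [blk, wp, skip, mov, NS.set_reg, Nat.or_self, Nat.reduceEqDiff, if_true, if_false]
  refine Tri.loop (fun i s' => Same 70 s s' ∧ s'.out = s.out ∧ s'.reg 70 = i ∧
    s'.reg 71 = p.bA + i ∧ s'.reg 74 = ad + i ∧ s'.reg 75 = off ∧ s'.reg 76 = 2 ^ K - 1 ∧
    s'.reg 77 = xm ∧ s'.reg 73 = 2 ^ p.w - 1 ∧ s'.reg 72 ≤ 1 ∧ Red p.w s'.mem ∧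
    (∀ a, a < p.bA ∨ p.bA + i ≤ a → s'.mem a = s.mem a) ∧
    big p.w s'.mem p.bA i + s'.reg 72 * 2 ^ (p.w * i) = big p.w s.mem p.bA i +
      ∑ i ∈ Finset.range i, ((s.mem (ad + i) / 2 ^ off % 2 ^ K) ^^^ xm) * 2 ^ (p.w * i) + c)
    p.nr 37 ?_ ?_ ?_
  · refine ⟨by simp, by simp, by simp, by simp [hr.r15], by simp [h74], by simp [h75],
      by simp [h76], by simp [h77], by simp [h73], by simp [h72, hc], hm, by simp, ?_⟩
    simp [big, h72]
  · rintro i hi s' ⟨i1, i2, i3, i4, i5, i6, i7, i8, i9, i10, i11, i12, i13⟩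
    have hr' : Regs p s' := hr.same i1
    refine ⟨⟨by omega, by rw [hr'.r11]; exact hnr⟩, by simp only [Test.truth, i3, hr'.r11, hi], ?_⟩
    refine (Tri.of_wp hS ?_).le (show addStep.cost ≤ 37 by simp [addStep, Cmd.cost, blk, skip, mov])
    have q1 : s'.mem (ad + i) = s.mem (ad + i) := i12 _ (by omega)
    have q2 : s'.mem (p.bA + i) = s.mem (p.bA + i) := i12 _ (by omega)
    have q3 : ad + i < p.S := by omega
    have q4 : p.bA + i < p.S := by omega
    have q5 := hm (ad + i)
    have q6 := hm (p.bA + i)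
    set d := (s.mem (ad + i) / 2 ^ off % 2 ^ K) ^^^ xm with hd
    have hdlt : d < 2 ^ p.w := Nat.xor_lt_two_pow (lt_of_le_of_lt ((Nat.mod_le _ _).trans
      (Nat.div_le_self _ _)) q5) hxm
    set a := s.mem (p.bA + i) with ha
    have hz : (a + d) % 2 ^ p.w < 2 ^ p.w := Nat.mod_lt _ (by positivity)
    have hz' : ((a + d) % 2 ^ p.w + s'.reg 72) % 2 ^ p.w < 2 ^ p.w := Nat.mod_lt _ (by positivity)
    have hcs := carry_spec q6 hdlt i10
    have hc1 : s'.reg 72 < 2 ^ p.w := lt_of_le_of_lt i10 (Nat.one_lt_two_pow (by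
      have := hp.hw; omega))
    set z := ((a + d) % 2 ^ p.w + s'.reg 72) % 2 ^ p.w with hzd
    have fin : ∀ s'' : NS, Same 70 s' s'' → s''.out = s'.out → s''.reg 70 = i + 1 →
        s''.reg 71 = p.bA + i + 1 → s''.reg 74 = ad + i + 1 →
        s''.reg 75 = s'.reg 75 → s''.reg 76 = s'.reg 76 → s''.reg 77 = s'.reg 77 →
        s''.reg 73 = s'.reg 73 → (s''.mem = fun x => if x = p.bA + i then z else s'.mem x) →
        s''.reg 72 = (if z < s'.reg 72 then 1 else if (a + d) % 2 ^ p.w < d then 1 else 0) →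
        (Same 70 s s'' ∧ s''.out = s.out ∧ s''.reg 70 = i + 1 ∧
        s''.reg 71 = p.bA + (i + 1) ∧ s''.reg 74 = ad + (i + 1) ∧ s''.reg 75 = off ∧
        s''.reg 76 = 2 ^ K - 1 ∧ s''.reg 77 = xm ∧ s''.reg 73 = 2 ^ p.w - 1 ∧ s''.reg 72 ≤ 1 ∧
        Red p.w s''.mem ∧ (∀ a, a < p.bA ∨ p.bA + (i + 1) ≤ a → s''.mem a = s.mem a) ∧
        big p.w s''.mem p.bA (i + 1) + s''.reg 72 * 2 ^ (p.w * (i + 1)) =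
          big p.w s.mem p.bA (i + 1) + ∑ i ∈ Finset.range (i + 1),
            ((s.mem (ad + i) / 2 ^ off % 2 ^ K) ^^^ xm) * 2 ^ (p.w * i) + c) := by
      intro s'' j1 j2 j3 j4 j5 j6 j7 j8 j9 j10 j11
      refine ⟨i1.trans j1, j2.trans i2, j3, j4, j5, j6.trans i6, j7.trans i7, j8.trans i8,
        j9.trans i9, by rw [j11]; split_ifs <;> omega, ?_, ?_, ?_⟩
      · intro x
        simp only [j10]
        split_ifs
        exacts [hz', i11 x]
      · intro x hx
        simp only [j10]
        rw [if_neg (by omega)]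
        exact i12 x (by omega)
      · rw [big_succ, big_succ, Finset.sum_range_succ, j11]
        have e1 : big p.w s''.mem p.bA i = big p.w s'.mem p.bA i := big_congr fun k hk => by
          simp only [j10]
          rw [if_neg (by omega)]
        have e2 : s''.mem (p.bA + i) = z := by simp [j10]
        rw [e1, e2, ← hd, ← ha, Nat.mul_succ, pow_add]
        generalize (if z < s'.reg 72 then 1 else if (a + d) % 2 ^ p.w < d then 1 else 0) = cc at hcs ⊢
        generalize 2 ^ p.w = W at *
        generalize 2 ^ (p.w * i) = X at *
        generalize big p.w s'.mem p.bA i = A at *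
        generalize big p.w s.mem p.bA i = B at *
        generalize ∑ i ∈ Finset.range i, ((s.mem (ad + i) / 2 ^ off % 2 ^ K) ^^^ xm) * 2 ^ (p.w * i) = D at *
        calc A + z * X + cc * (X * W) = A + (z + cc * W) * X := by ring
          _ = (A + s'.reg 72 * X) + (a + d) * X := by rw [hcs]; ring
          _ = _ := by rw [i13]; ring
    exact wp_addStep hp hr' i4 i5 i6 i7 i8 i10 i9 hoff hxm q1 q2 q3 q4 q5 hd hzd
      fun s'' j1 j2 j3 => fin s'' j1 j2 (j3.trans (by rw [i3]))
  · rintro s' ⟨i1, i2, i3, i4, i5, i6, i7, i8, i9, i10, i11, i12, i13⟩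
    have hr' : Regs p s' := hr.same i1
    refine ⟨⟨by omega, by rw [hr'.r11]; exact hnr⟩, by
      simp only [Test.truth, i3, hr'.r11, lt_irrefl, not_false_eq_true], ?_⟩
    exact hQ s' _ i1 i2 i12 i11 rfl i10 i13

end WordRAM

/-! ### The root: subtraction modulo `r`. -/

namespace WordRAM

/-- Subtraction modulo `r` for `a < r` and `v < 2 * r`. -/
def subm (r a v : ℕ) : ℕ := if v ≤ a then a - v else if v ≤ a + r then a + r - v else a + 2 * r - v

theorem subm_lt {r a v : ℕ} (ha : a < r) : subm r a v < r := by
  unfold subm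
  split_ifs <;> omega

/-- Adding the modulus to the accumulator. -/
def addR : Cmd := .seq (blk [mov 74 14, .const 75 0, mov 76 33, .const 77 0, mov 73 33,
  .const 72 1]) addAcc

/-- The memory holds `R`, not the modulus `R + 1`; the initial carry supplies the missing unit. -/
theorem tri_addR {p : Par} (hp : p.Valid) {inp : ℕ → ℕ} {s : NS} (hr : Regs p s)
    (hm : Red p.w s.mem) (h33 : s.reg 33 = 2 ^ p.w - 1) (hR : big p.w s.mem p.bR p.nr = p.R)
    {Q : NS → Prop}
    (hQ : ∀ s' c', Same 70 s s' → s'.out = s.out → (∀ a, a < p.bA ∨ p.bA + p.nr ≤ a →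
      s'.mem a = s.mem a) → Red p.w s'.mem → s'.reg 72 = c' → c' ≤ 1 →
      big p.w s'.mem p.bA p.nr + c' * 2 ^ (p.w * p.nr) = big p.w s.mem p.bA p.nr + (p.R + 1) →
      Q s') :
    Tri p.w p.S inp addR s (p.addTime + 14) Q := by
  have hS := hp.hS
  have hTW := p.TW_lt
  have hq := hp.hq
  have hAT : p.bA + p.nr ≤ p.bT := by
    unfold Par.bT Par.b1 Par.b0; omega
  have hRA : p.bR + p.nr ≤ p.bA := by unfold Par.bA; omega
  refine (Tri.wp_seq hS (n := p.addTime) ?_).le (by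
    simp [Cmd.cost, blk, skip, mov] <;> omega)
  simp only [blk, wp, skip, mov, NS.set_reg, Nat.or_self, Nat.reduceEqDiff, if_true, if_false]
  refine tri_addAcc hp (hr.same (b := 70) (by simp)) (by simpa using hm) (ad := p.bR) (off := 0)
    (K := p.w) (xm := 0) (c := 1) (by simp [hr.r14]) (by simp) (by simp [h33]) (by simp) (by simp)
    (by simp [h33]) (by positivity) (by positivity) le_rfl (by omega) (by omega) ?_
  intro s' c' h1 h2 h3 h4 h5 h6 h7
  refine hQ s' c' (Same.trans (by simp) h1) (by simpa using h2) (by simpa using h3) h4 h5 h6 ?_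
  rw [h7, add_assoc]
  simp only [NS.set_mem, pow_zero, Nat.div_one, Nat.xor_zero, Nat.mod_eq_of_lt (hm _)]
  congr 2

/-- Adding the modulus until the carry shows that the accumulator is not negative any more. -/
def fixup : Cmd := .loop (.eq 72 23) addR

/-- The accumulator holds `a - v` modulo `2 ^ (w * nr)`, and a carry indicates that the true result
is not negative. Since `v ≤ 2 * R`, at most two additions of the modulus are needed; the number `N`
of additions follows the three cases of `subm`. -/
theorem tri_fixup {p : Par} (hp : p.Valid) {inp : ℕ → ℕ} {s : NS} (hr : Regs p s)
    (hm : Red p.w s.mem) (h33 : s.reg 33 = 2 ^ p.w - 1) (hR : big p.w s.mem p.bR p.nr = p.R)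
    {a v : ℕ} (h72 : s.reg 72 ≤ 1) (ha : a ≤ p.R) (hv : v ≤ 2 * p.R) (hvw : v < 2 ^ (p.w * p.nr))
    (hb : big p.w s.mem p.bA p.nr + s.reg 72 * 2 ^ (p.w * p.nr) = a + 2 ^ (p.w * p.nr) - v)
    {Q : NS → Prop}
    (hQ : ∀ s', Same 70 s s' → s'.out = s.out → (∀ a, a < p.bA ∨ p.bA + p.nr ≤ a →
      s'.mem a = s.mem a) → Red p.w s'.mem →
      big p.w s'.mem p.bA p.nr = subm (p.R + 1) a v → Q s') :
    Tri p.w p.S inp fixup s (2 * p.addTime + 31) Q := by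
  have hRW := hp.hR
  have hRA : p.bR + p.nr ≤ p.bA := by have := hp.hq; unfold Par.bA; omega
  have h1w : 1 < 2 ^ p.w := Nat.one_lt_two_pow (by have := hp.hw; omega)
  set N := if v ≤ a then 0 else if v ≤ a + (p.R + 1) then 1 else 2 with hN
  have hN2 : N ≤ 2 := by rw [hN]; split_ifs <;> omega
  have hX := fun m hm => big_lt (b := p.bA) (m := m) (w := p.w) hm p.nr
  set X := 2 ^ (p.w * p.nr) with hXdef
  have hsub : N * (p.R + 1) + a - v = subm (p.R + 1) a v := by
    rw [hN, subm]; split_ifs <;> omega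
  have hcase : (N = 0 ∧ v ≤ a) ∨ (N = 1 ∧ a < v ∧ v ≤ a + (p.R + 1)) ∨
      (N = 2 ∧ a + (p.R + 1) < v) := by
    rw [hN]; split_ifs <;> omega
  clear_value N
  clear hN
  refine (Tri.loop (fun i s' => Same 70 s s' ∧ s'.out = s.out ∧ (∀ a, a < p.bA ∨ p.bA + p.nr ≤ a →
      s'.mem a = s.mem a) ∧ Red p.w s'.mem ∧ s'.reg 72 = (if i < N then 0 else 1) ∧
      big p.w s'.mem p.bA p.nr = if i < N then i * (p.R + 1) + a + X - v else N * (p.R + 1) + a - v)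
    N (p.addTime + 14) ?_ ?_ ?_).le ?_
  · refine ⟨by simp, rfl, by simp, hm, ?_⟩
    have := hX _ hm
    rcases Nat.le_one_iff_eq_zero_or_eq_one.1 h72 with e | e <;> rw [e] at hb ⊢ <;>
      rcases hcase with ⟨rfl, h⟩ | ⟨rfl, h⟩ | ⟨rfl, h⟩ <;> simp <;> omega
  · rintro i hi s' ⟨i1, i2, i3, i4, i5, i6⟩
    have hr' : Regs p s' := hr.same i1
    rw [if_pos hi] at i5 i6
    refine ⟨⟨by omega, by rw [hr'.r23]; omega⟩, by simp only [Test.truth, i5, hr'.r23], ?_⟩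
    refine tri_addR hp hr' i4 ((i1 _ (by norm_num)).trans h33) ?_ ?_
    · rw [← hR]
      exact big_congr fun k hk => i3 _ (by omega)
    · intro s'' c' j1 j2 j3 j4 j5 j6 j7
      refine ⟨i1.trans j1, j2.trans i2, fun x hx => (j3 x hx).trans (i3 x hx), j4, ?_⟩
      have := hX _ j4
      rw [i6, ← hXdef] at j7
      rw [j5]
      have hi' : i = 0 ∨ i = 1 := by omega
      rcases Nat.le_one_iff_eq_zero_or_eq_one.1 j6 with e | e <;> rw [e] at j7 ⊢ <;>
        rcases hi' with e' | e' <;> subst e' <;>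
        rcases hcase with ⟨rfl, h⟩ | ⟨rfl, h⟩ | ⟨rfl, h⟩ <;> simp at hi ⊢ <;> omega
  · rintro s' ⟨i1, i2, i3, i4, i5, i6⟩
    have hr' : Regs p s' := hr.same i1
    rw [if_neg (lt_irrefl _)] at i5 i6
    refine ⟨⟨by omega, by rw [hr'.r23]; omega⟩, by simp [Test.truth, i5, hr'.r23], ?_⟩
    exact hQ s' i1 i2 i3 i4 (i6.trans hsub)
  · nlinarith

namespace Par

variable (p : Par)

/-- The packed number `n` of the last table. -/
def dig (m : ℕ → ℕ) (n : ℕ) : ℕ :=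
  m (p.bV + n / 2 ^ p.gr) / 2 ^ (n % 2 ^ p.gr * 2 ^ p.ρ) % 2 ^ 2 ^ p.ρ

/-- The value in the entry `e` of the last table. -/
def vval (m : ℕ → ℕ) (e : ℕ) : ℕ :=
  ∑ i ∈ Finset.range p.nr, p.dig m (e * 2 ^ p.q + i) * 2 ^ (p.w * i)

/-- The table entry that belongs to the coordinate `j` of the root. -/
def topIdx (F c : ℕ → ℕ) (j : ℕ) : ℕ :=
  j * 2 ^ p.M + mux (p.mb j) (p.nodeVal F c (p.τ - 1) 0 j) (p.nodeVal F c (p.τ - 1) 1 j)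

/-- The value at the root, after `j` coordinates. -/
def topAcc (m c : ℕ → ℕ) : ℕ → ℕ
  | 0 => 0
  | j + 1 => subm (p.R + 1) (topAcc m c j) (p.vval m (p.topIdx (fld p m p.bT) c j))

theorem topAcc_le (m c : ℕ → ℕ) (j : ℕ) : p.topAcc m c j ≤ p.R := by
  induction j with
  | zero => simp [topAcc]
  | succ j ih => exact Nat.le_of_lt_succ (subm_lt (Nat.lt_succ_of_le ih))

end Par

/-- Processing one coordinate of the root. -/
def topBody : Cmd := .seq getIdx (.seq (blk [.op .shl 45 36 2, .op .add 45 45 40, .op .shl 45 45 10,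
  .op .shr 74 45 13, .op .add 74 74 19, .op .and 75 45 31, .op .shl 75 75 12, mov 76 32, mov 77 33,
  mov 73 33, .const 72 1]) (.seq addAcc (.seq fixup (.op .add 36 36 22))))

/-- The invariant while the root is evaluated. -/
structure TopInv (p : Par) (c m₀ o₀ : ℕ → ℕ) (ib j : ℕ) (s : NS) : Prop where
  regs : Regs p s
  r24 : s.reg 24 = p.τ + p.δ
  r30 : s.reg 30 = ib
  r31 : s.reg 31 = 2 ^ p.gr - 1
  r32 : s.reg 32 = 2 ^ 2 ^ p.ρ - 1
  r33 : s.reg 33 = 2 ^ p.w - 1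
  r34 : s.reg 34 = 2 ^ (p.τ - 1 + p.δ)
  r35 : s.reg 35 = 0
  r36 : s.reg 36 = j
  red : Red p.w s.mem
  out : s.out = o₀
  eq : MemEq p m₀ s.mem
  inb : ∀ f < 2 ^ (p.τ + p.δ), fld p s.mem ib f = p.nodeVal (fld p m₀ p.bT) c (p.τ - 1)
    (f / 2 ^ (p.τ - 1 + p.δ)) (f % 2 ^ (p.τ - 1 + p.δ))
  acc : big p.w s.mem p.bA p.nr = p.topAcc m₀ c j

theorem Par.Bufs.bounds' {p : Par} {ib ob : ℕ} (h : p.Bufs ib ob) : p.bA + 2 ^ p.q ≤ ib := by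
  have e : p.b0 = p.bA + 2 ^ p.q := rfl
  have e' : p.b1 = p.b0 + p.BW := rfl
  rcases h with ⟨rfl, rfl⟩ | ⟨rfl, rfl⟩ <;> omega

/-- Two's complement for numbers of `n` words. -/
theorem sum_compl (w n : ℕ) : ∀ (d : ℕ → ℕ), (∀ i, d i < 2 ^ w) →
    ∑ i ∈ Finset.range n, (2 ^ w - 1 - d i) * 2 ^ (w * i) + 1 +
      ∑ i ∈ Finset.range n, d i * 2 ^ (w * i) = 2 ^ (w * n) := by
  intro d hd
  induction n with
  | zero => simp
  | succ n ih =>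
    rw [Finset.sum_range_succ, Finset.sum_range_succ, Nat.mul_succ, pow_add]
    have h1 : (2 ^ w - 1 - d n) * 2 ^ (w * n) + 2 ^ (w * n) + d n * 2 ^ (w * n) =
        2 ^ (w * n) * 2 ^ w := by
      rw [← Nat.succ_mul, ← Nat.add_mul, mul_comm]
      congr 1
      have := hd n
      omega
    omega

theorem Par.Valid.root_lt {p : Par} (hp : p.Valid) {j v : ℕ} (hj : j < 2 ^ (p.τ - 1 + p.δ))
    (hv : v < 2 ^ p.M) : (j * 2 ^ p.M + v) < 2 ^ (p.τ - 1 + p.δ + p.M) ∧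
      (j * 2 ^ p.M + v + 1) * 2 ^ p.q ≤ p.NV := by
  have h1 : (j + 1) * 2 ^ p.M ≤ 2 ^ (p.τ - 1 + p.δ + p.M) := by
    rw [pow_add]; exact Nat.mul_le_mul_right _ hj
  rw [Nat.succ_mul] at h1
  refine ⟨by omega, ?_⟩
  have h2 : p.NV = 2 ^ (p.τ - 1 + p.δ + p.M) * 2 ^ p.q := by
    unfold Par.NV
    rw [← pow_add]; congr 1
    have := hp.hτ
    omega
  rw [h2]
  exact Nat.mul_le_mul_right _ (by omega)

/-- Either a value is a single packed digit (`q = 0`, so `i = 0`), or it consists of several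
unpacked words (`gr = 0`). In both cases its digits lie in consecutive words at one common offset.
-/
theorem Par.dig_entry {p : Par} (hp : p.Valid) (m : ℕ → ℕ) {e i : ℕ} (hi : i < p.nr) :
    p.dig m (e * 2 ^ p.q + i) = m (e * 2 ^ p.q / 2 ^ p.gr + p.bV + i) /
      2 ^ (e * 2 ^ p.q % 2 ^ p.gr * 2 ^ p.ρ) % 2 ^ 2 ^ p.ρ := by
  unfold Par.dig
  rcases Nat.eq_zero_or_pos p.q with h | h
  · have := hp.hq
    rw [h, pow_zero] at this
    have e0 : i = 0 := by omega
    subst e0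
    simp [add_comm]
  · have e1 : p.bV + (e * 2 ^ p.q + i) = e * 2 ^ p.q + p.bV + i := by ring
    simp [hp.hqg h, Nat.mod_one, e1]

theorem Par.Valid.vword {p : Par} (hp : p.Valid) {n : ℕ} (h : n + 2 ^ p.q ≤ p.NV) : n / 2 ^ p.gr + p.bV + p.nr ≤ p.S := by
  have hq := hp.hq
  have hτ := hp.hτ
  have hVW : p.NV ≤ p.VW * 2 ^ p.gr := by
    unfold Par.NV Par.VW
    rw [← pow_add]
    exact Nat.pow_le_pow_right (by norm_num) (by omega)
  unfold Par.S
  rcases Nat.eq_zero_or_pos p.q with h' | h'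
  · rw [h'] at h hq
    have : n / 2 ^ p.gr < p.VW := by
      rw [Nat.div_lt_iff_lt_mul (by positivity)]
      simp only [pow_zero] at h
      omega
    simp only [pow_zero] at hq
    omega
  · rw [hp.hqg h'] at hVW ⊢
    simp only [pow_zero, Nat.div_one, mul_one] at hVW ⊢
    omega

/-- The number of steps of `topBody`. -/
def Par.topTime (p : Par) : ℕ := 3 * p.addTime + 140

theorem tri_topBody {p : Par} (hp : p.Valid) {inp c m₀ o₀ : ℕ → ℕ} {ib ob j : ℕ} {s : NS}
    (hj : j < 2 ^ (p.τ - 1 + p.δ)) (hb : p.Bufs ib ob)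
    (hR : big p.w m₀ p.bR p.nr = p.R) (hV : ∀ e < 2 ^ (p.τ - 1 + p.δ + p.M), p.vval m₀ e ≤ 2 * p.R)
    (hm₀ : Red p.w m₀) (hI : TopInv p c m₀ o₀ ib j s) :
    Tri p.w p.S inp topBody s p.topTime fun s' => TopInv p c m₀ o₀ ib (j + 1) s' := by
  have hS := hp.hS
  have hidx := hp.hidx
  have hτ := hp.hτ
  obtain ⟨hb1, hb2, hb3, hb4, hb5⟩ := hb.bounds
  have hb6 := hb.bounds'
  have hTW := p.TW_lt
  have hq := hp.hq
  have hE2 : 2 ^ (p.τ + p.δ) = 2 * 2 ^ (p.τ - 1 + p.δ) := by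
    rw [← pow_succ']; congr 1; omega
  have hτδ := hp.two_pow_τδ
  have hfl : 0 * 2 ^ (p.τ + p.δ) + j + 2 ^ (p.τ - 1 + p.δ) < 2 ^ (p.τ + p.δ) := by omega
  have hMw : p.M < 2 ^ p.w := lt_of_le_of_lt hp.hM Nat.lt_two_pow_self
  set F := fld p m₀ p.bT with hF
  refine (Tri.wp_seq hS (n := 3 * p.addTime + 62) ?_).le (by
    simp [Cmd.cost, blk, skip, mov, getIdx, getField, Par.topTime] <;> omega)
  refine wp_getIdx hp hI.regs hI.red hτδ (fun n hn => ?_) hI.r35 hI.r36 hI.r24 hI.r34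
    (Nat.lt_two_pow_self.trans hτδ) hfl ?_
  · have := p.div_lt_BW hn
    rw [hI.r30]; omega
  intro s1 hs1 hm1 ho1 h40
  have e40 : s1.reg 40 = mux (p.mb j) (p.nodeVal F c (p.τ - 1) 0 j)
      (p.nodeVal F c (p.τ - 1) 1 j) := by
    rw [h40, hI.r30, hI.inb _ hfl, hI.inb _ (by omega), zero_mul, zero_add, Nat.div_eq_of_lt hj,
      Nat.mod_eq_of_lt hj, Nat.add_div_right _ (by positivity), Nat.add_mod_right,
      Nat.div_eq_of_lt hj, Nat.mod_eq_of_lt hj]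
  have hv : s1.reg 40 < 2 ^ p.M := by
    rw [h40]
    exact mux_lt (fld_lt p _ _ _) (fld_lt p _ _ _)
  obtain ⟨ht1, ht2⟩ := hp.root_lt hj hv
  have he : j * 2 ^ p.M + s1.reg 40 = p.topIdx F c j := by rw [e40]; rfl
  rw [he] at ht1 ht2
  set e := p.topIdx F c j with hedef
  have r1 : Regs p s1 := hI.regs.same hs1
  have k36 : s1.reg 36 = j := (hs1 _ (by norm_num)).trans hI.r36
  have k31 := (hs1 31 (by norm_num)).trans hI.r31
  have k32 := (hs1 32 (by norm_num)).trans hI.r32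
  have k33 := (hs1 33 (by norm_num)).trans hI.r33
  have hqlt : p.q < 2 ^ p.w := by
    have := (Nat.lt_two_pow_self (n := p.q))
    omega
  have hgr : p.gr < 2 ^ p.w := by
    rcases Nat.eq_zero_or_pos p.gr with h | h
    · rw [h]; positivity
    · have h1 := hp.hgr h
      have h2 : 2 ^ p.gr ≤ 2 ^ (p.gr + p.ρ) := Nat.pow_le_pow_right (by norm_num) (by omega)
      have h3 := (Nat.lt_two_pow_self (n := p.gr))
      have h4 := (Nat.lt_two_pow_self (n := p.w))
      omega
  have hρ : p.ρ < 2 ^ p.w := Nat.lt_two_pow_self.trans hp.hρ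
  have heq : e * 2 ^ p.q < 2 ^ p.w := by
    have h0 : 0 < 2 ^ p.q := by positivity
    rw [Nat.succ_mul] at ht2
    have := hp.hNV
    omega
  have hoff : e * 2 ^ p.q % 2 ^ p.gr * 2 ^ p.ρ < 2 ^ p.w := by
    rcases Nat.eq_zero_or_pos p.gr with h | h
    · simp [h, Nat.mod_one]
    · refine lt_of_lt_of_le ?_ ((hp.hgr h).trans Nat.lt_two_pow_self.le)
      rw [pow_add]
      exact Nat.mul_lt_mul_of_pos_right (Nat.mod_lt _ (by positivity)) (by positivity)
  refine (Tri.wp_seq hS (n := 3 * p.addTime + 36) ?_).le (by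
    simp [Cmd.cost, blk, skip, mov] <;> omega)
  simp only [blk, wp, skip, mov, NS.set_reg, NS.set_mem]
  simp only [Nat.reduceEqDiff, if_true, if_false, r1.r2, r1.r10, r1.r12, r1.r13, r1.r19, k36, hMw,
    true_and, he, k31, k32, k33, Nat.or_self, Nat.and_two_pow_sub_one_eq_mod, hqlt, hgr, hρ, heq]
  have hVS := hp.vword (n := e * 2 ^ p.q) (by rw [Nat.succ_mul] at ht2; omega)
  have hbV : p.bV = p.bT + p.TW := rfl
  have h00 := Nat.zero_le (e * 2 ^ p.q / 2 ^ p.gr)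
  refine (Tri.seq (n₁ := p.addTime) (n₂ := 2 * p.addTime + 33) (tri_addAcc hp
    (r1.same (b := 45) (by simp)) (by simpa [hm1] using hI.red) (c := 1)
    (ad := e * 2 ^ p.q / 2 ^ p.gr + p.bV) (off := e * 2 ^ p.q % 2 ^ p.gr * 2 ^ p.ρ)
    (K := 2 ^ p.ρ) (xm := 2 ^ p.w - 1) (by simp) (by simp) (by simp) (by simp) (by simp) (by simp)
    hoff (Nat.sub_lt (by positivity) one_pos) le_rfl hVS (by omega) ?_)).le (by omega)
  intro s2 c' h1 h2 h3 h4 h5 h6 h7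
  have hs02 : Same 40 s s2 := Same.trans (Same.trans hs1 (by simp)) (h1.mono (by norm_num))
  simp only [NS.set_mem, NS.set_out, hm1] at h2 h3 h7
  have hR2 : big p.w s2.mem p.bR p.nr = p.R := by
    rw [← hR]
    refine big_congr fun k hk => ?_
    have : p.bR + k < p.bA := by unfold Par.bA; omega
    rw [h3 _ (Or.inl this), hI.eq _ (Or.inl this)]
  have hdl : ∀ n, p.dig m₀ n < 2 ^ p.w := fun n =>
    lt_of_le_of_lt ((Nat.mod_le _ _).trans (Nat.div_le_self _ _)) (hm₀ _)
  have hsum : ∑ i ∈ Finset.range p.nr, ((s.mem (e * 2 ^ p.q / 2 ^ p.gr + p.bV + i) /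
      2 ^ (e * 2 ^ p.q % 2 ^ p.gr * 2 ^ p.ρ) % 2 ^ 2 ^ p.ρ) ^^^ (2 ^ p.w - 1)) * 2 ^ (p.w * i) =
      ∑ i ∈ Finset.range p.nr, (2 ^ p.w - 1 - p.dig m₀ (e * 2 ^ p.q + i)) * 2 ^ (p.w * i) := by
    refine Finset.sum_congr rfl fun i hi => ?_
    rw [hI.eq _ (Or.inr (by omega)), ← Par.dig_entry hp m₀ (Finset.mem_range.1 hi),
      xor_ones (hdl _)]
  rw [hsum] at h7
  have hcompl := sum_compl p.w p.nr (fun i => p.dig m₀ (e * 2 ^ p.q + i)) fun i => hdl _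
  have hvv : ∑ i ∈ Finset.range p.nr, p.dig m₀ (e * 2 ^ p.q + i) * 2 ^ (p.w * i) = p.vval m₀ e := rfl
  rw [hvv] at hcompl
  refine (Tri.seq (n₂ := 1) (tri_fixup hp (hI.regs.same hs02) h4 ((hs02 33 (by norm_num)).trans hI.r33)
    hR2 (a := p.topAcc m₀ c j) (v := p.vval m₀ e) (by omega) (p.topAcc_le m₀ c j) (hV _ ht1) (by omega)
    (by rw [h5, h7, hI.acc]; omega) ?_)).le (by omega)
  intro s3 g1 g2 g3 g4 g5
  have hs03 : Same 40 s s3 := hs02.trans (g1.mono (by norm_num))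
  have hm03 : ∀ a, a < p.bA ∨ p.bA + p.nr ≤ a → s3.mem a = s.mem a := fun a ha =>
    (g3 a ha).trans (h3 a ha)
  have r3 := hI.regs.same hs03
  refine (Tri.of_wp hS ?_).le (show _ ≤ 1 by simp [Cmd.cost])
  simp only [wp]
  have hsm : Same 36 s (s3.set 36 (s3.reg 36 + s3.reg 22)) := by simpa using hs03.mono (by norm_num)
  refine ⟨hI.regs.same hsm, (hsm _ (by norm_num)).trans hI.r24, (hsm _ (by norm_num)).trans hI.r30,
    (hsm _ (by norm_num)).trans hI.r31, (hsm _ (by norm_num)).trans hI.r32,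
    (hsm _ (by norm_num)).trans hI.r33, (hsm _ (by norm_num)).trans hI.r34,
    (hsm _ (by norm_num)).trans hI.r35, by simp [r3.r22, hs03 36, hI.r36], g4, ?_, ?_, ?_, ?_⟩
  · simp [g2, h2, ho1, hI.out]
  · intro a ha
    simp only [NS.set_mem]
    rw [hm03 a (by omega), hI.eq a ha]
  · intro f hf
    have := p.div_lt_BW hf
    simp only [NS.set_mem]
    rw [← hI.inb f hf]
    exact fld_congr (hm03 _ (Or.inr (by
      have h0 := Nat.zero_le (f / 2 ^ p.g)
      omega)))
  · simp only [NS.set_mem, g5]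
    rfl

end WordRAM

/-! ### The evaluation program and the function it represents. -/

namespace WordRAM

/-- Clearing the accumulator. -/
def clearAcc : Cmd := .seq (blk [mov 70 15, .op .add 71 15 11])
  (.loop (.lt 70 71) (blk [.store 70 23, .op .add 70 70 22]))

theorem tri_clearAcc {p : Par} (hp : p.Valid) {inp : ℕ → ℕ} {s : NS} (hr : Regs p s) {Q : NS → Prop}
    (hQ : ∀ s', Same 60 s s' → s'.out = s.out →
      s'.mem = (fun a => if p.bA ≤ a ∧ a < p.bA + p.nr then 0 else s.mem a) → Q s') :
    Tri p.w p.S inp clearAcc s (7 + p.nr * 6) Q := by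
  have h2 := hp.hS
  have hTW := p.TW_lt
  have hq := hp.hq
  have hAT : p.bA + p.nr ≤ p.bT := by
    unfold Par.bT Par.b1 Par.b0; omega
  refine (Tri.wp_seq h2 ?_).le (m := 5 + (p.nr * (5 + 1) + 1) + 1) (by omega)
  simp only [blk, wp, skip, mov, NS.set_reg, NS.set_mem]
  simp [hr.r15, hr.r11]
  refine Tri.loop (fun j s' => Same 60 s s' ∧ s'.out = s.out ∧ s'.reg 70 = p.bA + j ∧
    s'.reg 71 = p.bA + p.nr ∧
    s'.mem = fun a => if p.bA ≤ a ∧ a < p.bA + j then 0 else s.mem a) p.nr 5 ?_ ?_ ?_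
  · refine ⟨by simp, by simp, by simp, by simp, ?_⟩
    funext a
    simp
  · rintro j hj s' ⟨i1, i2, i3, i4, i5⟩
    refine ⟨⟨by omega, by omega⟩, by simp only [Test.truth]; omega, ?_⟩
    refine (Tri.of_wp h2 ?_).le (m := 5) le_rfl
    have hr' : Regs p s' := hr.same i1
    have q2 : p.bA + j < p.S := by omega
    simp only [blk, wp, skip, NS.set_reg, NS.set_mem, NS.put_reg, NS.put_mem, i3]
    simp [i1, i2, i3, i4, q2, hr'.r22, hr'.r23, i5, ← add_assoc]
    funext a
    by_cases h : a = p.bA + j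
    · simp [h]
    · have e : (a ≤ p.bA + j) ↔ (a < p.bA + j) := by omega
      simp [h, e]
  · rintro s' ⟨i1, i2, i3, i4, i5⟩
    refine ⟨⟨by omega, by omega⟩, by simp only [Test.truth]; omega, ?_⟩
    exact hQ _ i1 i2 i5

/-- Evaluating the root. -/
def top : Cmd := .seq (blk [.op .sub 34 24 22, .op .shl 34 22 34, .const 35 0, .const 36 0,
  .op .shl 31 22 13, .op .sub 31 31 22, .op .shl 32 22 12, .op .shl 32 22 32, .op .sub 32 32 22])
  (.seq (.op .sub 33 23 22) (.seq clearAcc (.loop (.lt 36 34) topBody)))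

theorem Par.Valid.gr_lt {p : Par} (hp : p.Valid) : p.gr < 2 ^ p.w := by
  rcases Nat.eq_zero_or_pos p.gr with h | h
  · rw [h]; positivity
  · have h1 := hp.hgr h
    have h2 : 2 ^ p.gr ≤ 2 ^ (p.gr + p.ρ) := Nat.pow_le_pow_right (by norm_num) (by omega)
    have h3 := (Nat.lt_two_pow_self (n := p.gr))
    have h4 := (Nat.lt_two_pow_self (n := p.w))
    omega

theorem tri_top {p : Par} (hp : p.Valid) {inp c m₀ o₀ : ℕ → ℕ} {ib ob : ℕ} {s : NS}
    (hb : p.Bufs ib ob) (hI : LevPre p c m₀ o₀ (p.τ - 1) ib ob s)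
    (hR : big p.w m₀ p.bR p.nr = p.R) (hV : ∀ e < 2 ^ (p.τ - 1 + p.δ + p.M), p.vval m₀ e ≤ 2 * p.R)
    (hm₀ : Red p.w m₀) :
    Tri p.w p.S inp top s (33 + p.nr * 6 + 2 ^ (p.τ - 1 + p.δ) * (p.topTime + 1))
      fun s' => TopInv p c m₀ o₀ ib (2 ^ (p.τ - 1 + p.δ)) s' := by
  have hS := hp.hS
  have hidx := hp.hidx
  have hτ := hp.hτ
  have hlt : ∀ k ≤ p.τ + p.δ, 2 ^ k < 2 ^ p.w := fun k hk =>
    Nat.pow_lt_pow_right (by norm_num) (by omega)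
  have hklt : ∀ k ≤ p.τ + p.δ, k < 2 ^ p.w := fun k hk => Nat.lt_two_pow_self.trans (hlt k hk)
  obtain ⟨hb1, hb2, hb3, hb4, hb5⟩ := hb.bounds
  have hb6 := hb.bounds'
  have hq := hp.hq
  have r := hI.regs
  refine (Tri.wp_seq hS (n := 11 + p.nr * 6 + 2 ^ (p.τ - 1 + p.δ) * (p.topTime + 1) + 1) ?_).le (by
    simp [Cmd.cost, blk, skip] <;> omega)
  have e24 : s.reg 24 = p.τ + p.δ := hI.r24.trans (by omega)
  have hsub : p.τ + p.δ - 1 = p.τ - 1 + p.δ := by omega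
  simp only [blk, wp, skip, NS.set_reg, NS.set_mem, e24, r.r22, r.r12, r.r13]
  simp only [Nat.reduceEqDiff, if_true, if_false, hsub, hklt _ (show p.τ - 1 + p.δ ≤ p.τ + p.δ by omega),
    hp.gr_lt, hp.hρ, Nat.lt_two_pow_self.trans hp.hρ, true_and, r.r22, r.r12, r.r13, one_mul,
    Nat.one_le_two_pow]
  refine ⟨by omega, ?_⟩
  refine (Tri.seq (n₁ := 1) (n₂ := 9 + p.nr * 6 + 2 ^ (p.τ - 1 + p.δ) * (p.topTime + 1))
    (tri_ones (by simp [r.r23]) (by simp [r.r22]) ?_)).le (by omega)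
  refine (Tri.seq (n₂ := 1 + 2 ^ (p.τ - 1 + p.δ) * (p.topTime + 1)) (tri_clearAcc hp
    (r.same (b := 30) (by simp)) fun s1 hs1 ho1 hm1 => ?_)).le (by omega)
  simp only [NS.set_mem, NS.set_out] at hm1 ho1
  have k : ∀ i < 60, i ≠ 31 → i ≠ 32 → i ≠ 33 → i ≠ 34 → i ≠ 35 → i ≠ 36 → s1.reg i = s.reg i := by
    intro i hi h1 h2 h3 h4 h5 h6
    rw [hs1 i hi]
    simp [h1, h2, h3, h4, h5, h6, show i ≠ 99 by omega]
  refine (Tri.loop (fun j s' => TopInv p c m₀ o₀ ib j s') (2 ^ (p.τ - 1 + p.δ)) p.topTime ?_ ?_ ?_).le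
    (by omega)
  · refine ⟨Regs.of_hdr fun i hi => ?_, ?_, ?_, ?_, ?_, ?_, ?_, ?_, ?_, ?_, ?_, ?_, ?_, ?_⟩
    · rw [k i (by omega) (by omega) (by omega) (by omega) (by omega) (by omega) (by omega)]
      exact r.hdr i hi
    · rw [k _ (by norm_num) (by norm_num) (by norm_num) (by norm_num) (by norm_num) (by norm_num) (by norm_num), e24]
    · rw [k _ (by norm_num) (by norm_num) (by norm_num) (by norm_num) (by norm_num) (by norm_num) (by norm_num), hI.r30]
    · rw [hs1 _ (by norm_num)]; simp
    · rw [hs1 _ (by norm_num)]; simp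
    · rw [hs1 _ (by norm_num)]; simp
    · rw [hs1 _ (by norm_num)]; simp
    · rw [hs1 _ (by norm_num)]; simp
    · rw [hs1 _ (by norm_num)]; simp
    · intro a
      simp only [hm1]
      split_ifs
      · positivity
      · exact hI.red a
    · rw [ho1, hI.out]
    · intro a ha
      simp only [hm1]
      rw [if_neg (by omega)]
      exact hI.eq a ha
    · intro f hf
      have := p.div_lt_BW hf
      have h0 := Nat.zero_le (f / 2 ^ p.g)
      rw [← hI.inb f hf]
      refine fld_congr ?_
      simp only [hm1]
      rw [if_neg (by omega)]
    · unfold big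
      refine Finset.sum_eq_zero fun i hi => ?_
      have := Finset.mem_range.1 hi
      simp only [hm1]
      rw [if_pos (by omega), zero_mul]
  · intro j hj s' h1
    have := hlt (p.τ - 1 + p.δ) (by omega)
    refine ⟨⟨by rw [h1.r36]; omega, by rw [h1.r34]; omega⟩, by
      simp only [Test.truth, h1.r36, h1.r34, hj], tri_topBody hp hj hb hR hV hm₀ h1⟩
  · intro s' h1
    have := hlt (p.τ - 1 + p.δ) (by omega)
    exact ⟨⟨by rw [h1.r36]; omega, by rw [h1.r34]; omega⟩, by
      simp only [Test.truth, h1.r36, h1.r34, lt_irrefl, not_false_eq_true], h1⟩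

/-- Writing the accumulator to the output. -/
def writeOut : Cmd := .seq (blk [.const 70 0, mov 71 15]) (.loop (.lt 70 11)
  (blk [.load 72 71, .output 70 72, .op .add 71 71 22, .op .add 70 70 22]))

theorem tri_writeOut {p : Par} (hp : p.Valid) {inp : ℕ → ℕ} {s : NS} (hr : Regs p s) {Q : NS → Prop}
    (hQ : ∀ s', s'.mem = s.mem →
      s'.out = (fun i => if i < p.nr then s.mem (p.bA + i) else s.out i) → Q s') :
    Tri p.w p.S inp writeOut s (7 + p.nr * 10) Q := by
  have h2 := hp.hS
  have hTW := p.TW_lt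
  have hq := hp.hq
  have hAT : p.bA + p.nr ≤ p.bT := by
    unfold Par.bT Par.b1 Par.b0; omega
  refine (Tri.wp_seq h2 ?_).le (m := 5 + (p.nr * (9 + 1) + 1) + 1) (by omega)
  simp only [blk, wp, skip, mov, NS.set_reg, NS.set_mem]
  simp [hr.r15, hr.r11]
  refine Tri.loop (fun j s' => Same 60 s s' ∧ s'.mem = s.mem ∧ s'.reg 70 = j ∧
    s'.reg 71 = p.bA + j ∧
    s'.out = fun i => if i < j then s.mem (p.bA + i) else s.out i) p.nr 9 ?_ ?_ ?_
  · exact ⟨by simp, by simp, by simp, by simp, by simp⟩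
  · rintro j hj s' ⟨i1, i2, i3, i4, i5⟩
    have hr' : Regs p s' := hr.same i1
    refine ⟨⟨by omega, by rw [hr'.r11]; omega⟩, by simp only [Test.truth, hr'.r11]; omega, ?_⟩
    refine (Tri.of_wp h2 ?_).le (m := 9) le_rfl
    have q2 : p.bA + j < p.S := by omega
    have q3 : j < 2 ^ p.w := by omega
    simp only [blk, wp, skip, NS.set_reg, NS.set_mem, NS.emit_reg, NS.emit_mem]
    simp [i1, i2, i3, i4, q2, q3, hr'.r22, i5, ← add_assoc]
    funext a
    by_cases h : a = j
    · simp [h]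
    · have e : (a ≤ j) ↔ (a < j) := by omega
      simp [h, e]
  · rintro s' ⟨i1, i2, i3, i4, i5⟩
    have hr' : Regs p s' := hr.same i1
    refine ⟨⟨by omega, by rw [hr'.r11]; omega⟩, by simp only [Test.truth, hr'.r11]; omega, ?_⟩
    exact hQ _ i2 i5

/-- Loading the first `n` words of the memory to the registers. -/
def loadHdr : ℕ → Cmd
  | 0 => skip
  | n + 1 => .seq (loadHdr n) (.seq (.const n n) (.load n n))

theorem wp_loadHdr {w S : ℕ} {inp : ℕ → ℕ} {s : NS} {n : ℕ} (hn : n ≤ S) (hn' : n ≤ 99)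
    {Q : NS → Prop} (hQ : ∀ s', (∀ i < n, s'.reg i = s.mem i) → 
      (∀ i, n ≤ i → s'.reg i = if i = 99 then 0 else s.reg i) → s'.mem = s.mem → s'.out = s.out →
      Q s') : wp w S inp (loadHdr n) s Q := by
  induction n generalizing Q with
  | zero => exact hQ _ (by simp) (by simp) rfl rfl
  | succ n ih =>
    refine ih (by omega) (by omega) fun s' h1 h4 h2 h3 => ?_
    simp only [wp, NS.set_reg, if_true]
    refine ⟨by omega, hQ _ (fun i hi => ?_) (fun i hi => ?_) h2 h3⟩
    · by_cases h : i = n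
      · simp [h, h2]
      · simp [h, h1 i (by omega)]
    · simp [show i ≠ n by omega, h4 i (by omega)]

theorem cost_loadHdr (n : ℕ) : (loadHdr n).cost = 1 + n * 4 := by
  induction n with
  | zero => rfl
  | succ n ih => simp only [loadHdr, Cmd.cost, ih]; ring

/-- The program that evaluates the represented function. -/
def evalProg : Cmd := .seq (loadHdr 24) (.seq leaves (.seq levels (.seq top writeOut)))

/-- The number of steps of `evalProg`. -/
def Par.evalTime (p : Par) : ℕ := 240 + p.BW * 6 + 2 ^ p.τ * (51 + 2 ^ (p.δ - p.g) * 22) +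
  ∑ h ∈ Finset.range (p.τ - 1), (p.levelTime h + 1) + p.nr * 16 +
  2 ^ (p.τ - 1 + p.δ) * (p.topTime + 1)

/-- The represented function. -/
def Par.hash (p : Par) (m : ℕ → ℕ) (x : ℕ) : ℕ := p.topAcc m (p.char x) (2 ^ (p.τ - 1 + p.δ))

theorem Par.S_ge (p : Par) : 24 ≤ p.S := by
  have := p.le_bT
  have := p.TW_lt
  omega

/-- The memory holds a representation of a function. -/
structure Repr (p : Par) (m : ℕ → ℕ) : Prop where
  red : Red p.w m
  hdr : ∀ i < 24, m i = p.hdr i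
  R : big p.w m p.bR p.nr = p.R
  V : ∀ e < 2 ^ (p.τ - 1 + p.δ + p.M), p.vval m e ≤ 2 * p.R

theorem tri_eval {p : Par} (hp : p.Valid) {inp m : ℕ → ℕ} (hm : Repr p m) :
    Tri p.w p.S inp evalProg ⟨fun _ => 0, m, fun _ => 0⟩ p.evalTime fun s' =>
      Red p.w s'.mem ∧ MemEq p m s'.mem ∧
        ∀ i, s'.out i = p.hash m (inp 0) / 2 ^ (p.w * i) % 2 ^ p.w := by
  have hS := hp.hS
  refine (Tri.wp_seq hS (n := 110 + p.BW * 6 + 2 ^ p.τ * (51 + 2 ^ (p.δ - p.g) * 22) +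
    ∑ h ∈ Finset.range (p.τ - 1), (p.levelTime h + 1) + p.nr * 16 +
      2 ^ (p.τ - 1 + p.δ) * (p.topTime + 1) + 10) ?_).le (by
    rw [cost_loadHdr]; unfold Par.evalTime; omega)
  refine wp_loadHdr p.S_ge (by norm_num) fun s1 h1 _ h2 h3 => ?_
  simp only at h1 h2 h3
  refine (Tri.seq (tri_leaves hp (Regs.of_hdr fun i hi => (h1 i hi).trans (hm.hdr i hi))
    (h2 ▸ hm.red) (Q := fun s' => Tri p.w p.S inp _ s' (13 + ∑ h ∈ Finset.range (p.τ - 1),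
      (p.levelTime h + 1) + p.nr * 16 + 2 ^ (p.τ - 1 + p.δ) * (p.topTime + 1) + 42) _) ?_)).le (by omega)
  intro s2 hr2 hm2 ho2 he2 hf2
  rw [h2] at he2 hf2
  refine (Tri.seq (n₂ := p.nr * 16 + 2 ^ (p.τ - 1 + p.δ) * (p.topTime + 1) + 41)
    ((tri_levels hp hr2 hm2 (ho2.trans h3) he2 hf2).imp ?_)).le (by omega)
  rintro s3 ⟨ib, ob, hb, hI⟩
  refine (Tri.seq (n₂ := 7 + p.nr * 10) ((tri_top hp hb hI hm.R hm.V hm.red).imp ?_)).le (by omega)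
  intro s4 hT
  refine tri_writeOut hp hT.regs fun s5 hm5 ho5 => ⟨hm5 ▸ hT.red, hm5 ▸ hT.eq, fun i => ?_⟩
  rw [ho5, Par.hash, ← hT.acc]
  by_cases h : i < p.nr
  · simp only [h, if_true]
    rw [big_digit hT.red h]
  · simp only [h, if_false]
    -- The output array is zero initially, so the words that are never written are correct too.
    rw [big_digit_ge hT.red (by omega), hT.out]
    simp

/-- The function depends only on the two tables and on fixed parameters, none of which lies in the
working space. This is what makes repeated evaluations possible. -/
theorem hash_congr {p : Par} {m m' : ℕ → ℕ} (h : MemEq p m m') (x : ℕ) :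
    p.hash m' x = p.hash m x := by
  have hF : fld p m' p.bT = fld p m p.bT := by
    funext n
    exact fld_congr (h _ (Or.inr (Nat.le_add_right _ _)))
  have hV : p.vval m' = p.vval m := by
    have hbV : p.bV = p.bT + p.TW := rfl
    funext e
    refine Finset.sum_congr rfl fun i _ => ?_
    unfold Par.dig
    rw [h _ (Or.inr _)]
    have := Nat.zero_le ((e * 2 ^ p.q + i) / 2 ^ p.gr)
    omega
  unfold Par.hash
  generalize 2 ^ (p.τ - 1 + p.δ) = N
  induction N with
  | zero => rfl
  | succ N ih => simp only [Par.topAcc, ih, hF, hV]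

/-- The contents of the memory as natural numbers. -/
def natMem {w S : ℕ} (m : Mem w S) (a : ℕ) : ℕ := if h : a < S then (m ⟨a, h⟩).toNat else 0

theorem red_natMem {w S : ℕ} (m : Mem w S) : Red w (natMem m) := by
  intro a
  unfold natMem
  split_ifs
  · exact BitVec.isLt _
  · positivity

theorem toState_natMem {w S : ℕ} (r o : ℕ → ℕ) (m : Mem w S) :
    (⟨r, natMem m, o⟩ : NS).toState w S = ⟨fun i => BitVec.ofNat w (r i), m,
      fun i => BitVec.ofNat w (o i)⟩ := by
  unfold NS.toState natMem
  congr 1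
  funext a
  simp

theorem natMem_toState {w S : ℕ} {s : NS} (h : Red w s.mem) {a : ℕ} (ha : a < S) :
    natMem (s.toState w S).mem a = s.mem a := by
  simp [natMem, ha, NS.toState, Nat.mod_eq_of_lt (h a)]

theorem Tri.run {w S : ℕ} {inp : ℕ → ℕ} {c : Cmd} {s : NS} {n : ℕ} {Q : NS → Prop}
    (h : Tri w S inp c s n Q) {T : ℕ} (hT : n ≤ T) : ∃ s', Q s' ∧
      stepN inp T (⟨[c], s.toState w S⟩ : Config w S) = PMF.pure ⟨[], s'.toState w S⟩ := by
  obtain ⟨j, hj, s', hQ, hd⟩ := h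
  refine ⟨s', hQ, ?_⟩
  obtain ⟨d, rfl⟩ : ∃ d, T = j + d := ⟨T - j, by omega⟩
  rw [stepN_add, hd [], PMF.pure_bind, stepN_nil]

theorem represents {D : HashProgram} (hD : D.eval = evalProg) {p : Par} (hp : p.Valid)
    {m : Mem p.w p.S} (hm : Repr p (natMem m)) {T u r : ℕ} (hT : p.evalTime ≤ T)
    (f : Fin u → Fin r) (hf : ∀ x : Fin u, (f x : ℕ) = p.hash (natMem m) x) :
    D.Represents T m f := by
  -- The invariant set consists of all memories that differ from `m` in the working space only; no
  -- cleaning up between evaluations is required.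
  refine ⟨{m' | MemEq p (natMem m) (natMem m')}, fun a _ => rfl, fun m' hm' x c hc => ?_⟩
  have hbA : 24 + p.nr ≤ p.bA := by have := hp.hq; unfold Par.bA Par.bR; omega
  have hm1 : Repr p (natMem m') := by
    refine ⟨red_natMem _, fun i hi => ?_, ?_, fun e he => ?_⟩
    · rw [← hm.hdr i hi]; exact hm' i (Or.inl (by omega))
    · rw [← hm.R]
      exact big_congr fun i hi => hm' _ (Or.inl (by unfold Par.bR; omega))
    · convert hm.V e he using 1
      refine Finset.sum_congr rfl fun i _ => ?_
      unfold Par.dig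
      have hbV : p.bV = p.bT + p.TW := rfl
      rw [hm' _ (Or.inr _)]
      have := Nat.zero_le ((e * 2 ^ p.q + i) / 2 ^ p.gr)
      omega
  obtain ⟨s', ⟨h1, h2, h3⟩, h4⟩ := (tri_eval hp (inp := fun _ => (x : ℕ)) hm1).run hT
  have e : D.runEval m' x T = PMF.pure ⟨[], s'.toState p.w p.S⟩ := by
    rw [← h4, toState_natMem]
    unfold HashProgram.runEval run
    rw [hD]
    simp
  rw [e, PMF.mem_support_pure_iff] at hc
  subst hc
  refine ⟨rfl, fun i => ?_, fun a ha => ?_⟩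
  · show BitVec.ofNat _ _ = _
    rw [h3, hash_congr hm', ← hf, ofNat_mod]
    rfl
  · by_cases haS : a < p.S
    · rw [natMem_toState h1 haS, h2 a ha]
      exact hm' a ha
    · simp [natMem, haS]

/-- Every run has some outcome, because its law has nonempty support, and the words of the output
determine the value. -/
theorem represents_unique {D : HashProgram} {w S : ℕ} {m : Mem w S} {T u r n : ℕ}
    (hr : r ≤ 2 ^ (w * n)) {f f' : Fin u → Fin r} (h : D.Represents T m f) (h' : D.Represents T m f') :
    f = f' := by
  obtain ⟨R, hR, hf⟩ := h
  obtain ⟨R', hR', hf'⟩ := h'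
  funext x
  obtain ⟨c, hc⟩ := (D.runEval m x T).support_nonempty
  have h1 := (hf m hR x c hc).2.1
  have h2 := (hf' m hR' x c hc).2.1
  have key : ∀ n, ∀ a b : ℕ, a < 2 ^ (w * n) → b < 2 ^ (w * n) →
      (∀ i, wordOf w a i = wordOf w b i) → a = b := by
    intro n
    induction n with
    | zero => intro a b ha hb _; simp at ha hb; omega
    | succ n ih =>
      intro a b ha hb hab
      have e0 := congrArg BitVec.toNat (hab 0)
      simp [wordOf] at e0
      have e1 : a / 2 ^ w = b / 2 ^ w := by
        refine ih _ _ ?_ ?_ fun i => ?_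
        · rw [Nat.div_lt_iff_lt_mul (by positivity), ← pow_add]; exact ha
        · rw [Nat.div_lt_iff_lt_mul (by positivity), ← pow_add]; exact hb
        · have := hab (i + 1)
          unfold wordOf at this ⊢
          rw [Nat.div_div_eq_div_mul, Nat.div_div_eq_div_mul, ← pow_add]
          convert this using 4 <;> ring
      rw [← Nat.div_add_mod a (2 ^ w), ← Nat.div_add_mod b (2 ^ w), e0, e1]
  refine Fin.ext (key n _ _ ((f x).2.trans_le hr) ((f' x).2.trans_le hr) fun i => ?_)
  rw [← h1 i, h2 i]

end WordRAM

/-! ### The program that draws a member of the family. -/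

namespace WordRAM

/-- The branches of the loop-free command take the same time. -/
def Cmd.Balanced : Cmd → Prop
  | .seq c₁ c₂ => c₁.Balanced ∧ c₂.Balanced
  | .branch _ c₁ c₂ => c₁.Balanced ∧ c₂.Balanced ∧ c₁.cost = c₂.cost
  | _ => True

/-- Zero steps are impossible, as the command would still be on the list. -/
theorem Tri.det_one {w S : ℕ} {inp : ℕ → ℕ} {c : Cmd} {s : NS} {Q : NS → Prop}
    (h : Tri w S inp c s 1 Q) : ∃ s', Q s' ∧ Det w S inp c s s' 1 := by
  obtain ⟨j, hj, s', hQ, hd⟩ := h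
  rcases Nat.le_one_iff_eq_zero_or_eq_one.1 hj with rfl | rfl
  · have := hd []
    simp only [stepN] at this
    have h2 : (⟨[c], s.toState w S⟩ : Config w S) ∈
        (PMF.pure (⟨[], s'.toState w S⟩ : Config w S)).support := by
      rw [← this]; simp
    rw [PMF.mem_support_pure_iff] at h2
    simp at h2
  · exact ⟨s', hQ, hd⟩

theorem Det.seq {w S : ℕ} {inp : ℕ → ℕ} {c₁ c₂ : Cmd} {s s' s'' : NS} {j j' : ℕ}
    (h : Det w S inp c₁ s s' j) (h' : Det w S inp c₂ s' s'' j') :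
    Det w S inp (.seq c₁ c₂) s s'' (j + j' + 1) := by
  intro K
  rw [add_comm, stepN_add]
  simp only [stepN, step, PMF.bind_pure, PMF.pure_bind]
  rw [stepN_add, h, PMF.pure_bind, h' K]

-- In contrast to `Tri.of_wp`, the number of steps is exact, as needed for `RDet`.
open Classical in
theorem Det.of_wp {w S : ℕ} (hS : S ≤ 2 ^ w) {inp : ℕ → ℕ} {c : Cmd} {s : NS} {Q : NS → Prop}
    (hc : c.Balanced) (h : wp w S inp c s Q) : ∃ s', Q s' ∧ Det w S inp c s s' c.cost := by
  induction c generalizing s Q with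
  | seq c₁ c₂ h₁ h₂ =>
    obtain ⟨s', hs', hd⟩ := h₁ hc.1 h
    obtain ⟨s'', hs'', hd'⟩ := h₂ hc.2 hs'
    exact ⟨s'', hs'', hd.seq hd'⟩
  | branch b c₁ c₂ h₁ h₂ =>
    have hs : ∀ K, step inp (⟨.branch b c₁ c₂ :: K, s.toState w S⟩ : Config w S) =
        PMF.pure ⟨(if b.holds (s.toState w S) then c₁ else c₂) :: K, s.toState w S⟩ := by
      intro K
      simp only [step]
    have e : (Cmd.branch b c₁ c₂).cost = 1 + c₁.cost := by
      simp [Cmd.cost, hc.2.2, add_comm]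
    rw [e]
    by_cases ht : b.truth s
    · obtain ⟨s', hQ, hd⟩ := h₁ hc.1 (h.2.1 ht)
      refine ⟨s', hQ, fun K => ?_⟩
      rw [stepN_add]
      simp [stepN, hs, if_pos ((Test.holds_iff s b h.1).2 ht), hd K]
    · obtain ⟨s', hQ, hd⟩ := h₂ hc.2.1 (h.2.2 ht)
      rw [← hc.2.2] at hd
      refine ⟨s', hQ, fun K => ?_⟩
      rw [stepN_add]
      simp [stepN, hs, if_neg (mt (Test.holds_iff s b h.1).1 ht), hd K]
  | const d n => exact (Tri.of_wp hS h).det_one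
  | op o d a b => exact (Tri.of_wp hS h).det_one
  | load d a => exact (Tri.of_wp hS h).det_one
  | store a b => exact (Tri.of_wp hS h).det_one
  | input d p a => exact (Tri.of_wp hS h).det_one
  | output a b => exact (Tri.of_wp hS h).det_one
  | rand => exact h.elim
  | loop => exact h.elim

theorem tape_support {rng : ℕ → ℕ} {n : ℕ} (hr : ∀ i < n, 0 < rng i) {f : ℕ → ℕ}
    (hf : f ∈ (tape rng n).support) : (∀ i < n, f i < rng i) ∧ ∀ i, n ≤ i → f i = 0 := by
  induction n generalizing f with
  | zero =>
    simp only [tape, PMF.mem_support_pure_iff] at hf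
    subst hf
    simp
  | succ n ih =>
    rw [tape_succ (Finset.nonempty_range_iff.2 (hr n (by omega)).ne')] at hf
    simp only [PMF.mem_support_bind_iff, PMF.mem_support_map_iff,
      PMF.mem_support_uniformOfFinset_iff, Finset.mem_range] at hf
    obtain ⟨g, hg, v, hv, rfl⟩ := hf
    obtain ⟨h1, h2⟩ := ih (fun i hi => hr i (by omega)) hg
    constructor
    · intro i hi
      by_cases h : i = n
      · simp [h, hv]
      · simp [h, h1 i (by omega)]
    · intro i hi
      simp [show i ≠ n by omega, h2 i (by omega)]

/-- The range of the random digit number `i`, where `i` is in register 30. -/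
def sampleRange : Cmd := blk [.op .and 40 30 32, .branch (.lt 40 33)
    (blk [.const 41 0, .const 41 0, .const 41 0])
    (blk [.op .add 42 14 40, .load 41 42, .op .add 41 41 22])]

/-- Storing the random digit in register 43. -/
def sampleStore : Cmd := blk [.op .shr 44 30 13, .op .add 44 44 19, .op .and 45 30 31,
  .op .shl 45 45 12, .op .shl 43 43 45, .load 46 44, .op .add 46 46 43, .store 44 46,
  .op .add 30 30 22, .const 40 0, .const 41 0, .const 42 0, .const 43 0, .const 44 0, .const 45 0,
  .const 46 0]

/-- Drawing a random digit of the last table. -/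
def sampleBody : Cmd := .seq sampleRange (.seq (.rand 43 41) sampleStore)

/-- Initialization of the registers. -/
def samplePre : Cmd := .seq (loadHdr 24) (blk [.const 30 0, .op .shl 31 22 13,
  .op .sub 31 31 22, .op .shl 32 22 10, .op .sub 32 32 22, .op .sub 33 11 22, .op .add 34 0 1,
  .op .add 34 34 2, .op .add 34 34 10, .op .sub 34 34 22, .op .shl 34 22 34])

/-- The program that turns the representation of a family into one of a member of the family. -/
def sampleProg : Cmd := .seq samplePre (.loop (.lt 30 34) sampleBody)

namespace Par

variable (p : Par)

/-- The range of the random number `n`. -/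
def range (m : ℕ → ℕ) (n : ℕ) : ℕ :=
  if n % 2 ^ p.q < p.nr - 1 then 2 ^ p.w else m (p.bR + n % 2 ^ p.q) + 1

/-- The memory after `i` random numbers have been stored. -/
def sampleMem (m φ : ℕ → ℕ) : ℕ → ℕ → ℕ
  | 0, a => m a
  | i + 1, a => if a = p.bV + i / 2 ^ p.gr then
      sampleMem m φ i a + φ i * 2 ^ (i % 2 ^ p.gr * 2 ^ p.ρ) else sampleMem m φ i a

theorem range_pos (m : ℕ → ℕ) (n : ℕ) : 0 < p.range m n := by
  unfold range
  split_ifs <;> positivity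

theorem sampleMem_congr {m φ ψ : ℕ → ℕ} {i : ℕ} (h : ∀ j < i, φ j = ψ j) :
    p.sampleMem m φ i = p.sampleMem m ψ i := by
  induction i with
  | zero => rfl
  | succ i ih =>
    funext a
    simp only [sampleMem, ih fun j hj => h j (by omega), h i (by omega)]

theorem sampleMem_of_lt {m φ : ℕ → ℕ} {i a : ℕ} (h : a < p.bV) : p.sampleMem m φ i a = m a := by
  induction i with
  | zero => rfl
  | succ i ih =>
    rw [sampleMem, if_neg, ih]
    have := Nat.zero_le (i / 2 ^ p.gr)
    omega

end Par

/-- What `sampleProg` expects of the memory. -/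
structure Fam (p : Par) (m : ℕ → ℕ) : Prop where
  red : Red p.w m
  hdr : ∀ i < 24, m i = p.hdr i
  R : big p.w m p.bR p.nr = p.R
  pad : ∀ i, p.nr ≤ i → i < 2 ^ p.q → m (p.bR + i) = 0
  V : ∀ a, p.bV ≤ a → m a = 0

theorem Par.Valid.ρ_off {p : Par} (hp : p.Valid) (n : ℕ) :
    n % 2 ^ p.gr * 2 ^ p.ρ < 2 ^ p.w := by
  rcases Nat.eq_zero_or_pos p.gr with h | h
  · simp [h, Nat.mod_one]
  · refine lt_of_lt_of_le ?_ ((hp.hgr h).trans Nat.lt_two_pow_self.le)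
    rw [pow_add]
    exact Nat.mul_lt_mul_of_pos_right (Nat.mod_lt _ (by positivity)) (by positivity)

theorem Par.Valid.VW_word {p : Par} (_ : p.Valid) {n : ℕ} (h : n < p.NV) :
    p.bV + n / 2 ^ p.gr < p.S := by
  have hVW : p.NV ≤ p.VW * 2 ^ p.gr := by
    unfold Par.NV Par.VW
    rw [← pow_add]
    exact Nat.pow_le_pow_right (by norm_num) (by omega)
  have : n / 2 ^ p.gr < p.VW := by
    rw [Nat.div_lt_iff_lt_mul (by positivity)]
    omega
  unfold Par.S
  omega

theorem Par.Valid.q_lt {p : Par} (hp : p.Valid) : 2 ^ p.q < 2 ^ p.w := by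
  refine lt_of_le_of_lt (Nat.pow_le_pow_right (by norm_num) ?_) hp.hNV
  have := hp.hτ
  omega

theorem wp_samplePre {p : Par} (hp : p.Valid) {inp m : ℕ → ℕ} (hm : Fam p m) {Q : NS → Prop}
    (hQ : ∀ s, Regs p s → s.reg 30 = 0 → s.reg 31 = 2 ^ p.gr - 1 → s.reg 32 = 2 ^ p.q - 1 →
      s.reg 33 = p.nr - 1 → s.reg 34 = p.NV → (∀ i, 40 ≤ i → s.reg i = 0) → s.mem = m →
      (s.out = fun _ => 0) → Q s) :
    wp p.w p.S inp samplePre ⟨fun _ => 0, m, fun _ => 0⟩ Q := by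
  have hidx := hp.hidx
  have hτ := hp.hτ
  have hnr := hp.hnr
  have hq' : p.q < 2 ^ p.w := Nat.lt_two_pow_self.trans hp.q_lt
  have hNVpos : p.τ + p.δ + p.M + p.q - 1 < 2 ^ p.w := Nat.lt_two_pow_self.trans hp.hNV
  simp only [samplePre, wp]
  refine wp_loadHdr p.S_ge (by norm_num) fun s1 h1 h4 h2 h3 => ?_
  simp only at h1 h2 h3 h4
  have r : Regs p s1 := Regs.of_hdr fun i hi => (h1 i hi).trans (hm.hdr i hi)
  simp only [blk, wp, skip, NS.set_reg, NS.set_mem, r.r22, r.r13, r.r10, r.r11]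
  simp only [Nat.reduceEqDiff, if_true, if_false, r.r22, r.r13, r.r10, r.r11, r.r0, r.r1, r.r2,
    one_mul, Nat.one_le_two_pow, true_and, hp.gr_lt, hq', hnr]
  refine ⟨by omega, hNVpos, hQ _ (r.same (b := 24) (by simp)) (by simp) (by simp) (by simp) (by simp)
    (by simp [Par.NV]) (fun i hi => ?_) (by simp [h2]) (by simp [h3])⟩
  have := h4 i (by omega)
  simp [show i ≠ 30 by omega, show i ≠ 31 by omega, show i ≠ 32 by omega, show i ≠ 33 by omega,
      show i ≠ 34 by omega, this]

/-- The range `2 ^ w` is passed to `rand` as the word 0. It arises below the leading word, and also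
at the leading word if that of `R` is `2 ^ w - 1`, where adding one wraps around. Padding positions
find a zero in memory, hence range 1. The repeated constants in `sampleRange` balance its branches.
-/
theorem wp_sampleRange {p : Par} (hp : p.Valid) {inp m : ℕ → ℕ} (hm : Fam p m) {s : NS} {i : ℕ}
    (hr : Regs p s) (h30 : s.reg 30 = i) (h32 : s.reg 32 = 2 ^ p.q - 1) (h33 : s.reg 33 = p.nr - 1)
    (h99 : s.reg 99 = 0) (hmem : ∀ a < p.bA, s.mem a = m a) {Q : NS → Prop}
    (hQ : ∀ s', (∀ k, (k < 40 ∨ 43 ≤ k) → s'.reg k = s.reg k) → s'.mem = s.mem → s'.out = s.out →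
      randRange (BitVec.ofNat p.w (s'.reg 41)) = p.range m i → Q s') :
    wp p.w p.S inp sampleRange s Q := by
  have hS := hp.hS
  have hnr := hp.hnr
  have hq := hp.hq
  have e1 : i % 2 ^ p.q < 2 ^ p.w := (Nat.mod_lt _ (by positivity)).trans hp.q_lt
  have e2 : i % 2 ^ p.q < 2 ^ p.q := Nat.mod_lt _ (by positivity)
  have hbA : p.bA = p.bR + 2 ^ p.q := rfl
  have hbAS : p.bA < p.S := by
    have := p.TW_lt
    have : p.bA ≤ p.bT := by unfold Par.bT Par.b1 Par.b0; omega
    omega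
  simp only [sampleRange, blk, wp, skip, Test.ok, Test.truth, NS.set_reg, NS.set_mem, hr.r14, hr.r22]
  simp only [Nat.reduceEqDiff, if_true, if_false, hr.r14, hr.r22, h30, h32, h33,
    Nat.and_two_pow_sub_one_eq_mod, e1, true_and]
  refine ⟨by omega, fun hlt => ?_, fun hlt => ⟨by omega, ?_⟩⟩
  · refine hQ _ (fun k hk => ?_) rfl rfl ?_
    · by_cases h : k = 99
      · simp [h, h99]
      · simp [show k ≠ 40 by omega, show k ≠ 41 by omega, h]
    · simp [Par.range, hlt, randRange]
  · refine hQ _ (fun k hk => ?_) rfl rfl ?_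
    · by_cases h : k = 99
      · simp [h, h99]
      · simp [show k ≠ 40 by omega, show k ≠ 41 by omega, show k ≠ 42 by omega, h]
    · rw [hmem _ (by omega)]
      simp only [NS.set_reg, Nat.reduceEqDiff, if_true, if_false, Par.range, hlt, randRange,
        BitVec.toNat_ofNat]
      have f6 := hm.red (p.bR + i % 2 ^ p.q)
      rcases Nat.lt_or_ge (m (p.bR + i % 2 ^ p.q) + 1) (2 ^ p.w) with h | h
      · rw [Nat.mod_eq_of_lt h]; simp
      · have : m (p.bR + i % 2 ^ p.q) + 1 = 2 ^ p.w := by omega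
        rw [this]; simp

/-- Clearing the registers 40 to 46 makes the resulting state a function of the numbers drawn, as
`RDet.loop` demands. -/
theorem wp_sampleStore {p : Par} (hp : p.Valid) {inp : ℕ → ℕ} {s : NS} {i v : ℕ} (hi : i < p.NV)
    (hr : Regs p s) (h30 : s.reg 30 = i) (h31 : s.reg 31 = 2 ^ p.gr - 1) (h43 : s.reg 43 = v)
    {Q : NS → Prop} (hQ : ∀ s', (s'.reg = fun k => if k = 99 ∨ (40 ≤ k ∧ k ≤ 46) then 0 else
        if k = 30 then i + 1 else s.reg k) → (s'.mem = fun a => if a = p.bV + i / 2 ^ p.gr then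
          s.mem a + v * 2 ^ (i % 2 ^ p.gr * 2 ^ p.ρ) else s.mem a) → s'.out = s.out → Q s') :
    wp p.w p.S inp sampleStore s Q := by
  have hi' : i < 2 ^ p.w := hi.trans hp.hNV
  have hw := hp.VW_word hi
  rw [add_comm] at hw
  simp only [sampleStore, blk, wp, skip, NS.set_reg, NS.set_mem, NS.put_reg, NS.put_mem]
  simp only [Nat.reduceEqDiff, if_true, if_false, h30, h31, h43, hr.r13, hr.r19, hr.r12, hr.r22,
    Nat.and_two_pow_sub_one_eq_mod, hi', hp.gr_lt, Nat.lt_two_pow_self.trans hp.hρ, true_and,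
    hp.ρ_off, hw]
  refine hQ _ ?_ ?_ rfl
  · funext k
    by_cases hk : k = 99 ∨ (40 ≤ k ∧ k ≤ 46)
    · rw [if_pos hk]
      rcases hk with rfl | ⟨hk1, hk2⟩
      · simp
      · interval_cases k <;> simp
    · rw [if_neg hk]
      push Not at hk
      have hk1 : k ≠ 40 ∧ k ≠ 41 ∧ k ≠ 42 ∧ k ≠ 43 ∧ k ≠ 44 ∧ k ≠ 45 ∧ k ≠ 46 := by
        refine ⟨?_, ?_, ?_, ?_, ?_, ?_, ?_⟩ <;> rintro rfl <;> omega
      simp [hk1, hk.1]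
  · funext a
    simp only [NS.set_mem, NS.put_mem, add_comm p.bV]
    split_ifs with h
    · rw [h]
    · rfl

/-- The number of steps of `sampleProg`. -/
def Par.sampleTime (p : Par) : ℕ := 150 + p.NV * 54

theorem sample_run {p : Par} (hp : p.Valid) {inp m : ℕ → ℕ} (hm : Fam p m) {T : ℕ}
    (hT : p.sampleTime ≤ T) : ∃ r : (ℕ → ℕ) → ℕ → ℕ,
      stepN inp T (⟨[sampleProg], (⟨fun _ => 0, m, fun _ => 0⟩ : NS).toState p.w p.S⟩ :
        Config p.w p.S) = (tape (p.range m) p.NV).map fun φ =>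
          ⟨[], (⟨r φ, p.sampleMem m φ p.NV, fun _ => 0⟩ : NS).toState p.w p.S⟩ := by
  have hS := hp.hS
  have hbAV : p.bA ≤ p.bV := by
    have := Nat.zero_le (2 ^ p.q)
    unfold Par.bV Par.bT Par.b1 Par.b0
    omega
  have hpre := Tri.of_wp hS (wp_samplePre hp (inp := inp) hm (Q := fun s => Regs p s ∧ s.reg 30 = 0 ∧
        s.reg 31 = 2 ^ p.gr - 1 ∧ s.reg 32 = 2 ^ p.q - 1 ∧ s.reg 33 = p.nr - 1 ∧ s.reg 34 = p.NV ∧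
        (∀ i, 40 ≤ i → s.reg i = 0) ∧ s.mem = m ∧ s.out = fun _ => 0)
        fun s h1 h2 h3 h4 h5 h6 h7 h8 h9 => ⟨h1, h2, h3, h4, h5, h6, h7, h8, h9⟩)
  obtain ⟨j, hj, s1, ⟨r, h30, h31, h32, h33, h34, h40, hmem, hout⟩, hd⟩ := hpre
  have hj' : j ≤ 140 := hj.trans (by
    simp only [samplePre, Cmd.cost, cost_loadHdr, blk, skip]; norm_num)
  -- Between rounds only the counter in register 30 and the last table have changed.
  set st : ℕ → (ℕ → ℕ) → NS := fun i φ =>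
    ⟨(s1.set 30 i).reg, p.sampleMem m φ i, fun _ => 0⟩ with hst
  have hst0 : st 0 (fun _ => 0) = s1 := by
    obtain ⟨reg, mem, out⟩ := s1
    simp only [hst] at *
    congr 1
    · funext k
      simp only [NS.set_reg]
      split_ifs with h
      · rw [h, h30]
      · rfl
    · subst hmem; rfl
    · exact hout.symm
  have hloop : RDet p.w p.S inp (.loop (.lt 30 34) sampleBody) (st 0 fun _ => 0)
      (∑ i ∈ Finset.range p.NV, (48 + 1) + 1) ((tape (p.range m) p.NV).map (st p.NV)) := by
    refine RDet.loop (p.range m) p.NV st (fun _ => 48)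
      (fun i _ => Finset.nonempty_range_iff.2 (p.range_pos m i).ne') (fun i hi φ hφ => ?_)
      (fun φ hφ => ?_)
    · have hi' : i < 2 ^ p.w := hi.trans hp.hNV
      refine ⟨⟨by simpa [hst] using hi', by simpa [hst, h34] using hp.hNV⟩,
        by simpa [Test.truth, hst, h34] using hi, ?_⟩
      have rst : Regs p (st i φ) := Regs.of_hdr fun k hk => by
        simp [hst, show k ≠ 30 by omega, r.hdr k hk]
      obtain ⟨s2, ⟨g1, g2, g3, g4⟩, hd2⟩ := Det.of_wp hS (inp := inp) (by
          simp [sampleRange, Cmd.Balanced, blk, skip, Cmd.cost])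
        (wp_sampleRange hp hm rst (i := i) (by simp [hst])
          (by simp [hst, h32]) (by simp [hst, h33]) (by simp [hst, h40]) (fun a ha => by
            simp only [hst]
            rw [Par.sampleMem_of_lt _ (by omega)])
          (Q := fun s2 => (∀ k, (k < 40 ∨ 43 ≤ k) → s2.reg k = (st i φ).reg k) ∧
            s2.mem = (st i φ).mem ∧ s2.out = (st i φ).out ∧
            randRange (BitVec.ofNat p.w (s2.reg 41)) = p.range m i)
          fun s2 h1 h2 h3 h4 => ⟨h1, h2, h3, h4⟩)
      have hrand := RDet.rand (w := p.w) (S := p.S) (inp := inp) (d := 43) (a := 41) g4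
        (Finset.nonempty_range_iff.2 (p.range_pos m i).ne')
      have hpost : ∀ v, Det p.w p.S inp sampleStore (s2.set 43 v)
          (st (i + 1) fun j => if j = i then v else φ j) 33 := by
        intro v
        have r2 : Regs p (s2.set 43 v) := Regs.of_hdr fun k hk => by
          simp [show k ≠ 43 by omega, g1 k (by omega), rst.hdr k hk]
        obtain ⟨s3, rfl, hd3⟩ := Det.of_wp hS (inp := inp) (by
            simp [sampleStore, Cmd.Balanced, blk, skip, Cmd.cost])
          (wp_sampleStore hp hi r2 (v := v) (by simp [g1, hst]) (by simp [g1, hst, h31]) (by simp)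
            (Q := fun s3 => s3 = st (i + 1) fun j => if j = i then v else φ j) (by
              intro s3 k1 k2 k3
              obtain ⟨reg, mem, out⟩ := s3
              simp only [hst] at k1 k2 k3 ⊢
              rw [NS.mk.injEq]
              refine ⟨?_, ?_, by rw [k3, NS.set_out, g3]⟩
              · rw [k1]
                funext k
                by_cases hk : k = 99 ∨ (40 ≤ k ∧ k ≤ 46)
                · rw [if_pos hk, NS.set_reg, if_neg (by omega), h40 k (by omega)]
                · rw [if_neg hk, NS.set_reg, NS.set_reg, if_neg (show k ≠ 43 by omega),
                    g1 k (by omega)]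
                  simp [hst]
                  split_ifs <;> rfl
              · have hcongr : p.sampleMem m (fun j => if j = i then v else φ j) i =
                    p.sampleMem m φ i := p.sampleMem_congr fun j hj => by simp [hj.ne]
                rw [k2]
                funext a
                simp only [Par.sampleMem, hcongr, if_true, NS.set_mem, g2, hst]))
        exact hd3
      have hall := hd2.rdet.seq (n₂ := 35) (c₂ := .seq (.rand 43 41) sampleStore)
        (q := fun s' => ((PMF.uniformOfFinset (Finset.range (p.range m i))
          (Finset.nonempty_range_iff.2 (p.range_pos m i).ne')).map fun v => s'.set 43 v).bind fun s' =>
            PMF.pure (st (i + 1) fun j => if j = i then s'.reg 43 else φ j)) fun s' hs' => by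
          rw [PMF.mem_support_pure_iff] at hs'
          subst hs'
          exact hrand.seq (n₂ := 33) fun s' hs' => by
            simp only [PMF.mem_support_map_iff, PMF.mem_support_uniformOfFinset_iff,
              Finset.mem_range] at hs'
            obtain ⟨v, hv, rfl⟩ := hs'
            have := (hpost v).rdet
            simpa using this
      rw [PMF.pure_bind, PMF.bind_map] at hall
      exact hall
    · refine ⟨⟨by simpa [hst] using hp.hNV, by simpa [hst, h34] using hp.hNV⟩, ?_⟩
      simp [Test.truth, hst, h34]
  rw [hst0] at hloop
  have hall := hd.rdet.seq (n₂ := ∑ i ∈ Finset.range p.NV, (48 + 1) + 1)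
    (q := fun _ => (tape (p.range m) p.NV).map (st p.NV)) fun s' hs' => by
      rw [PMF.mem_support_pure_iff] at hs'
      subst hs'
      exact hloop
  rw [PMF.pure_bind] at hall
  have hle : 1 + (j + (∑ i ∈ Finset.range p.NV, (48 + 1) + 1)) ≤ T := by
    simp only [Finset.sum_const, Finset.card_range, smul_eq_mul]
    unfold Par.sampleTime at hT
    omega
  obtain ⟨d, rfl⟩ := Nat.exists_eq_add_of_le hle
  refine ⟨fun φ => (st p.NV φ).reg, ?_⟩
  have := hall [] d
  rw [sampleProg, this]
  simp only [stepN_nil, PMF.bind_map]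
  rfl

end WordRAM

/-! ### The selection program: logarithms and the length of a character. -/

namespace WordRAM

/-- The least `e` with `x ≤ 2 ^ e`. -/
def clg (x : ℕ) : ℕ := Nat.size (x - 1)

/-- A lower bound for the logarithm of a number `u` of `nu` words. -/
def lam (w nu u : ℕ) : ℕ := if nu = 1 then Nat.size u - 1 else (nu - 1) * w

/-- The number of bits of the words of a number. -/
def xbits (w nu u : ℕ) : ℕ := if nu = 1 then Nat.size u else w

/-- The assumptions on the input and the equations that define the parameters. -/
structure Sel (p : Par) (inp : ℕ → ℕ) (nu nt : ℕ) : Prop where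
  valid : p.Valid
  u2 : 2 ≤ inp 0
  r0 : 0 < inp 1
  t0 : 0 < inp 2
  k0 : 0 < inp 3
  k_lt : inp 3 < 2 ^ p.w
  nu1 : 1 ≤ nu
  nu_lt : nu < 2 ^ p.w
  u_lt : nu = 1 → inp 0 < 2 ^ p.w
  nt_lt : nt < 2 ^ p.w
  t_lt : nt = 1 → inp 2 < 2 ^ p.w
  lam_lt : lam p.w nu (inp 0) < 2 ^ p.w
  α : p.α = if nt = 1 then Nat.log 2 (lam p.w nu (inp 0) / 16 / inp 2) else 0
  ℓ : p.ℓ = Nat.size (Nat.size (inp 3)) - p.α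
  δ : p.δ = 10 + 2 * p.ℓ
  M : p.M = Nat.size (inp 3) + 3 * p.s + 17
  μ : p.μ = clg p.M
  g : p.g = Nat.size p.w - 1 - p.μ
  π : p.π = clg (xbits p.w nu (inp 0)) - p.α
  τ : p.τ = 1 + p.π + clg nu
  q : p.q = clg p.nr
  R : p.R = inp 1 - 1
  ρ : p.ρ = if p.nr = 1 then clg (Nat.size p.R) else clg p.w
  gr : p.gr = Nat.size p.w - 1 - p.ρ

/-- The number of bits of register 90, computed into register 91. -/
def bitlen : Cmd := .seq (blk [.const 91 0])
  (.loop (.lt 88 90) (blk [.op .shr 90 90 89, .op .add 91 91 89]))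

theorem NS.ext_reg {s s' : NS} (hr : ∀ k, s.reg k = s'.reg k) (hm : s.mem = s'.mem)
    (ho : s.out = s'.out) : s = s' := by
  obtain ⟨r, m, o⟩ := s
  obtain ⟨r', m', o'⟩ := s'
  simp only at *
  subst hm ho
  congr
  exact funext hr

/-- The exact final state and an arbitrary continuation `c` are built into the statement, so that it
can be chained within a long straight-line computation. -/
theorem tri_bitlen {w S : ℕ} (hS : S ≤ 2 ^ w) {inp : ℕ → ℕ} {s : NS} {c : Cmd} {n x : ℕ}
    {Q : NS → Prop} (h90 : s.reg 90 = x) (hx : x < 2 ^ w) (h88 : s.reg 88 = 0) (h89 : s.reg 89 = 1)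
    (hw : 0 < w) (hQ : Tri w S inp c (((s.set 90 0).set 91 (Nat.size x)).set 99 0) n Q) :
    Tri w S inp (.seq bitlen c) s (n + (w * 6 + 6)) Q := by
  have h1w : 1 < 2 ^ w := Nat.one_lt_two_pow (by omega)
  have hsz : Nat.size x ≤ w := Nat.size_le.2 hx
  suffices h : Tri w S inp bitlen s (w * 6 + 5)
      fun s' => s' = ((s.set 90 0).set 91 (Nat.size x)).set 99 0 from
    (Tri.seq (h.imp fun s' hs => by rw [hs]; exact hQ)).le (by omega)
  refine (Tri.wp_seq hS (n := Nat.size x * (5 + 1) + 1) ?_).le (by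
    simp [Cmd.cost, blk, skip] <;> omega)
  simp only [blk, wp, skip]
  refine Tri.loop (fun i s' => s' = ((s.set 90 (x / 2 ^ i)).set 91 i).set 99 0) _ 5 ?_ ?_ ?_
  · refine NS.ext_reg (fun k => ?_) rfl rfl
    by_cases hk : k = 90 <;> simp [hk, h90]
  · rintro i hi s' rfl
    have h2 : x / 2 ^ i < 2 ^ w := lt_of_le_of_lt (Nat.div_le_self _ _) hx
    have h3 : 0 < x / 2 ^ i := Nat.div_pos (Nat.lt_size.1 hi) (by positivity)
    refine ⟨⟨by simp [h88], by simpa using h2⟩, by simpa [Test.truth, h88] using h3, ?_⟩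
    refine (Tri.of_wp hS ?_).le (show _ ≤ 5 by simp [Cmd.cost, blk, skip])
    simp only [blk, wp, skip, NS.set_reg]
    simp only [Nat.reduceEqDiff, if_true, if_false, h89, h2, h1w, true_and]
    refine NS.ext_reg (fun k => ?_) rfl rfl
    by_cases hk : k = 90
    · simp [hk, Nat.div_div_eq_div_mul, pow_succ]
    · by_cases hk' : k = 91 <;> simp [hk, hk']
      tauto
  · rintro s' rfl
    have h3 : x / 2 ^ Nat.size x = 0 := Nat.div_eq_of_lt (Nat.lt_size_self x)
    refine ⟨⟨by simp [h88], by simp [h3]⟩, by simp [Test.truth, h88, h3], by rw [h3]⟩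

/-- Truncated subtraction. -/
def tsub (d a b : ℕ) : Cmd := .branch (.lt a b) (.const d 0) (.op .sub d a b)

theorem wp_tsub {w S : ℕ} {inp : ℕ → ℕ} {s : NS} {d a b : ℕ} {Q : NS → Prop} (ha : s.reg a < 2 ^ w)
    (hb : s.reg b < 2 ^ w) (hQ : Q (s.set d (s.reg a - s.reg b))) : wp w S inp (tsub d a b) s Q := by
  refine ⟨⟨ha, hb⟩, fun h => ?_, fun h => ?_⟩
  · simp only [Test.truth] at h
    simp only [wp]
    rwa [Nat.sub_eq_zero_of_le h.le] at hQ
  · simp only [Test.truth, not_lt] at h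
    exact ⟨h, hQ⟩

/-- Multiplication of the number of full words by the word size. -/
def mulLoop : Cmd := .seq (blk [mov 90 81, .const 25 0, .op .sub 90 90 89])
  (.loop (.lt 88 90) (blk [.op .add 25 25 80, .op .sub 90 90 89]))

/-- The product is formed by repeated addition. This is affordable, since `nu` is at most `1 + log u
/ w`. -/
theorem tri_mulLoop {w S : ℕ} (hS : S ≤ 2 ^ w) {inp : ℕ → ℕ} {s : NS} {n nu : ℕ} {c : Cmd}
    {Q : NS → Prop} (h81 : s.reg 81 = nu) (h80 : s.reg 80 = w) (hnu1 : 1 ≤ nu) (hnu : nu < 2 ^ w)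
    (h88 : s.reg 88 = 0) (h89 : s.reg 89 = 1)
    (hQ : Tri w S inp c (((s.set 25 ((nu - 1) * w)).set 90 0).set 99 0) n Q) :
    Tri w S inp (.seq mulLoop c) s (n + (nu * 6 + 10)) Q := by
  suffices h : Tri w S inp mulLoop s (nu * 6 + 9)
      fun s' => s' = ((s.set 25 ((nu - 1) * w)).set 90 0).set 99 0 from
    (Tri.seq (h.imp fun s' hs => by rw [hs]; exact hQ)).le (by omega)
  refine (Tri.wp_seq hS (n := (nu - 1) * (5 + 1) + 1) ?_).le (by
    simp [Cmd.cost, blk, skip, mov] <;> omega)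
  simp only [blk, wp, skip, mov, NS.set_reg]
  simp only [Nat.reduceEqDiff, if_true, if_false, h81, h89, Nat.or_self, hnu1, true_and]
  refine Tri.loop (fun i s' => s' = ((s.set 25 (i * w)).set 90 (nu - 1 - i)).set 99 0) _ 5 ?_ ?_ ?_
  · refine NS.ext_reg (fun k => ?_) rfl rfl
    by_cases hk : k = 90
    · simp [hk]
    · by_cases hk' : k = 25 <;> simp [hk, hk']
  · rintro i hi s' rfl
    refine ⟨⟨by simp [h88], by simp; omega⟩, by simp [Test.truth, h88]; omega, ?_⟩
    refine (Tri.of_wp hS ?_).le (show _ ≤ 5 by simp [Cmd.cost, blk, skip])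
    simp only [blk, wp, skip, NS.set_reg]
    simp only [Nat.reduceEqDiff, if_true, if_false, h89, h80]
    refine ⟨by omega, NS.ext_reg (fun k => ?_) rfl rfl⟩
    by_cases hk : k = 90
    · simp [hk]; omega
    · by_cases hk' : k = 25
      · simp [hk']; ring
      · simp [hk, hk']
        tauto
  · rintro s' rfl
    refine ⟨⟨by simp [h88], by simp⟩, by simp [Test.truth, h88], by simp⟩

/-- Computation of the logarithm of the number of bits of a character from register 90 (the
logarithm of the key length, over 32) and register 92 (the number `t`, minus one). -/
def alphaLoop : Cmd := .seq (.const 6 0)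
  (.loop (.lt 92 90) (blk [.op .shr 90 90 89, .op .add 6 6 89]))

/-- The quotient `y / t` is never computed. As division by `t` commutes with division by powers of
two, it is enough to halve `y` and to compare with `t`. -/
theorem tri_alphaLoop {w S : ℕ} (hS : S ≤ 2 ^ w) {inp : ℕ → ℕ} {s : NS} {t y : ℕ}
    {Q : NS → Prop} (h90 : s.reg 90 = y / 2) (h92 : s.reg 92 = t - 1) (ht : 0 < t) (htw : t < 2 ^ w)
    (hy : y < 2 ^ w) (h89 : s.reg 89 = 1) (h99 : s.reg 99 = 0) (hw : 0 < w)
    (hQ : ∀ v, Q ((s.set 90 v).set 6 (Nat.log 2 (y / t)))) :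
    Tri w S inp alphaLoop s (w * 6 + 3) Q := by
  have h1w : 1 < 2 ^ w := Nat.one_lt_two_pow (by omega)
  have hlog : Nat.log 2 (y / t) ≤ w := by
    have h1 : y / t < 2 ^ w := lt_of_le_of_lt (Nat.div_le_self _ _) hy
    exact (Nat.log_lt_of_lt_pow' (by omega) h1).le
  refine (Tri.wp_seq hS (n := Nat.log 2 (y / t) * (5 + 1) + 1) ?_).le (by
    simp [Cmd.cost] <;> omega)
  simp only [wp]
  have key : ∀ i, (i < Nat.log 2 (y / t)) ↔ (t - 1 < y / 2 ^ (i + 1)) := by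
    intro i
    have e : (t - 1 < y / 2 ^ (i + 1)) ↔ t ≤ y / 2 ^ (i + 1) := by omega
    rw [e, Nat.le_div_iff_mul_le (by positivity), mul_comm, ← Nat.le_div_iff_mul_le ht]
    constructor
    · intro h
      have h0 : y / t ≠ 0 := by
        intro h0
        rw [h0] at h
        simp at h
      exact (Nat.le_log_iff_pow_le (by norm_num) h0).1 h
    · intro h
      have h0 : y / t ≠ 0 := by
        have : 0 < 2 ^ (i + 1) := by positivity
        omega
      exact (Nat.le_log_iff_pow_le (by norm_num) h0).2 h
  refine Tri.loop (fun i s' => s' = (s.set 90 (y / 2 ^ (i + 1))).set 6 i) _ 5 ?_ ?_ ?_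
  · refine NS.ext_reg (fun k => ?_) rfl rfl
    by_cases hk : k = 90
    · simp [hk, h90]
    · simp [hk]
  · rintro i hi s' rfl
    have h2 : y / 2 ^ (i + 1) < 2 ^ w := lt_of_le_of_lt (Nat.div_le_self _ _) hy
    refine ⟨⟨by simp [h92]; omega, by simpa using h2⟩, by simpa [Test.truth, h92] using (key i).1 hi, ?_⟩
    refine (Tri.of_wp hS ?_).le (show _ ≤ 5 by simp [Cmd.cost, blk, skip])
    simp only [blk, wp, skip, NS.set_reg]
    simp only [Nat.reduceEqDiff, if_true, if_false, h89, h2, h1w, true_and]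
    refine NS.ext_reg (fun k => ?_) rfl rfl
    by_cases hk : k = 90
    · simp [hk, Nat.div_div_eq_div_mul, pow_succ]
    · by_cases hk' : k = 6
      · simp [hk']
      · by_cases hk'' : k = 99
        · simp [hk'', h99]
        · simp [hk, hk', hk'']
  · rintro s' rfl
    have h2 : y / 2 ^ (Nat.log 2 (y / t) + 1) < 2 ^ w := lt_of_le_of_lt (Nat.div_le_self _ _) hy
    refine ⟨⟨by simp [h92]; omega, by simpa using h2⟩, ?_, hQ _⟩
    have := (key (Nat.log 2 (y / t)))
    simp only [lt_irrefl, false_iff] at this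
    simpa [Test.truth, h92] using this

/-- The registers that are computed first. -/
structure SelA (p : Par) (inp : ℕ → ℕ) (nu : ℕ) (s : NS) : Prop where
  r6 : s.reg 6 = p.α
  r24 : s.reg 24 = Nat.size p.w - 1
  r26 : s.reg 26 = xbits p.w nu (inp 0)
  r80 : s.reg 80 = p.w
  r81 : s.reg 81 = nu
  r82 : s.reg 82 = p.nr
  r88 : s.reg 88 = 0
  r89 : s.reg 89 = 1
  mem : s.mem = fun _ => 0
  out : s.out = fun _ => 0

/-- The first part of the computation of the parameters. -/
def selA (c : Cmd) : Cmd := .seq (blk [mov 80 0, mov 81 1, mov 82 2, mov 83 3, .const 88 0,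
    .const 89 1, mov 90 80]) (.seq bitlen (.seq (.op .sub 24 91 89)
  (.seq (.branch (.eq 81 89)
      (.seq (.input 90 0 88) (.seq bitlen (.seq (mov 26 91) (.op .sub 25 91 89))))
      (.seq mulLoop (mov 26 80)))
  (.seq (.branch (.eq 83 89)
      (.seq (.seq (.input 92 2 88) (.seq (.op .sub 92 92 89) (.seq (.const 93 5)
        (.op .shr 90 25 93)))) alphaLoop) (.const 6 0))
    c))))

theorem tri_selA {p : Par} {inp : ℕ → ℕ} {nu nt nk : ℕ} (h : Sel p inp nu nt) {c : Cmd} {n : ℕ}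
    {Q : NS → Prop} (hQ : ∀ s, SelA p inp nu s → Tri p.w p.S inp c s n Q) :
    Tri p.w p.S inp (selA c) ⟨fun i => [p.w, nu, p.nr, nt, nk].getD i 0, fun _ => 0, fun _ => 0⟩
      (n + (p.w * 18 + nu * 6 + 100)) Q := by
  have hS := h.valid.hS
  have hw := h.valid.hw
  have hww : p.w < 2 ^ p.w := Nat.lt_two_pow_self
  have h1w : 1 < 2 ^ p.w := Nat.one_lt_two_pow (by omega)
  have h0w : 0 < 2 ^ p.w := by positivity
  refine (Tri.wp_seq hS (n := n + (p.w * 18 + nu * 6 + 80)) ?_).le (by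
    simp [Cmd.cost, blk, skip, mov] <;> omega)
  simp only [blk, wp, skip, mov, NS.set_reg]
  simp only [Nat.reduceEqDiff, if_true, if_false, Nat.or_self, List.getD_cons_zero,
    List.getD_cons_succ]
  refine (tri_bitlen hS (n := n + (p.w * 12 + nu * 6 + 70)) (x := p.w) (by simp) hww (by simp)
    (by simp) (by omega) ?_).le (by omega)
  have hsw : 1 ≤ Nat.size p.w := Nat.size_pos.2 (by omega)
  refine (Tri.wp_seq hS (n := n + (p.w * 12 + nu * 6 + 65)) ?_).le (by
    simp [Cmd.cost, blk, skip, mov] <;> omega)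
  simp only [wp, NS.set_reg]
  simp only [Nat.reduceEqDiff, if_true, if_false]
  refine ⟨hsw, ?_⟩
  have fin : ∀ s : NS, s.reg 25 = lam p.w nu (inp 0) → s.reg 24 = Nat.size p.w - 1 →
      s.reg 26 = xbits p.w nu (inp 0) → s.reg 80 = p.w → s.reg 81 = nu → s.reg 82 = p.nr →
      s.reg 83 = nt → s.reg 88 = 0 → s.reg 89 = 1 → s.reg 99 = 0 → (s.mem = fun _ => 0) →
      (s.out = fun _ => 0) → Tri p.w p.S inp (.seq (.branch (.eq 83 89)
        (.seq (.seq (.input 92 2 88) (.seq (.op .sub 92 92 89) (.seq (.const 93 5)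
        (.op .shr 90 25 93)))) alphaLoop) (.const 6 0)) c) s (n + (p.w * 6 + 30)) Q := by
    intro s a25 a24 a26 a80 a81 a82 a83 a88 a89 a99 am ao
    refine (Tri.seq (n₁ := p.w * 6 + 19 + 1) (n₂ := n) ?_).le (by omega)
    refine Tri.branch ⟨by rw [a83]; exact h.nt_lt, by rw [a89]; exact h1w⟩ (fun hb => ?_)
      (fun hb => ?_)
    · simp only [Test.truth, a83, a89] at hb
      have e2 := Nat.mod_eq_of_lt (h.t_lt hb)
      have h5 : 5 < 2 ^ p.w := by omega
      have hll := h.lam_lt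
      have := h.t0
      refine (Tri.wp_seq hS (n := p.w * 6 + 3) ?_).le (by simp [Cmd.cost] <;> omega)
      simp only [wp, NS.set_reg]
      simp only [Nat.reduceEqDiff, if_true, if_false, a25, a88, a89, h0w, h5, hll, true_and,
        Nat.mul_zero, Nat.pow_zero, Nat.div_one, e2]
      refine ⟨h.t0, tri_alphaLoop hS (t := inp 2) (y := lam p.w nu (inp 0) / 16) ?_ (by simp) h.t0
        (h.t_lt hb) (lt_of_le_of_lt (Nat.div_le_self _ _) hll) (by simp [a89]) (by simp [a99])
        (by omega) fun v => hQ _ ?_⟩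
      · simp [Nat.div_div_eq_div_mul]
      · constructor <;> simp [h.α, hb, *]
    · simp only [Test.truth, a83, a89] at hb
      refine (Tri.of_wp hS ?_).le (m := 1) (by omega)
      simp only [wp]
      refine hQ _ ?_
      constructor <;> simp [h.α, hb, *]
  refine (Tri.seq (n₁ := p.w * 6 + nu * 6 + 29 + 1) (n₂ := n + (p.w * 6 + 30)) ?_).le (by omega)
  refine Tri.branch ⟨by simpa using h.nu_lt, by simpa using h1w⟩ (fun hb => ?_) (fun hb => ?_)
  · simp only [Test.truth, NS.set_reg, Nat.reduceEqDiff, if_true, if_false] at hb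
    have e2 := Nat.mod_eq_of_lt (h.u_lt hb)
    refine (Tri.wp_seq hS (n := p.w * 6 + 25) ?_).le (by simp [Cmd.cost] <;> omega)
    simp only [wp, NS.set_reg]
    simp only [Nat.reduceEqDiff, if_true, if_false, h0w, true_and, Nat.mul_zero, Nat.pow_zero,
      Nat.div_one, e2]
    refine (tri_bitlen hS (n := 10) (x := inp 0) (by simp) (h.u_lt hb) (by simp) (by simp) (by omega)
      ?_).le (by omega)
    refine (Tri.of_wp hS ?_).le (show _ ≤ 10 by simp [Cmd.cost, mov])
    simp only [wp, mov, NS.set_reg]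
    simp only [Nat.reduceEqDiff, if_true, if_false, Nat.or_self]
    refine ⟨Nat.size_pos.2 (by have := h.u2; omega), fin _ ?_ ?_ ?_ ?_ ?_ ?_ ?_ ?_ ?_ ?_ ?_ ?_⟩ <;>
      simp [lam, xbits, hb]
  · simp only [Test.truth, NS.set_reg, Nat.reduceEqDiff, if_true, if_false] at hb
    refine (tri_mulLoop hS (n := 3) (nu := nu) (by simp) (by simp) h.nu1 h.nu_lt (by simp) (by simp)
      ?_).le (by omega)
    refine (Tri.of_wp hS ?_).le (show _ ≤ 3 by simp [Cmd.cost, mov])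
    simp only [wp, mov, NS.set_reg]
    simp only [Nat.reduceEqDiff, if_true, if_false, Nat.or_self]
    refine fin _ ?_ ?_ ?_ ?_ ?_ ?_ ?_ ?_ ?_ ?_ ?_ ?_ <;> simp [lam, xbits, hb]

end WordRAM

/-! ### The selection program: table parameters and the words of `r - 1`. -/

namespace WordRAM

theorem wp_tsub_iff {w S : ℕ} {inp : ℕ → ℕ} {s : NS} {d a b : ℕ} {Q : NS → Prop} :
    wp w S inp (tsub d a b) s Q ↔ (s.reg a < 2 ^ w ∧ s.reg b < 2 ^ w) ∧
      Q (s.set d (s.reg a - s.reg b)) := by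
  refine ⟨fun h => ⟨h.1, ?_⟩, fun h => wp_tsub h.1.1 h.1.2 h.2⟩
  by_cases hb : s.reg a < s.reg b
  · have := h.2.1 hb
    simp only [wp] at this
    rwa [Nat.sub_eq_zero_of_le hb.le]
  · exact (h.2.2 hb).2

/-- The registers that describe the tables. -/
structure SelB (p : Par) (s : NS) : Prop where
  r0 : s.reg 0 = p.τ
  r1 : s.reg 1 = p.δ
  r2 : s.reg 2 = p.M
  r3 : s.reg 3 = p.μ
  r4 : s.reg 4 = p.g
  r5 : s.reg 5 = p.s
  r6 : s.reg 6 = p.α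
  r7 : s.reg 7 = p.π
  r8 : s.reg 8 = 2 ^ p.ℓ - 1
  r9 : s.reg 9 = 8 + 2 * p.s
  r10 : s.reg 10 = p.q
  r11 : s.reg 11 = p.nr
  r14 : s.reg 14 = p.bR
  r24 : s.reg 24 = Nat.size p.w - 1
  r80 : s.reg 80 = p.w
  r82 : s.reg 82 = p.nr
  r88 : s.reg 88 = 0
  r89 : s.reg 89 = 1

theorem SelB.congr {p : Par} {s s' : NS} (h : SelB p s) (hs : ∀ k < 90, s'.reg k = s.reg k) :
    SelB p s' := by
  cases h
  constructor <;> rw [hs _ (by norm_num)] <;> assumption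

/-- The second part of the computation of the parameters. -/
def selB (c : Cmd) : Cmd := .seq (blk [.op .shl 5 89 6, .input 90 3 88]) (.seq bitlen
  (.seq (blk [mov 27 91, mov 90 27]) (.seq bitlen
  (.seq (blk [tsub 28 91 6, .const 1 10, .op .add 1 1 28, .op .add 1 1 28, .const 2 17,
    .op .add 2 2 27, .op .add 2 2 5, .op .add 2 2 5, .op .add 2 2 5, .op .sub 90 2 89]) (.seq bitlen
  (.seq (blk [mov 3 91, tsub 4 24 3, .op .sub 90 26 89]) (.seq bitlen
  (.seq (blk [tsub 7 91 6, .op .sub 90 81 89]) (.seq bitlen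
  (.seq (blk [.op .add 0 7 91, .op .add 0 0 89, .op .shl 8 89 28, .op .sub 8 8 89, .const 9 8,
    .op .add 9 9 5, .op .add 9 9 5, .op .sub 90 82 89]) (.seq bitlen
  (.seq (blk [mov 10 91, mov 11 82, .const 14 24]) c))))))))))))

theorem tri_selB {p : Par} {inp : ℕ → ℕ} {nu nt : ℕ} (h : Sel p inp nu nt) {c : Cmd} {n : ℕ} {s : NS}
    (hA : SelA p inp nu s) {Q : NS → Prop} (hQ : ∀ s', SelB p s' → (s'.mem = fun _ => 0) →
      (s'.out = fun _ => 0) → Tri p.w p.S inp c s' n Q) :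
    Tri p.w p.S inp (selB c) s (n + (p.w * 36 + 200)) Q := by
  have hp := h.valid
  have hS := hp.hS
  have hw := hp.hw
  have hww : p.w < 2 ^ p.w := Nat.lt_two_pow_self
  have h0w : 0 < 2 ^ p.w := by positivity
  have hkz : Nat.size (inp 3) ≤ p.w := Nat.size_le.2 h.k_lt
  have hM := hp.hM
  have hM1 := hp.hM1
  have hs := hp.hs
  have hnrlt : p.nr < 2 ^ p.w := lt_of_le_of_lt hp.hq hp.q_lt
  have hnr := hp.hnr
  have hx1 : 1 ≤ xbits p.w nu (inp 0) := by
    unfold xbits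
    split_ifs
    · exact Nat.size_pos.2 (by have := h.u2; omega)
    · omega
  have hxw : xbits p.w nu (inp 0) ≤ p.w := by
    unfold xbits
    split_ifs with hb
    · exact Nat.size_le.2 (h.u_lt hb)
    · exact le_rfl
  have hsize : ∀ x < 2 ^ p.w, Nat.size x ≤ p.w := fun x hx => Nat.size_le.2 hx
  have hsizel : ∀ x < 2 ^ p.w, Nat.size x < 2 ^ p.w := fun x hx => (hsize x hx).trans_lt hww
  have hα := hp.α_lt
  have hMe := h.M
  have hMe' : 17 + Nat.size (inp 3) + p.s + p.s + p.s = p.M := by rw [hMe]; ring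
  have hδe : 10 + p.ℓ + p.ℓ = p.δ := by rw [h.δ]; ring
  have hℓw : p.ℓ < 2 ^ p.w := by
    have := hsizel (Nat.size (inp 3)) (hkz.trans_lt hww)
    rw [h.ℓ]; omega
  have e90 := Nat.mod_eq_of_lt h.k_lt
  refine (Tri.wp_seq hS (n := n + (p.w * 36 + 190)) ?_).le (by
    simp [Cmd.cost, blk, skip, mov] <;> omega)
  simp only [blk, wp, skip, mov, NS.set_reg]
  simp only [Nat.reduceEqDiff, if_true, if_false, hA.r89, hA.r6, hA.r88, hα, h0w, true_and,
    Nat.mul_zero, Nat.pow_zero, Nat.div_one, e90, one_mul]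
  refine (tri_bitlen hS (n := n + (p.w * 30 + 180)) (x := inp 3) (by simp) h.k_lt (by simp [hA.r88])
    (by simp [hA.r89]) (by omega) ?_).le (by omega)
  refine (Tri.wp_seq hS (n := n + (p.w * 30 + 170)) ?_).le (by
    simp [Cmd.cost, blk, skip, mov] <;> omega)
  simp only [blk, wp, skip, mov, NS.set_reg]
  simp only [Nat.reduceEqDiff, if_true, if_false, Nat.or_self]
  refine (tri_bitlen hS (n := n + (p.w * 24 + 160)) (x := Nat.size (inp 3)) (by simp)
    (hkz.trans_lt hww) (by simp [hA.r88]) (by simp [hA.r89]) (by omega) ?_).le (by omega)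
  refine (Tri.wp_seq hS (n := n + (p.w * 24 + 130)) ?_).le (by
    simp [Cmd.cost, blk, skip, mov, tsub] <;> omega)
  simp only [blk, wp, skip, mov, NS.set_reg, wp_tsub_iff]
  simp only [Nat.reduceEqDiff, if_true, if_false, hA.r6, hA.r89, ← h.ℓ, hδe, hα, hM1,
    hsizel _ (hkz.trans_lt hww), true_and]
  have e2s : (2 : ℕ) ^ p.α = p.s := rfl
  simp only [e2s, hMe', hM1, true_and]
  refine (tri_bitlen hS (n := n + (p.w * 18 + 120)) (x := p.M - 1) (by simp)
    (by omega) (by simp [hA.r88]) (by simp [hA.r89]) (by omega) ?_).le (by omega)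
  refine (Tri.wp_seq hS (n := n + (p.w * 18 + 100)) ?_).le (by
    simp [Cmd.cost, blk, skip, mov, tsub] <;> omega)
  have eμ : Nat.size (p.M - 1) = p.μ := h.μ.symm
  simp only [blk, wp, skip, mov, NS.set_reg, wp_tsub_iff, eμ]
  simp only [Nat.reduceEqDiff, if_true, if_false, Nat.or_self, hA.r24, hA.r26, hA.r89, ← h.g, hp.μ_lt,
    hx1, true_and]
  refine ⟨⟨by have := hsizel _ hww; omega, trivial⟩, ?_⟩
  refine (tri_bitlen hS (n := n + (p.w * 12 + 90)) (x := xbits p.w nu (inp 0) - 1) (by simp)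
    (by omega) (by simp [hA.r88]) (by simp [hA.r89]) (by omega) ?_).le (by omega)
  refine (Tri.wp_seq hS (n := n + (p.w * 12 + 80)) ?_).le (by
    simp [Cmd.cost, blk, skip, mov, tsub] <;> omega)
  have eπ : Nat.size (xbits p.w nu (inp 0) - 1) - p.α = p.π := h.π.symm
  simp only [blk, wp, skip, mov, NS.set_reg, wp_tsub_iff]
  simp only [Nat.reduceEqDiff, if_true, if_false, hA.r6, hA.r81, hA.r89, eπ, hα, h.nu1,
    hsizel (xbits p.w nu (inp 0) - 1) (by omega), true_and]
  have hnul := h.nu_lt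
  refine (tri_bitlen hS (n := n + (p.w * 6 + 70)) (x := nu - 1) (by simp)
    (by omega) (by simp [hA.r88]) (by simp [hA.r89]) (by omega) ?_).le (by omega)
  refine (Tri.wp_seq hS (n := n + (p.w * 6 + 45)) ?_).le (by
    simp [Cmd.cost, blk, skip, mov, tsub] <;> omega)
  have eτ : p.π + Nat.size (nu - 1) + 1 = p.τ := by rw [h.τ]; unfold clg; ring
  simp only [blk, wp, skip, mov, NS.set_reg, wp_tsub_iff]
  simp only [Nat.reduceEqDiff, if_true, if_false, hA.r82, hA.r89, eτ, hℓw, hnr, one_mul,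
    Nat.one_le_two_pow, true_and]
  refine (tri_bitlen hS (n := n + 20) (x := p.nr - 1) (by simp)
    (by omega) (by simp [hA.r88]) (by simp [hA.r89]) (by omega) ?_).le (by omega)
  refine (Tri.wp_seq hS (n := n) ?_).le (by
    simp [Cmd.cost, blk, skip, mov, tsub] <;> omega)
  have eq : Nat.size (p.nr - 1) = p.q := h.q.symm
  simp only [blk, wp, skip, mov, NS.set_reg, wp_tsub_iff, eq]
  simp only [Nat.reduceEqDiff, if_true, if_false, hA.r82, Nat.or_self]
  refine hQ _ ?_ hA.mem hA.out
  cases hA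
  constructor <;> simp [Par.bR, *]
  ring

/-- Computing one digit of the largest value. -/
def digitStep : Cmd := .seq (.input 96 1 94) (blk [.branch (.lt 96 93) (mov 96 92)
    (.seq (.op .sub 96 96 93) (.const 93 0)), .store 95 96, .op .add 94 94 89, .op .add 95 95 89])

/-- Computing the digits of the largest value. -/
def digits : Cmd := .seq (.op .sub 92 88 89) (.seq (blk [.const 93 1, .const 94 0, mov 95 14])
  (.loop (.lt 94 82) digitStep))

/-- Register 93 is the borrow when 1 is subtracted from the input number `r`. Only a zero digit
passes a borrow on, and it then becomes `2 ^ w - 1`. -/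
theorem wp_digitStep {w S : ℕ} {inp : ℕ → ℕ} {s : NS} {i d : ℕ} (h89 : s.reg 89 = 1)
    (h92 : s.reg 92 = 2 ^ w - 1) (h93 : s.reg 93 ≤ 1) (h94 : s.reg 94 = i) (h95 : s.reg 95 = 24 + i)
    (hiw : i < 2 ^ w) (hS : 24 + i < S) (h1w : 1 < 2 ^ w) (hd : inp 1 / 2 ^ (w * i) % 2 ^ w = d)
    {Q : NS → Prop} (hQ : ∀ s'' : NS, ∀ v b, (∀ k < 90, s''.reg k = s.reg k) →
        s''.reg 92 = s.reg 92 →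
        s''.reg 93 = b → b ≤ 1 → v < 2 ^ w → v + s.reg 93 = d + b * 2 ^ w →
        s''.reg 94 = i + 1 → s''.reg 95 = 24 + i + 1 →
        (s''.mem = fun a => if a = 24 + i then v else s.mem a) → s''.out = s.out → Q s'') :
    wp w S inp digitStep s Q := by
  have hdlt : d < 2 ^ w := hd ▸ Nat.mod_lt _ (by positivity)
  simp only [digitStep, blk, wp, skip, mov, NS.set_reg, NS.set_mem, NS.put_reg, NS.put_mem, Test.ok,
    Test.truth]
  simp only [Nat.reduceEqDiff, if_true, if_false, Nat.or_self, h92, h94, h95, h89, hiw, true_and,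
    hd, hdlt, hS]
  refine ⟨by omega, fun hlt => ?_, fun hlt => ⟨by omega, ?_⟩⟩
  · refine hQ _ (2 ^ w - 1) 1 (fun k hk => ?_) (by simp) ?_ le_rfl (by omega) (by omega) (by simp)
      (by simp) (by simp) (by simp)
    · simp [show k ≠ 94 by omega, show k ≠ 95 by omega, show k ≠ 96 by omega, show k ≠ 99 by omega]
    · simp
      omega
  · refine hQ _ (d - s.reg 93) 0 (fun k hk => ?_) (by simp) (by simp) (by omega) (by omega)
      (by omega) (by simp) (by simp) (by simp) (by simp)
    simp [show k ≠ 93 by omega, show k ≠ 94 by omega, show k ≠ 95 by omega, show k ≠ 96 by omega,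
      show k ≠ 99 by omega]

theorem tri_digits {p : Par} {inp : ℕ → ℕ} {nu nt : ℕ} (h : Sel p inp nu nt) {s : NS}
    (hB : SelB p s) (hm : s.mem = fun _ => 0) {Q : NS → Prop}
    (hQ : ∀ s', SelB p s' → Red p.w s'.mem → (∀ a, a < 24 ∨ 24 + p.nr ≤ a → s'.mem a = 0) →
      big p.w s'.mem 24 p.nr = p.R → s'.out = s.out → Q s') :
    Tri p.w p.S inp digits s (p.nr * 17 + 11) Q := by
  have hp := h.valid
  have hS := hp.hS
  have hw := hp.hw
  have h0w : 0 < 2 ^ p.w := by positivity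
  have h1w : 1 < 2 ^ p.w := Nat.one_lt_two_pow (by omega)
  have hnrlt : p.nr < 2 ^ p.w := lt_of_le_of_lt hp.hq hp.q_lt
  have hTW := p.TW_lt
  have hq := hp.hq
  have hAT : 24 + p.nr ≤ p.bT := by
    have e : p.bA = 24 + 2 ^ p.q := rfl
    unfold Par.bT Par.b1 Par.b0; omega
  refine (Tri.seq (n₁ := 1) (n₂ := p.nr * 17 + 9) (tri_ones hB.r88 hB.r89 ?_)).le (by omega)
  refine (Tri.wp_seq hS (n := p.nr * (16 + 1) + 1) ?_).le (by
    simp [Cmd.cost, blk, skip, mov] <;> omega)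
  simp only [blk, wp, skip, mov, NS.set_reg]
  simp only [Nat.reduceEqDiff, if_true, if_false, Nat.or_self, hB.r14]
  refine Tri.loop (fun i s' => (∀ k < 90, s'.reg k = s.reg k) ∧ s'.reg 92 = 2 ^ p.w - 1 ∧
    s'.reg 93 ≤ 1 ∧ s'.reg 94 = i ∧ s'.reg 95 = 24 + i ∧ Red p.w s'.mem ∧
    (∀ a, a < 24 ∨ 24 + i ≤ a → s'.mem a = 0) ∧
    big p.w s'.mem 24 i + 1 = inp 1 % 2 ^ (p.w * i) + s'.reg 93 * 2 ^ (p.w * i) ∧ s'.out = s.out)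
    p.nr 16 ?_ ?_ ?_
  · refine ⟨fun k hk => ?_, by simp, by simp, by simp, by simp [Par.bR], ?_, ?_, ?_, by simp⟩
    · simp [show k ≠ 92 by omega, show k ≠ 93 by omega, show k ≠ 94 by omega, show k ≠ 95 by omega,
        show k ≠ 99 by omega]
    · intro a
      simp [hm]
    · simp [hm]
    · simp [big, Nat.mod_one]
  · rintro i hi s' ⟨i1, i2, i3, i4, i5, i6, i7, i8, i9⟩
    have hB' := hB.congr i1
    refine ⟨⟨by omega, by rw [hB'.r82]; exact hnrlt⟩, by simp only [Test.truth, i4, hB'.r82, hi], ?_⟩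
    refine (Tri.of_wp hS ?_).le (show _ ≤ 16 by simp [digitStep, Cmd.cost, blk, skip, mov])
    set d := inp 1 / 2 ^ (p.w * i) % 2 ^ p.w with hd
    have hdlt : d < 2 ^ p.w := Nat.mod_lt _ h0w
    have hiw : i < 2 ^ p.w := by omega
    have hmod : inp 1 % 2 ^ (p.w * (i + 1)) = inp 1 % 2 ^ (p.w * i) + d * 2 ^ (p.w * i) := by
      rw [Nat.mul_succ, pow_add, Nat.mod_mul, ← hd, mul_comm d]
    have hst : ∀ s'' : NS, ∀ v b, (∀ k < 90, s''.reg k = s'.reg k) → s''.reg 92 = s'.reg 92 →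
        s''.reg 93 = b → b ≤ 1 → v < 2 ^ p.w → v + s'.reg 93 = d + b * 2 ^ p.w →
        s''.reg 94 = i + 1 → s''.reg 95 = 24 + i + 1 →
        (s''.mem = fun a => if a = 24 + i then v else s'.mem a) → s''.out = s'.out →
        ((∀ k < 90, s''.reg k = s.reg k) ∧ s''.reg 92 = 2 ^ p.w - 1 ∧ s''.reg 93 ≤ 1 ∧
        s''.reg 94 = i + 1 ∧ s''.reg 95 = 24 + (i + 1) ∧ Red p.w s''.mem ∧
        (∀ a, a < 24 ∨ 24 + (i + 1) ≤ a → s''.mem a = 0) ∧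
        big p.w s''.mem 24 (i + 1) + 1 = inp 1 % 2 ^ (p.w * (i + 1)) +
          s''.reg 93 * 2 ^ (p.w * (i + 1)) ∧ s''.out = s.out) := by
      intro s'' v b j1 j2 j3 j4 j5 j6 j7 j8 j9 j10
      refine ⟨fun k hk => (j1 k hk).trans (i1 k hk), j2.trans i2, by omega, j7, by omega, ?_, ?_, ?_,
        j10.trans i9⟩
      · intro a
        rw [j9]
        simp only
        split_ifs
        exacts [j5, i6 a]
      · intro a ha
        rw [j9]
        simp only
        rw [if_neg (by omega), i7 a (by omega)]
      · rw [big_succ, j3, hmod]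
        have e1 : big p.w s''.mem 24 i = big p.w s'.mem 24 i := big_congr fun k hk => by
          rw [j9]
          simp only
          rw [if_neg (by omega)]
        have e2 : s''.mem (24 + i) = v := by rw [j9]; simp
        rw [e1, e2, Nat.mul_succ, pow_add]
        generalize big p.w s'.mem 24 i = B at *
        generalize inp 1 % 2 ^ (p.w * i) = r0 at *
        generalize 2 ^ (p.w * i) = X at *
        generalize 2 ^ p.w = W at *
        have : v * X + s'.reg 93 * X = d * X + b * W * X := by
          rw [← Nat.add_mul, j6, Nat.add_mul]
        nlinarith
    exact wp_digitStep hB'.r89 i2 i3 i4 i5 hiw (by omega) h1w hd.symm hst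
  · rintro s' ⟨i1, i2, i3, i4, i5, i6, i7, i8, i9⟩
    have hB' := hB.congr i1
    refine ⟨⟨by omega, by rw [hB'.r82]; exact hnrlt⟩, by simp [Test.truth, i4, hB'.r82], ?_⟩
    refine hQ s' hB' i6 i7 ?_ i9
    have h1 := big_lt (b := 24) i6 p.nr
    have h2 := hp.hR
    have h3 := h.r0
    have h4 := h.R
    -- The bound on `R` leaves the possibility `inp 1 = 2 ^ (w * nr)`. Then all digits read are zero
    -- and the last borrow survives, but the digits written are still those of `R`.
    rcases Nat.lt_or_ge (inp 1) (2 ^ (p.w * p.nr)) with h5 | h5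
    · rw [Nat.mod_eq_of_lt h5] at i8
      rcases Nat.le_one_iff_eq_zero_or_eq_one.1 i3 with e | e <;> rw [e] at i8 <;> omega
    · have h6 : inp 1 = 2 ^ (p.w * p.nr) := by omega
      rw [h6, Nat.mod_self] at i8
      rcases Nat.le_one_iff_eq_zero_or_eq_one.1 i3 with e | e <;> rw [e] at i8 <;> omega

end WordRAM

/-! ### The selection program: addresses. -/

namespace WordRAM

/-- The third part of the computation of the parameters. -/
def selC (c : Cmd) : Cmd :=
  .seq (.branch (.eq 82 89) (.seq (.load 90 14) (.seq bitlen
      (.branch (.eq 91 88) (.const 90 0) (.op .sub 90 91 89)))) (.op .sub 90 80 89))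
  (.seq bitlen (.seq (blk [mov 12 91, tsub 13 24 12, .op .shl 90 89 10, .op .add 15 14 90,
    .op .add 16 15 90, .op .add 91 0 1, tsub 91 91 4, .op .shl 20 89 91, .op .add 17 16 20,
    .op .add 18 17 20, .op .add 91 0 0, .op .sub 91 91 89, .op .sub 91 91 89, .op .add 91 91 1,
    .op .add 91 91 1, .op .add 91 91 2, tsub 91 91 4, .op .shl 91 89 91, .op .add 19 18 91,
    .op .shl 21 89 2, .op .sub 21 21 89, .const 22 1, .const 23 0]) c))

theorem tri_selC {p : Par} {inp : ℕ → ℕ} {nu nt : ℕ} (h : Sel p inp nu nt) {c : Cmd} {n : ℕ} {s : NS}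
    (hB : SelB p s) (hred : Red p.w s.mem) (hR : big p.w s.mem 24 p.nr = p.R)
    {Q : NS → Prop} (hQ : ∀ s', Regs p s' → s'.reg 88 = 0 → s'.reg 89 = 1 → s'.mem = s.mem →
      s'.out = s.out → Tri p.w p.S inp c s' n Q) :
    Tri p.w p.S inp (selC c) s (n + (p.w * 12 + 120)) Q := by
  have hp := h.valid
  have hS := hp.hS
  have hw := hp.hw
  have hww : p.w < 2 ^ p.w := Nat.lt_two_pow_self
  have h0w : 0 < 2 ^ p.w := by positivity
  have hnrlt : p.nr < 2 ^ p.w := lt_of_le_of_lt hp.hq hp.q_lt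
  have hidx := hp.hidx
  have hτ := hp.hτ
  have hπ := hp.hπ
  have hnr := hp.hnr
  have hqp : 0 < 2 ^ p.q := by positivity
  have hb1 : p.b1 = p.b0 + p.BW := rfl
  have hbT : p.bT = p.b1 + p.BW := rfl
  have hbV : p.bV = p.bT + p.TW := rfl
  have hbA : p.bA = 24 + 2 ^ p.q := rfl
  have hb0 : p.b0 = p.bA + 2 ^ p.q := rfl
  have hSe : p.S = p.bV + p.VW := rfl
  have hVWp : 0 < p.VW := by unfold Par.VW; positivity
  have hBWp : 0 < p.BW := by unfold Par.BW; positivity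
  have hTWp : 0 < p.TW := by unfold Par.TW; positivity
  have hMw : 2 ^ p.M < 2 ^ p.w := Nat.pow_lt_pow_right (by norm_num) (by omega)
  have hM1 : 1 ≤ 2 ^ p.M := Nat.one_le_two_pow
  have hqw : p.q < 2 ^ p.w := Nat.lt_two_pow_self.trans_le (by omega)
  have hgw := hp.g_lt
  -- Exponents such as `τ + τ + δ + δ + M` exceed `w` only by a small factor, so they are reduced
  -- words.
  have h3w : ∀ n ≥ 7, 3 * n < 2 ^ n := fun n hn => by
    induction n, hn using Nat.le_induction with
    | base => norm_num
    | succ n _ ih => rw [pow_succ]; omega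
  have h3 := h3w p.w hw
  have fin : ∀ (s1 : NS) (x : ℕ), SelB p s1 → s1.mem = s.mem → s1.out = s.out → s1.reg 90 = x →
      x < 2 ^ p.w → Nat.size x = p.ρ → Tri p.w p.S inp
      (.seq bitlen (.seq (blk [mov 12 91, tsub 13 24 12, .op .shl 90 89 10, .op .add 15 14 90,
    .op .add 16 15 90, .op .add 91 0 1, tsub 91 91 4, .op .shl 20 89 91, .op .add 17 16 20,
    .op .add 18 17 20, .op .add 91 0 0, .op .sub 91 91 89, .op .sub 91 91 89, .op .add 91 91 1,
    .op .add 91 91 1, .op .add 91 91 2, tsub 91 91 4, .op .shl 91 89 91, .op .add 19 18 91,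
    .op .shl 21 89 2, .op .sub 21 21 89, .const 22 1, .const 23 0]) c)) s1
      (n + (p.w * 6 + 90)) Q := by
    intro s1 x hB1 hmem hout h90 hx hsz
    refine (tri_bitlen hS (n := n + 80) (x := x) h90 hx hB1.r88 hB1.r89 (by omega) ?_).le (by omega)
    refine (Tri.wp_seq hS (n := n) ?_).le (by
      simp [Cmd.cost, blk, skip, mov, tsub] <;> omega)
    have hρ : p.ρ < 2 ^ p.w := Nat.lt_two_pow_self.trans hp.hρ
    have egr : Nat.size p.w - 1 - p.ρ = p.gr := h.gr.symm
    have hszw : Nat.size p.w - 1 < 2 ^ p.w := by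
      have : Nat.size p.w ≤ p.w := Nat.size_le.2 hww
      omega
    have eBW : (2 : ℕ) ^ (p.τ + p.δ - p.g) = p.BW := rfl
    have eTW : (2 : ℕ) ^ (p.τ + p.τ - 1 - 1 + p.δ + p.δ + p.M - p.g) = p.TW := by
      unfold Par.TW
      congr 1
    simp only [blk, wp, skip, mov, NS.set_reg, wp_tsub_iff, hsz]
    simp only [Nat.reduceEqDiff, if_true, if_false, Nat.or_self, hB1.r24, hB1.r89, hB1.r10, hB1.r14,
      hB1.r0, hB1.r1, hB1.r2, hB1.r4, egr, one_mul, Par.bR, ← hbA, ← hb0, eBW, ← hb1, ← hbT, eTW,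
      ← hbV, hρ, hszw, hqw, hgw, true_and, and_true]
    repeat refine And.intro (by omega) ?_
    cases hB1
    refine hQ _ ?_ (by simp [*]) (by simp [*]) hmem hout
    constructor <;> simp [*]
  have hsz' : ∀ x < 2 ^ p.w, Nat.size x < 2 ^ p.w := fun x hx => (Nat.size_le.2 hx).trans_lt hww
  suffices hpre : Tri p.w p.S inp (.branch (.eq 82 89) (.seq (.load 90 14) (.seq bitlen
      (.branch (.eq 91 88) (.const 90 0) (.op .sub 90 91 89)))) (.op .sub 90 80 89)) s
      (p.w * 6 + 20) fun s1 => ∃ x, SelB p s1 ∧ s1.mem = s.mem ∧ s1.out = s.out ∧ s1.reg 90 = x ∧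
        x < 2 ^ p.w ∧ Nat.size x = p.ρ from
    (Tri.seq (hpre.imp fun s1 ⟨x, h1, h2, h3, h4, h5, h6⟩ => fin s1 x h1 h2 h3 h4 h5 h6)).le
      (by omega)
  have hset : ∀ (s1 : NS) (i : ℕ) v, 90 ≤ i → SelB p s1 → SelB p (s1.set i v) := fun s1 i v hi h1 =>
    h1.congr fun k hk => by simp [show k ≠ i by omega]
  have hbr : ((.eq 82 89 : Test)).ok p.w s := ⟨by rw [hB.r82]; exact hnrlt, by rw [hB.r89]; omega⟩
  refine Tri.le (m := p.w * 6 + 19 + 1) ?_ (by omega)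
  refine Tri.branch hbr (fun ht => ?_) (fun ht => ?_)
  · have h1 : p.nr = 1 := by simpa [Test.truth, hB.r82, hB.r89] using ht
    have hm24 : s.mem 24 = p.R := by
      rw [← hR, h1]; simp [big]
    have hRw : p.R < 2 ^ p.w := hm24 ▸ hred 24
    refine (Tri.wp_seq hS (n := p.w * 6 + 15) ?_).le (by simp [Cmd.cost] <;> omega)
    simp only [wp, hB.r14, Par.bR, hm24]
    refine ⟨by omega, ?_⟩
    refine (tri_bitlen hS (n := 5) (x := p.R) (by simp) hRw (by simp [hB.r88])
      (by simp [hB.r89]) (by omega) ?_).le (by omega)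
    refine (Tri.of_wp hS ?_).le (show _ ≤ 5 by simp [Cmd.cost])
    have hρ := h.ρ
    rw [if_pos h1] at hρ
    have hsR := hsz' p.R hRw
    simp only [wp, NS.set_reg, Test.ok, Test.truth]
    simp only [Nat.reduceEqDiff, if_true, if_false, Nat.or_self, hB.r88, hB.r89, hsR, h0w, true_and]
    have hB4 : SelB p ((((s.set 90 p.R).set 90 0).set 91 (Nat.size p.R)).set 99 0) := by
      repeat' first | exact hB | refine hset _ _ _ (by norm_num) ?_
    -- For `r = 1` the size of `R` is zero; `clg` uses truncated subtraction there, and the program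
    -- takes a separate branch to avoid the borrow.
    refine ⟨fun h0 => ?_, fun h0 => ⟨by omega, ?_⟩⟩
    · exact ⟨0, hset _ _ _ (by norm_num) hB4, rfl, rfl, by simp, h0w, by
        rw [hρ, h0]; rfl⟩
    · exact ⟨Nat.size p.R - 1, hset _ _ _ (by norm_num) hB4, rfl, rfl, by simp, by omega, by
        rw [hρ]; rfl⟩
  · have h1 : p.nr ≠ 1 := by simpa [Test.truth, hB.r82, hB.r89] using ht
    have hρ := h.ρ
    rw [if_neg h1] at hρ
    refine (Tri.of_wp hS ?_).le (show _ ≤ p.w * 6 + 19 by simp [Cmd.cost])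
    simp only [wp, hB.r80, hB.r89]
    exact ⟨by omega, p.w - 1, hset _ _ _ (by norm_num) hB, rfl, rfl, by simp, by omega, hρ.symm⟩

end WordRAM

/-! ### The selection program: storing the header and filling the tables. -/

namespace WordRAM

/-- Storing the registers below `n` in memory. -/
def storeHdr : ℕ → Cmd
  | 0 => skip
  | n + 1 => .seq (storeHdr n) (.seq (.const 90 n) (.store 90 n))

theorem cost_storeHdr (n : ℕ) : (storeHdr n).cost = 4 * n + 1 := by
  induction n with
  | zero => rfl
  | succ n ih => simp only [storeHdr, Cmd.cost, ih]; ring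

theorem wp_storeHdr {w S : ℕ} {inp : ℕ → ℕ} {s : NS} {n : ℕ} (hn : n ≤ 90) (hnS : n ≤ S) {Q : NS → Prop}
    (hQ : ∀ s' : NS, (∀ k, k ≠ 90 → k ≠ 99 → s'.reg k = s.reg k) →
      (s'.mem = fun a => if a < n then s.reg a else s.mem a) → s'.out = s.out → Q s') :
    wp w S inp (storeHdr n) s Q := by
  induction n generalizing Q with
  | zero => exact hQ _ (fun k _ h => by simp [h]) (by simp) rfl
  | succ n ih =>
    refine ih (by omega) (by omega) fun s' h1 h2 h3 => ?_
    simp only [wp, NS.set_reg]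
    simp only [if_true, if_neg (show n ≠ 90 by omega)]
    refine ⟨by omega, hQ _ (fun k hk h99 => ?_) ?_ h3⟩
    · simp [hk, h1 k hk h99]
    · funext a
      simp only [NS.put_mem, NS.set_mem, h2, h1 n (by omega) (by omega)]
      by_cases ha : a = n
      · subst ha; simp
      · simp only [ha, if_false]
        split_ifs <;> first | rfl | omega

theorem Par.Valid.hdr_lt {p : Par} (hp : p.Valid) : ∀ i < 24, p.hdr i < 2 ^ p.w := by
  have hww : p.w < 2 ^ p.w := Nat.lt_two_pow_self
  have hS := hp.hS
  have hbT : p.bT = p.bA + 2 ^ p.q + p.BW + p.BW := rfl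
  have hbV : p.bV = p.bT + p.TW := rfl
  have hbA : p.bA = 24 + 2 ^ p.q := rfl
  have hb0 : p.b0 = p.bA + 2 ^ p.q := rfl
  have hb1 : p.b1 = p.b0 + p.BW := rfl
  have hbR : p.bR = 24 := rfl
  have hSe : p.S = p.bV + p.VW := rfl
  have hVWp : 0 < p.VW := by unfold Par.VW; positivity
  have hqp : p.q < 2 ^ p.q := Nat.lt_two_pow_self
  have hMw : 2 ^ p.M < 2 ^ p.w := Nat.pow_lt_pow_right (by norm_num) (by have := hp.hidx; omega)
  have hℓ : 2 ^ p.ℓ ≤ p.s * 2 ^ p.ℓ := Nat.le_mul_of_pos_left _ (by unfold Par.s; positivity)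
  have h1 := hp.hidx
  have h2 := hp.μ_lt
  have h3 := hp.g_lt
  have h4 := hp.hs
  have h5 := hp.α_lt
  have h6 := hp.hπ
  have h7 := hp.hb
  have h8 := hp.hq
  have h9 : p.ρ < 2 ^ p.ρ := Nat.lt_two_pow_self
  have h10 := hp.hρ
  have h11 := hp.gr_lt
  intro i hi
  interval_cases i <;> simp only [Par.hdr] <;> omega

/-- The loop that fills the tables of the tree. -/
def fillBody : Cmd := .seq (.rand 91 88) (.seq (.store 90 91) (.seq (.op .add 90 90 89) (.const 91 0)))

/-- The program that selects a family. -/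
def selectProg : Cmd := .seq (selA (selB (.seq digits (selC (.seq (storeHdr 24)
  (blk [mov 90 18, .const 91 0])))))) (.loop (.lt 90 19) fillBody)

/-- The time used by `selectProg`. -/
def Par.selectTime (p : Par) (nu : ℕ) : ℕ :=
  p.w * 66 + nu * 6 + p.nr * 17 + p.TW * 8 + 700

/-- The memory after the tables of the tree have been filled. -/
def Par.fillMem (p : Par) (m φ : ℕ → ℕ) (i a : ℕ) : ℕ :=
  if p.bT ≤ a ∧ a < p.bT + i then φ (a - p.bT) else m a

/-- Everything before the filling loop is deterministic and hence takes some fixed number of steps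
on a given input. Only the loop has to be analysed with laws. -/
theorem select_run {p : Par} {inp : ℕ → ℕ} {nu nt nk : ℕ} (h : Sel p inp nu nt) {T : ℕ}
    (hT : p.selectTime nu ≤ T) : ∃ (r : (ℕ → ℕ) → ℕ → ℕ) (m₀ : ℕ → ℕ),
      Fam p m₀ ∧ (∀ a, p.bA ≤ a → m₀ a = 0) ∧
      stepN inp T (⟨[selectProg],
          (⟨fun i => [p.w, nu, p.nr, nt, nk].getD i 0, fun _ => 0, fun _ => 0⟩ : NS).toState p.w p.S⟩ :
        Config p.w p.S) = (tape (fun _ => 2 ^ p.w) p.TW).map fun φ =>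
          ⟨[], (⟨r φ, p.fillMem m₀ φ p.TW, fun _ => 0⟩ : NS).toState p.w p.S⟩ := by
  have hp := h.valid
  have hS := hp.hS
  have hbT : p.bT = p.bA + 2 ^ p.q + p.BW + p.BW := rfl
  have hbV : p.bV = p.bT + p.TW := rfl
  have hbA : p.bA = 24 + 2 ^ p.q := rfl
  have hSe : p.S = p.bV + p.VW := rfl
  have hVWp : 0 < p.VW := by unfold Par.VW; positivity
  have hqp : 0 < 2 ^ p.q := by positivity
  have hq := hp.hq
  have hpre : Tri p.w p.S inp (selA (selB (.seq digits (selC (.seq (storeHdr 24)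
      (blk [mov 90 18, .const 91 0])))))) ⟨fun i => [p.w, nu, p.nr, nt, nk].getD i 0, fun _ => 0, fun _ => 0⟩
      (p.w * 66 + nu * 6 + p.nr * 17 + 600) fun s => Fam p s.mem ∧ (∀ a, p.bA ≤ a → s.mem a = 0) ∧
        Regs p s ∧ s.reg 88 = 0 ∧ s.reg 89 = 1 ∧ s.reg 90 = p.bT ∧ s.reg 91 = 0 ∧ s.out = fun _ => 0 := by
    refine (tri_selA h (n := p.w * 48 + p.nr * 17 + 500) fun s hs => ?_).le (by omega)
    refine (tri_selB h hs (n := p.w * 12 + p.nr * 17 + 300) fun s hs hm ho => ?_).le (by omega)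
    refine (Tri.seq (n₂ := p.w * 12 + 280) (tri_digits h hs hm fun s hs hr hz hR ho' => ?_)).le (by omega)
    refine (tri_selC h hs hr hR (n := 110) fun s' r h88 h89 hm' ho'' => ?_).le (by omega)
    refine (Tri.of_wp hS ?_).le (show _ ≤ 110 by
      simp only [Cmd.cost, cost_storeHdr, blk, skip, mov]; norm_num)
    rw [wp]
    refine wp_storeHdr (by norm_num) (by omega) fun s'' g1 g2 g3 => ?_
    simp only [blk, wp, skip, mov, NS.set_reg]
    have rh := r.hdr
    have r2 : Regs p s'' := Regs.of_hdr fun k hk => (g1 k (by omega) (by omega)).trans (rh k hk)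
    have hdr_lt := hp.hdr_lt
    have hm2 : s''.mem = fun a => if a < 24 then p.hdr a else s.mem a := by
      rw [g2, hm']
      funext a
      split_ifs with ha
      exacts [rh a ha, rfl]
    refine ⟨⟨fun a => ?_, fun i hi => ?_, ?_, fun i h1 h2 => ?_, fun a ha => ?_⟩, fun a ha => ?_, ?_, ?_, ?_, ?_, ?_, ?_⟩
    · simp only [NS.set_mem, hm2]
      split_ifs with ha
      exacts [hdr_lt a ha, hr a]
    · simp [hm2, hi]
    · rw [← hR]
      exact big_congr fun i hi => by simp [hm2, Par.bR]
    · simp only [NS.set_mem, hm2, Par.bR]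
      rw [if_neg (by omega), hz _ (by omega)]
    · simp only [NS.set_mem, hm2]
      rw [if_neg (by omega), hz _ (by omega)]
    · simp only [NS.set_mem, hm2]
      rw [if_neg (by omega), hz _ (by omega)]
    · exact Regs.of_hdr fun k hk => by
        simp [show k ≠ 90 by omega, show k ≠ 91 by omega, show k ≠ 99 by omega, r2.hdr k hk]
    · simp [g1, h88]
    · simp [g1, h89]
    · simp [r2.r18]
    · simp
    · simp [g3, ho'', ho', ho]
  obtain ⟨j, hj, s1, ⟨hF, hz, r, h88, h89, h90, h91, hout⟩, hd⟩ := hpre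
  set st : ℕ → (ℕ → ℕ) → NS := fun i φ =>
    ⟨(s1.set 90 (p.bT + i)).reg, p.fillMem s1.mem φ i, fun _ => 0⟩ with hst
  have hst0 : st 0 (fun _ => 0) = s1 := by
    refine NS.ext_reg (fun k => ?_) ?_ hout.symm
    · by_cases hk : k = 90 <;> simp [hst, hk, h90]
    · funext a
      simp only [hst, Par.fillMem]
      rw [if_neg (by omega)]
  have hrng : ∀ i : ℕ, (Finset.range ((fun _ => 2 ^ p.w) i)).Nonempty := fun i =>
    Finset.nonempty_range_iff.2 (by positivity)
  have hloop : RDet p.w p.S inp (.loop (.lt 90 19) fillBody) (st 0 fun _ => 0)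
      (∑ i ∈ Finset.range p.TW, (7 + 1) + 1) ((tape (fun _ => 2 ^ p.w) p.TW).map (st p.TW)) := by
    refine RDet.loop (fun _ => 2 ^ p.w) p.TW st (fun _ => 7) (fun i _ => hrng i) (fun i hi φ hφ => ?_)
      (fun φ hφ => ?_)
    · refine ⟨⟨by simp [hst]; omega, by simp [hst, r.r19]; omega⟩,
        by simp [Test.truth, hst, r.r19]; omega, ?_⟩
      -- Register 88 contains 0, which stands for the range `2 ^ w`.
      have hrand := RDet.rand (w := p.w) (S := p.S) (inp := inp) (d := 91) (a := 88) (s := st i φ)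
        (N := 2 ^ p.w) (by simp [hst, h88, randRange]) (hrng i)
      have hpost : ∀ v, Det p.w p.S inp (.seq (.store 90 91) (.seq (.op .add 90 90 89) (.const 91 0)))
          ((st i φ).set 91 v) (st (i + 1) fun j => if j = i then v else φ j) 5 := by
        intro v
        obtain ⟨s3, rfl, hd3⟩ := Det.of_wp hS (inp := inp)
          (c := .seq (.store 90 91) (.seq (.op .add 90 90 89) (.const 91 0))) (by
            simp [Cmd.Balanced, Cmd.cost]) (s := (st i φ).set 91 v)
            (Q := fun s3 => s3 = st (i + 1) fun j => if j = i then v else φ j) (by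
              simp only [wp, NS.set_reg]
              simp only [Nat.reduceEqDiff, if_true, if_false, hst, NS.set_reg]
              refine ⟨by omega, NS.ext_reg (fun k => ?_) ?_ rfl⟩
              · by_cases h1 : k = 91
                · simp [h1, h91]
                · by_cases h2 : k = 90
                  · simp [h2, h89, add_assoc]
                  · simp [h1, h2]
              · funext a
                simp only [NS.set_mem, NS.put_mem, Par.fillMem, NS.set_reg]
                by_cases ha : a = p.bT + i
                · simp [ha]
                · rw [if_neg ha]
                  by_cases ha2 : p.bT ≤ a ∧ a < p.bT + i
                  · rw [if_pos ha2, if_pos (by omega), if_neg (by omega)]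
                  · rw [if_neg ha2, if_neg (by omega)])
        exact hd3
      have hall := hrand.seq (n₂ := 5)
        (q := fun s' => PMF.pure (st (i + 1) fun j => if j = i then s'.reg 91 else φ j))
        fun s' hs' => by
          simp only [PMF.mem_support_map_iff] at hs'
          obtain ⟨v, hv, rfl⟩ := hs'
          simpa using (hpost v).rdet
      rw [PMF.bind_map] at hall
      exact hall
    · refine ⟨⟨by simp [hst]; omega, by simp [hst, r.r19]; omega⟩, ?_⟩
      simp [Test.truth, hst, r.r19]; omega
  rw [hst0] at hloop
  have hall := hd.rdet.seq (n₂ := ∑ i ∈ Finset.range p.TW, (7 + 1) + 1)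
    (q := fun _ => (tape (fun _ => 2 ^ p.w) p.TW).map (st p.TW)) fun s' hs' => by
      rw [PMF.mem_support_pure_iff] at hs'
      subst hs'
      exact hloop
  rw [PMF.pure_bind] at hall
  have hle : 1 + (j + (∑ i ∈ Finset.range p.TW, (7 + 1) + 1)) ≤ T := by
    simp only [Finset.sum_const, Finset.card_range, smul_eq_mul]
    unfold Par.selectTime at hT
    omega
  obtain ⟨d, rfl⟩ := Nat.exists_eq_add_of_le hle
  refine ⟨fun φ => (st p.TW φ).reg, s1.mem, hF, hz, ?_⟩
  have := hall [] d
  rw [selectProg, this]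
  simp only [stepN_nil, PMF.bind_map]
  rfl

end WordRAM

/-! Collisions of random functions. -/

section moment

variable {U V A : Type*} [Fintype U] [Fintype A] [DecidableEq V] [DecidableEq A]

open Finset

/-- An exponential moment of the number of repeats, computed by adding one point at a time. With `n`
points present, the new point repeats a value in at most `n * c` cases, and each repeat is weighted
by `z`. By `hn` this at most doubles the number of choices. -/
theorem sum_pow_repeats_fin (f : U → V) {z c : ℕ} (hc : ∀ y, #{u | f u = y} ≤ c) (n : ℕ)
    (hn : n * z * c ≤ Fintype.card U) :
    ∑ φ : Fin n → U, z ^ (n - #(univ.image (f ∘ φ))) ≤ (2 * Fintype.card U) ^ n := by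
  induction n with
  | zero => simp
  | succ n ih =>
    have hn' : n * z * c ≤ Fintype.card U := le_trans (by gcongr; omega) hn
    rw [← (Fin.consEquiv fun _ => U).sum_comp, Fintype.sum_prod_type_right, pow_succ]
    refine le_trans ?_ (Nat.mul_le_mul_right _ (ih hn'))
    rw [Finset.sum_mul]
    refine Finset.sum_le_sum fun φ _ => ?_
    have him : #(univ.image (f ∘ φ)) ≤ n := card_image_le.trans (by simp)
    have h1 : ∀ u : U, (univ.image (f ∘ (Fin.consEquiv fun _ => U) (u, φ))) =
        insert (f u) (univ.image (f ∘ φ)) := by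
      intro u
      ext y
      simp only [Fin.consEquiv, Equiv.coe_fn_mk, mem_image, mem_univ, true_and, Function.comp_apply,
        mem_insert, Fin.exists_fin_succ, Fin.cons_zero, Fin.cons_succ]
      constructor
      · rintro (h | h)
        exacts [Or.inl h.symm, Or.inr h]
      · rintro (h | h)
        exacts [Or.inl h.symm, Or.inr h]
    have h2 : ∀ u : U, z ^ (n + 1 - #(univ.image (f ∘ (Fin.consEquiv fun _ => U) (u, φ)))) ≤
        z ^ (n - #(univ.image (f ∘ φ))) * (1 + if f u ∈ univ.image (f ∘ φ) then z else 0) := by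
      intro u
      rw [h1]
      split_ifs with hu
      · rw [insert_eq_of_mem hu, Nat.sub_add_comm him, pow_succ]
        exact Nat.mul_le_mul_left _ (by omega)
      · rw [card_insert_of_notMem hu]
        simp
    refine (Finset.sum_le_sum fun u _ => h2 u).trans ?_
    rw [← Finset.mul_sum]
    refine Nat.mul_le_mul_left _ ?_
    rw [Finset.sum_add_distrib, ← Finset.sum_filter, Finset.sum_const, Finset.sum_const]
    have h3 : #{u | f u ∈ univ.image (f ∘ φ)} ≤ n * c := by
      rw [card_eq_sum_card_fiberwise (f := f) (t := univ.image (f ∘ φ)) (fun u hu => by simpa using hu)]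
      refine (Finset.sum_le_card_nsmul _ _ c fun y _ => ?_).trans (Nat.mul_le_mul_right _ him)
      refine le_trans (card_le_card ?_) (hc y)
      intro u hu
      simp only [mem_filter, mem_univ, true_and] at hu ⊢
      exact hu.2
    have h4 : (n + 1) * z * c = n * c * z + z * c := by ring
    simp only [smul_eq_mul, card_univ, mul_one]
    nlinarith [Nat.mul_le_mul_right z h3]

theorem sum_pow_repeats (f : U → V) {z c : ℕ} (hc : ∀ y, #{u | f u = y} ≤ c)
    (hn : Fintype.card A * z * c ≤ Fintype.card U) :
    ∑ φ : A → U, z ^ (Fintype.card A - #(univ.image (f ∘ φ))) ≤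
      (2 * Fintype.card U) ^ Fintype.card A := by
  refine le_trans (le_of_eq ?_) (sum_pow_repeats_fin f hc _ hn)
  refine Fintype.sum_equiv (Equiv.arrowCongr (Fintype.equivFin A) (Equiv.refl U)) _ _ fun φ => ?_
  congr 3
  ext y
  simp only [mem_image, mem_univ, true_and, Function.comp_apply, Equiv.arrowCongr_apply,
    Equiv.coe_refl, id_eq]
  exact ⟨fun ⟨a, h⟩ => ⟨Fintype.equivFin A a, by simpa using h⟩, fun ⟨a, h⟩ => ⟨_, h⟩⟩

/-- A fibre of size `m ≥ 2` contributes `m` colliding elements and `m - 1` repeats, and `m ≤ 2 * (m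
- 1)`. -/
theorem card_nonunique_le (φ : A → V) :
    #{x | ∃ x', x' ≠ x ∧ φ x' = φ x} ≤ 2 * (Fintype.card A - #(univ.image φ)) := by
  have h1 := card_eq_sum_card_image φ (univ : Finset A)
  have h2 : #{x | ∃ x', x' ≠ x ∧ φ x' = φ x} ≤
      ∑ y ∈ univ.image φ, 2 * (#{x | φ x = y} - 1) := by
    rw [card_eq_sum_card_fiberwise (f := φ) (t := univ.image φ) (fun x _ => by simp)]
    refine Finset.sum_le_sum fun y _ => ?_
    rcases Nat.lt_or_ge 1 #{x | φ x = y} with h | h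
    · refine le_trans (card_le_card fun x hx => ?_) (show #{x | φ x = y} ≤ _ by omega)
      simp only [mem_filter, mem_univ, true_and] at hx ⊢
      exact hx.2
    · refine le_trans (le_of_eq ?_) (Nat.zero_le _)
      rw [card_eq_zero, filter_eq_empty_iff]
      rintro x hx hxy
      simp only [mem_filter, mem_univ, true_and] at hx
      obtain ⟨x', hne, he⟩ := hx
      exact hne (card_le_one.1 h x' (by simp [he, hxy]) x (by simp [hxy]))
  have h3 : ∑ y ∈ univ.image φ, (#{x | φ x = y} - 1) + #(univ.image φ) = Fintype.card A := by
    rw [card_eq_sum_ones (univ.image φ), ← Finset.sum_add_distrib, ← card_univ, h1]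
    refine Finset.sum_congr rfl fun y hy => ?_
    have : 0 < #{x | φ x = y} := by
      obtain ⟨x, _, rfl⟩ := mem_image.1 hy
      exact card_pos.2 ⟨x, by simp⟩
    omega
  rw [← Finset.mul_sum] at h2
  omega

variable {J : Type*} [Fintype J] [DecidableEq J]

/-- Few functions have many collisions in the coordinates `T`: at least half of the elements of
`A` collide in at least half of these coordinates. -/
theorem card_many_collisions (f : U → V) {c e d : ℕ} (hc : ∀ y, #{u | f u = y} ≤ c)
    (hn : Fintype.card A * 2 ^ (8 + e) * c ≤ Fintype.card U) (T : Finset J) (hT : #T = 8 * d)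
    (Ψ : Finset (A → J → U)) (hΨ : ∀ ψ ∈ Ψ, ¬ Fintype.card A ≤ 2 * #{x | #T <
      2 * #{j ∈ T | ∀ x', x' ≠ x → f (ψ x' j) ≠ f (ψ x j)}}) :
    #Ψ * 2 ^ (e * (Fintype.card A * d)) ≤ Fintype.card (A → J → U) := by
  set a := Fintype.card A with ha
  set u := Fintype.card U with hu
  set rep : (A → U) → ℕ := fun φ => a - #(univ.image (f ∘ φ)) with hrep
  -- Each repeat in a coordinate of `T` gets weight `2 ^ (8 + e)`: the 8 pays for the factor `2 ^ a`
  -- lost in each of the `8 * d` coordinates, and the `e` is the gain.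
  set g : J → (A → U) → ℕ := fun j φ => if j ∈ T then (2 ^ (8 + e)) ^ rep φ else 1 with hg
  -- More than half of the elements collide in at least `4 * d` coordinates. These are at least `2 *
  -- a * d` collisions, hence at least `a * d` repeats.
  have key : ∀ ψ ∈ Ψ, 2 ^ ((8 + e) * (a * d)) ≤ ∏ j, g j fun x => ψ x j := by
    intro ψ hψ
    have h1 := hΨ ψ hψ
    set good : Finset A := {x | #T < 2 * #{j ∈ T | ∀ x', x' ≠ x → f (ψ x' j) ≠ f (ψ x j)}} with hgood
    have h2 : #(univ \ good) + #good = a := card_sdiff_add_card_eq_card (subset_univ _)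
    have h3 : ∀ x ∈ univ \ good, 4 * d ≤ #{j ∈ T | ∃ x', x' ≠ x ∧ f (ψ x' j) = f (ψ x j)} := by
      intro x hx
      simp only [hgood, mem_sdiff, mem_univ, true_and, mem_filter, not_lt] at hx
      have h4 := card_filter_add_card_filter_not (s := T)
        (fun j => ∀ x', x' ≠ x → f (ψ x' j) ≠ f (ψ x j))
      have h5 : #{j ∈ T | ¬ ∀ x', x' ≠ x → f (ψ x' j) ≠ f (ψ x j)} =
          #{j ∈ T | ∃ x', x' ≠ x ∧ f (ψ x' j) = f (ψ x j)} := by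
        congr 1
        ext j
        simp
      omega
    have h6 : #(univ \ good) * (4 * d) ≤
        ∑ x : A, #{j ∈ T | ∃ x', x' ≠ x ∧ f (ψ x' j) = f (ψ x j)} :=
      (Finset.card_nsmul_le_sum _ _ _ h3).trans (Finset.sum_le_sum_of_subset (subset_univ _))
    have h7 : ∑ x : A, #{j ∈ T | ∃ x', x' ≠ x ∧ f (ψ x' j) = f (ψ x j)} =
        ∑ j ∈ T, #{x : A | ∃ x', x' ≠ x ∧ f (ψ x' j) = f (ψ x j)} := by
      simp only [card_filter]
      rw [Finset.sum_comm]
    have h8 : ∑ j ∈ T, #{x : A | ∃ x', x' ≠ x ∧ f (ψ x' j) = f (ψ x j)} ≤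
        ∑ j ∈ T, 2 * rep fun x => ψ x j :=
      Finset.sum_le_sum fun j _ => card_nonunique_le (f ∘ fun x => ψ x j)
    rw [← Finset.mul_sum] at h8
    have h9 : a * d ≤ ∑ j ∈ T, rep fun x => ψ x j := by
      have h10 : a * (4 * d) ≤ 2 * #(univ \ good) * (4 * d) := Nat.mul_le_mul_right _ (by omega)
      nlinarith
    have h11 : ∏ j, g j (fun x => ψ x j) = ∏ j ∈ T, (2 ^ (8 + e)) ^ rep fun x => ψ x j := by
      simp only [hg]
      rw [Finset.prod_ite_mem, univ_inter]
    rw [h11, Finset.prod_pow_eq_pow_sum, ← pow_mul]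
    exact Nat.pow_le_pow_right (by norm_num) (Nat.mul_le_mul_left _ h9)
  have hsum : #Ψ * 2 ^ ((8 + e) * (a * d)) ≤ ∑ ψ : A → J → U, ∏ j, g j fun x => ψ x j :=
    (Finset.card_nsmul_le_sum _ _ _ key).trans (Finset.sum_le_sum_of_subset (subset_univ _))
  -- The coordinates are independent, so the sum of products factors.
  have hprod : ∑ ψ : A → J → U, ∏ j, g j (fun x => ψ x j) = ∏ j, ∑ φ : A → U, g j φ := by
    rw [Finset.prod_univ_sum, Fintype.piFinset_univ]
    exact Fintype.sum_equiv (Equiv.piComm _) _ _ fun ψ => rfl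
  have hle : ∏ j, ∑ φ : A → U, g j φ ≤ ∏ j, (if j ∈ T then 2 ^ a else 1) * u ^ a := by
    refine Finset.prod_le_prod' fun j _ => ?_
    simp only [hg]
    split_ifs with hj
    · rw [← mul_pow]
      exact sum_pow_repeats f hc hn
    · simp [hu, ha]
  rw [Finset.prod_mul_distrib, Finset.prod_ite_mem, univ_inter, Finset.prod_const, Finset.prod_const,
    hT, card_univ, ← pow_mul, ← pow_mul] at hle
  have hcard : Fintype.card (A → J → U) = u ^ (a * Fintype.card J) := by
    rw [Fintype.card_fun, Fintype.card_fun, ← pow_mul, mul_comm]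
  rw [hcard]
  have h2 : 2 ^ ((8 + e) * (a * d)) = 2 ^ (a * (8 * d)) * 2 ^ (e * (a * d)) := by
    rw [← pow_add]; congr 1; ring
  rw [hprod] at hsum
  have h3 := hsum.trans hle
  rw [h2, mul_left_comm] at h3
  exact Nat.le_of_mul_le_mul_left h3 (by positivity)

end moment

/-! ### Uniformity from affine structure, and solving for table contents by peeling. -/

open Finset in
theorem AddMonoidHom.card_preimage_mul {H W : Type*} [AddGroup H] [AddGroup W] [Fintype H] [Fintype W]
    [DecidableEq W] (L : H →+ W) (hL : Function.Surjective L) (B : Finset W) :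
    #{D | L D ∈ B} * Fintype.card W = #B * Fintype.card H := by
  have h1 : ∀ B : Finset W, #{D | L D ∈ B} = #B * #{D | L D = 0} := by
    intro B
    rw [card_eq_sum_card_fiberwise (f := L) (t := B) (fun D hD => by simpa using hD)]
    rw [← smul_eq_mul, ← Finset.sum_const]
    refine Finset.sum_congr rfl fun y hy => ?_
    rw [filter_filter, ← AddMonoidHom.card_fiber_eq_of_mem_range L (hL y) (hL 0)]
    congr 1
    ext D
    simp only [mem_filter, mem_univ, true_and]
    exact ⟨fun h => h.2, fun h => ⟨h ▸ hy, h⟩⟩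
  have h2 := h1 univ
  simp only [mem_univ, filter_true, card_univ] at h2
  rw [h1 B, h2]
  ring

open Finset in
/-- A function that is affine and onto along a subgroup is uniformly distributed. -/
theorem card_mem_mul_card {Ω W : Type*} [AddCommGroup Ω] [AddCommGroup W] [Fintype Ω] [Fintype W]
    [DecidableEq Ω] [DecidableEq W] (H : AddSubgroup Ω) (E : Finset Ω) (X : Ω → W)
    (hE : ∀ F ∈ E, ∀ D ∈ H, F + D ∈ E)
    (hX : ∀ F ∈ E, ∃ L : H →+ W, Function.Surjective L ∧ ∀ D : H, X (F + D) = X F + L D)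
    (B : Finset W) : #{F ∈ E | X F ∈ B} * Fintype.card W = #E * #B := by
  classical
  have h1 : ∀ D : H, #{F ∈ E | X (F + D) ∈ B} = #{F ∈ E | X F ∈ B} := by
    intro D
    refine card_bij (fun F _ => F + D) (fun F hF => ?_) (fun F _ F' _ h => add_right_cancel h)
      fun F hF => ?_
    · simp only [mem_filter] at hF ⊢
      exact ⟨hE F hF.1 D D.2, hF.2⟩
    · simp only [mem_filter] at hF
      refine ⟨F + (-D : H), ?_, by simp⟩
      simp only [mem_filter]
      exact ⟨hE F hF.1 _ (-D).2, by simpa using hF.2⟩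
  have h2 : ∀ F ∈ E, #{D : H | X (F + D) ∈ B} * Fintype.card W = #B * Fintype.card H := by
    intro F hF
    obtain ⟨L, hL, h⟩ := hX F hF
    have := L.card_preimage_mul hL (B.image fun y => -X F + y)
    rw [card_image_of_injective _ (add_right_injective _)] at this
    rw [← this]
    congr 2
    ext D
    simp only [mem_filter, mem_univ, true_and, mem_image, h]
    constructor
    · exact fun hB => ⟨_, hB, by simp⟩
    · rintro ⟨y, hy, e⟩
      rw [← e]
      simpa using hy
  -- Double counting: translation by `D` does not change the size of the event, and for each fixed
  -- `F` the value `X (F + D)` is uniform as `D` varies.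
  have h3 : ∑ D : H, #{F ∈ E | X (F + D) ∈ B} = ∑ F ∈ E, #{D : H | X (F + D) ∈ B} := by
    simp only [card_filter]
    rw [Finset.sum_comm]
  simp only [h1, Finset.sum_const, card_univ, smul_eq_mul] at h3
  have h4 : (∑ F ∈ E, #{D : H | X (F + D) ∈ B}) * Fintype.card W = #E * (#B * Fintype.card H) := by
    rw [Finset.sum_mul, Finset.sum_congr rfl h2, Finset.sum_const, smul_eq_mul]
  rw [← h3] at h4
  have h5 : 0 < Fintype.card H := Fintype.card_pos
  exact Nat.eq_of_mul_eq_mul_left h5 (by linarith)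

open Finset in
/-- If in every subset of `S` some element has a cell of its own, the sums over the cells of the
elements of `S` can be prescribed. -/
theorem exists_sum_cell_eq {K W : Type*} [AddCommGroup W] [DecidableEq K] (cell : K → Finset ℕ)
    (S : Finset K) (hS : ∀ S' ⊆ S, S'.Nonempty → ∃ z ∈ S', ∃ e ∈ cell z, ∀ z' ∈ S', z' ≠ z → e ∉ cell z')
    (y : K → W) : ∃ D : ℕ → W, ∀ z ∈ S, ∑ e ∈ cell z, D e = y z := by
  induction S using Finset.strongInduction with
  | H S ih =>
    rcases S.eq_empty_or_nonempty with rfl | hne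
    · exact ⟨0, by simp⟩
    · obtain ⟨z, hz, e, he, hu⟩ := hS S subset_rfl hne
      obtain ⟨D, hD⟩ := ih (S.erase z) (erase_ssubset hz) fun S' h => hS S' (h.trans (erase_subset _ _))
      -- The peeled element is dealt with last: its private cell `e` occurs in no other sum, so
      -- correcting the value there does no harm.
      refine ⟨Function.update D e (y z - ∑ e' ∈ (cell z).erase e, D e'), fun z' hz' => ?_⟩
      by_cases h : z' = z
      · subst h
        rw [← Finset.add_sum_erase _ _ he, Function.update_self]
        rw [Finset.sum_congr rfl fun e' he' => Function.update_of_ne (ne_of_mem_erase he') _ _]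
        simp
      · rw [← hD z' (mem_erase.2 ⟨h, hz'⟩)]
        refine Finset.sum_congr rfl fun e' he' => Function.update_of_ne ?_ _ _
        rintro rfl
        exact hu z' hz' h he'

/-! ### The group of bit vectors. -/

/-- Bit vectors with bitwise addition. -/
def XV (M : ℕ) : Type := Fin (2 ^ M)

namespace XV

variable {M : ℕ}

instance : Fintype (XV M) := inferInstanceAs (Fintype (Fin (2 ^ M)))
instance : DecidableEq (XV M) := inferInstanceAs (DecidableEq (Fin (2 ^ M)))

theorem card : Fintype.card (XV M) = 2 ^ M := Fintype.card_fin _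

def mk (x : ℕ) (h : x < 2 ^ M) : XV M := Fin.mk x h
def val (x : XV M) : ℕ := Fin.val x

theorem lt (x : XV M) : x.val < 2 ^ M := Fin.isLt x
@[ext] theorem ext {x y : XV M} (h : x.val = y.val) : x = y := Fin.ext h
@[simp] theorem val_mk (x : ℕ) (h : x < 2 ^ M) : (mk x h).val = x := rfl

instance : Zero (XV M) := ⟨mk 0 (by positivity)⟩
instance : Add (XV M) := ⟨fun x y => mk (x.val ^^^ y.val) (Nat.xor_lt_two_pow x.lt y.lt)⟩
instance : Neg (XV M) := ⟨id⟩

@[simp] theorem val_zero : (0 : XV M).val = 0 := rfl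
@[simp] theorem val_add (x y : XV M) : (x + y).val = x.val ^^^ y.val := rfl
@[simp] theorem neg_eq (x : XV M) : -x = x := rfl

instance : AddCommGroup (XV M) where
  add_assoc x y z := by ext; simp [Nat.xor_assoc]
  zero_add x := by ext; simp
  add_zero x := by ext; simp
  add_comm x y := by ext; simp [Nat.xor_comm]
  neg_add_cancel x := by ext; simp
  nsmul := nsmulRec
  zsmul := zsmulRec

/-- This and `card_div_le` are the fibre bounds for the moment estimate, for the low part and the
high part of a field. -/
theorem card_mod_le (b y : ℕ) : (Finset.univ.filter fun u : XV M => u.val % 2 ^ b = y).card ≤ 2 ^ (M - b) := by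
  rw [← Finset.card_range (2 ^ (M - b))]
  refine Finset.card_le_card_of_injOn (fun u => u.val / 2 ^ b) (fun u _ => ?_) fun u hu v hv h => ?_
  · simp only [Finset.coe_range, Set.mem_Iio]
    rcases le_total b M with hb | hb
    · rw [Nat.div_lt_iff_lt_mul (by positivity), ← pow_add, Nat.sub_add_cancel hb]
      exact u.lt
    · rw [Nat.div_eq_of_lt (u.lt.trans_le (Nat.pow_le_pow_right (by norm_num) hb))]
      positivity
  · simp only [Finset.coe_filter, Finset.mem_univ, true_and, Set.mem_ofPred_eq] at hu hv
    ext
    rw [← Nat.div_add_mod u.val (2 ^ b), ← Nat.div_add_mod v.val (2 ^ b), hu, hv]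
    simp only at h
    rw [h]

theorem card_div_le (b y : ℕ) : (Finset.univ.filter fun u : XV M => u.val / 2 ^ b = y).card ≤ 2 ^ b := by
  refine le_trans ?_ (Finset.card_range (2 ^ b)).le
  refine Finset.card_le_card_of_injOn (fun u => u.val % 2 ^ b) (fun u _ => ?_) fun u hu v hv h => ?_
  · simp only [Finset.coe_range, Set.mem_Iio]
    exact Nat.mod_lt _ (by positivity)
  · simp only [Finset.coe_filter, Finset.mem_univ, true_and, Set.mem_ofPred_eq] at hu hv
    ext
    rw [← Nat.div_add_mod u.val (2 ^ b), ← Nat.div_add_mod v.val (2 ^ b), hu, hv]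
    simp only at h
    rw [h]

end XV

/-! ### Keys as trees, and uniform node vectors under the peeling condition. -/

namespace WordRAM

/-- Keys of `2 ^ h` characters, as complete binary trees. -/
def Key (s : ℕ) : ℕ → Type
  | 0 => Fin (2 ^ s)
  | h + 1 => Key s h × Key s h

namespace Key

variable {s : ℕ}

@[reducible] def fintype : ∀ h, Fintype (Key s h)
  | 0 => inferInstanceAs (Fintype (Fin (2 ^ s)))
  | h + 1 => @instFintypeProd _ _ (fintype h) (fintype h)

instance (h : ℕ) : Fintype (Key s h) := fintype h

noncomputable instance (h : ℕ) : DecidableEq (Key s h) := Classical.decEq _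

theorem card (h : ℕ) : Fintype.card (Key s h) = 2 ^ (s * 2 ^ h) := by
  induction h with
  | zero => exact (Fintype.card_fin _).trans (by simp)
  | succ h ih =>
    have : Fintype.card (Key s (h + 1)) = Fintype.card (Key s h × Key s h) := rfl
    rw [this, Fintype.card_prod, ih, ← pow_add]
    congr 1
    ring

end Key

/-- In every nonempty set of at most `k` keys, some key differs from all others in one of the first
`d` coordinates. -/
def Peel {K : Type*} (k d : ℕ) (v : K → ℕ → ℕ) : Prop :=
  ∀ S : Finset K, S.Nonempty → S.card ≤ k → ∃ z ∈ S, ∃ j < d, ∀ z' ∈ S, z' ≠ z → v z' j ≠ v z j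

theorem Peel.congr {K : Type*} {k d : ℕ} {v v' : K → ℕ → ℕ} (h : Peel k d v)
    (e : ∀ z, ∀ j < d, v z j = v' z j) : Peel k d v' := by
  intro S hS hk
  obtain ⟨z, hz, j, hj, hu⟩ := h S hS hk
  exact ⟨z, hz, j, hj, fun z' hz' hne => by rw [← e _ j hj, ← e _ j hj]; exact hu z' hz' hne⟩

/-- The table entries selected by a vector. -/
def tabCells (c M d : ℕ) (v : ℕ → ℕ) : Finset ℕ := (Finset.range d).image fun j => (c + j) * 2 ^ M + v j

theorem tabCells_injOn {c M d : ℕ} {v : ℕ → ℕ} (hv : ∀ j < d, v j < 2 ^ M) :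
    Set.InjOn (fun j => (c + j) * 2 ^ M + v j) (Finset.range d) := by
  intro j hj j' hj' h
  simp only [Finset.coe_range, Set.mem_Iio] at hj hj' h
  have h1 : ∀ i < d, ((c + i) * 2 ^ M + v i) / 2 ^ M = c + i := fun i hi => by
    rw [mul_comm, Nat.mul_add_div (by positivity), Nat.div_eq_of_lt (hv i hi), add_zero]
  have h2 := h1 j hj
  rw [h, h1 j' hj'] at h2
  omega

theorem sum_tabCells {W : Type*} [AddCommMonoid W] {c M d : ℕ} {v : ℕ → ℕ} (hv : ∀ j < d, v j < 2 ^ M)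
    (f : ℕ → W) : ∑ e ∈ tabCells c M d v, f e = ∑ j ∈ Finset.range d, f ((c + j) * 2 ^ M + v j) :=
  Finset.sum_image (tabCells_injOn hv)

/-- Different coordinates use disjoint blocks of `2 ^ M` entries, so a private value in one
coordinate is a private table entry. -/
theorem Peel.cells {K : Type*} {k c M d : ℕ} {v : K → ℕ → ℕ} (h : Peel k d v)
    (hv : ∀ z, ∀ j < d, v z j < 2 ^ M) (S : Finset K) (hS : S.Nonempty) (hk : S.card ≤ k) :
    ∃ z ∈ S, ∃ e ∈ tabCells c M d (v z), ∀ z' ∈ S, z' ≠ z → e ∉ tabCells c M d (v z') := by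
  obtain ⟨z, hz, j, hj, hu⟩ := h S hS hk
  refine ⟨z, hz, _, Finset.mem_image_of_mem _ (Finset.mem_range.2 hj), fun z' hz' hne hmem => ?_⟩
  obtain ⟨j', hj', e⟩ := Finset.mem_image.1 hmem
  have hj2 := Finset.mem_range.1 hj'
  have h1 : ∀ z, ∀ i < d, ((c + i) * 2 ^ M + v z i) / 2 ^ M = c + i := fun z i hi => by
    rw [mul_comm, Nat.mul_add_div (by positivity), Nat.div_eq_of_lt (hv z i hi), add_zero]
  have h2 := h1 z' j' hj2
  rw [e, h1 z j hj] at h2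
  have h3 : j' = j := by omega
  subst h3
  exact hu z' hz' hne (by omega)

namespace Par

variable (p : Par)

open Finset

/-- The vector of the node with the given key. -/
def vec (F : ℕ → XV p.M) : (h : ℕ) → Key p.s h → ℕ → XV p.M
  | 0, x, j => F ((2 ^ p.s + Fin.val (n := 2 ^ p.s) x) * 2 ^ p.δ + j)
  | h + 1, z, j => ∑ j' ∈ Finset.range (2 ^ (h + p.δ)), F (p.entry h j'
      (mux (p.mb j') (vec F h z.1 j').val (vec F h z.2 j').val) * 2 ^ (h + 1 + p.δ) + j)

/-- The combination of the vectors of two siblings. -/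
def slot (F : ℕ → XV p.M) (h : ℕ) (z : Key p.s h × Key p.s h) (j : ℕ) : ℕ :=
  mux (p.mb j) (p.vec F h z.1 j).val (p.vec F h z.2 j).val

theorem slot_lt (F : ℕ → XV p.M) (h : ℕ) (z : Key p.s h × Key p.s h) (j : ℕ) :
    p.slot F h z j < 2 ^ p.M := mux_lt (XV.lt _) (XV.lt _)

/-- The table entries used at the node with the given key. -/
def cell (F : ℕ → XV p.M) : (h : ℕ) → Key p.s h → Finset ℕ
  | 0, x => {2 ^ p.s + Fin.val (n := 2 ^ p.s) x}
  | h + 1, z => tabCells (2 ^ (h + p.δ)) p.M (2 ^ (h + p.δ)) (p.slot F h z)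

theorem vec_eq (F : ℕ → XV p.M) (h : ℕ) (x : Key p.s h) (j : ℕ) :
    p.vec F h x j = ∑ e ∈ p.cell F h x, F (e * 2 ^ (h + p.δ) + j) := by
  cases h with
  | zero => simp [vec, cell]
  | succ h => exact (sum_tabCells (c := 2 ^ (h + p.δ)) (fun j _ => p.slot_lt F h x j)
      fun e => F (e * 2 ^ (h + 1 + p.δ) + j)).symm

/-- The first entry of the table for height `h`. -/
def base : ℕ → ℕ
  | 0 => 2 ^ p.s
  | h + 1 => 2 ^ (h + p.δ + p.M)

theorem cell_range (F : ℕ → XV p.M) {h : ℕ} {x : Key p.s h} {e : ℕ} (he : e ∈ p.cell F h x) :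
    p.base h ≤ e ∧ e + 1 ≤ 2 * p.base h := by
  cases h with
  | zero =>
    simp only [cell, mem_singleton] at he
    have := Fin.isLt (n := 2 ^ p.s) x
    simp only [base]
    omega
  | succ h =>
    obtain ⟨j, hj, rfl⟩ := mem_image.1 he
    have hj := mem_range.1 hj
    have h1 := p.slot_lt F h x j
    have h2 : (2 ^ (h + p.δ) + j + 1) * 2 ^ p.M ≤ (2 * 2 ^ (h + p.δ)) * 2 ^ p.M :=
      Nat.mul_le_mul_right _ (by omega)
    have h3 : 2 ^ (h + p.δ) * 2 ^ p.M ≤ (2 ^ (h + p.δ) + j) * 2 ^ p.M :=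
      Nat.mul_le_mul_right _ (by omega)
    rw [Nat.succ_mul] at h2
    simp only [base]
    rw [pow_add _ _ p.M]
    constructor
    · omega
    · nlinarith

/-- The first field of the table for height `h`. -/
def thr (h : ℕ) : ℕ := p.base h * 2 ^ (h + p.δ)

variable {p}

theorem cell_thr {F : ℕ → XV p.M} {h : ℕ} {x : Key p.s h} {e j : ℕ} (he : e ∈ p.cell F h x)
    (hj : j < 2 ^ (h + p.δ)) : p.thr h ≤ e * 2 ^ (h + p.δ) + j ∧ e * 2 ^ (h + p.δ) + j < 2 * p.thr h := by
  obtain ⟨h1, h2⟩ := p.cell_range F he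
  have h3 := Nat.mul_le_mul_right (2 ^ (h + p.δ)) h1
  have h4 := Nat.mul_le_mul_right (2 ^ (h + p.δ)) h2
  rw [Nat.succ_mul, mul_assoc] at h4
  unfold thr
  omega

/-- The table for height `h` occupies fields from `thr h` up to `2 * thr h`, so tables of different
heights are disjoint. In particular the cells at height `h` are determined by fields below `thr h`,
and the vectors depend linearly on the rest. -/
theorem two_mul_thr_le (hs : p.s < p.M) (h : ℕ) : 2 * p.thr h ≤ p.thr (h + 1) := by
  unfold thr
  cases h with
  | zero =>
    simp only [base]
    rw [← pow_add, ← pow_add, ← pow_succ']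
    exact Nat.pow_le_pow_right (by norm_num) (by omega)
  | succ h =>
    simp only [base]
    rw [← pow_add, ← pow_add, ← pow_succ']
    exact Nat.pow_le_pow_right (by norm_num) (by omega)

theorem thr_mono (hs : p.s < p.M) : Monotone p.thr :=
  monotone_nat_of_le_succ fun h => le_trans (by omega) (two_mul_thr_le hs h)

theorem cell_congr (hs : p.s < p.M) {F F' : ℕ → XV p.M} {h : ℕ} (hF : ∀ n < p.thr h, F n = F' n)
    (x : Key p.s h) : p.cell F h x = p.cell F' h x := by
  induction h with
  | zero => rfl
  | succ h ih =>
    have h1 := two_mul_thr_le hs h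
    refine Finset.image_congr fun j' hj' => ?_
    have hj' := mem_range.1 hj'
    have h1 : ∀ x : Key p.s h, p.vec F h x j' = p.vec F' h x j' := fun x => by
      rw [vec_eq, vec_eq, ← ih fun n hn => hF n (by omega)]
      exact Finset.sum_congr rfl fun e he => hF _ ((cell_thr he hj').2.trans_le h1)
    simp only [slot, h1]

theorem vec_congr (hs : p.s < p.M) {F F' : ℕ → XV p.M} {h : ℕ} (hF : ∀ n < 2 * p.thr h, F n = F' n)
    (x : Key p.s h) {j : ℕ} (hj : j < 2 ^ (h + p.δ)) : p.vec F h x j = p.vec F' h x j := by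
  rw [vec_eq, vec_eq, cell_congr hs fun n hn => hF n (by omega)]
  exact Finset.sum_congr rfl fun e he => hF _ (cell_thr he hj).2

theorem slot_congr (hs : p.s < p.M) {F F' : ℕ → XV p.M} {h : ℕ} (hF : ∀ n < 2 * p.thr h, F n = F' n)
    (z : Key p.s h × Key p.s h) {j : ℕ} (hj : j < 2 ^ (h + p.δ)) : p.slot F h z j = p.slot F' h z j := by
  unfold slot
  rw [vec_congr hs hF _ hj, vec_congr hs hF _ hj]

variable (p) in
/-- Up to height `h`, every small set of keys can be peeled. -/
def Peels (k : ℕ) (F : ℕ → XV p.M) (h : ℕ) : Prop :=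
  ∀ h' < h, Peel k (2 ^ (h' + p.δ)) (p.slot F h')

theorem Peels.congr (hs : p.s < p.M) {k h : ℕ} {F F' : ℕ → XV p.M} (hP : p.Peels k F h)
    (hF : ∀ h' < h, ∀ n < 2 * p.thr h', F n = F' n) : p.Peels k F' h := fun h' hh =>
  (hP h' hh).congr fun z _ hj => slot_congr hs (hF h' hh) z hj

/-- At the leaves nothing is assumed: distinct characters have distinct entries. -/
theorem Peels.cell {k h : ℕ} {F : ℕ → XV p.M} (hP : p.Peels k F h) (S : Finset (Key p.s h))
    (hS : S.Nonempty) (hk : S.card ≤ k) :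
    ∃ z ∈ S, ∃ e ∈ p.cell F h z, ∀ z' ∈ S, z' ≠ z → e ∉ p.cell F h z' := by
  cases h with
  | zero =>
    obtain ⟨z, hz⟩ := hS
    refine ⟨z, hz, _, mem_singleton_self _, fun z' _ hne hmem => hne ?_⟩
    have := mem_singleton.1 hmem
    exact Fin.ext (n := 2 ^ p.s) (by omega)
  | succ h => exact (hP h (by omega)).cells (fun z j _ => p.slot_lt F h z j) S hS hk

/-- The fields given by a finite sequence, extended by zero. -/
def ext {M N : ℕ} (F : Fin N → XV M) (n : ℕ) : XV M := if h : n < N then F ⟨n, h⟩ else 0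

theorem ext_add {M N : ℕ} (F D : Fin N → XV M) (n : ℕ) : ext (F + D) n = ext F n + ext D n := by
  unfold ext
  split_ifs <;> simp

open Classical in
/-- As long as small sets can be peeled, the vectors of a small set of keys are uniformly
distributed. -/
theorem card_vec_mem (hs : p.s < p.M) {N k h : ℕ} (hN : 2 * p.thr h ≤ N) (A : Finset (Key p.s h))
    (hA : A.card ≤ k) (B : Finset (A → Fin (2 ^ (h + p.δ)) → XV p.M)) :
    #{F : Fin N → XV p.M | p.Peels k (ext F) h ∧ (fun (x : A) (j : Fin (2 ^ (h + p.δ))) => p.vec (ext F) h x j) ∈ B} *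
        Fintype.card (A → Fin (2 ^ (h + p.δ)) → XV p.M) =
      #{F : Fin N → XV p.M | p.Peels k (ext F) h} * #B := by
  -- Translations that leave the fields below `thr h` alone preserve `Peels` up to height `h` and
  -- all cells at height `h`, so along them the vectors change by a homomorphism.
  set H : AddSubgroup (Fin N → XV p.M) :=
    { carrier := {D | ∀ n < p.thr h, ext D n = 0}
      add_mem' := fun {a b} ha hb n hn => by rw [ext_add, ha n hn, hb n hn, add_zero]
      zero_mem' := fun n _ => by simp [ext]
      neg_mem' := fun {a} ha n hn => ha n hn } with hH
  have hmem : ∀ D ∈ H, ∀ F, ∀ n < p.thr h, ext F n = ext (F + D) n := fun D hD F n hn => by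
    rw [ext_add, hD n hn, add_zero]
  rw [← Finset.filter_filter]
  refine card_mem_mul_card H _ _ (fun F hF D hD => ?_) (fun F hF => ?_) B
  · simp only [mem_filter, mem_univ, true_and] at hF ⊢
    exact hF.congr hs fun h' hh n hn => hmem D hD F n
      (hn.trans_le ((two_mul_thr_le hs h').trans (thr_mono hs hh)))
  · simp only [mem_filter, mem_univ, true_and] at hF
    refine ⟨{ toFun := fun D x j => ∑ e ∈ p.cell (ext F) h x, ext D.1 (e * 2 ^ (h + p.δ) + j)
              map_zero' := by funext x j; simp [ext]
              map_add' := fun D D' => by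
                funext x j
                simp [ext_add, Finset.sum_add_distrib] }, fun y => ?_, fun D => ?_⟩
    -- This homomorphism is onto, because the cells of the keys in `A` can be peeled.
    · obtain ⟨D, hD⟩ := exists_sum_cell_eq (p.cell (ext F) h) A
        (fun S' hS' hne => hF.cell S' hne ((card_le_card hS').trans hA))
        (fun x (j : Fin (2 ^ (h + p.δ))) => if hx : x ∈ A then y ⟨x, hx⟩ j else 0)
      set D' : Fin N → XV p.M := fun n => if p.thr h ≤ n then
        D (n / 2 ^ (h + p.δ)) ⟨n % 2 ^ (h + p.δ), Nat.mod_lt _ (by positivity)⟩ else 0 with hD'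
      refine ⟨⟨D', fun n hn => ?_⟩, ?_⟩
      · simp only [ext, hD']
        split_ifs <;> first | rfl | omega
      · funext x j
        have h1 := congrFun (hD x.1 x.2) j
        simp only [x.2, dif_pos, Finset.sum_apply] at h1
        simp only [AddMonoidHom.coe_mk, ZeroHom.coe_mk]
        refine Eq.trans (Finset.sum_congr rfl fun e he => ?_) h1
        obtain ⟨h2, h3⟩ := cell_thr he j.2
        simp only [ext, hD']
        rw [dif_pos (by omega), if_pos h2]
        have h4 : (e * 2 ^ (h + p.δ) + j) / 2 ^ (h + p.δ) = e := by
          rw [mul_comm, Nat.mul_add_div (by positivity), Nat.div_eq_of_lt j.2, add_zero]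
        have h5 : (e * 2 ^ (h + p.δ) + j) % 2 ^ (h + p.δ) = j := by
          rw [mul_comm, Nat.mul_add_mod, Nat.mod_eq_of_lt j.2]
        simp only [h4, h5]
    · funext x j
      simp only [Pi.add_apply, AddMonoidHom.coe_mk, ZeroHom.coe_mk]
      rw [vec_eq, vec_eq, ← cell_congr hs (hmem D D.2 F), ← Finset.sum_add_distrib]
      simp only [ext_add]

end Par

end WordRAM

/-! ### Spread vectors: they make pairs peelable, and they are likely. -/

namespace WordRAM

open Finset

open Classical in
/-- In every set of at most `min k c` keys, at least half of the keys are distinguished from all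
others by the function `f` of more than half of the coordinates in `T`. -/
def Spread {X : Type*} {M d : ℕ} (k c : ℕ) (T : Finset (Fin d)) (f : XV M → ℕ) (v : X → ℕ → XV M) :
    Prop :=
  ∀ A : Finset X, #A ≤ k → #A ≤ c → Fintype.card A ≤ 2 * #{x : A | #T < 2 *
    #(T.filter fun j : Fin d => ∀ x' : A, x' ≠ x → f (v x' j) ≠ f (v x j))}

theorem Spread.exists_good {X : Type*} {M d k c : ℕ} {T : Finset (Fin d)} {f : XV M → ℕ}
    {v : X → ℕ → XV M} (h : Spread k c T f v) (A : Finset X) (hk : #A ≤ k) (hc : #A ≤ c) :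
    ∃ G ⊆ A, #A ≤ 2 * #G ∧ ∀ x ∈ G, ∃ T' ⊆ T, #T < 2 * #T' ∧
      ∀ j ∈ T', ∀ x' ∈ A, x' ≠ x → f (v x' j) ≠ f (v x j) := by
  classical
  have h1 := h A hk hc
  rw [Fintype.card_coe] at h1
  refine ⟨_, fun x hx => ?_, h1.trans (Nat.mul_le_mul_left _ (card_image_of_injective _
    Subtype.val_injective).ge), fun x hx => ?_⟩
  · obtain ⟨y, _, rfl⟩ := mem_image.1 hx
    exact y.2
  · obtain ⟨y, hy, rfl⟩ := mem_image.1 hx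
    simp only [mem_filter, mem_univ, true_and] at hy
    refine ⟨_, filter_subset _ _, hy, fun j hj x' hx' hne => ?_⟩
    exact (mem_filter.1 hj).2 ⟨x', hx'⟩ fun e => hne (congrArg Subtype.val e)

/-- The coordinates with scale `i`. -/
def scale (ℓ d i : ℕ) : Finset (Fin d) := {j | (j : ℕ) % 2 ^ ℓ = i}

theorem card_scale {ℓ n i : ℕ} (hi : i < 2 ^ ℓ) : #(scale ℓ (2 ^ (n + ℓ)) i) = 2 ^ n := by
  refine (card_bij' (s := scale ℓ (2 ^ (n + ℓ)) i) (t := Finset.range (2 ^ n)) (fun j _ => (j : ℕ) / 2 ^ ℓ)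
    (fun m hm => (⟨m * 2 ^ ℓ + i, ?_⟩ : Fin (2 ^ (n + ℓ)))) (fun j _ => ?_) (fun m hm => ?_) (fun j hj => ?_)
    (fun m hm => ?_)).trans (card_range _)
  · have h1 : (m + 1) * 2 ^ ℓ ≤ 2 ^ n * 2 ^ ℓ := Nat.mul_le_mul_right _ (Finset.mem_range.1 hm)
    rw [Nat.succ_mul] at h1
    rw [pow_add]
    omega
  · rw [Finset.mem_range, Nat.div_lt_iff_lt_mul (by positivity), ← pow_add]
    exact j.2
  · simp [scale, Nat.mul_add_mod', Nat.mod_eq_of_lt hi]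
  · have := (mem_filter.1 hj).2
    ext
    simp only
    rw [← this, Nat.div_add_mod']
  · simp only
    rw [mul_comm, Nat.mul_add_div (by positivity), Nat.div_eq_of_lt hi, add_zero]

namespace Par

variable {p : Par}

/-- If the vectors of the children are spread at all scales, their combinations can be peeled. -/
theorem peel_slot {k κ : ℕ} (hk : k < 2 ^ κ) (hκ : κ < p.s * 2 ^ p.ℓ) {F : ℕ → XV p.M} {h : ℕ}
    (hsp : ∀ i < 2 ^ p.ℓ, p.s * i ≤ κ →
      Spread k (2 ^ (p.s * (i + 1))) (scale p.ℓ (2 ^ (h + p.δ)) i)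
        (fun u => u.val % 2 ^ (8 + 2 * p.s + i * p.s)) (p.vec F h) ∧
      Spread k (2 ^ (κ + 1 - p.s * i)) (scale p.ℓ (2 ^ (h + p.δ)) i)
        (fun u => u.val / 2 ^ (8 + 2 * p.s + i * p.s)) (p.vec F h)) :
    Peel k (2 ^ (h + p.δ)) (p.slot F h) := by
  classical
  intro S hS hSk
  have hs0 : 0 < p.s := by unfold Par.s; positivity
  set A := S.image Prod.fst with hA
  set a := #A with ha
  have ha0 : 0 < a := card_pos.2 (hS.image _)
  have hak : a ≤ k := card_image_le.trans hSk
  -- The number `a` of first components selects the scale.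
  set i := Nat.log (2 ^ p.s) a with hi
  have hb : 1 < 2 ^ p.s := Nat.one_lt_two_pow hs0.ne'
  have hi1 : 2 ^ (p.s * i) ≤ a := by rw [pow_mul]; exact Nat.pow_log_le_self _ ha0.ne'
  have hi2 : a < 2 ^ (p.s * (i + 1)) := by rw [pow_mul]; exact Nat.lt_pow_succ_log_self hb _
  have hiκ : p.s * i < κ := (Nat.pow_lt_pow_iff_right (by norm_num : 1 < 2)).1
    (hi1.trans_lt (hak.trans_lt hk))
  have hiℓ : i < 2 ^ p.ℓ := Nat.lt_of_mul_lt_mul_left (hiκ.trans hκ)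
  obtain ⟨hlo, hhi⟩ := hsp i hiℓ hiκ.le
  obtain ⟨G, hGA, hG, hGx⟩ := hlo.exists_good A hak hi2.le
  have hG0 : G.Nonempty := card_pos.1 (by omega)
  -- The isolated components `G` are at least half of all `a` first components, so one of them has
  -- at most the average `2 * #S / a` of partners.
  have hfib : ∃ x ∈ G, #{z ∈ S | z.1 = x} * a ≤ 2 * #S := by
    by_contra hcon
    push Not at hcon
    have h1 : ∑ x ∈ G, 2 * #S < ∑ x ∈ G, #{z ∈ S | z.1 = x} * a :=
      Finset.sum_lt_sum_of_nonempty hG0 hcon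
    rw [Finset.sum_const, ← Finset.sum_mul, smul_eq_mul] at h1
    have h2 : ∑ x ∈ G, #{z ∈ S | z.1 = x} ≤ #S := by
      rw [card_eq_sum_card_fiberwise (f := Prod.fst) (s := S) (t := A)
        (fun z hz => mem_image_of_mem _ hz)]
      exact Finset.sum_le_sum_of_subset hGA
    have h3 := Nat.mul_le_mul_right a h2
    have h4 := Nat.mul_le_mul_right #S hG
    nlinarith
  obtain ⟨x, hx, hxS⟩ := hfib
  set Y := ({z ∈ S | z.1 = x} : Finset _).image Prod.snd with hY
  have hY0 : Y.Nonempty := by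
    obtain ⟨z, hz, e⟩ := mem_image.1 (hGA hx)
    exact ⟨z.2, mem_image_of_mem _ (mem_filter.2 ⟨hz, e⟩)⟩
  have hYc : #Y ≤ #{z ∈ S | z.1 = x} := card_image_le
  -- From `a ≥ 2 ^ (s * i)` and `#S < 2 ^ κ`; the factor 2 accounts for the `+ 1`.
  have hY1 : #Y ≤ 2 ^ (κ + 1 - p.s * i) := by
    have h1 : #Y * 2 ^ (p.s * i) ≤ 2 ^ (κ + 1 - p.s * i) * 2 ^ (p.s * i) := by
      rw [← pow_add, Nat.sub_add_cancel (by omega), pow_succ]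
      calc #Y * 2 ^ (p.s * i) ≤ #{z ∈ S | z.1 = x} * a := Nat.mul_le_mul hYc hi1
        _ ≤ _ := by omega
    exact Nat.le_of_mul_le_mul_right h1 (by positivity)
  obtain ⟨G', hGY, hG', hGy⟩ := hhi.exists_good Y
    (hYc.trans ((card_le_card (filter_subset _ _)).trans hSk)) hY1
  have hG0' : G'.Nonempty := card_pos.1 (by have := card_pos.2 hY0; omega)
  obtain ⟨y, hy⟩ := hG0'
  obtain ⟨T₁, hT₁, hc₁, hu₁⟩ := hGx x hx
  obtain ⟨T₂, hT₂, hc₂, hu₂⟩ := hGy y hy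
  -- Both are more than half of the coordinates of the same scale.
  have hT : (T₁ ∩ T₂).Nonempty := by
    rw [← card_pos]
    have h1 := card_union_add_card_inter T₁ T₂
    have h2 := card_le_card (union_subset hT₁ hT₂)
    omega
  obtain ⟨j, hj⟩ := hT
  obtain ⟨hj₁, hj₂⟩ := mem_inter.1 hj
  obtain ⟨z, hz, e⟩ := mem_image.1 (hGY hy)
  obtain ⟨hzS, hzx⟩ := mem_filter.1 hz
  have hmb : p.mb j = 8 + 2 * p.s + i * p.s := by
    unfold Par.mb
    rw [(mem_filter.1 (hT₁ hj₁)).2]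
  refine ⟨z, hzS, j, j.2, fun z' hz' hne heq => ?_⟩
  unfold slot at heq
  rw [hmb] at heq
  -- A rival with the same first component is told apart by the high bits, any other one by the low
  -- bits.
  by_cases hx' : z'.1 = x
  · have hy' : z'.2 ≠ y := fun e' => hne (Prod.ext (hx'.trans hzx.symm) (e'.trans e.symm))
    have h1 := congrArg (· / 2 ^ (8 + 2 * p.s + i * p.s)) heq
    simp only [mux_div] at h1
    rw [e] at h1
    exact hu₂ j hj₂ z'.2 (mem_image_of_mem _ (mem_filter.2 ⟨hz', hx'⟩)) hy' h1
  · have h1 := congrArg (· % 2 ^ (8 + 2 * p.s + i * p.s)) heq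
    simp only [mux_mod] at h1
    rw [hzx] at h1
    exact hu₁ j hj₁ z'.1 (mem_image_of_mem _ hz') hx' h1

end Par

theorem one_add_pow_sub_one_le {x : ℝ} (hx : 0 ≤ x) {n : ℕ} (h : n * x ≤ 1) :
    (1 + x) ^ n - 1 ≤ 2 * (n * x) := by
  have h1 : (1 + x) ^ n ≤ Real.exp (n * x) := by
    rw [Real.exp_nat_mul]
    exact pow_le_pow_left₀ (by linarith) (by linarith [Real.add_one_le_exp x]) n
  have h2 := Real.abs_exp_sub_one_le (x := n * x) (by rw [abs_of_nonneg (by positivity)]; exact h)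
  rw [abs_of_nonneg (a := (n : ℝ) * x) (by positivity)] at h2
  linarith [le_abs_self (Real.exp (n * x) - 1)]

-- Union bound over all sets `A` of keys. For fixed `A` the vectors are uniform, so failure has
-- probability at most `ω ^ #A`. Summed over all nonempty sets of `n` keys this is `(1 + ω) ^ n -
-- 1`, which is at most `2 * n * ω`. The bound `hc` says that a set of `c` elements is small enough
-- for the moment estimate.
open Classical in
theorem Par.card_not_spread {p : Par} (hs : p.s < p.M) {N k h c b e : ℕ} (hN : 2 * p.thr h ≤ N)
    {f : XV p.M → ℕ} (hf : ∀ y, #{u | f u = y} ≤ b) (hc : c * 2 ^ (8 + p.s) * b ≤ 2 ^ p.M)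
    {T : Finset (Fin (2 ^ (h + p.δ)))} (hT : #T = 8 * e)
    (he : (2 : ℝ) ^ (p.s * 2 ^ h) * ((2 : ℝ) ^ (p.s * e))⁻¹ ≤ 1) :
    (#{F : Fin N → XV p.M | p.Peels k (ext F) h ∧ ¬ Spread k c T f (p.vec (ext F) h)} : ℝ) ≤
      Fintype.card (Fin N → XV p.M) * (2 * ((2 : ℝ) ^ (p.s * 2 ^ h) * ((2 : ℝ) ^ (p.s * e))⁻¹)) := by
  set Ω := Fintype.card (Fin N → XV p.M) with hΩ
  set ω : ℝ := ((2 : ℝ) ^ (p.s * e))⁻¹ with hω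
  have hω0 : 0 < ω := by positivity
  set bad : (A : Finset (Key p.s h)) → Finset (A → Fin (2 ^ (h + p.δ)) → XV p.M) := fun A =>
    {ψ | ¬ Fintype.card A ≤ 2 * #{x : A | #T < 2 *
      #{j ∈ T | ∀ x' : A, x' ≠ x → f (ψ x' j) ≠ f (ψ x j)}}} with hbad
  set ev : Finset (Key p.s h) → Finset (Fin N → XV p.M) := fun A =>
    {F | p.Peels k (ext F) h ∧
      (fun (x : A) (j : Fin (2 ^ (h + p.δ))) => p.vec (ext F) h x j) ∈ bad A} with hev
  have h1 : ∀ A : Finset (Key p.s h), #A ≤ k → #A ≤ c → (#(ev A) : ℝ) ≤ Ω * ω ^ #A := by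
    intro A hAk hAc
    have g1 := Par.card_vec_mem hs hN A hAk (bad A)
    have g2 := card_many_collisions (A := A) f hf (e := p.s) (d := e) (by
      rw [Fintype.card_coe, XV.card]
      exact le_trans (by gcongr) hc) T hT (bad A) (fun ψ hψ => (mem_filter.1 hψ).2)
    have g3 : #{F : Fin N → XV p.M | p.Peels k (ext F) h} ≤ Ω := card_le_univ _
    rw [Fintype.card_coe] at g2
    set W := Fintype.card (A → Fin (2 ^ (h + p.δ)) → XV p.M) with hW
    have hW0 : 0 < W := Fintype.card_pos
    have g4 : #(ev A) * W * 2 ^ (p.s * (#A * e)) ≤ Ω * W := by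
      rw [hev]
      simp only
      rw [g1, mul_assoc]
      exact Nat.mul_le_mul g3 g2
    have g5 : #(ev A) * 2 ^ (p.s * (#A * e)) ≤ Ω := by
      refine Nat.le_of_mul_le_mul_right (c := W) ?_ hW0
      calc _ = #(ev A) * W * 2 ^ (p.s * (#A * e)) := by ring
        _ ≤ _ := g4
    have g6 : (#(ev A) : ℝ) * 2 ^ (p.s * (#A * e)) ≤ Ω := by exact_mod_cast g5
    have g7 : ω ^ #A = ((2 : ℝ) ^ (p.s * (#A * e)))⁻¹ := by
      rw [hω, inv_pow, ← pow_mul]; congr 2; ring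
    rw [g7, ← div_eq_mul_inv, le_div_iff₀ (by positivity)]
    exact g6
  have h2 : ({F | p.Peels k (ext F) h ∧ ¬ Spread k c T f (p.vec (ext F) h)} :
      Finset (Fin N → XV p.M)) ⊆
      ({A | A.Nonempty ∧ #A ≤ k ∧ #A ≤ c} : Finset (Finset (Key p.s h))).biUnion ev := by
    intro F hF
    simp only [mem_filter, mem_univ, true_and, Spread, not_forall] at hF
    obtain ⟨hP, A, hAk, hAc, hA⟩ := hF
    simp only [mem_biUnion, mem_filter, mem_univ, true_and]
    refine ⟨A, ⟨?_, hAk, hAc⟩, ?_⟩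
    · rw [nonempty_iff_ne_empty]
      rintro rfl
      exact hA (by simp)
    · simp only [hev, hbad, mem_filter, mem_univ, true_and]
      exact ⟨hP, hA⟩
  calc _ ≤ ((∑ A ∈ ({A | A.Nonempty ∧ #A ≤ k ∧ #A ≤ c} : Finset (Finset (Key p.s h))), #(ev A) : ℕ) : ℝ) := by
        exact_mod_cast (card_le_card h2).trans card_biUnion_le
    _ ≤ ∑ A ∈ ({A | A.Nonempty ∧ #A ≤ k ∧ #A ≤ c} : Finset (Finset (Key p.s h))), Ω * ω ^ #A := by
        push_cast
        refine Finset.sum_le_sum fun A hA => ?_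
        have := (mem_filter.1 hA).2
        exact h1 A this.2.1 this.2.2
    _ ≤ ∑ A ∈ (univ.erase ∅ : Finset (Finset (Key p.s h))), Ω * ω ^ #A := by
        refine Finset.sum_le_sum_of_subset_of_nonneg (fun A hA => ?_) fun A _ _ => by positivity
        exact mem_erase.2 ⟨(mem_filter.1 hA).2.1.ne_empty, mem_univ _⟩
    _ = Ω * ((1 + ω) ^ Fintype.card (Key p.s h) - 1) := by
        rw [← Finset.mul_sum]
        have g1 := Finset.sum_pow_mul_eq_add_pow ω 1 (univ : Finset (Key p.s h))
        simp only [one_pow, mul_one, powerset_univ, card_univ] at g1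
        rw [add_comm 1 ω, ← g1, ← Finset.add_sum_erase _ _ (mem_univ ∅)]
        simp
    _ ≤ _ := by
        have g2 := one_add_pow_sub_one_le hω0.le (n := Fintype.card (Key p.s h)) (by
          rw [Key.card]; push_cast; exact he)
        rw [Key.card] at g2
        push_cast at g2
        rw [Key.card]
        exact mul_le_mul_of_nonneg_left g2 (by positivity)

end WordRAM

/-! ### Probability that peeling fails, over all scales and heights. -/

namespace WordRAM

open Finset

-- There are two conditions for each of at most `2 ^ ℓ` scales, and each fails with probability at
-- most `2 * q`. The coordinates of a scale double in number with the height, like the characters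
-- below a node, but outnumber them by a large constant; so `q` is small enough to leave the factor
-- `2 ^ (-h)` that is summed later.
open Classical in
theorem Par.card_not_peel {p : Par} {k κ N h : ℕ} (hδ : p.δ = 10 + 2 * p.ℓ)
    (hM : p.M = κ + 3 * p.s + 17) (hk : k < 2 ^ κ) (hκ : κ < p.s * 2 ^ p.ℓ)
    (hN : 2 * p.thr h ≤ N) :
    (#{F : Fin N → XV p.M | p.Peels k (ext F) h ∧
      ¬ Peel k (2 ^ (h + p.δ)) (p.slot (ext F) h)} : ℝ) ≤
      Fintype.card (Fin N → XV p.M) * ((2 : ℝ) ^ (64 * p.s + 1 + h))⁻¹ := by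
  have hs0 : 0 < p.s := by unfold Par.s; positivity
  have hs : p.s < p.M := by omega
  set Ω := Fintype.card (Fin N → XV p.M) with hΩ
  set q : ℝ := (2 : ℝ) ^ (p.s * 2 ^ h) * ((2 : ℝ) ^ (p.s * 2 ^ (h + 7 + p.ℓ)))⁻¹ with hq
  have hP : 2 ^ (h + 7 + p.ℓ) = 128 * (2 ^ h * 2 ^ p.ℓ) := by rw [pow_add, pow_add]; ring
  have hh : 2 ^ h ≤ 2 ^ h * 2 ^ p.ℓ := Nat.le_mul_of_pos_right _ (by positivity)
  have hℓ : 2 ^ p.ℓ ≤ 2 ^ h * 2 ^ p.ℓ := Nat.le_mul_of_pos_left _ (by positivity)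
  set P := 2 ^ h * 2 ^ p.ℓ with hPdef
  have hP1 : 1 ≤ P := Nat.one_le_iff_ne_zero.2 (by positivity)
  have hexp : p.ℓ + 2 + p.s * 2 ^ h + (64 * p.s + 1 + h) ≤ p.s * 2 ^ (h + 7 + p.ℓ) := by
    rw [hP]
    have h1 : p.ℓ < P := Nat.lt_two_pow_self.trans_le hℓ
    have h2 : h < P := Nat.lt_two_pow_self.trans_le hh
    have h3 : p.s * 2 ^ h ≤ p.s * P := Nat.mul_le_mul_left _ hh
    have h4 : P ≤ p.s * P := Nat.le_mul_of_pos_left _ hs0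
    have h5 : p.s ≤ p.s * P := Nat.le_mul_of_pos_right _ hP1
    have h6 : p.s * (128 * P) = 128 * (p.s * P) := by ring
    omega
  have hq1 : q ≤ 1 := by
    rw [hq, ← div_eq_mul_inv, div_le_one (by positivity)]
    exact pow_le_pow_right₀ (by norm_num) (by omega)
  have hqb : 2 ^ p.ℓ * 4 * q ≤ ((2 : ℝ) ^ (64 * p.s + 1 + h))⁻¹ := by
    rw [hq, ← mul_assoc, ← div_eq_mul_inv, inv_eq_one_div, div_le_div_iff₀ (by positivity) (by positivity),
      one_mul, show (4 : ℝ) = 2 ^ 2 by norm_num, ← pow_add, ← pow_add, ← pow_add]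
    exact pow_le_pow_right₀ (by norm_num) hexp
  have hT : ∀ i < 2 ^ p.ℓ, #(scale p.ℓ (2 ^ (h + p.δ)) i) = 8 * 2 ^ (h + 7 + p.ℓ) := by
    intro i hi
    -- Here `δ = 10 + 2 * ℓ` is used: one `ℓ` divides the coordinates into scales, the other makes
    -- each scale large enough for the union bound over scales.
    have e : h + p.δ = (h + 10 + p.ℓ) + p.ℓ := by omega
    rw [e, card_scale hi, show h + 10 + p.ℓ = 3 + (h + 7 + p.ℓ) by ring, pow_add 2 3]
    norm_num
  set I : Finset ℕ := {i ∈ Finset.range (2 ^ p.ℓ) | p.s * i ≤ κ} with hI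
  set lo : ℕ → Finset (Fin N → XV p.M) := fun i => {F | p.Peels k (ext F) h ∧
    ¬ Spread k (2 ^ (p.s * (i + 1))) (scale p.ℓ (2 ^ (h + p.δ)) i)
        (fun u => u.val % 2 ^ (8 + 2 * p.s + i * p.s)) (p.vec (ext F) h)} with hlo
  set hi : ℕ → Finset (Fin N → XV p.M) := fun i => {F | p.Peels k (ext F) h ∧
    ¬ Spread k (2 ^ (κ + 1 - p.s * i)) (scale p.ℓ (2 ^ (h + p.δ)) i)
        (fun u => u.val / 2 ^ (8 + 2 * p.s + i * p.s)) (p.vec (ext F) h)} with hhi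
  have hlo1 : ∀ i ∈ I, (#(lo i) : ℝ) ≤ Ω * (2 * q) := by
    intro i hi
    obtain ⟨h1, h2⟩ := mem_filter.1 hi
    refine Par.card_not_spread hs hN (fun y => XV.card_mod_le (8 + 2 * p.s + i * p.s) y) ?_
      (hT i (Finset.mem_range.1 h1)) hq1
    -- The low part has just enough bits: `s * (i + 1)` for the size of the set and `8 + s` for the
    -- weight.
    rw [← pow_add, ← pow_add]
    refine Nat.pow_le_pow_right (by norm_num) ?_
    have : p.s * (i + 1) = p.s * i + p.s := by ring
    have : i * p.s = p.s * i := by ring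
    omega
  have hhi1 : ∀ i ∈ I, (#(hi i) : ℝ) ≤ Ω * (2 * q) := by
    intro i hi
    obtain ⟨h1, h2⟩ := mem_filter.1 hi
    refine Par.card_not_spread hs hN (fun y => XV.card_div_le (8 + 2 * p.s + i * p.s) y) ?_
      (hT i (Finset.mem_range.1 h1)) hq1
    -- The exponents `κ + 1 - s * i`, `8 + s` and `8 + 2 * s + i * s` add up to `κ + 3 * s + 17`,
    -- which is `M`.
    rw [← pow_add, ← pow_add]
    refine Nat.pow_le_pow_right (by norm_num) ?_
    have : i * p.s = p.s * i := by ring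
    omega
  have hsub : ({F | p.Peels k (ext F) h ∧ ¬ Peel k (2 ^ (h + p.δ)) (p.slot (ext F) h)} :
      Finset (Fin N → XV p.M)) ⊆ I.biUnion fun i => lo i ∪ hi i := by
    intro F hF
    obtain ⟨hF1, hF2⟩ := (mem_filter.1 hF).2
    by_contra hcon
    refine hF2 (Par.peel_slot hk hκ fun i hi hiκ => ?_)
    simp only [mem_biUnion, mem_union, hlo, hhi, mem_filter, mem_univ, true_and, not_exists, not_and,
      not_or, hF1, not_not] at hcon
    exact hcon i (mem_filter.2 ⟨Finset.mem_range.2 hi, hiκ⟩)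
  have hIc : #I ≤ 2 ^ p.ℓ := (card_filter_le _ _).trans (card_range _).le
  calc _ ≤ ((∑ i ∈ I, (#(lo i) + #(hi i)) : ℕ) : ℝ) := by
        exact_mod_cast (card_le_card hsub).trans (card_biUnion_le.trans
          (Finset.sum_le_sum fun i _ => card_union_le _ _))
    _ ≤ ∑ i ∈ I, (Ω * (2 * q) + Ω * (2 * q)) := by
        push_cast
        exact Finset.sum_le_sum fun i hi => add_le_add (hlo1 i hi) (hhi1 i hi)
    _ = #I * (4 * Ω * q) := by rw [Finset.sum_const, nsmul_eq_mul]; ring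
    _ ≤ 2 ^ p.ℓ * (4 * Ω * q) := by
        refine mul_le_mul_of_nonneg_right ?_ (by positivity)
        exact_mod_cast hIc
    _ = Ω * (2 ^ p.ℓ * 4 * q) := by ring
    _ ≤ _ := mul_le_mul_of_nonneg_left hqb (by positivity)

-- A failure is attributed to the first height where it occurs, and the bounds form a geometric
-- series.
open Classical in
theorem Par.card_not_peels {p : Par} {k κ N : ℕ} (hδ : p.δ = 10 + 2 * p.ℓ)
    (hM : p.M = κ + 3 * p.s + 17) (hk : k < 2 ^ κ) (hκ : κ < p.s * 2 ^ p.ℓ) (h : ℕ)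
    (hN : ∀ h' < h, 2 * p.thr h' ≤ N) :
    (#{F : Fin N → XV p.M | ¬ p.Peels k (ext F) h} : ℝ) ≤
      Fintype.card (Fin N → XV p.M) * (((2 : ℝ) ^ (64 * p.s))⁻¹ * (1 - ((2 : ℝ) ^ h)⁻¹)) := by
  induction h with
  | zero => simp [Par.Peels]
  | succ h ih =>
    have h1 := ih fun h' hh => hN h' (by omega)
    have h2 := Par.card_not_peel hδ hM hk hκ (hN h (by omega))
    have h3 : ({F | ¬ p.Peels k (ext F) (h + 1)} : Finset (Fin N → XV p.M)) ⊆
        ({F | ¬ p.Peels k (ext F) h} : Finset (Fin N → XV p.M)) ∪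
        ({F | p.Peels k (ext F) h ∧ ¬ Peel k (2 ^ (h + p.δ)) (p.slot (ext F) h)} :
          Finset (Fin N → XV p.M)) := by
      intro F hF
      simp only [mem_filter, mem_univ, true_and, mem_union] at hF ⊢
      by_contra hcon
      push Not at hcon
      refine hF fun h' hh => ?_
      rcases Nat.lt_succ_iff_lt_or_eq.1 hh with hh | rfl
      exacts [hcon.1 h' hh, hcon.2 hcon.1]
    have h4 : (#({F | ¬ p.Peels k (ext F) (h + 1)} : Finset (Fin N → XV p.M)) : ℝ) ≤
        #({F | ¬ p.Peels k (ext F) h} : Finset (Fin N → XV p.M)) +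
        #({F | p.Peels k (ext F) h ∧ ¬ Peel k (2 ^ (h + p.δ)) (p.slot (ext F) h)} :
          Finset (Fin N → XV p.M)) := by
      exact_mod_cast (card_le_card h3).trans (card_union_le _ _)
    refine h4.trans ((add_le_add h1 h2).trans (le_of_eq ?_))
    rw [pow_add _ _ h, pow_succ, pow_succ _ h, mul_inv, mul_inv, mul_inv]
    ring

end WordRAM

/-! ### Laws of sequences of random numbers. -/

namespace WordRAM

open scoped ENNReal in
open Classical in
theorem tape_apply {rng : ℕ → ℕ} {n : ℕ} (hr : ∀ i < n, 0 < rng i) (g : ℕ → ℕ) :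
    tape rng n g = if (∀ i < n, g i < rng i) ∧ ∀ i, n ≤ i → g i = 0 then
      (∏ i ∈ Finset.range n, (rng i : ℝ≥0∞))⁻¹ else 0 := by
  induction n generalizing g with
  | zero =>
    simp only [tape, PMF.pure_apply, Finset.range_zero, Finset.prod_empty, inv_one]
    congr 1
    simp [funext_iff]
  | succ n ih =>
    have hn : (Finset.range (rng n)).Nonempty := Finset.nonempty_range_iff.2 (hr n (by omega)).ne'
    rw [tape_succ hn, PMF.bind_apply]
    rw [tsum_eq_single (fun i => if i = n then 0 else g i)]
    · rw [ih fun i hi => hr i (by omega), PMF.map_apply, tsum_eq_single (g n)]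
      · have e : g = fun i => if i = n then g n else if i = n then 0 else g i := by
          funext i
          by_cases h : i = n <;> simp [h]
        rw [if_pos e, PMF.uniformOfFinset_apply, Finset.card_range]
        have h1 : (∀ i < n, (if i = n then 0 else g i) < rng i) ∧
            (∀ i, n ≤ i → (if i = n then 0 else g i) = 0) ↔
            (∀ i < n, g i < rng i) ∧ ∀ i, n + 1 ≤ i → g i = 0 := by
          refine and_congr ⟨fun h i hi => ?_, fun h i hi => ?_⟩ ⟨fun h i hi => ?_, fun h i hi => ?_⟩
          · simpa [hi.ne] using h i hi
          · simpa [hi.ne] using h i hi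
          · simpa [show i ≠ n by omega] using h i (by omega)
          · split_ifs with h2
            exacts [rfl, h i (by omega)]
        have h2 : ((∀ i < n + 1, g i < rng i) ∧ ∀ i, n + 1 ≤ i → g i = 0) ↔
            ((∀ i < n, g i < rng i) ∧ ∀ i, n + 1 ≤ i → g i = 0) ∧ g n < rng n := by
          constructor
          · exact fun h => ⟨⟨fun i hi => h.1 i (by omega), h.2⟩, h.1 n (by omega)⟩
          · refine fun h => ⟨fun i hi => ?_, h.1.2⟩
            rcases Nat.lt_succ_iff_lt_or_eq.1 hi with hi | rfl
            exacts [h.1.1 i hi, h.2]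
        simp only [h1, h2, Finset.mem_range]
        by_cases h3 : (∀ i < n, g i < rng i) ∧ ∀ i, n + 1 ≤ i → g i = 0
        · by_cases h4 : g n < rng n
          · rw [if_pos h3, if_pos h4, if_pos ⟨h3, h4⟩, Finset.prod_range_succ, ENNReal.mul_inv]
            · exact Or.inr (ENNReal.natCast_ne_top _)
            · exact Or.inr (by exact_mod_cast (hr n (by omega)).ne')
          · simp [h4]
        · rw [if_neg h3, zero_mul, if_neg (not_and_of_not_left _ h3)]
      · intro v hv
        rw [if_neg]
        intro e
        exact hv (by simpa using (congrFun e n).symm)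
    · intro f hf
      by_cases h0 : tape rng n f = 0
      · rw [h0, zero_mul]
      · have hz : f n = 0 := (tape_support (fun i hi => hr i (by omega))
          ((PMF.mem_support_iff _ _).2 h0)).2 n le_rfl
        rw [mul_eq_zero]
        right
        rw [PMF.map_apply, ENNReal.tsum_eq_zero]
        intro v
        rw [if_neg]
        intro e
        refine hf (funext fun i => ?_)
        by_cases h : i = n
        · simp [h, hz]
        · simp [h, e]

open scoped ENNReal in
/-- The law of a tape as the image of a uniform distribution. -/
theorem tape_eq_map {rng : ℕ → ℕ} {n : ℕ} (hr : ∀ i < n, 0 < rng i) {Ω : Type*} [Fintype Ω]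
    [Nonempty Ω] (ι : Ω → ℕ → ℕ) (hι : Function.Injective ι)
    (h : ∀ g, g ∈ Set.range ι ↔ (∀ i < n, g i < rng i) ∧ ∀ i, n ≤ i → g i = 0) :
    tape rng n = (PMF.uniformOfFintype Ω).map ι := by
  classical
  set c : ℝ≥0∞ := (∏ i ∈ Finset.range n, (rng i : ℝ≥0∞))⁻¹ with hc
  have happ : ∀ g, tape rng n g = if g ∈ Set.range ι then c else 0 := fun g => by
    rw [tape_apply hr]
    simp only [h]
    congr
  have hsum := (tape rng n).tsum_coe
  have h1 : ∑' g, tape rng n g = ∑' ω, tape rng n (ι ω) := by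
    refine (hι.tsum_eq fun g hg => ?_).symm
    rw [Function.mem_support, happ] at hg
    by_contra hn
    exact hg (if_neg hn)
  rw [h1, tsum_fintype] at hsum
  simp only [happ, Set.mem_range_self, if_true, Finset.sum_const, Finset.card_univ, nsmul_eq_mul] at hsum
  -- The law is constant on its support, and total mass 1 determines the constant.
  have hcard : c = (Fintype.card Ω : ℝ≥0∞)⁻¹ := ENNReal.eq_inv_of_mul_eq_one_left (by rwa [mul_comm])
  refine PMF.ext fun g => ?_
  rw [happ, PMF.map_apply]
  by_cases hg : g ∈ Set.range ι
  · obtain ⟨ω, rfl⟩ := hg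
    rw [if_pos ⟨ω, rfl⟩, tsum_eq_single ω fun ω' hne => if_neg fun e => hne (hι e).symm, if_pos rfl,
      PMF.uniformOfFintype_apply, hcard]
  · rw [if_neg hg, eq_comm, ENNReal.tsum_eq_zero]
    exact fun ω => if_neg fun e => hg ⟨ω, e.symm⟩

/-- Uniformly random words. -/
theorem tape_words (w n : ℕ) : tape (fun _ => 2 ^ w) n =
    (PMF.uniformOfFintype (Fin n → XV w)).map fun ω i => (Par.ext ω i).val := by
  refine tape_eq_map (fun _ _ => by positivity) _ (fun ω ω' h => funext fun i => ?_) fun g => ?_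
  · have := congrFun h i
    simp only [Par.ext, i.2, dif_pos] at this
    exact XV.ext this
  · constructor
    · rintro ⟨ω, rfl⟩
      refine ⟨fun i _ => XV.lt _, fun i hi => ?_⟩
      simp [Par.ext, show ¬ i < n by omega]
    · rintro ⟨h1, h2⟩
      refine ⟨fun i => XV.mk (g i) (h1 i i.2), funext fun i => ?_⟩
      simp only [Par.ext]
      split_ifs with hi
      · rfl
      · exact (h2 i (by omega)).symm

end WordRAM

/-! ### From random words to random fields, and from keys to characters. -/

namespace WordRAM

namespace Par

variable {p : Par}

/-- The field number `n` of a sequence of words. -/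
def field (p : Par) (W : ℕ → ℕ) (n : ℕ) : XV p.M :=
  XV.mk (W (n / 2 ^ p.g) / 2 ^ (n % 2 ^ p.g * 2 ^ p.μ) % 2 ^ p.M) (Nat.mod_lt _ (by positivity))

/-- Reading the fields of a sequence of words. -/
def fields (p : Par) (n N : ℕ) : (Fin n → XV p.w) →+ (Fin N → XV p.M) where
  toFun ω i := p.field (fun a => (ext ω a).val) i
  map_zero' := by
    funext i
    ext
    simp [field, ext]
  map_add' ω ω' := by
    funext i
    ext
    simp only [field, ext_add, XV.val_add, XV.val_mk, Pi.add_apply]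
    generalize (i : ℕ) % 2 ^ p.g * 2 ^ p.μ = o
    rw [Nat.xor_div_two_pow, Nat.xor_mod_two_pow]

/-- Fields lie in disjoint slots of `2 ^ μ` bits, so any sequence of fields can be packed into
words. A surjective homomorphism takes uniform words to uniform fields. -/
theorem Valid.fields_surjective (hp : p.Valid) (ν : ℕ) :
    Function.Surjective (p.fields (2 ^ (ν - p.g)) (2 ^ ν)) := by
  intro F
  set v : ℕ → ℕ := fun n => (ext F n).val with hv
  have hred : Red (2 ^ p.μ) v := fun n =>
    (XV.lt _).trans_le (Nat.pow_le_pow_right (by norm_num) hp.hMμ)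
  have hlt : ∀ a, big (2 ^ p.μ) v (a * 2 ^ p.g) (2 ^ p.g) < 2 ^ p.w := by
    intro a
    rcases Nat.eq_zero_or_pos p.g with h | h
    · simp only [h, big, pow_zero, mul_one, Finset.range_one, Finset.sum_singleton, mul_zero, add_zero]
      exact (XV.lt _).trans_le (Nat.pow_le_pow_right (by norm_num) hp.hM)
    · refine (big_lt hred _).trans_le (Nat.pow_le_pow_right (by norm_num) ?_)
      rw [← pow_add, add_comm]
      exact hp.hg h
  refine ⟨fun a => XV.mk _ (hlt a), funext fun n => ?_⟩
  have hn : (n : ℕ) / 2 ^ p.g < 2 ^ (ν - p.g) := by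
    rw [Nat.div_lt_iff_lt_mul (by positivity), ← pow_add]
    exact n.2.trans_le (Nat.pow_le_pow_right (by norm_num) (by omega))
  ext
  simp only [fields, field, AddMonoidHom.coe_mk, ZeroHom.coe_mk, XV.val_mk]
  rw [ext, dif_pos hn]
  simp only [XV.val_mk]
  rw [mul_comm _ (2 ^ p.μ), ← Nat.mod_mod_of_dvd _ (Nat.pow_dvd_pow 2 hp.hMμ),
    big_digit hred (Nat.mod_lt _ (by positivity)), mul_comm, Nat.div_add_mod]
  simp only [hv, ext, n.2, dif_pos]
  exact Nat.mod_eq_of_lt (XV.lt _)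

theorem xsum_val {M : ℕ} (n : ℕ) (f : ℕ → XV M) :
    (∑ j ∈ Finset.range n, f j).val = xsum n fun j => (f j).val := by
  induction n with
  | zero => rfl
  | succ n ih => rw [Finset.sum_range_succ, XV.val_add, ih]; rfl

/-- The key below the node number `i` at height `h`. -/
def keyOf (s : ℕ) (c : ℕ → ℕ) : (h : ℕ) → ℕ → Key s h
  | 0, i => (⟨c i % 2 ^ s, Nat.mod_lt _ (by positivity)⟩ : Fin (2 ^ s))
  | h + 1, i => (keyOf s c h (2 * i), keyOf s c h (2 * i + 1))

theorem keyOf_inj {s : ℕ} {c c' : ℕ → ℕ} {h i : ℕ} (e : keyOf s c h i = keyOf s c' h i) :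
    ∀ n, i * 2 ^ h ≤ n → n < (i + 1) * 2 ^ h → c n % 2 ^ s = c' n % 2 ^ s := by
  induction h generalizing i with
  | zero =>
    intro n h1 h2
    have : n = i := by omega
    subst this
    exact congrArg (Fin.val (n := 2 ^ s)) e
  | succ h ih =>
    intro n h1 h2
    have e1 := congrArg Prod.fst e
    have e2 := congrArg Prod.snd e
    rw [pow_succ] at h1 h2
    rcases Nat.lt_or_ge n ((2 * i + 1) * 2 ^ h) with h3 | h3
    · exact ih e1 n (by nlinarith) h3
    · exact ih e2 n h3 (by nlinarith)

/-- Connects the number computed by the program with the group-valued vector used for the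
probabilities. -/
theorem nodeVal_eq (F : ℕ → XV p.M) {c : ℕ → ℕ} (hc : ∀ n, c n < 2 ^ p.s) (h i j : ℕ) :
    p.nodeVal (fun n => (F n).val) c h i j = (p.vec F h (keyOf p.s c h i) j).val := by
  induction h generalizing i j with
  | zero => simp [nodeVal, vec, keyOf, Nat.mod_eq_of_lt (hc i)]
  | succ h ih =>
    simp only [nodeVal, vec, keyOf, xsum_val, ih]

theorem char_lt (p : Par) (x n : ℕ) : p.char x n < 2 ^ p.s := Nat.mod_lt _ (by positivity)

/-- A number is determined by its pieces. -/
theorem eq_of_pieces {s n x y : ℕ} (hx : x < 2 ^ (s * n)) (hy : y < 2 ^ (s * n))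
    (h : ∀ i < n, x / 2 ^ (s * i) % 2 ^ s = y / 2 ^ (s * i) % 2 ^ s) : x = y := by
  induction n generalizing x y with
  | zero => simp at hx hy; omega
  | succ n ih =>
    have h0 := h 0 (by omega)
    simp only [mul_zero, pow_zero, Nat.div_one] at h0
    have h1 : x / 2 ^ s = y / 2 ^ s := by
      refine ih ?_ ?_ fun i hi => ?_
      · rw [Nat.div_lt_iff_lt_mul (by positivity), ← pow_add]; exact hx
      · rw [Nat.div_lt_iff_lt_mul (by positivity), ← pow_add]; exact hy
      · rw [Nat.div_div_eq_div_mul, Nat.div_div_eq_div_mul, ← pow_add]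
        have := h (i + 1) (by omega)
        rwa [show s * (i + 1) = s + s * i by ring] at this
    rw [← Nat.div_add_mod x (2 ^ s), ← Nat.div_add_mod y (2 ^ s), h0, h1]

/-- The characters of one word cover `s * 2 ^ π` bits. By `hxb` this is the whole word, or else the
key is a single word that fits into so many bits. -/
theorem char_inj {nu x y : ℕ} (hτ : nu ≤ 2 ^ (p.τ - p.π)) (hπ : p.π ≤ p.τ)
    (hx : x < 2 ^ (p.w * nu)) (hy : y < 2 ^ (p.w * nu))
    (hxb : p.w ≤ p.s * 2 ^ p.π ∨ nu = 1 ∧ x < 2 ^ (p.s * 2 ^ p.π) ∧ y < 2 ^ (p.s * 2 ^ p.π))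
    (h : ∀ n < 2 ^ p.τ, p.char x n = p.char y n) : x = y := by
  refine eq_of_pieces hx hy fun i hi => ?_
  have hb : x / 2 ^ (p.w * i) % 2 ^ p.w < 2 ^ (p.s * 2 ^ p.π) ∧
      y / 2 ^ (p.w * i) % 2 ^ p.w < 2 ^ (p.s * 2 ^ p.π) := by
    rcases hxb with hb | ⟨rfl, h1, h2⟩
    · have h0 : 2 ^ p.w ≤ 2 ^ (p.s * 2 ^ p.π) := Nat.pow_le_pow_right (by norm_num) hb
      exact ⟨(Nat.mod_lt _ (by positivity)).trans_le h0, (Nat.mod_lt _ (by positivity)).trans_le h0⟩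
    · exact ⟨((Nat.mod_le _ _).trans (Nat.div_le_self _ _)).trans_lt h1,
        ((Nat.mod_le _ _).trans (Nat.div_le_self _ _)).trans_lt h2⟩
  refine eq_of_pieces hb.1 hb.2 fun j hj => ?_
  have h1 : i * 2 ^ p.π + j < 2 ^ p.τ := by
    have h2 : (i + 1) * 2 ^ p.π ≤ 2 ^ (p.τ - p.π) * 2 ^ p.π :=
      Nat.mul_le_mul_right _ (by omega)
    rw [← pow_add, Nat.sub_add_cancel hπ, Nat.succ_mul] at h2
    omega
  have h3 := h _ h1
  unfold Par.char at h3
  have h4 : (i * 2 ^ p.π + j) / 2 ^ p.π = i := by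
    rw [mul_comm, Nat.mul_add_div (by positivity), Nat.div_eq_of_lt hj, add_zero]
  have h5 : (i * 2 ^ p.π + j) % 2 ^ p.π = j := by
    rw [mul_comm, Nat.mul_add_mod, Nat.mod_eq_of_lt hj]
  rw [h4, h5, mul_comm j] at h3
  exact h3

end Par

end WordRAM

/-! ### Families that are images of homomorphisms. -/

section linear

variable {G U : Type*} [AddCommGroup G] {r : ℕ} [NeZero r]

/-- The functions given by a homomorphism. -/
def homFun (L : G →+ (U → ZMod r)) (V : G) (x : U) : Fin r := ⟨(L V x).val, ZMod.val_lt _⟩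

theorem homFun_eq_iff (L : G →+ (U → ZMod r)) (V V' : G) : homFun L V = homFun L V' ↔ L V = L V' := by
  constructor
  · intro h
    funext x
    exact ZMod.val_injective r (congrArg Fin.val (congrFun h x))
  · intro h
    funext x
    simp [homFun, h]

variable [Fintype G] [Fintype U]

-- Each function in the image is given by as many elements as the kernel has.
open Finset in
open Classical in
theorem card_homFun_mem (L : G →+ (U → ZMod r)) (S : Set (U → Fin r)) (hS : S ⊆ Set.range (homFun L)) :
    #{V | homFun L V ∈ S} = S.ncard * #{V | L V = 0} := by
  rw [Set.ncard_eq_toFinset_card', card_eq_sum_card_fiberwise (f := homFun L) (t := S.toFinset)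
    (fun V hV => by simpa using hV), ← smul_eq_mul, ← Finset.sum_const]
  refine Finset.sum_congr rfl fun f hf => ?_
  obtain ⟨V, rfl⟩ := hS (Set.mem_toFinset.1 hf)
  rw [filter_filter, ← AddMonoidHom.card_fiber_eq_of_mem_range L (⟨V, rfl⟩ : L V ∈ Set.range L) ⟨0, map_zero L⟩]
  congr 1
  ext V'
  simp only [mem_filter, mem_univ, true_and, homFun_eq_iff]
  exact ⟨fun h => h.2, fun h => ⟨((homFun_eq_iff L V' V).2 h) ▸ Set.mem_toFinset.1 hf, h⟩⟩

open Finset in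
open Classical in
theorem card_homFun (L : G →+ (U → ZMod r)) :
    Fintype.card G = (Set.range (homFun L)).ncard * #{V | L V = 0} := by
  rw [← card_homFun_mem L _ subset_rfl]
  simp

open Finset in
open Classical in
/-- A family that is the range of a homomorphism is `k`-independent if the values on any `k` keys can
be prescribed. -/
theorem kIndependent_range_homFun {k : ℕ} (L : G →+ (U → ZMod r))
    (hL : ∀ l ≤ k, ∀ x : Fin l → U, Function.Injective x → ∀ y : Fin l → ZMod r, ∃ V, ∀ i, L V (x i) = y i) :
    KIndependent k (Set.range (homFun L)) := by
  intro l hl x hx y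
  set S : Set (U → Fin r) := {f ∈ Set.range (homFun L) | ∀ i, f (x i) = y i} with hS
  set c := #{V | L V = 0} with hc
  have hc0 : 0 < c := card_pos.2 ⟨0, by simp⟩
  have h1 := card_homFun_mem L S fun f hf => hf.1
  have h2 := card_homFun L
  set L' : G →+ (Fin l → ZMod r) :=
    { toFun := fun V i => L V (x i)
      map_zero' := by funext i; simp
      map_add' := fun V V' => by funext i; simp } with hL'
  have h3 := L'.card_preimage_mul (fun y => by
    obtain ⟨V, hV⟩ := hL l hl x hx y
    exact ⟨V, funext hV⟩) {fun i => ((y i : ℕ) : ZMod r)}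
  have h4 : #{V | L' V ∈ ({fun i => ((y i : ℕ) : ZMod r)} : Finset (Fin l → ZMod r))} =
      S.ncard * c := by
    rw [hc, ← h1]
    congr 1
    ext V
    simp only [mem_filter, mem_univ, true_and, mem_singleton, hS, Set.mem_ofPred_eq, Set.mem_range_self,
      funext_iff, hL', AddMonoidHom.coe_mk, ZeroHom.coe_mk]
    refine forall_congr' fun i => ?_
    constructor
    · intro h
      ext
      simp only [homFun, h, ZMod.val_natCast, Nat.mod_eq_of_lt (y i).2]
    · intro h
      have := congrArg Fin.val h
      simp only [homFun] at this
      rw [← this, ZMod.natCast_zmod_val]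
  rw [h4, Fintype.card_fun, ZMod.card, Fintype.card_fin, card_singleton, one_mul, h2] at h3
  have h5 : S.ncard * r ^ l = (Set.range (homFun L)).ncard :=
    Nat.eq_of_mul_eq_mul_right hc0 (by linarith)
  have hr : (0 : ℝ) < r := by exact_mod_cast Nat.pos_of_ne_zero (NeZero.ne r)
  have h6 : 0 < (Set.range (homFun L)).ncard :=
    (Set.ncard_pos (Set.toFinite _)).2 ⟨_, 0, rfl⟩
  rw [Fintype.card_fin, ← h5]
  have h7 : (0 : ℝ) < S.ncard := by
    have : 0 < S.ncard := Nat.pos_of_ne_zero fun h => by rw [← h5, h] at h6; simp at h6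
    exact_mod_cast this
  push_cast
  field_simp

end linear

/-! ### The drawn table of values. -/

namespace WordRAM

namespace Par

variable {p : Par}

theorem range_le (hp : p.Valid) {m : ℕ → ℕ} (hm : Fam p m) (n : ℕ) : p.range m n ≤ 2 ^ 2 ^ p.ρ := by
  have hone : 1 ≤ 2 ^ 2 ^ p.ρ := Nat.one_le_two_pow
  have hnr := hp.hnr
  have hlt : n % 2 ^ p.q < 2 ^ p.q := Nat.mod_lt _ (by positivity)
  unfold range
  split_ifs with h
  · exact Nat.pow_le_pow_right (by norm_num) (hp.hwρ (by omega))
  · rcases Nat.lt_or_ge (n % 2 ^ p.q) p.nr with h1 | h1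
    · by_cases h2 : p.nr = 1
      · have h3 := hm.R
        have h4 := hp.hRρ h2
        rw [h2] at h3
        simp [big] at h3
        rw [show n % 2 ^ p.q = 0 by omega, add_zero, h3]
        exact h4
      · exact (hm.red _).trans_le (Nat.pow_le_pow_right (by norm_num) (hp.hwρ h2))
    · rw [hm.pad _ h1 hlt]
      simpa using hone

/-- The table is zero at first and each digit is added at its own position. Hence a word has the
drawn numbers as digits in base `2 ^ 2 ^ ρ`, where digits not yet drawn count as zero. -/
theorem sampleMem_eq {m φ : ℕ → ℕ} (hm : ∀ a, p.bV ≤ a → m a = 0) (i a : ℕ) :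
    p.sampleMem m φ i (p.bV + a) =
      big (2 ^ p.ρ) (fun n => if n < i then φ n else 0) (a * 2 ^ p.gr) (2 ^ p.gr) := by
  induction i with
  | zero => simp [sampleMem, hm, big]
  | succ i ih =>
    have h1 : big (2 ^ p.ρ) (fun n => if n < i + 1 then φ n else 0) (a * 2 ^ p.gr) (2 ^ p.gr) =
        big (2 ^ p.ρ) (fun n => if n < i then φ n else 0) (a * 2 ^ p.gr) (2 ^ p.gr) +
        ∑ j ∈ Finset.range (2 ^ p.gr), if a * 2 ^ p.gr + j = i then φ i * 2 ^ (2 ^ p.ρ * j) else 0 := by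
      unfold big
      rw [← Finset.sum_add_distrib]
      refine Finset.sum_congr rfl fun j _ => ?_
      beta_reduce
      rcases lt_trichotomy (a * 2 ^ p.gr + j) i with h | h | h
      · rw [if_pos (by omega), if_pos h, if_neg h.ne, add_zero]
      · rw [if_pos (by omega), if_neg (by omega), if_pos h, h, zero_mul, zero_add]
      · rw [if_neg (by omega), if_neg (by omega), if_neg (by omega), zero_mul, add_zero]
    rw [h1, ← ih]
    simp only [sampleMem]
    have hlt : i % 2 ^ p.gr < 2 ^ p.gr := Nat.mod_lt _ (by positivity)
    have hdm := Nat.div_add_mod' i (2 ^ p.gr)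
    split_ifs with h
    · have ha : a = i / 2 ^ p.gr := by omega
      rw [Finset.sum_eq_single (i % 2 ^ p.gr)]
      · rw [if_pos (by rw [ha]; omega), mul_comm (2 ^ p.ρ)]
      · intro j _ hne
        rw [if_neg]
        rw [ha]
        omega
      · intro hn
        exact absurd (Finset.mem_range.2 hlt) hn
    · rw [Finset.sum_eq_zero, add_zero]
      intro j hj
      have hj := Finset.mem_range.1 hj
      rw [if_neg]
      intro e
      refine h ?_
      rw [← e, mul_comm a, Nat.mul_add_div (by positivity), Nat.div_eq_of_lt hj, add_zero]

/-- The sequences that `sampleProg` may draw. -/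
def Box (p : Par) (m : ℕ → ℕ) (φ : ℕ → ℕ) : Prop :=
  (∀ i < p.NV, φ i < p.range m i) ∧ ∀ i, p.NV ≤ i → φ i = 0

theorem Box.red {m φ : ℕ → ℕ} (hm : Fam p m) (hφ : p.Box m φ) : Red p.w φ := fun n => by
  rcases Nat.lt_or_ge n p.NV with h | h
  · refine (hφ.1 n h).trans_le ?_
    unfold range
    split_ifs
    exacts [le_rfl, hm.red _]
  · rw [hφ.2 n h]; positivity

theorem range_pos' (p : Par) (m : ℕ → ℕ) : ∀ i < p.NV, 0 < p.range m i := fun i _ => p.range_pos m i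

theorem mem_support_tape {m φ : ℕ → ℕ} : φ ∈ (tape (p.range m) p.NV).support ↔ p.Box m φ := by
  rw [PMF.mem_support_iff, tape_apply (p.range_pos' m)]
  simp only [Box, ne_eq, ite_eq_right_iff, not_forall, exists_prop, ENNReal.inv_eq_zero,
    and_iff_left_iff_imp]
  exact fun _ => (ENNReal.prod_lt_top fun i _ => ENNReal.natCast_lt_top _).ne

theorem dig_sampleMem (hp : p.Valid) {m φ : ℕ → ℕ} (hm : Fam p m) (hφ : p.Box m φ) (n : ℕ) :
    p.dig (p.sampleMem m φ p.NV) n = φ n := by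
  have hf : (fun n => if n < p.NV then φ n else 0) = φ := by
    funext n
    split_ifs with h
    exacts [rfl, (hφ.2 n (by omega)).symm]
  have hred : Red (2 ^ p.ρ) φ := fun n => by
    rcases Nat.lt_or_ge n p.NV with h | h
    · exact (hφ.1 n h).trans_le (range_le hp hm n)
    · rw [hφ.2 n h]; positivity
  unfold dig
  rw [sampleMem_eq hm.V, hf, mul_comm (n % _), big_digit hred (Nat.mod_lt _ (by positivity)),
    Nat.div_add_mod']

theorem vval_sampleMem (hp : p.Valid) {m φ : ℕ → ℕ} (hm : Fam p m) (hφ : p.Box m φ) (e : ℕ) :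
    p.vval (p.sampleMem m φ p.NV) e = big p.w φ (e * 2 ^ p.q) p.nr :=
  Finset.sum_congr rfl fun i _ => by rw [dig_sampleMem hp hm hφ]

/-- The leading word of the largest value. -/
theorem R_div (hp : p.Valid) {m : ℕ → ℕ} (hm : Fam p m) :
    p.R / 2 ^ (p.w * (p.nr - 1)) = m (p.bR + (p.nr - 1)) := by
  have hnr := hp.hnr
  obtain ⟨n, hn⟩ : ∃ n, p.nr = n + 1 := ⟨p.nr - 1, by omega⟩
  rw [← hm.R, hn, big_succ, Nat.add_sub_cancel, Nat.add_mul_div_right _ _ (by positivity),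
    Nat.div_eq_of_lt (big_lt hm.red n), zero_add]

theorem NV_eq (hp : p.Valid) : p.NV = 2 ^ (p.τ - 1 + p.δ + p.M) * 2 ^ p.q := by
  unfold Par.NV
  rw [← pow_add]; congr 1
  have := hp.hτ
  omega

theorem Box.index (hp : p.Valid) {e i : ℕ} (he : e < 2 ^ (p.τ - 1 + p.δ + p.M)) (hi : i < 2 ^ p.q) :
    e * 2 ^ p.q + i < p.NV ∧ (e * 2 ^ p.q + i) % 2 ^ p.q = i ∧ (e * 2 ^ p.q + i) / 2 ^ p.q = e := by
  refine ⟨?_, by rw [Nat.mul_add_mod', Nat.mod_eq_of_lt hi], by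
    rw [mul_comm, Nat.mul_add_div (by positivity), Nat.div_eq_of_lt hi, add_zero]⟩
  rw [NV_eq hp]
  have := Nat.mul_le_mul_right (2 ^ p.q) (Nat.succ_le_of_lt he)
  rw [Nat.succ_mul] at this
  omega

/-- A drawn value exceeds the largest value only in the words below the leading one. -/
theorem Box.big_lt (hp : p.Valid) {m φ : ℕ → ℕ} (hm : Fam p m) (hφ : p.Box m φ) {e : ℕ}
    (he : e < 2 ^ (p.τ - 1 + p.δ + p.M)) : big p.w φ (e * 2 ^ p.q) p.nr <
      (p.R / 2 ^ (p.w * (p.nr - 1)) + 1) * 2 ^ (p.w * (p.nr - 1)) := by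
  have hnr := hp.hnr
  have hq := hp.hq
  rw [R_div hp hm]
  obtain ⟨n, hn⟩ : ∃ n, p.nr = n + 1 := ⟨p.nr - 1, by omega⟩
  have h1 : ∀ i < p.nr, φ (e * 2 ^ p.q + i) < if i < n then 2 ^ p.w else m (p.bR + i) + 1 := by
    intro i hi
    obtain ⟨h1, h2, -⟩ := Box.index hp he (show i < 2 ^ p.q by omega)
    have h3 := hφ.1 _ h1
    unfold range at h3
    rwa [h2, hn, Nat.add_sub_cancel] at h3
  have h2 : ∀ k ≤ n, big p.w φ (e * 2 ^ p.q) k < 2 ^ (p.w * k) := by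
    intro k hk
    induction k with
    | zero => simp [big]
    | succ k ih =>
      have h3 := ih (by omega)
      have h4 := h1 k (by omega)
      rw [if_pos (by omega)] at h4
      rw [big_succ, Nat.mul_succ, pow_add]
      have := Nat.mul_le_mul_right (2 ^ (p.w * k)) (Nat.succ_le_of_lt h4)
      rw [Nat.succ_mul] at this
      rw [mul_comm (2 ^ (p.w * k)) (2 ^ p.w)]
      omega
  have h3 := h2 n le_rfl
  have h4 := h1 n (by omega)
  rw [if_neg (lt_irrefl _)] at h4
  rw [hn, big_succ, Nat.add_sub_cancel]
  have := Nat.mul_le_mul_right (2 ^ (p.w * n)) (Nat.succ_le_of_lt h4)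
  rw [Nat.succ_mul] at this
  omega

/-- The lower words add less than `2 ^ (w * (nr - 1)) ≤ R + 1` to the contribution of the leading
word, which is at most `R`. This is the bound that limits `fixup` to two additions. -/
theorem Box.le (hp : p.Valid) {m φ : ℕ → ℕ} (hm : Fam p m) (hφ : p.Box m φ) {e : ℕ}
    (he : e < 2 ^ (p.τ - 1 + p.δ + p.M)) : big p.w φ (e * 2 ^ p.q) p.nr ≤ 2 * p.R := by
  have h1 := hφ.big_lt hp hm he
  have h2 := hp.hR'
  have h3 := Nat.div_mul_le_self p.R (2 ^ (p.w * (p.nr - 1)))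
  rw [Nat.succ_mul] at h1
  omega

/-- The sequence that holds the given values. -/
def boxOf (p : Par) (v : ℕ → ℕ) (n : ℕ) : ℕ :=
  if n < p.NV then v (n / 2 ^ p.q) / 2 ^ (p.w * (n % 2 ^ p.q)) % 2 ^ p.w else 0

theorem big_boxOf (hp : p.Valid) {v : ℕ → ℕ} (hv : ∀ e, v e ≤ p.R) {e : ℕ}
    (he : e < 2 ^ (p.τ - 1 + p.δ + p.M)) : big p.w (p.boxOf v) (e * 2 ^ p.q) p.nr = v e := by
  have hq := hp.hq
  have h1 : ∀ i < p.nr, p.boxOf v (e * 2 ^ p.q + i) = v e / 2 ^ (p.w * i) % 2 ^ p.w := by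
    intro i hi
    obtain ⟨h1, h2, h3⟩ := Box.index hp he (show i < 2 ^ p.q by omega)
    simp only [boxOf, h1, h2, h3, if_true]
  have h2 : ∀ k ≤ p.nr, big p.w (p.boxOf v) (e * 2 ^ p.q) k = v e % 2 ^ (p.w * k) := by
    intro k hk
    induction k with
    | zero => simp [big, Nat.mod_one]
    | succ k ih =>
      rw [big_succ, ih (by omega), h1 k (by omega), Nat.mul_succ, pow_add, Nat.mod_mul, mul_comm (2 ^ _)]
  rw [h2 _ le_rfl]
  exact Nat.mod_eq_of_lt ((hv e).trans_lt hp.hR)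

theorem box_boxOf (hp : p.Valid) {m : ℕ → ℕ} (hm : Fam p m) {v : ℕ → ℕ} (hv : ∀ e, v e ≤ p.R) :
    p.Box m (p.boxOf v) := by
  have hnr := hp.hnr
  refine ⟨fun n hn => ?_, fun n hn => if_neg (by omega)⟩
  simp only [boxOf, hn, if_true, range]
  split_ifs with h
  · exact Nat.mod_lt _ (by positivity)
  · refine Nat.lt_succ_of_le ((Nat.mod_le _ _).trans ?_)
    rcases Nat.lt_or_ge (n % 2 ^ p.q) p.nr with h1 | h1
    · rw [show n % 2 ^ p.q = p.nr - 1 by omega, ← R_div hp hm]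
      exact Nat.div_le_div_right (hv _)
    · rw [Nat.div_eq_of_lt]
      · exact Nat.zero_le _
      · exact ((hv _).trans_lt hp.hR).trans_le (Nat.pow_le_pow_right (by norm_num)
          (Nat.mul_le_mul_left _ h1))

/-- If the leading word of the largest value allows it, the values drawn are uniformly
distributed. -/
theorem tape_eq_uniform (hp : p.Valid) {m : ℕ → ℕ} (hm : Fam p m) {r : ℕ} [NeZero r]
    (hr : p.R + 1 = r) (hd : 2 ^ (p.w * (p.nr - 1)) ∣ r) : tape (p.range m) p.NV =
      (PMF.uniformOfFintype (Fin (2 ^ (p.τ - 1 + p.δ + p.M)) → ZMod r)).map fun V =>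
        p.boxOf fun e => if h : e < 2 ^ (p.τ - 1 + p.δ + p.M) then (V ⟨e, h⟩).val else 0 := by
  have hle : ∀ V : Fin (2 ^ (p.τ - 1 + p.δ + p.M)) → ZMod r, ∀ e,
      (if h : e < 2 ^ (p.τ - 1 + p.δ + p.M) then (V ⟨e, h⟩).val else 0) ≤ p.R := by
    intro V e
    split_ifs with h
    · have := ZMod.val_lt (V ⟨e, h⟩)
      omega
    · exact Nat.zero_le _
  refine tape_eq_map (p.range_pos' m) _ (fun V V' h => funext fun e => ?_) fun φ => ?_
  · have h1 := big_boxOf hp (hle V) e.2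
    have h2 := big_boxOf hp (hle V') e.2
    simp only [e.2, dif_pos] at h1 h2
    have h3 := congrArg (fun φ => big p.w φ (e * 2 ^ p.q) p.nr) h
    beta_reduce at h3
    rw [h3, h2] at h1
    exact (ZMod.val_injective r h1).symm
  · constructor
    · rintro ⟨V, rfl⟩
      exact box_boxOf hp hm (hle V)
    · intro hφ
      -- If `r = 2 ^ (w * (nr - 1)) * c`, the leading word of `r - 1` is `c - 1`, so restricting the
      -- leading word gives exactly the numbers below `r`.
      have hlt : ∀ e < 2 ^ (p.τ - 1 + p.δ + p.M), big p.w φ (e * 2 ^ p.q) p.nr < r := by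
        intro e he
        refine (Box.big_lt hp hm hφ he).trans_le (le_of_eq ?_)
        obtain ⟨c, hc⟩ := hd
        have hc0 : 0 < c := Nat.pos_of_ne_zero fun h => by rw [h, mul_zero] at hc; exact NeZero.ne r hc
        have hP : 0 < 2 ^ (p.w * (p.nr - 1)) := by positivity
        have : p.R / 2 ^ (p.w * (p.nr - 1)) = c - 1 := by
          refine Nat.div_eq_of_lt_le ?_ ?_
          · rw [Nat.sub_mul, one_mul, mul_comm c, ← hc]; omega
          · rw [Nat.sub_add_cancel hc0, mul_comm c, ← hc]; omega
        rw [this, Nat.sub_add_cancel hc0, mul_comm, ← hc]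
      refine ⟨fun e => ((big p.w φ (e * 2 ^ p.q) p.nr : ℕ) : ZMod r), funext fun n => ?_⟩
      simp only [boxOf]
      split_ifs with hn hn2
      · rw [ZMod.val_natCast, Nat.mod_eq_of_lt (hlt _ hn2)]
        rcases Nat.lt_or_ge (n % 2 ^ p.q) p.nr with h1 | h1
        · rw [big_digit (Box.red hm hφ) h1, Nat.div_add_mod']
        · rw [big_digit_ge (Box.red hm hφ) h1, Nat.zero_mod]
          -- A padding position has range 1, so its digit is zero.
          have h2 := hφ.1 n hn
          unfold range at h2
          rw [if_neg (by omega), hm.pad _ h1 (Nat.mod_lt _ (by positivity))] at h2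
          omega
      · exfalso
        rw [NV_eq hp] at hn
        exact hn2 ((Nat.div_lt_iff_lt_mul (by positivity)).2 hn)
      · exact (hφ.2 n (by omega)).symm

end Par

end WordRAM

/-! ### The represented function as a homomorphic image of the last table, and the family. -/

namespace WordRAM

theorem subm_cast {r a v : ℕ} (hv : v ≤ a + 2 * r) : ((subm r a v : ℕ) : ZMod r) = a - v := by
  unfold subm
  split_ifs with h1 h2
  · rw [Nat.cast_sub h1]
  · rw [Nat.cast_sub h2]; simp
  · rw [Nat.cast_sub hv]; simp

namespace Par

variable {p : Par}

/-- The two halves of a key. -/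
def topKey (p : Par) (x : ℕ) : Key p.s (p.τ - 1) × Key p.s (p.τ - 1) :=
  (keyOf p.s (p.char x) (p.τ - 1) 0, keyOf p.s (p.char x) (p.τ - 1) 1)

/-- The entries of the last table used for a key. -/
def topCell (p : Par) (F : ℕ → XV p.M) (x : ℕ) : Finset ℕ :=
  tabCells 0 p.M (2 ^ (p.τ - 1 + p.δ)) (p.slot F (p.τ - 1) (p.topKey x))

/-- The number of entries of the last table. -/
def topSize (p : Par) : ℕ := 2 ^ (p.τ - 1 + p.δ + p.M)

theorem topCell_lt (hp : p.Valid) (F : ℕ → XV p.M) {x e : ℕ} (he : e ∈ p.topCell F x) :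
    e < p.topSize := by
  obtain ⟨j, hj, rfl⟩ := Finset.mem_image.1 he
  rw [zero_add]
  exact (hp.root_lt (Finset.mem_range.1 hj) (p.slot_lt F _ _ j)).1

/-- The represented function depends linearly on the last table. -/
noncomputable def lin (p : Par) (F : ℕ → XV p.M) (u r : ℕ) :
    (Fin p.topSize → ZMod r) →+ (Fin u → ZMod r) where
  toFun V x := - ∑ e ∈ p.topCell F x, if h : e < p.topSize then V ⟨e, h⟩ else 0
  map_zero' := by funext x; simp
  map_add' V V' := by
    funext x
    simp only [Pi.add_apply]
    rw [← neg_add, ← Finset.sum_add_distrib]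
    congr 1
    refine Finset.sum_congr rfl fun e _ => ?_
    split_ifs <;> simp

theorem topAcc_cast {m c : ℕ → ℕ} {F : ℕ → XV p.M} {z : Key p.s (p.τ - 1) × Key p.s (p.τ - 1)} {n : ℕ}
    (hz : ∀ j < n, p.topIdx (fld p m p.bT) c j = j * 2 ^ p.M + p.slot F (p.τ - 1) z j)
    (hv : ∀ j < n, p.vval m (j * 2 ^ p.M + p.slot F (p.τ - 1) z j) ≤ 2 * p.R) :
    ((p.topAcc m c n : ℕ) : ZMod (p.R + 1)) =
      - ∑ j ∈ Finset.range n, ((p.vval m (j * 2 ^ p.M + p.slot F (p.τ - 1) z j) : ℕ) : ZMod (p.R + 1)) := by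
  induction n with
  | zero => simp [topAcc]
  | succ n ih =>
    have h1 := hv n (by omega)
    rw [topAcc, hz n (by omega), subm_cast (by omega), ih (fun j hj => hz j (by omega)) fun j hj => hv j (by omega),
      Finset.sum_range_succ, neg_add, sub_eq_add_neg]

theorem thr_le (hp : p.Valid) : ∀ h' < p.τ, 2 * p.thr h' ≤ 2 ^ (p.τ + p.τ - 2 + p.δ + p.δ + p.M) := by
  intro h hh
  have h1 := hp.hs
  have h2 := thr_mono (p := p) h1 (show h ≤ p.τ - 1 by omega)
  refine (Nat.mul_le_mul_left 2 h2).trans ?_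
  unfold thr
  have h3 : p.base (p.τ - 1) ≤ 2 ^ (p.τ - 2 + p.δ + p.M) ∨ p.τ = 1 := by
    rcases Nat.lt_or_ge 1 p.τ with h4 | h4
    · left
      rw [show p.τ - 1 = p.τ - 2 + 1 by omega]
      exact le_rfl
    · right; omega
  rcases h3 with h3 | h3
  · rcases Nat.lt_or_ge 1 p.τ with h4 | h4
    · refine (Nat.mul_le_mul_left 2 (Nat.mul_le_mul_right _ h3)).trans ?_
      rw [← pow_add, ← pow_succ']
      exact Nat.pow_le_pow_right (by norm_num) (by omega)
    · have h5 : p.τ = 1 := by omega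
      simp only [h5, base, Nat.sub_self]
      rw [← pow_add, ← pow_succ']
      exact Nat.pow_le_pow_right (by norm_num) (by omega)
  · simp only [h3, base, Nat.sub_self]
    rw [← pow_add, ← pow_succ']
    exact Nat.pow_le_pow_right (by norm_num) (by omega)

theorem topIdx_eq (hp : p.Valid) {m m' : ℕ → ℕ} (hm : ∀ a < p.TW, m' (p.bT + a) = m (p.bT + a)) (x : ℕ)
    {j : ℕ} (hj : j < 2 ^ (p.τ - 1 + p.δ)) :
    p.topIdx (fld p m' p.bT) (p.char x) j =
      j * 2 ^ p.M + p.slot (p.field fun a => m (p.bT + a)) (p.τ - 1) (p.topKey x) j := by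
  have h1 : ∀ n < 2 * p.thr (p.τ - 1), p.field (fun a => m' (p.bT + a)) n =
      p.field (fun a => m (p.bT + a)) n := by
    intro n hn
    have hτ := hp.hτ
    have h2 := hn.trans_le (thr_le hp (p.τ - 1) (by omega))
    have h3 : n / 2 ^ p.g < p.TW := by
      unfold TW
      rw [Nat.div_lt_iff_lt_mul (by positivity), ← pow_add]
      exact h2.trans_le (Nat.pow_le_pow_right (by norm_num) (by omega))
    unfold field
    rw [XV.ext_iff, XV.val_mk, XV.val_mk]
    beta_reduce
    rw [hm _ h3]
  rw [← slot_congr hp.hs h1 _ hj]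
  unfold topIdx slot topKey
  rw [← nodeVal_eq _ (char_lt p x), ← nodeVal_eq _ (char_lt p x)]
  rfl

theorem red_sampleMem (hp : p.Valid) {m φ : ℕ → ℕ} (hm : Fam p m) (hφ : p.Box m φ) :
    Red p.w (p.sampleMem m φ p.NV) := by
  intro a
  rcases Nat.lt_or_ge a p.bV with h | h
  · rw [sampleMem_of_lt _ h]; exact hm.red a
  · obtain ⟨a, rfl⟩ := Nat.exists_eq_add_of_le h
    have hf : (fun n => if n < p.NV then φ n else 0) = φ := by
      funext n
      split_ifs with h
      exacts [rfl, (hφ.2 n (by omega)).symm]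
    rw [sampleMem_eq hm.V, hf]
    rcases Nat.eq_zero_or_pos p.gr with h0 | h0
    · simp only [h0, big, pow_zero, Finset.range_one, Finset.sum_singleton, mul_zero, mul_one]
      exact hφ.red hm _
    · refine (WordRAM.big_lt (fun n => ?_) _).trans_le (Nat.pow_le_pow_right (by norm_num) ?_)
      · rcases Nat.lt_or_ge n p.NV with h | h
        · exact (hφ.1 n h).trans_le (range_le hp hm n)
        · rw [hφ.2 n h]; positivity
      · rw [← pow_add, add_comm]; exact hp.hgr h0

theorem natMem_sampleMem (hp : p.Valid) {m φ : ℕ → ℕ} (hm : Fam p m) (hφ : p.Box m φ) (r : ℕ → ℕ) :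
    natMem ((⟨r, p.sampleMem m φ p.NV, fun _ => 0⟩ : NS).toState p.w p.S).mem =
      p.sampleMem m φ p.NV := by
  funext a
  rcases Nat.lt_or_ge a p.S with h | h
  · exact natMem_toState (red_sampleMem hp hm hφ) h
  · have hSe : p.S = p.bV + p.VW := rfl
    obtain ⟨b, rfl⟩ := Nat.exists_eq_add_of_le (show p.bV ≤ a by omega)
    rw [natMem, dif_neg (by omega), sampleMem_eq hm.V]
    unfold big
    rw [Finset.sum_eq_zero]
    intro j _
    have hVW : p.NV ≤ p.VW * 2 ^ p.gr := by
      unfold Par.NV Par.VW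
      rw [← pow_add]
      exact Nat.pow_le_pow_right (by norm_num) (by omega)
    have h2 := Nat.mul_le_mul_right (2 ^ p.gr) (show p.VW ≤ b by omega)
    beta_reduce
    rw [if_neg (by omega), zero_mul]

theorem repr_sampleMem (hp : p.Valid) {m φ : ℕ → ℕ} (hm : Fam p m) (hφ : p.Box m φ) :
    Repr p (p.sampleMem m φ p.NV) := by
  have hb : 24 + p.nr ≤ p.bV := by
    have hq := hp.hq
    unfold bV bT b1 b0 bA bR
    omega
  refine ⟨red_sampleMem hp hm hφ, fun i hi => ?_, ?_, fun e he => ?_⟩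
  · rw [sampleMem_of_lt _ (by omega)]; exact hm.hdr i hi
  · rw [← hm.R]
    exact big_congr fun i hi => sampleMem_of_lt _ (by unfold bR; omega)
  · rw [vval_sampleMem hp hm hφ]
    exact hφ.le hp hm he

/-- The table of values held by a drawn sequence. -/
def table (p : Par) (φ : ℕ → ℕ) (r : ℕ) (e : Fin p.topSize) : ZMod r :=
  ((big p.w φ (e * 2 ^ p.q) p.nr : ℕ) : ZMod r)

/-- Values above `R` are harmless, since the root computes modulo `r`; the function depends only on
the residues in `Par.table`. -/
theorem hash_eq (hp : p.Valid) {m φ : ℕ → ℕ} (hm : Fam p m) (hφ : p.Box m φ) {u r : ℕ} [NeZero r]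
    (hr : p.R + 1 = r) (x : Fin u) : (homFun (p.lin (p.field fun a => m (p.bT + a)) u r)
      (p.table φ r) x : ℕ) = p.hash (p.sampleMem m φ p.NV) x := by
  subst hr
  have h1 : ((p.hash (p.sampleMem m φ p.NV) x : ℕ) : ZMod (p.R + 1)) =
      p.lin (p.field fun a => m (p.bT + a)) u (p.R + 1) (p.table φ (p.R + 1)) x := by
    have hslot : ∀ j < 2 ^ (p.τ - 1 + p.δ), j * 2 ^ p.M +
        p.slot (p.field fun a => m (p.bT + a)) (p.τ - 1) (p.topKey x) j < p.topSize := fun j hj =>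
      (hp.root_lt hj (p.slot_lt _ _ _ j)).1
    unfold Par.hash
    rw [topAcc_cast (z := p.topKey x) (fun j hj => topIdx_eq hp (fun a ha => sampleMem_of_lt _ ?_) x hj)
      fun j hj => ?_]
    · simp only [lin, AddMonoidHom.coe_mk, ZeroHom.coe_mk, topCell]
      rw [sum_tabCells fun j _ => p.slot_lt _ _ _ j]
      congr 1
      refine Finset.sum_congr rfl fun j hj => ?_
      have h2 := hslot j (Finset.mem_range.1 hj)
      rw [vval_sampleMem hp hm hφ]
      simp only [zero_add]
      rw [dif_pos h2]
      rfl
    · unfold bV; omega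
    · rw [vval_sampleMem hp hm hφ]
      exact hφ.le hp hm (hslot j hj)
  unfold homFun
  simp only
  rw [← h1, ZMod.val_natCast, Nat.mod_eq_of_lt]
  exact Nat.lt_succ_of_le (topAcc_le p _ _ _)

theorem R_lt_of (hp : p.Valid) {r : ℕ} (hr : p.R + 1 = r) : r ≤ 2 ^ (p.w * p.nr) := by
  have := hp.hR; omega

theorem table_boxOf (hp : p.Valid) {r : ℕ} [NeZero r] (hr : p.R + 1 = r) (V : Fin p.topSize → ZMod r) :
    p.table (p.boxOf fun e => if h : e < p.topSize then (V ⟨e, h⟩).val else 0) r = V := by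
  funext e
  unfold table
  rw [big_boxOf hp (fun e => ?_) e.2]
  · simp
  · split_ifs with h
    · have := ZMod.val_lt (V ⟨e, h⟩)
      omega
    · exact Nat.zero_le _

end Par

/-- The data structure. -/
def hashProgram : HashProgram := ⟨selectProg, sampleProg, evalProg⟩

section sample

variable {p : Par} {m : Mem p.w p.S} {T T' : ℕ}

theorem runSample_eq (hp : p.Valid) (hm : Fam p (natMem m)) (hT : p.sampleTime ≤ T) :
    ∃ r : (ℕ → ℕ) → ℕ → ℕ, hashProgram.runSample m T = (tape (p.range (natMem m)) p.NV).map fun φ =>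
      ⟨[], (⟨r φ, p.sampleMem (natMem m) φ p.NV, fun _ => 0⟩ : NS).toState p.w p.S⟩ := by
  obtain ⟨r, hr⟩ := sample_run hp (inp := fun _ => 0) hm hT
  refine ⟨r, ?_⟩
  rw [← hr, toState_natMem]
  rfl

theorem alwaysHalted_sample (hp : p.Valid) (hm : Fam p (natMem m)) (hT : p.sampleTime ≤ T) :
    AlwaysHalted (hashProgram.runSample m T) := by
  obtain ⟨r, hr⟩ := runSample_eq hp hm hT
  intro c hc
  rw [hr, PMF.mem_support_map_iff] at hc
  obtain ⟨φ, _, rfl⟩ := hc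
  rfl

/-- The hash function given by a table. -/
noncomputable def famFun (m : Mem p.w p.S) (u r : ℕ) [NeZero r] (V : Fin p.topSize → ZMod r) : Fin u → Fin r :=
  homFun (p.lin (p.field fun a => natMem m (p.bT + a)) u r) V

theorem memLaw_sample (hp : p.Valid) (hm : Fam p (natMem m)) (hT : p.sampleTime ≤ T)
    (hT' : p.evalTime ≤ T') {u r : ℕ} [NeZero r] (hr : p.R + 1 = r) :
    ∃ M : (ℕ → ℕ) → Mem p.w p.S, memLaw (hashProgram.runSample m T) =
      (tape (p.range (natMem m)) p.NV).map M ∧ ∀ φ, p.Box (natMem m) φ →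
        hashProgram.Represents T' (M φ) (famFun m u r (p.table φ r)) := by
  obtain ⟨ρ, hρ⟩ := runSample_eq hp hm hT
  refine ⟨_, by rw [hρ, memLaw, PMF.map_comp], fun φ hφ => ?_⟩
  have h1 := Par.natMem_sampleMem hp hm hφ (ρ φ)
  refine represents rfl hp (by rw [Function.comp_apply, h1]; exact Par.repr_sampleMem hp hm hφ) hT' _ fun x => ?_
  rw [Function.comp_apply, h1]
  exact Par.hash_eq hp hm hφ hr x

theorem exists_represents (hp : p.Valid) (hm : Fam p (natMem m)) (hT : p.sampleTime ≤ T)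
    (hT' : p.evalTime ≤ T') {u r : ℕ} [NeZero r] (hr : p.R + 1 = r) :
    ∀ m' ∈ (memLaw (hashProgram.runSample m T)).support, ∃ f : Fin u → Fin r,
      hashProgram.Represents T' m' f := by
  obtain ⟨M, hM, hrep⟩ := memLaw_sample (u := u) hp hm hT hT' hr
  intro m' hm'
  rw [hM, PMF.mem_support_map_iff] at hm'
  obtain ⟨φ, hφ, rfl⟩ := hm'
  exact ⟨_, hrep φ (Par.mem_support_tape.1 hφ)⟩

/-- The family is the whole image even if the draw is not uniform: every table of residues is
represented by values below `r`, and those can be drawn. -/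
theorem family_eq (hp : p.Valid) (hm : Fam p (natMem m)) (hT : p.sampleTime ≤ T)
    (hT' : p.evalTime ≤ T') {u r : ℕ} [NeZero r] (hr : p.R + 1 = r) :
    hashProgram.family T T' u r m = Set.range (famFun m u r) := by
  obtain ⟨M, hM, hrep⟩ := memLaw_sample (u := u) hp hm hT hT' hr
  ext f
  simp only [HashProgram.family, Set.mem_ofPred_eq, Set.mem_range, hM, PMF.mem_support_map_iff]
  constructor
  · rintro ⟨m', ⟨φ, hφ, rfl⟩, hf⟩
    exact ⟨_, represents_unique (Par.R_lt_of hp hr) (hrep φ (Par.mem_support_tape.1 hφ)) hf⟩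
  · rintro ⟨V, rfl⟩
    have hb := Par.box_boxOf hp hm (v := fun e => if h : e < p.topSize then (V ⟨e, h⟩).val else 0)
      fun e => by
        split_ifs with h
        · have := ZMod.val_lt (V ⟨e, h⟩)
          omega
        · exact Nat.zero_le _
    refine ⟨_, ⟨_, Par.mem_support_tape.2 hb, rfl⟩, ?_⟩
    have := hrep _ hb
    rwa [Par.table_boxOf hp hr] at this

-- A uniform table is mapped by a homomorphism, whose fibres have equal size.
open Classical in
theorem uniform_sample (hp : p.Valid) (hm : Fam p (natMem m)) (hT : p.sampleTime ≤ T)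
    (hT' : p.evalTime ≤ T') {u r : ℕ} [NeZero r] (hr : p.R + 1 = r) (hd : 2 ^ (p.w * (p.nr - 1)) ∣ r)
    {f : Fin u → Fin r} (hf : f ∈ hashProgram.family T T' u r m) :
    (memLaw (hashProgram.runSample m T)).toOuterMeasure {m' | hashProgram.Represents T' m' f} =
      ((hashProgram.family T T' u r m).ncard : ENNReal)⁻¹ := by
  obtain ⟨M, hM, hrep⟩ := memLaw_sample (u := u) hp hm hT hT' hr
  rw [family_eq hp hm hT hT' hr] at hf ⊢
  rw [hM, Par.tape_eq_uniform hp hm hr hd, PMF.map_comp, PMF.toOuterMeasure_map_apply,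
    PMF.toOuterMeasure_uniformOfFintype_apply]
  have h1 : ∀ V, M (p.boxOf fun e => if h : e < 2 ^ (p.τ - 1 + p.δ + p.M) then (V ⟨e, h⟩).val else 0) ∈
      {m' | hashProgram.Represents T' m' f} ↔ famFun m u r V ∈ ({f} : Set (Fin u → Fin r)) := by
    intro V
    have h2 := hrep _ (Par.box_boxOf hp hm (v := fun e => if h : e < p.topSize then (V ⟨e, h⟩).val else 0)
      fun e => by
        split_ifs with h
        · have := ZMod.val_lt (V ⟨e, h⟩)
          omega
        · exact Nat.zero_le _)
    rw [Par.table_boxOf hp hr] at h2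
    simp only [Set.mem_ofPred_eq, Set.mem_singleton_iff]
    constructor
    · exact fun h => represents_unique (Par.R_lt_of hp hr) h2 h
    · rintro rfl
      exact h2
  set L := p.lin (p.field fun a => natMem m (p.bT + a)) u r with hL
  have h2 := card_homFun_mem L {f} (by rintro _ rfl; exact hf)
  have h3 := card_homFun L
  have h4 : 0 < (Finset.univ.filter fun V => L V = 0).card := Finset.card_pos.2 ⟨0, by simp⟩
  have h5 : Fintype.card ((M ∘ fun V : Fin (2 ^ (p.τ - 1 + p.δ + p.M)) → ZMod r => p.boxOf fun e =>
      if h : e < 2 ^ (p.τ - 1 + p.δ + p.M) then (V ⟨e, h⟩).val else 0) ⁻¹'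
        {m' | hashProgram.Represents T' m' f}) =
      (Finset.univ.filter fun V => L V = 0).card := by
    rw [Set.ncard_singleton, one_mul] at h2
    rw [← h2, ← Set.toFinset_card]
    congr 1
    ext V
    exact Set.mem_toFinset.trans ((h1 V).trans
      ⟨fun h => Finset.mem_filter.2 ⟨Finset.mem_univ _, h⟩, fun h => (Finset.mem_filter.1 h).2⟩)
  have h6 : Fintype.card (Fin (2 ^ (p.τ - 1 + p.δ + p.M)) → ZMod r) = _ := h3
  rw [h5, h6, Nat.cast_mul]
  have h7 : ((Finset.univ.filter fun V => L V = 0).card : ENNReal) ≠ 0 := by exact_mod_cast h4.ne'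
  refine ENNReal.eq_inv_of_mul_eq_one_left ?_
  rw [mul_comm, ← mul_div_assoc]
  refine ENNReal.div_self (mul_ne_zero ?_ h7) (ENNReal.mul_ne_top (ENNReal.natCast_ne_top _) (ENNReal.natCast_ne_top _))
  have : 0 < (Set.range (famFun m u r)).ncard := (Set.ncard_pos (Set.toFinite _)).2 ⟨_, 0, rfl⟩
  exact_mod_cast this.ne'

/-- Small sets of keys get independent values if small sets can be peeled. -/
theorem kIndependent_family {u r k : ℕ} [NeZero r] (hp : p.Valid)
    (hP : p.Peels k (p.field fun a => natMem m (p.bT + a)) p.τ)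
    (hinj : ∀ x < u, ∀ y < u, (∀ n < 2 ^ p.τ, p.char x n = p.char y n) → x = y) :
    KIndependent k (Set.range (famFun m u r)) := by
  set F := p.field fun a => natMem m (p.bT + a) with hF
  have hτ := hp.hτ
  -- The two halves at the root contain all characters, and these determine the key.
  have hkey : Function.Injective fun x : Fin u => p.topKey x := by
    intro x y h
    refine Fin.ext (hinj x x.2 y y.2 fun n hn => ?_)
    have h1 := congrArg Prod.fst h
    have h2 := congrArg Prod.snd h
    have h3 : 2 ^ p.τ = 2 ^ (p.τ - 1) + 2 ^ (p.τ - 1) := by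
      rw [← two_mul, ← pow_succ', Nat.sub_add_cancel hτ]
    rw [← Nat.mod_eq_of_lt (Par.char_lt p x n), ← Nat.mod_eq_of_lt (Par.char_lt p y n)]
    rcases Nat.lt_or_ge n (2 ^ (p.τ - 1)) with h4 | h4
    · exact Par.keyOf_inj h1 n (by omega) (by omega)
    · exact Par.keyOf_inj h2 n (by omega) (by omega)
  refine kIndependent_range_homFun _ fun l hl x hx y => ?_
  have hkx : Function.Injective fun i => p.topKey (x i) := hkey.comp hx
  obtain ⟨D, hD⟩ := exists_sum_cell_eq
    (fun z => tabCells 0 p.M (2 ^ (p.τ - 1 + p.δ)) (p.slot F (p.τ - 1) z))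
    (Finset.univ.image fun i => p.topKey (x i)) (fun S' hS' hne =>
      (hP (p.τ - 1) (by omega)).cells (fun z j _ => p.slot_lt F _ z j) S' hne
        ((Finset.card_le_card hS').trans (Finset.card_image_le.trans (by simpa using hl))))
    -- The values are negated because `lin` is minus the sum of the entries.
    (Function.extend (fun i => p.topKey (x i)) (fun i => - y i) 0)
  refine ⟨fun e => D e, fun i => ?_⟩
  have h1 := hD (p.topKey (x i)) (Finset.mem_image_of_mem _ (Finset.mem_univ i))
  rw [hkx.extend_apply] at h1
  rw [← neg_neg (y i), ← h1]
  simp only [Par.lin, AddMonoidHom.coe_mk, ZeroHom.coe_mk]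
  congr 1
  refine Finset.sum_congr rfl fun e he => ?_
  rw [dif_pos (Par.topCell_lt hp F he)]

end sample

end WordRAM

/-! ### Law of the selected family and its failure probability. -/

namespace WordRAM

variable {p : Par}

theorem Fam.fillMem (hp : p.Valid) {m φ : ℕ → ℕ} (hm : Fam p m) (hφ : Red p.w φ) (n : ℕ)
    (hn : n ≤ p.TW) : Fam p (p.fillMem m φ n) := by
  have hbV : p.bV = p.bT + p.TW := rfl
  have hbT : p.bT = 24 + 2 ^ p.q + 2 ^ p.q + p.BW + p.BW := rfl
  have hbR : p.bR = 24 := rfl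
  have hq := hp.hq
  have h : ∀ a < p.bT, p.fillMem m φ n a = m a := fun a ha => if_neg (by omega)
  refine ⟨fun a => ?_, fun i hi => ?_, ?_, fun i h1 h2 => ?_, fun a ha => ?_⟩
  · unfold Par.fillMem
    split_ifs
    exacts [hφ _, hm.red a]
  · rw [h _ (by omega)]; exact hm.hdr i hi
  · rw [← hm.R]
    exact big_congr fun i hi => h _ (by omega)
  · rw [h _ (by omega)]; exact hm.pad i h1 h2
  · unfold Par.fillMem
    rw [if_neg (by omega)]
    exact hm.V a ha

theorem Fam.natMem {m : ℕ → ℕ} (hm : Fam p m) (r o : ℕ → ℕ) :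
    natMem ((⟨r, m, o⟩ : NS).toState p.w p.S).mem = m := by
  funext a
  rcases Nat.lt_or_ge a p.S with h | h
  · exact natMem_toState hm.red h
  · have hS : p.S = p.bV + p.VW := rfl
    rw [WordRAM.natMem, dif_neg (by omega), hm.V a (by omega)]

/-- The law of the memory after the selection of a family. -/
theorem select_law {u r t k T : ℕ}
    (h : Sel p (fun i => [u, r, t, k].getD i 0) (wordLen p.w u) (wordLen p.w t))
    (hr : p.nr = wordLen p.w r) (hT : p.selectTime (wordLen p.w u) ≤ T) :
    AlwaysHalted (hashProgram.runSelect p.w p.S u r t k T) ∧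
      ∃ G : (Fin p.TW → XV p.w) → Mem p.w p.S, memLaw (hashProgram.runSelect p.w p.S u r t k T) =
        (PMF.uniformOfFintype _).map G ∧ ∀ ω, Fam p (natMem (G ω)) ∧
          ∀ a < p.TW, natMem (G ω) (p.bT + a) = (Par.ext ω a).val := by
  have hp := h.valid
  obtain ⟨ρ, m₀, hm, -, hrun⟩ := select_run (nk := wordLen p.w k) h hT
  have h0 : hashProgram.runSelect p.w p.S u r t k T = (tape (fun _ => 2 ^ p.w) p.TW).map fun φ =>
      ⟨[], (⟨ρ φ, p.fillMem m₀ φ p.TW, fun _ => 0⟩ : NS).toState p.w p.S⟩ := by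
    rw [← hrun, hr]
    rfl
  constructor
  · intro c hc
    rw [h0, PMF.mem_support_map_iff] at hc
    obtain ⟨φ, _, rfl⟩ := hc
    rfl
  · refine ⟨fun ω => ((⟨ρ fun i => (Par.ext ω i).val, p.fillMem m₀ (fun i => (Par.ext ω i).val) p.TW,
      fun _ => 0⟩ : NS).toState p.w p.S).mem, ?_, fun ω => ?_⟩
    · rw [h0, memLaw, tape_words, PMF.map_comp, PMF.map_comp]
      rfl
    · have h1 := hm.fillMem hp (φ := fun i => (Par.ext ω i).val) (fun n => XV.lt _) p.TW le_rfl
      rw [h1.natMem]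
      refine ⟨h1, fun a ha => ?_⟩
      rw [Par.fillMem, if_pos (by omega), Nat.add_sub_cancel_left]

open Classical in
/-- Most words make small sets of keys peelable. -/
theorem card_not_peels_fields (hp : p.Valid) {k κ : ℕ} (hδ : p.δ = 10 + 2 * p.ℓ)
    (hM : p.M = κ + 3 * p.s + 17) (hk : k < 2 ^ κ) (hκ : κ < p.s * 2 ^ p.ℓ) :
    ((Finset.univ.filter fun ω : Fin p.TW → XV p.w =>
        ¬ p.Peels k (p.field fun a => (Par.ext ω a).val) p.τ).card : ℝ) ≤
      Fintype.card (Fin p.TW → XV p.w) * (2 ^ (64 * p.s))⁻¹ := by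
  set ν := p.τ + p.τ - 2 + p.δ + p.δ + p.M with hν
  set L := p.fields p.TW (2 ^ ν) with hL
  -- The estimate holds for uniform fields and is pulled back along the surjection from words.
  have h1 := L.card_preimage_mul (show Function.Surjective L from hp.fields_surjective ν)
    (Finset.univ.filter fun F => ¬ p.Peels k (Par.ext F) p.τ)
  have h2 := Par.card_not_peels (p := p) (N := 2 ^ ν) hδ hM hk hκ p.τ (Par.thr_le hp)
  have h3 : (Finset.univ.filter fun ω : Fin p.TW → XV p.w =>
      ¬ p.Peels k (p.field fun a => (Par.ext ω a).val) p.τ) =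
      Finset.univ.filter fun ω => L ω ∈ Finset.univ.filter fun F => ¬ p.Peels k (Par.ext F) p.τ := by
    ext ω
    have h4 : ∀ h' < p.τ, ∀ n < 2 * p.thr h', p.field (fun a => (Par.ext ω a).val) n =
        Par.ext (L ω) n := by
      intro h' hh n hn
      have := hn.trans_le (Par.thr_le hp h' hh)
      rw [Par.ext, dif_pos this]
      rfl
    have h5 : p.Peels k (p.field fun a => (Par.ext ω a).val) p.τ ↔ p.Peels k (Par.ext (L ω)) p.τ :=
      ⟨fun h => h.congr hp.hs h4, fun h => h.congr hp.hs fun h' hh n hn => (h4 h' hh n hn).symm⟩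
    simp [h5]
  rw [h3]
  have hW : (0 : ℝ) < Fintype.card (Fin (2 ^ ν) → XV p.M) := by exact_mod_cast Fintype.card_pos
  have h5 : ((Finset.univ.filter fun ω => L ω ∈ Finset.univ.filter fun F =>
      ¬ p.Peels k (Par.ext F) p.τ).card : ℝ) * Fintype.card (Fin (2 ^ ν) → XV p.M) =
      (Finset.univ.filter fun F : Fin (2 ^ ν) → XV p.M => ¬ p.Peels k (Par.ext F) p.τ).card *
        Fintype.card (Fin p.TW → XV p.w) := by exact_mod_cast h1
  refine le_of_mul_le_mul_right (h5.trans_le ?_) hW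
  have h6 : ((2 : ℝ) ^ (64 * p.s))⁻¹ * (1 - (2 ^ p.τ)⁻¹) ≤ (2 ^ (64 * p.s))⁻¹ :=
    mul_le_of_le_one_right (by positivity) (by simp)
  have h7 := h2.trans (mul_le_mul_of_nonneg_left h6 (Nat.cast_nonneg _))
  calc _ ≤ _ := mul_le_mul_of_nonneg_right h7 (Nat.cast_nonneg _)
    _ = _ := by ring

theorem toOuterMeasure_uniform_ge {Ω : Type*} [Fintype Ω] [Nonempty Ω] (E : Set Ω) (P : Ω → Prop)
    [DecidablePred P] (hE : ∀ ω, ¬ P ω → ω ∈ E) {ε : ℝ}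
    (hP : ((Finset.univ.filter P).card : ℝ) ≤ Fintype.card Ω * ε) :
    ENNReal.ofReal (1 - ε) ≤ (PMF.uniformOfFintype Ω).toOuterMeasure E := by
  classical
  rw [PMF.toOuterMeasure_uniformOfFintype_apply]
  have h0 : (0 : ℝ) < Fintype.card Ω := by exact_mod_cast Fintype.card_pos
  have h1 : (Finset.univ.filter fun ω => ¬ P ω).card ≤ Fintype.card E := by
    rw [← Set.toFinset_card]
    exact Finset.card_le_card fun ω hω => Set.mem_toFinset.2 (hE ω (Finset.mem_filter.1 hω).2)
  have h2 : ((Finset.univ.filter P).card : ℝ) + (Finset.univ.filter fun ω => ¬ P ω).card =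
      Fintype.card Ω := by
    exact_mod_cast Finset.card_filter_add_card_filter_not (s := Finset.univ) P
  have h3 : ((Finset.univ.filter fun ω => ¬ P ω).card : ℝ) ≤ Fintype.card E := by exact_mod_cast h1
  have h4 : ((Fintype.card E : ℕ) : ENNReal) / (Fintype.card Ω : ℕ) =
      ENNReal.ofReal ((Fintype.card E : ℝ) / Fintype.card Ω) := by
    rw [ENNReal.ofReal_div_of_pos h0, ENNReal.ofReal_natCast, ENNReal.ofReal_natCast]
  rw [h4]
  refine ENNReal.ofReal_le_ofReal ?_
  rw [le_div_iff₀ h0]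
  nlinarith

theorem le_two_pow_clg (x : ℕ) : x ≤ 2 ^ clg x := by
  unfold clg
  have := Nat.lt_size_self (x - 1)
  omega

theorem Sel.bits_le {inp : ℕ → ℕ} {nu nt : ℕ} (h : Sel p inp nu nt) :
    xbits p.w nu (inp 0) ≤ p.s * 2 ^ p.π := by
  rw [Par.s, ← pow_add, h.π]
  exact (le_two_pow_clg _).trans (Nat.pow_le_pow_right (by norm_num) (by omega))

theorem kIndependent_select {u r t k T T' T'' : ℕ} [NeZero r]
    (h : Sel p (fun i => [u, r, t, k].getD i 0) (wordLen p.w u) (wordLen p.w t))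
    (hr : p.nr = wordLen p.w r) (hT : p.selectTime (wordLen p.w u) ≤ T)
    (hT₁ : p.sampleTime ≤ T') (hT₂ : p.evalTime ≤ T'') (hκ : Nat.size k < p.s * 2 ^ p.ℓ) :
    ENNReal.ofReal (1 - (2 ^ (64 * p.s))⁻¹) ≤
      (memLaw (hashProgram.runSelect p.w p.S u r t k T)).toOuterMeasure
        {m | KIndependent k (hashProgram.family T' T'' u r m)} := by
  classical
  have hp := h.valid
  obtain ⟨-, G, hG, hm⟩ := select_law h hr hT
  rw [hG, PMF.toOuterMeasure_map_apply]
  refine toOuterMeasure_uniform_ge _ _ (fun ω hω => ?_) (card_not_peels_fields hp h.δ (k := k) h.M (Nat.lt_size_self k) hκ)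
  have hr0 : p.R + 1 = r := by
    have h1 : p.R = r - 1 := h.R
    have := NeZero.pos r
    omega
  rw [Set.mem_preimage, Set.mem_ofPred_eq, family_eq hp (hm ω).1 hT₁ hT₂ hr0]
  have hu : u < 2 ^ (p.w * wordLen p.w u) := by
    rw [pow_mul]
    exact Nat.lt_base_pow_length_digits (Nat.one_lt_two_pow (by have := hp.hw; omega))
  refine kIndependent_family hp ((not_not.1 hω).congr hp.hs fun h' hh n hn => ?_) fun x hx y hy hxy =>
    Par.char_inj (nu := wordLen p.w u) ?_ hp.hπ.le (hx.trans hu) (hy.trans hu) ?_ hxy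
  · have hτ := hp.hτ
    have h2 := hn.trans_le (Par.thr_le hp h' hh)
    have h3 : n / 2 ^ p.g < p.TW := by
      unfold Par.TW
      rw [Nat.div_lt_iff_lt_mul (by positivity), ← pow_add]
      exact h2.trans_le (Nat.pow_le_pow_right (by norm_num) (by omega))
    unfold Par.field
    rw [XV.ext_iff, XV.val_mk, XV.val_mk]
    beta_reduce
    rw [(hm ω).2 _ h3]
  · refine (le_two_pow_clg _).trans (Nat.pow_le_pow_right (by norm_num) ?_)
    have := h.τ
    omega
  · have h3 := h.bits_le
    unfold xbits at h3
    split_ifs at h3 with h4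
    · right
      have h5 : u < 2 ^ (p.s * 2 ^ p.π) :=
        (Nat.lt_size_self u).trans_le (Nat.pow_le_pow_right (by norm_num) h3)
      exact ⟨h4, hx.trans h5, hy.trans h5⟩
    · exact .inl h3

end WordRAM

/-! ### Choice of the parameters. -/

namespace WordRAM

theorem wordLen_spec {w x : ℕ} (hw : 0 < w) (hx : 0 < x) : 1 ≤ wordLen w x ∧
    2 ^ (w * (wordLen w x - 1)) ≤ x ∧ x < 2 ^ (w * wordLen w x) := by
  have h1 : 1 < 2 ^ w := Nat.one_lt_two_pow hw.ne'
  have h2 : x < (2 ^ w) ^ wordLen w x := Nat.lt_base_pow_length_digits h1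
  have h3 : (2 ^ w) ^ wordLen w x ≤ 2 ^ w * x := Nat.base_pow_length_digits_le _ _ (by omega) hx.ne'
  have h4 : 1 ≤ wordLen w x := by
    by_contra h
    rw [show wordLen w x = 0 by omega] at h2
    simp at h2; omega
  refine ⟨h4, ?_, by rwa [pow_mul]⟩
  obtain ⟨n, hn⟩ := Nat.exists_eq_add_of_le' h4
  rw [hn, pow_succ, mul_comm] at h3
  rw [pow_mul, hn]
  exact Nat.le_of_mul_le_mul_left h3 (by omega)

theorem two_pow_size_le {x : ℕ} (hx : 0 < x) : 2 ^ Nat.size x ≤ 2 * x := by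
  have h1 : 0 < Nat.size x := Nat.size_pos.2 hx
  have h2 : 2 ^ (Nat.size x - 1) ≤ x := Nat.lt_size.1 (by omega)
  obtain ⟨n, hn⟩ := Nat.exists_eq_add_of_le' h1
  rw [hn, Nat.add_sub_cancel] at h2
  rw [hn, pow_succ]
  omega

theorem two_pow_clg_le {x : ℕ} (hx : 0 < x) : 2 ^ clg x ≤ 2 * x := by
  unfold clg
  rcases Nat.lt_or_ge 1 x with h | h
  · exact (two_pow_size_le (by omega)).trans (by omega)
  · rw [show x - 1 = 0 by omega]; simp; omega

theorem clg_le (x : ℕ) : clg x ≤ x - 1 := Nat.size_le.2 Nat.lt_two_pow_self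

theorem le_two_pow_packed (w x : ℕ) : w ≤ 2 * 2 ^ x * 2 ^ (Nat.size w - 1 - x) := by
  have h := Nat.lt_size_self w
  rw [mul_assoc, ← pow_add, ← pow_succ']
  exact h.le.trans (Nat.pow_le_pow_right (by norm_num) (by omega))

theorem two_pow_packed_le {w x : ℕ} (h : 0 < Nat.size w - 1 - x) : 2 ^ (Nat.size w - 1 - x + x) ≤ w := by
  rw [Nat.sub_add_cancel (by omega)]
  exact Nat.lt_size.1 (by omega)

/-- `lam` is within a factor of 2 of `log u`, but is computed from the number of words, and from the
leading bit if there is a single word. -/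
theorem lam_spec {w u : ℕ} (hw : 0 < w) (hu : 2 ≤ u) :
    1 ≤ lam w (wordLen w u) u ∧ 2 ^ lam w (wordLen w u) u ≤ u ∧
      wordLen w u * xbits w (wordLen w u) u ≤ 2 * lam w (wordLen w u) u ∧
      u < 2 ^ (wordLen w u * xbits w (wordLen w u) u) := by
  obtain ⟨h1, h2, h3⟩ := wordLen_spec (x := u) hw (by omega)
  unfold lam xbits
  split_ifs with h
  · have h4 : 1 < Nat.size u := Nat.lt_size.2 hu
    refine ⟨by omega, Nat.lt_size.1 (by omega), by rw [h]; omega, ?_⟩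
    rw [h, one_mul]
    exact Nat.lt_size_self u
  · obtain ⟨n, hn⟩ := Nat.exists_eq_add_of_le' (show 2 ≤ wordLen w u by omega)
    rw [hn] at h2 h3 ⊢
    rw [Nat.add_sub_assoc (by norm_num), show 2 - 1 = 1 from rfl] at h2 ⊢
    refine ⟨Nat.mul_pos (by omega) hw, by rwa [mul_comm], ?_, by rwa [mul_comm (n + 2)]⟩
    rw [← mul_assoc]
    exact Nat.mul_le_mul_right _ (by omega)

/-- The logarithm of the number of bits of a character. -/
def chr (w u t : ℕ) : ℕ := if wordLen w t = 1 then Nat.log 2 (lam w (wordLen w u) u / 16 / t) else 0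

/-- With `lt_chr`: up to the extreme case of one bit, `s` lies between `lam / (32 * t)` and `lam /
(16 * t)`. The upper bound keeps the tables small, the lower bound keeps the characters few and the
error small. -/
theorem chr_le (w u t : ℕ) : 2 ^ chr w u t = 1 ∨ 16 * t * 2 ^ chr w u t ≤ lam w (wordLen w u) u := by
  unfold chr
  split_ifs with h
  · rcases Nat.eq_zero_or_pos (lam w (wordLen w u) u / 16 / t) with h0 | h0
    · left; simp [h0]
    · right
      have h1 := Nat.pow_log_le_self 2 h0.ne'
      rw [Nat.div_div_eq_div_mul] at h1 ⊢
      exact (Nat.mul_le_mul_left _ h1).trans (Nat.mul_div_le _ _)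
  · simp

theorem lt_chr {w u t : ℕ} (ht : 0 < t) (h : wordLen w t = 1) :
    lam w (wordLen w u) u < 32 * t * 2 ^ chr w u t := by
  unfold chr
  rw [if_pos h]
  have h1 := Nat.lt_pow_succ_log_self (b := 2) (by norm_num) (lam w (wordLen w u) u / 16 / t)
  rw [Nat.div_div_eq_div_mul, Nat.div_lt_iff_lt_mul (by positivity)] at h1
  rw [Nat.div_div_eq_div_mul]
  refine h1.trans_eq ?_
  rw [pow_succ]; ring

/-- The parameters used for a given input. -/
def par (w u r t k : ℕ) : Par :=
  let α := chr w u t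
  let ℓ := Nat.size (Nat.size k) - α
  let M := Nat.size k + 3 * 2 ^ α + 17
  let π := clg (xbits w (wordLen w u) u) - α
  let nr := wordLen w r
  let ρ := if nr = 1 then clg (Nat.size (r - 1)) else clg w
  { w := w
    τ := 1 + π + clg (wordLen w u)
    δ := 10 + 2 * ℓ
    M := M
    μ := clg M
    g := Nat.size w - 1 - clg M
    α := α
    π := π
    ℓ := ℓ
    q := clg nr
    nr := nr
    ρ := ρ
    gr := Nat.size w - 1 - ρ
    R := r - 1 }

end WordRAM

/-! ### Space and time in terms of the parameters. -/

namespace WordRAM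

/-- Bounds for the parameters, in terms of `Λ = log u`, `t`, and `V = k * u ^ (1 / t)`. -/
structure ParBounds (p : Par) (K Λ t V : ℝ) : Prop where
  K1 : 1 ≤ K
  Λ1 : 1 ≤ Λ
  t1 : 1 ≤ t
  V1 : 1 ≤ V
  w0 : (0 : ℝ) < p.w
  X : (2 : ℝ) ^ p.τ ≤ 512 * t
  Xs : (2 : ℝ) ^ p.τ * p.s ≤ 16 * Λ
  D : (2 : ℝ) ^ p.δ ≤ K
  M : (p.M : ℝ) ≤ K * p.s
  E : (2 : ℝ) ^ p.M ≤ K * V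
  g : (p.w : ℝ) ≤ 4 * p.M * 2 ^ p.g
  q : (2 : ℝ) ^ p.q * p.w ≤ K * Λ * 2 ^ p.gr
  q' : (2 : ℝ) ^ p.q ≤ K * (1 + Λ / p.w)
  nr : (p.nr : ℝ) ≤ 2 ^ p.q

theorem two_pow_sub_le (a g : ℕ) : (2 : ℝ) ^ (a - g) ≤ 1 + 2 ^ a / 2 ^ g := by
  rcases le_total g a with h | h
  · rw [pow_sub₀ _ (by norm_num) h, ← div_eq_mul_inv]
    linarith
  · rw [Nat.sub_eq_zero_of_le h, pow_zero]
    have : (0 : ℝ) ≤ 2 ^ a / 2 ^ g := by positivity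
    linarith

namespace ParBounds

variable {p : Par} {K Λ t V : ℝ}

theorem L0 (h : ParBounds p K Λ t V) : 0 < Λ / p.w := div_pos (by linarith [h.Λ1]) h.w0

/-- The length of a character cancels: `2 ^ τ * s` is of order `log u`, and a word holds about `w /
M ≥ w / (K * s)` fields. -/
theorem Xg (h : ParBounds p K Λ t V) : (2 : ℝ) ^ p.τ / 2 ^ p.g ≤ 64 * K * (Λ / p.w) := by
  have hK := h.K1
  have h1 : (2 : ℝ) ^ p.τ * p.w ≤ 64 * K * Λ * 2 ^ p.g := calc
    (2 : ℝ) ^ p.τ * p.w ≤ 2 ^ p.τ * (4 * (K * p.s) * 2 ^ p.g) := by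
      refine mul_le_mul_of_nonneg_left (h.g.trans ?_) (by positivity)
      exact mul_le_mul_of_nonneg_right (by linarith [h.M]) (by positivity)
    _ = 4 * K * 2 ^ p.g * (2 ^ p.τ * p.s) := by ring
    _ ≤ 4 * K * 2 ^ p.g * (16 * Λ) := mul_le_mul_of_nonneg_left h.Xs (by positivity)
    _ = 64 * K * Λ * 2 ^ p.g := by ring
  rw [div_le_iff₀ (by positivity), ← mul_div_assoc, div_mul_eq_mul_div, le_div_iff₀ h.w0]
  exact h1

theorem Qg (h : ParBounds p K Λ t V) : (2 : ℝ) ^ p.q / 2 ^ p.gr ≤ K * (Λ / p.w) := by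
  rw [div_le_iff₀ (by positivity), ← mul_div_assoc, div_mul_eq_mul_div, le_div_iff₀ h.w0]
  exact h.q

theorem XDE (h : ParBounds p K Λ t V) : (2 : ℝ) ^ (p.τ + p.δ + p.M) ≤ 512 * K ^ 2 * (t * V) := by
  have hK := h.K1
  have ht := h.t1
  calc (2 : ℝ) ^ (p.τ + p.δ + p.M) = 2 ^ p.τ * 2 ^ p.δ * 2 ^ p.M := by rw [pow_add, pow_add]
    _ ≤ 512 * t * K * (K * V) := by
      have := h.X
      have := h.D
      have := h.E
      gcongr
    _ = _ := by ring

theorem BW (h : ParBounds p K Λ t V) : (p.BW : ℝ) ≤ 1 + 64 * K ^ 2 * (Λ / p.w) := by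
  have hK := h.K1
  have hL := h.L0
  unfold Par.BW
  push_cast
  refine (two_pow_sub_le _ _).trans (add_le_add_right ?_ _)
  calc (2 : ℝ) ^ (p.τ + p.δ) / 2 ^ p.g = 2 ^ p.τ / 2 ^ p.g * 2 ^ p.δ := by rw [pow_add]; ring
    _ ≤ 64 * K * (Λ / p.w) * K := by
      have := h.Xg
      have := h.D
      gcongr
    _ = _ := by ring

/-- Of the two factors `2 ^ τ`, one combines with the packing to `Λ / w`, and the other belongs to
the `t * V` entries. -/
theorem TW (h : ParBounds p K Λ t V) (hτ : 1 ≤ p.τ) :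
    (p.TW : ℝ) ≤ 1 + 32768 * K ^ 4 * (t * V * (Λ / p.w)) := by
  have hK := h.K1
  have hL := h.L0
  have ht := h.t1
  unfold Par.TW
  push_cast
  refine (two_pow_sub_le _ _).trans (add_le_add_right ?_ _)
  calc (2 : ℝ) ^ (p.τ + p.τ - 2 + p.δ + p.δ + p.M) / 2 ^ p.g
      ≤ 2 ^ (p.τ + p.τ + p.δ + p.δ + p.M) / 2 ^ p.g := by
        refine div_le_div_of_nonneg_right ?_ (by positivity)
        exact pow_le_pow_right₀ (by norm_num) (by omega)
    _ = 2 ^ p.τ / 2 ^ p.g * 2 ^ p.δ * 2 ^ (p.τ + p.δ + p.M) := by simp only [pow_add]; ring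
    _ ≤ 64 * K * (Λ / p.w) * K * (512 * K ^ 2 * (t * V)) := by
      have := h.Xg
      have := h.D
      have := h.XDE
      gcongr
    _ = _ := by ring

theorem VW (h : ParBounds p K Λ t V) : (p.VW : ℝ) ≤ 1 + 512 * K ^ 3 * (t * V * (Λ / p.w)) := by
  have hK := h.K1
  have hL := h.L0
  have ht := h.t1
  unfold Par.VW
  push_cast
  refine (two_pow_sub_le _ _).trans (add_le_add_right ?_ _)
  calc (2 : ℝ) ^ (p.τ + p.δ + p.M + p.q - 1) / 2 ^ p.gr
      ≤ 2 ^ (p.τ + p.δ + p.M + p.q) / 2 ^ p.gr := by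
        refine div_le_div_of_nonneg_right ?_ (by positivity)
        exact pow_le_pow_right₀ (by norm_num) (by omega)
    _ = 2 ^ (p.τ + p.δ + p.M) * (2 ^ p.q / 2 ^ p.gr) := by rw [pow_add _ _ p.q]; ring
    _ ≤ 512 * K ^ 2 * (t * V) * (K * (Λ / p.w)) := by
      have := h.XDE
      have := h.Qg
      have := h.V1
      gcongr
    _ = _ := by ring

theorem NV (h : ParBounds p K Λ t V) : (p.NV : ℝ) ≤ 512 * K ^ 3 * (t * V * (1 + Λ / p.w)) := by
  have hK := h.K1
  have hL := h.L0
  have ht := h.t1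
  unfold Par.NV
  push_cast
  calc (2 : ℝ) ^ (p.τ + p.δ + p.M + p.q - 1)
      ≤ 2 ^ (p.τ + p.δ + p.M + p.q) := pow_le_pow_right₀ (by norm_num) (by omega)
    _ = 2 ^ (p.τ + p.δ + p.M) * 2 ^ p.q := by rw [pow_add _ _ p.q]
    _ ≤ 512 * K ^ 2 * (t * V) * (K * (1 + Λ / p.w)) := by
      have := h.XDE
      have := h.q'
      have := h.V1
      gcongr
    _ = _ := by ring

theorem one_le_tV (h : ParBounds p K Λ t V) : 1 ≤ t * V := one_le_mul_of_one_le_of_one_le h.t1 h.V1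

theorem S (h : ParBounds p K Λ t V) (hτ : 1 ≤ p.τ) :
    (p.S : ℝ) ≤ 40000 * K ^ 4 * (1 + t * V * (Λ / p.w)) := by
  have hK := h.K1
  have hL := h.L0
  have h1 := h.BW
  have h2 := h.TW hτ
  have h3 := h.VW
  have h4 := h.q'
  have h0 : (p.S : ℝ) = 24 + 2 ^ p.q + 2 ^ p.q + p.BW + p.BW + p.TW + p.VW := by
    simp only [Par.S, Par.bV, Par.bT, Par.b1, Par.b0, Par.bA, Par.bR]
    push_cast
    ring
  have hLP : Λ / p.w ≤ t * V * (Λ / p.w) := le_mul_of_one_le_left hL.le h.one_le_tV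
  have hK2 : K ≤ K ^ 4 := le_self_pow₀ hK (by norm_num)
  have hK3 : K ^ 2 ≤ K ^ 4 := pow_le_pow_right₀ hK (by norm_num)
  have hK4 : K ^ 3 ≤ K ^ 4 := pow_le_pow_right₀ hK (by norm_num)
  set P := t * V * (Λ / p.w) with hP
  have hP0 : 0 < P := hL.trans_le hLP
  have e1 : K * (Λ / p.w) ≤ K ^ 4 * P := mul_le_mul hK2 hLP hL.le (by positivity)
  have e2 : K ^ 2 * (Λ / p.w) ≤ K ^ 4 * P := mul_le_mul hK3 hLP hL.le (by positivity)
  have e3 : K ^ 3 * P ≤ K ^ 4 * P := mul_le_mul_of_nonneg_right hK4 hP0.le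
  rw [h0]
  nlinarith

theorem one_le_X (p : Par) : (1 : ℝ) ≤ 2 ^ p.τ := one_le_pow₀ (by norm_num)

theorem τ_le (h : ParBounds p K Λ t V) : (p.τ : ℝ) ≤ 9 + Real.logb 2 t := by
  have h1 : Real.logb 2 ((2 : ℝ) ^ p.τ) ≤ Real.logb 2 (2 ^ 9 * t) :=
    Real.logb_le_logb_of_le (by norm_num) (by positivity) (h.X.trans_eq (by norm_num))
  rw [Real.logb_mul (by positivity) (by linarith [h.t1]), Real.logb_pow, Real.logb_pow] at h1
  simpa using h1

/-- Each height has fewer than `2 ^ (τ + δ)` coordinates in total. Their fixed overhead gives the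
summand with `τ`, the source of `t * log t`. The words per entry double with the height, so that
part is a geometric sum. -/
theorem levels (p : Par) :
    ((∑ j ∈ Finset.range (p.τ - 1), (p.levelTime j + 1) : ℕ) : ℝ) ≤
      p.τ * (71 + 6 * p.BW) + 6 * 2 ^ p.τ +
        2 ^ p.τ * 2 ^ p.δ * (128 * p.τ + 22 * (2 ^ p.τ * 2 ^ p.δ / 2 ^ p.g)) := by
  have hgeo : ∀ n : ℕ, ∑ j ∈ Finset.range n, (2 : ℝ) ^ (j + 1) ≤ 2 ^ (n + 1) := by
    intro n
    induction n with
    | zero => simp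
    | succ n ih => rw [Finset.sum_range_succ, pow_succ _ (n + 1)]; linarith
  have hstep : ∀ j ∈ Finset.range (p.τ - 1), ((p.levelTime j + 1 : ℕ) : ℝ) ≤
      (71 + 6 * p.BW) + 2 ^ (p.τ - 1 - j) * 6 + 2 ^ p.τ * 2 ^ p.δ * (128 + 22 * (2 ^ (j + 1) * (2 ^ p.δ / 2 ^ p.g))) := by
    intro j hj
    have hj := Finset.mem_range.1 hj
    have e1 : (2 : ℝ) ^ (p.τ - j - 1) * 2 ^ (j + p.δ) ≤ 2 ^ p.τ * 2 ^ p.δ := by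
      rw [← pow_add, ← pow_add]
      exact pow_le_pow_right₀ (by norm_num) (by omega)
    have e2 := two_pow_sub_le (j + 1 + p.δ) p.g
    have e3 : (2 : ℝ) ^ (j + 1 + p.δ) / 2 ^ p.g = 2 ^ (j + 1) * (2 ^ p.δ / 2 ^ p.g) := by
      rw [pow_add]; ring
    rw [e3] at e2
    have e4 : (0 : ℝ) < 2 ^ p.τ * 2 ^ p.δ := by positivity
    have e5 : (2 : ℝ) ^ (p.τ - j - 1) * 2 ^ (j + p.δ) * (106 + 2 ^ (j + 1 + p.δ - p.g) * 22) ≤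
        2 ^ p.τ * 2 ^ p.δ * (128 + 22 * (2 ^ (j + 1) * (2 ^ p.δ / 2 ^ p.g))) :=
      mul_le_mul e1 (by linarith) (by positivity) e4.le
    unfold Par.levelTime Par.nodeTime
    push_cast
    rw [show p.τ - 1 - j = p.τ - j - 1 by omega]
    linarith
  rw [Nat.cast_sum]
  refine (Finset.sum_le_sum hstep).trans ?_
  have h6 : ∑ j ∈ Finset.range (p.τ - 1), (2 : ℝ) ^ (p.τ - 1 - j) = ∑ j ∈ Finset.range (p.τ - 1), 2 ^ (j + 1) := by
    rw [← Finset.sum_range_reflect]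
    refine Finset.sum_congr rfl fun j hj => ?_
    have := Finset.mem_range.1 hj
    congr 1
    omega
  have h7 := hgeo (p.τ - 1)
  have h8 : ((p.τ - 1 : ℕ) : ℝ) ≤ p.τ := by exact_mod_cast Nat.sub_le _ _
  rcases Nat.eq_zero_or_pos p.τ with h9 | h9
  · simp [h9]
    have : (0 : ℝ) ≤ 2 ^ p.δ * (22 * (2 ^ p.δ / 2 ^ p.g)) := by positivity
    linarith
  rw [Nat.sub_add_cancel h9] at h7
  simp only [Finset.sum_add_distrib, ← Finset.sum_mul, ← Finset.mul_sum, h6, Finset.sum_const,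
    Finset.card_range, nsmul_eq_mul]
  have a1 := mul_le_mul_of_nonneg_right h8 (Nat.cast_nonneg (α := ℝ) p.BW)
  have a2 : (2 : ℝ) ^ p.τ * 2 ^ p.δ * (((p.τ - 1 : ℕ) : ℝ) * 128 +
      22 * ((∑ j ∈ Finset.range (p.τ - 1), (2 : ℝ) ^ (j + 1)) * (2 ^ p.δ / 2 ^ p.g))) ≤
      2 ^ p.τ * 2 ^ p.δ * (128 * p.τ + 22 * (2 ^ p.τ * 2 ^ p.δ / 2 ^ p.g)) := by
    refine mul_le_mul_of_nonneg_left ?_ (by positivity)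
    have h10 := mul_le_mul_of_nonneg_right h7 (show (0 : ℝ) ≤ 2 ^ p.δ / 2 ^ p.g by positivity)
    have h11 : (2 : ℝ) ^ p.τ * 2 ^ p.δ / 2 ^ p.g = 2 ^ p.τ * (2 ^ p.δ / 2 ^ p.g) := by ring
    rw [h11]
    linarith
  linarith

theorem eval (h : ParBounds p K Λ t V) : (p.evalTime : ℝ) ≤
    10 ^ 8 * K ^ 4 * (1 + t * Real.logb 2 t + t * Λ / p.w) := by
  have hK := h.K1
  have hL := h.L0
  have ht := h.t1
  have h1 := h.BW
  have h2 := levels p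
  have h3 := h.X
  have h4 := h.τ_le
  have h5 := h.D
  have h6 : (p.nr : ℝ) ≤ K * (1 + Λ / p.w) := h.nr.trans h.q'
  have hlog : 0 ≤ Real.logb 2 t := Real.logb_nonneg (by norm_num) ht
  have hD : (2 : ℝ) ^ (p.δ - p.g) ≤ 2 ^ p.δ := pow_le_pow_right₀ (by norm_num) (by omega)
  have hX1 := one_le_X p
  have hτX : (p.τ : ℝ) ≤ 2 ^ p.τ := by exact_mod_cast Nat.lt_two_pow_self.le
  set X : ℝ := 2 ^ p.τ with hX
  set D : ℝ := 2 ^ p.δ with hDd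
  set L := Λ / p.w with hLd
  set l := Real.logb 2 t with hl
  set Y := 1 + t + t * l + t * L with hY
  have htl : 0 ≤ t * l := by positivity
  have htL : 0 ≤ t * L := by positivity
  have hLt : L ≤ t * L := le_mul_of_one_le_left hL.le ht
  have hY1 : 1 ≤ Y := by linarith
  have hKn : ∀ n ≤ 4, K ^ n ≤ K ^ 4 := fun n hn => pow_le_pow_right₀ hK hn
  have hD1 : 1 ≤ D := one_le_pow₀ (by norm_num)
  have b1 : (p.BW : ℝ) ≤ 65 * K ^ 2 * Y := by nlinarith [hKn 2 (by norm_num), one_le_pow₀ hK (n := 2)]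
  have b2 : X * (51 + 2 ^ (p.δ - p.g) * 22) ≤ 512 * t * (73 * K) :=
    mul_le_mul h3 (by linarith) (by positivity) (by positivity)
  have b3 : (p.nr : ℝ) ≤ K * Y := h6.trans (mul_le_mul_of_nonneg_left (by linarith) (by linarith))
  have b4 : (2 : ℝ) ^ (p.τ - 1 + p.δ) * (p.topTime + 1) ≤ 512 * t * K * (276 * K * (1 + L)) := by
    refine mul_le_mul ?_ ?_ (by positivity) (by positivity)
    · calc (2 : ℝ) ^ (p.τ - 1 + p.δ) ≤ 2 ^ (p.τ + p.δ) := pow_le_pow_right₀ (by norm_num) (by omega)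
        _ = X * D := pow_add _ _ _
        _ ≤ _ := mul_le_mul h3 h5 (by positivity) (by positivity)
    · unfold Par.topTime Par.addTime
      push_cast
      nlinarith [mul_nonneg (sub_nonneg.2 hK) hL.le]
  have b5 : p.τ * (71 + 6 * p.BW : ℝ) ≤ 512 * t * (71 + 6 * (1 + 64 * K ^ 2 * L)) :=
    mul_le_mul (hτX.trans h3) (by linarith) (by positivity) (by positivity)
  have b6 : X * D * (128 * p.τ + 22 * (X * D / 2 ^ p.g)) ≤
      512 * t * K * (128 * (9 + l) + 22 * (64 * K * L * K)) := by
    have h7 := h.Xg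
    have h8 : X * D / 2 ^ p.g ≤ 64 * K * L * K := by
      rw [mul_div_right_comm]
      exact mul_le_mul h7 h5 (by positivity) (by positivity)
    exact mul_le_mul (mul_le_mul h3 h5 (by positivity) (by positivity)) (by linarith) (by positivity)
      (by positivity)
  have htY : t ≤ Y := by linarith
  have htlY : t * l ≤ Y := by linarith
  have htLY : t * L ≤ Y := by linarith
  have hm : ∀ n ≤ 4, ∀ z ≤ Y, 0 ≤ z → K ^ n * z ≤ K ^ 4 * Y := fun n hn z hz h0 =>
    mul_le_mul (hKn n hn) hz h0 (by positivity)
  have m0 := hm 0 (by norm_num) t htY (by linarith)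
  have m1 := hm 1 (by norm_num) t htY (by linarith)
  have m1l := hm 1 (by norm_num) _ htlY htl
  have m2 := hm 2 (by norm_num) t htY (by linarith)
  have m2L := hm 2 (by norm_num) _ htLY htL
  have m3L := hm 3 (by norm_num) _ htLY htL
  have m0Y := hm 0 (by norm_num) Y le_rfl (by linarith)
  have m1Y := hm 1 (by norm_num) Y le_rfl (by linarith)
  have m2Y := hm 2 (by norm_num) Y le_rfl (by linarith)
  have htot : (p.evalTime : ℝ) ≤ 3 * 10 ^ 7 * (K ^ 4 * Y) := by
    unfold Par.evalTime
    push_cast at h2 ⊢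
    have c2 : 512 * t * (73 * K) = 37376 * (K ^ 1 * t) := by ring
    have c4 : 512 * t * K * (276 * K * (1 + L)) = 141312 * (K ^ 2 * t) + 141312 * (K ^ 2 * (t * L)) := by ring
    have c5 : 512 * t * (71 + 6 * (1 + 64 * K ^ 2 * L)) =
        39424 * (K ^ 0 * t) + 196608 * (K ^ 2 * (t * L)) := by ring
    have c6 : 512 * t * K * (128 * (9 + l) + 22 * (64 * K * L * K)) = 589824 * (K ^ 1 * t) +
        65536 * (K ^ 1 * (t * l)) + 720896 * (K ^ 3 * (t * L)) := by ring
    rw [c2] at b2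
    rw [c4] at b4
    rw [c5] at b5
    rw [c6] at b6
    have d0 : K ^ 0 * Y = Y := by ring
    have d1 : K ^ 1 * Y = K * Y := by ring
    have d2 : K ^ 0 * t = t := by ring
    have d3 : 65 * K ^ 2 * Y = 65 * (K ^ 2 * Y) := by ring
    rw [d3] at b1
    have hB : (0 : ℝ) ≤ K ^ 4 * Y := by positivity
    linarith
  -- The terms linear in `t` are absorbed with `1 - 1 / t ≤ log t`.
  have htle : t ≤ 1 + t * l := by
    have h7 := Real.one_sub_inv_le_log_of_pos (show 0 < t by linarith)
    have h8 : Real.log t ≤ l := by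
      rw [hl, Real.logb, le_div_iff₀ (Real.log_pos (by norm_num))]
      exact mul_le_of_le_one_right (Real.log_nonneg ht)
        ((Real.log_two_lt_d9.le).trans (by norm_num))
    have h9 := mul_le_mul_of_nonneg_left (h7.trans h8) (show 0 ≤ t by linarith)
    rw [mul_sub, mul_one, mul_inv_cancel₀ (by linarith)] at h9
    linarith
  have hYle : Y ≤ 3 * (1 + t * l + t * L) := by linarith
  rw [mul_div_assoc]
  refine htot.trans ?_
  have := mul_le_mul_of_nonneg_left hYle (show 0 ≤ K ^ 4 by positivity)
  have h0 : 0 ≤ K ^ 4 * (1 + t * l + t * L) := by positivity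
  linarith

theorem init (h : ParBounds p K Λ t V) (hτ : 1 ≤ p.τ) {nu : ℕ} (hnu : (nu : ℝ) ≤ 1 + Λ / p.w) :
    (max (p.selectTime nu) p.sampleTime : ℝ) ≤ 10 ^ 6 * K ^ 4 * (t * V * (1 + Λ / p.w) + p.w) := by
  have hK := h.K1
  have hL := h.L0
  have h1 := h.TW hτ
  have h2 := h.NV
  have h3 : (p.nr : ℝ) ≤ K * (1 + Λ / p.w) := h.nr.trans h.q'
  have h4 := h.one_le_tV
  have hw := h.w0
  set L := Λ / p.w with hLd
  set P := t * V * (1 + L) with hP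
  have hP1 : 1 + L ≤ P := le_mul_of_one_le_left (by linarith) h4
  have hPL : t * V * L ≤ P := mul_le_mul_of_nonneg_left (by linarith) (by linarith)
  have hP0 : 0 < P := by linarith
  have hKn : ∀ n ≤ 4, ∀ z ≤ P, 0 ≤ z → K ^ n * z ≤ K ^ 4 * P := fun n hn z hz h0 =>
    mul_le_mul (pow_le_pow_right₀ hK hn) hz h0 (by positivity)
  have m0 := hKn 0 (by norm_num) P le_rfl hP0.le
  have m1 := hKn 1 (by norm_num) (1 + L) hP1 (by linarith)
  have m3 := hKn 3 (by norm_num) P le_rfl hP0.le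
  have m4 := hKn 4 (by norm_num) _ hPL (by positivity)
  have m5 : (p.w : ℝ) ≤ K ^ 4 * p.w := le_mul_of_one_le_left hw.le (one_le_pow₀ hK)
  rw [pow_zero, one_mul] at m0
  rw [pow_one] at m1
  rw [mul_assoc] at h1 h2
  have h5 : 10 ^ 6 * K ^ 4 * (P + p.w) = 10 ^ 6 * (K ^ 4 * P) + 10 ^ 6 * (K ^ 4 * p.w) := by ring
  rw [h5]
  refine max_le ?_ ?_
  · unfold Par.selectTime
    push_cast
    linarith
  · unfold Par.sampleTime
    push_cast
    linarith

end ParBounds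

end WordRAM

/-! ### Consequences of the assumptions on the input and on the word size. -/

namespace WordRAM

/-- The constant in `ParBounds`. -/
def parConst (A B : ℕ) : ℕ := 2 ^ 21 * (64 * B + 21) ^ 2 * (A + 1)

/-- The assumptions on the input. -/
structure Admissible (A B u r t k w : ℕ) : Prop where
  u2 : 2 ≤ u
  r0 : 0 < r
  t0 : 0 < t
  k0 : 0 < k
  w0 : 0 < w
  rA : r ≤ u ^ A
  kB : (k : ℝ) ≤ (u : ℝ) ^ ((B : ℝ) / (t : ℝ))
  space : 10 ^ 8 * (parConst A B : ℝ) ^ 4 * spaceBound u t k w ≤ (2 : ℝ) ^ w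

theorem le_logb {n x : ℕ} (h : 2 ^ n ≤ x) : (n : ℝ) ≤ Real.logb 2 x := by
  have : (0 : ℝ) < x := by exact_mod_cast (Nat.two_pow_pos n).trans_le h
  rw [Real.le_logb_iff_rpow_le (by norm_num) this, Real.rpow_natCast]
  exact_mod_cast h

theorem logb_le {n x : ℕ} (h0 : 0 < x) (h : x ≤ 2 ^ n) : Real.logb 2 x ≤ n := by
  have : (0 : ℝ) < x := by exact_mod_cast h0
  rw [Real.logb_le_iff_le_rpow (by norm_num) this, Real.rpow_natCast]
  exact_mod_cast h

theorem parConst_ge (A B : ℕ) : 2 ^ 21 ≤ parConst A B ∧ 64 * B + 21 ≤ parConst A B ∧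
    2 ^ 12 * (64 * B + 21) ^ 2 ≤ parConst A B ∧ 4 * (A + 1) ≤ parConst A B := by
  unfold parConst
  have h1 : 1 ≤ (64 * B + 21) ^ 2 := Nat.one_le_pow _ _ (by omega)
  have h2 : 64 * B + 21 ≤ (64 * B + 21) ^ 2 := Nat.le_self_pow (by norm_num) _
  generalize (64 * B + 21) ^ 2 = x at *
  refine ⟨?_, ?_, ?_, ?_⟩ <;> nlinarith [Nat.zero_le (A * x)]

namespace Admissible

variable {A B u r t k w : ℕ}

theorem Λ1 (h : Admissible A B u r t k w) : 1 ≤ Real.logb 2 u := by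
  simpa using le_logb (n := 1) (by simpa using h.u2)

theorem U1 (h : Admissible A B u r t k w) : 1 ≤ (u : ℝ) ^ (1 / (t : ℝ)) :=
  Real.one_le_rpow (by exact_mod_cast (by have := h.u2; omega)) (by positivity)

theorem V1 (h : Admissible A B u r t k w) : 1 ≤ (k : ℝ) * (u : ℝ) ^ (1 / (t : ℝ)) :=
  one_le_mul_of_one_le_of_one_le (by exact_mod_cast h.k0) h.U1

theorem U_eq (h : Admissible A B u r t k w) (c : ℝ) :
    (u : ℝ) ^ (c / (t : ℝ)) = 2 ^ (c * Real.logb 2 u / t) := by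
  have hu : (0 : ℝ) < u := by exact_mod_cast (by have := h.u2; omega)
  nth_rewrite 1 [← Real.rpow_logb (b := 2) (by norm_num) (by norm_num) hu]
  rw [← Real.rpow_mul (by norm_num)]
  congr 1
  ring

theorem K1 (A B : ℕ) : (1 : ℝ) ≤ parConst A B := by
  exact_mod_cast (parConst_ge A B).1.trans' (by norm_num)

theorem space' (h : Admissible A B u r t k w) : 10 ^ 8 * (parConst A B : ℝ) ^ 4 *
    (1 + t * (k * (u : ℝ) ^ (1 / (t : ℝ))) * (Real.logb 2 u / w)) ≤ (2 : ℝ) ^ w := by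
  convert h.space using 2
  unfold spaceBound
  ring

theorem mul_le (h : Admissible A B u r t k w) :
    10 ^ 8 * (t * (u : ℝ) ^ (1 / (t : ℝ)) * Real.logb 2 u) ≤ (2 : ℝ) ^ w * w := by
  have hw : (0 : ℝ) < w := by exact_mod_cast h.w0
  rw [← div_le_iff₀ hw]
  refine le_trans ?_ h.space'
  have h1 : (1 : ℝ) ≤ parConst A B ^ 4 := one_le_pow₀ (K1 A B)
  have h2 : (1 : ℝ) ≤ k := by exact_mod_cast h.k0
  have h3 := h.U1
  have h4 := h.Λ1
  have h5 : (1 : ℝ) ≤ t := by exact_mod_cast h.t0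
  set U := (u : ℝ) ^ (1 / (t : ℝ))
  set Λ := Real.logb 2 u
  have h6 : (t : ℝ) * U * Λ / w ≤ t * (k * U) * (Λ / w) := by
    rw [← mul_div_assoc]
    refine div_le_div_of_nonneg_right ?_ hw.le
    have : (t : ℝ) * U * Λ ≤ k * (t * U * Λ) := le_mul_of_one_le_left (by positivity) h2
    linarith
  have h7 : 0 ≤ (t : ℝ) * U * Λ / w := by positivity
  calc 10 ^ 8 * (t * U * Λ) / w = 10 ^ 8 * 1 * (t * U * Λ / w) := by ring
    _ ≤ 10 ^ 8 * (parConst A B : ℝ) ^ 4 * (1 + t * (k * U) * (Λ / w)) := by gcongr; linarith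

theorem w7 (h : Admissible A B u r t k w) : 7 ≤ w := by
  by_contra hw
  have h1 := h.space'
  have h2 : (1 : ℝ) ≤ parConst A B ^ 4 := one_le_pow₀ (K1 A B)
  have h3 : (2 : ℝ) ^ w ≤ 2 ^ 6 := pow_le_pow_right₀ (by norm_num) (by omega)
  have h4 := h.Λ1
  have h5 : 0 ≤ (t : ℝ) * (k * (u : ℝ) ^ (1 / (t : ℝ))) * (Real.logb 2 u / w) := by positivity
  nlinarith

theorem w_le (w : ℕ) : (w : ℝ) ≤ 2 ^ w := by exact_mod_cast Nat.lt_two_pow_self.le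

/-- The space alone exceeds `u ^ (1 / t)`, up to a factor `w`, and must be addressable; take
logarithms. -/
theorem Λ_le (h : Admissible A B u r t k w) : Real.logb 2 u ≤ 2 * w * t := by
  have ht : (0 : ℝ) < t := by exact_mod_cast h.t0
  have h5 : (1 : ℝ) ≤ t := by exact_mod_cast h.t0
  have h3 := h.U1
  have h4 := h.Λ1
  have h1 : (u : ℝ) ^ (1 / (t : ℝ)) ≤ 2 ^ w * 2 ^ w := by
    refine le_trans ?_ (h.mul_le.trans (mul_le_mul_of_nonneg_left (w_le w) (by positivity)))
    have : (u : ℝ) ^ (1 / (t : ℝ)) ≤ t * (u : ℝ) ^ (1 / (t : ℝ)) * Real.logb 2 u := by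
      rw [mul_right_comm]
      exact le_mul_of_one_le_left (by linarith) (one_le_mul_of_one_le_of_one_le h5 h4)
    linarith
  rw [h.U_eq, one_mul, ← pow_add, ← Real.rpow_natCast, Real.rpow_le_rpow_left_iff (by norm_num),
    div_le_iff₀ ht] at h1
  push_cast at h1
  linarith

/-- Since `log u / t ≤ u ^ (1 / t)`, a logarithm of at least `2 ^ w` would make the space too large
to be addressed. -/
theorem Λ_lt (h : Admissible A B u r t k w) : Real.logb 2 u < 2 ^ w := by
  have ht : (1 : ℝ) ≤ t := by exact_mod_cast h.t0
  have h4 := h.Λ1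
  have h1 : Real.logb 2 u ≤ t * (u : ℝ) ^ (1 / (t : ℝ)) := by
    have h2 := Real.add_one_le_exp (Real.log 2 * (Real.logb 2 u / t))
    rw [h.U_eq, one_mul, Real.rpow_def_of_pos (by norm_num)]
    have h3 : Real.logb 2 u / t ≤ Real.exp (Real.log 2 * (Real.logb 2 u / t)) := by
      have h5 := Real.add_one_le_exp (Real.log 2 * (Real.logb 2 u / t) - Real.log 2 )
      rw [Real.exp_sub, Real.exp_log (by norm_num)] at h5
      have h6 := Real.log_two_gt_d9
      have h7 := Real.log_two_lt_d9
      have h8 : 0 ≤ Real.logb 2 u / t := by positivity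
      nlinarith
    rw [div_le_iff₀ (by linarith)] at h3
    linarith
  by_contra h2
  have h3 := h.mul_le
  have h5 : Real.logb 2 u * 2 ^ w ≤ t * (u : ℝ) ^ (1 / (t : ℝ)) * Real.logb 2 u := by
    rw [mul_comm]
    exact mul_le_mul ((not_lt.1 h2).trans h1) le_rfl (by linarith) (by positivity)
  have h6 := w_le w
  have h7 : (0 : ℝ) < 2 ^ w := by positivity
  nlinarith

theorem t_Λ (h : Admissible A B u r t k w) : t * Real.logb 2 u ≤ 2 ^ w * w := by
  have ht : (1 : ℝ) ≤ t := by exact_mod_cast h.t0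
  have h4 := h.Λ1
  refine le_trans ?_ h.mul_le
  have : t * Real.logb 2 u ≤ t * (u : ℝ) ^ (1 / (t : ℝ)) * Real.logb 2 u := by
    rw [mul_right_comm]
    exact le_mul_of_one_le_right (by positivity) h.U1
  have h0 : 0 ≤ t * Real.logb 2 u := by positivity
  linarith

theorem lam_le (h : Admissible A B u r t k w) : (lam w (wordLen w u) u : ℝ) ≤ Real.logb 2 u :=
  le_logb (lam_spec h.w0 h.u2).2.1

theorem le_lam (h : Admissible A B u r t k w) : Real.logb 2 u ≤ 2 * lam w (wordLen w u) u := by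
  have h1 := lam_spec h.w0 h.u2
  exact_mod_cast (logb_le (by have := h.u2; omega) h1.2.2.2.le).trans (Nat.cast_le.2 h1.2.2.1)

theorem lam_lt (h : Admissible A B u r t k w) : lam w (wordLen w u) u < 2 ^ w := by
  exact_mod_cast h.lam_le.trans_lt h.Λ_lt

/-- If `t` needs several words, then `t ≥ 2 ^ w`, which forces `log u ≤ t`. Characters of one bit
are then long enough, which justifies that `chr` ignores `t` in this case. -/
theorem lam_le_chr (h : Admissible A B u r t k w) :
    lam w (wordLen w u) u ≤ 32 * t * 2 ^ chr w u t := by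
  rcases eq_or_ne (wordLen w t) 1 with h1 | h1
  · exact (lt_chr h.t0 h1).le
  · obtain ⟨h2, h3, -⟩ := wordLen_spec h.w0 h.t0
    have h4 : (2 : ℝ) ^ w ≤ t := by
      exact_mod_cast (Nat.pow_le_pow_right (by norm_num) (Nat.le_mul_of_pos_right w (by omega))).trans h3
    have h5 := h.t_Λ
    have h6 : Real.logb 2 u ≤ t := by
      have h7 := w_le w
      have h8 : (0 : ℝ) < 2 ^ w := by positivity
      have h9 := h.Λ1
      nlinarith
    have h7 : lam w (wordLen w u) u ≤ t := by exact_mod_cast h.lam_le.trans h6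
    have h8 : 1 ≤ 2 ^ chr w u t := Nat.one_le_two_pow
    nlinarith

theorem chr_le_w (h : Admissible A B u r t k w) : 2 ^ chr w u t ≤ xbits w (wordLen w u) u := by
  have hw := h.w0
  have ht := h.t0
  obtain ⟨h1, h2, h3, h4⟩ := lam_spec h.w0 h.u2
  rcases chr_le w u t with h5 | h5
  · rw [h5]
    rcases Nat.eq_zero_or_pos (xbits w (wordLen w u) u) with h6 | h6
    · rw [h6] at h4
      have := h.u2
      simp at h4
      omega
    · exact h6
  · have h6 := h.lam_le.trans h.Λ_le
    have h7 : lam w (wordLen w u) u ≤ 2 * w * t := by exact_mod_cast h6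
    have h8 : 2 ^ chr w u t ≤ w := by
      refine Nat.le_of_mul_le_mul_left (h5.trans (h7.trans ?_)) (show 0 < 16 * t by omega)
      nlinarith [Nat.zero_le (w * t)]
    unfold xbits
    split_ifs with h9
    · unfold lam at h5
      rw [if_pos h9] at h5
      have : 2 ^ chr w u t ≤ 16 * t * 2 ^ chr w u t := Nat.le_mul_of_pos_left _ (by omega)
      omega
    · exact h8

/-- Rounding both the bits per word and the number of words up to powers of two costs a factor 4,
the summand 1 in `τ` another 2, and `lam_spec` another 2. -/
theorem two_pow_τ (h : Admissible A B u r t k w) :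
    2 ^ (par w u r t k).τ * 2 ^ chr w u t ≤ 16 * lam w (wordLen w u) u := by
  have h1 : chr w u t ≤ clg (xbits w (wordLen w u) u) := by
    by_contra h2
    exact absurd (h.chr_le_w.trans (le_two_pow_clg _))
      (not_le.2 (Nat.pow_lt_pow_right (by norm_num) (by omega)))
  have hx : 0 < xbits w (wordLen w u) u := (Nat.two_pow_pos _).trans_le h.chr_le_w
  have hn := (wordLen_spec (x := u) h.w0 (by have := h.u2; omega)).1
  have e : 2 ^ (par w u r t k).τ * 2 ^ chr w u t =
      2 * (2 ^ clg (xbits w (wordLen w u) u) * 2 ^ clg (wordLen w u)) := by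
    rw [← pow_add, ← pow_add, ← pow_succ']
    congr 1
    show 1 + (clg (xbits w (wordLen w u) u) - chr w u t) + clg (wordLen w u) + chr w u t = _
    omega
  rw [e]
  have h3 := Nat.mul_le_mul (two_pow_clg_le hx) (two_pow_clg_le hn)
  have h4 := (lam_spec h.w0 h.u2).2.2.1
  nlinarith

theorem two_pow_τ_le (h : Admissible A B u r t k w) : 2 ^ (par w u r t k).τ ≤ 512 * t := by
  have h1 := h.two_pow_τ.trans (Nat.mul_le_mul_left 16 h.lam_le_chr)
  refine Nat.le_of_mul_le_mul_right (h1.trans_eq ?_) (Nat.two_pow_pos (chr w u t))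
  ring

theorem Λ_le_chr (h : Admissible A B u r t k w) : Real.logb 2 u / t ≤ 64 * 2 ^ chr w u t := by
  have ht : (0 : ℝ) < t := by exact_mod_cast h.t0
  rw [div_le_iff₀ ht]
  have h1 : (lam w (wordLen w u) u : ℝ) ≤ 32 * t * 2 ^ chr w u t := by exact_mod_cast h.lam_le_chr
  linarith [h.le_lam]

/-- The only place where `k ≤ u ^ (B / t)` enters: `log k` is at most a constant times the length of
a character, so the number of scales is bounded. -/
theorem size_k_le (h : Admissible A B u r t k w) : Nat.size k ≤ (64 * B + 1) * 2 ^ chr w u t := by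
  have h0 : 0 < Nat.size k := Nat.size_pos.2 h.k0
  have h1 : ((Nat.size k - 1 : ℕ) : ℝ) ≤ Real.logb 2 k := le_logb (Nat.lt_size.1 (by omega))
  have hk : (0 : ℝ) < k := by exact_mod_cast h.k0
  have h2 := Real.logb_le_logb_of_le (b := 2) (by norm_num) hk h.kB
  rw [h.U_eq, Real.logb_rpow (by norm_num) (by norm_num), mul_div_assoc] at h2
  have h3 := h1.trans (h2.trans (mul_le_mul_of_nonneg_left h.Λ_le_chr (Nat.cast_nonneg B)))
  have h4 : Nat.size k - 1 ≤ B * (64 * 2 ^ chr w u t) := by exact_mod_cast h3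
  have h5 : 1 ≤ 2 ^ chr w u t := Nat.one_le_two_pow
  nlinarith [Nat.sub_add_cancel h0]

theorem two_pow_ℓ (h : Admissible A B u r t k w) :
    2 ^ (par w u r t k).ℓ ≤ 2 * (64 * B + 1) := by
  show 2 ^ (Nat.size (Nat.size k) - chr w u t) ≤ _
  rcases le_total (Nat.size (Nat.size k)) (chr w u t) with h1 | h1
  · rw [Nat.sub_eq_zero_of_le h1]; omega
  · refine Nat.le_of_mul_le_mul_right ?_ (Nat.two_pow_pos (chr w u t))
    rw [← pow_add, Nat.sub_add_cancel h1]
    refine (two_pow_size_le (Nat.size_pos.2 h.k0)).trans ?_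
    rw [mul_assoc]
    exact Nat.mul_le_mul_left 2 h.size_k_le

theorem M_le (h : Admissible A B u r t k w) :
    (par w u r t k).M ≤ (64 * B + 21) * 2 ^ chr w u t := by
  show Nat.size k + 3 * 2 ^ chr w u t + 17 ≤ _
  have := h.size_k_le
  have h5 : 1 ≤ 2 ^ chr w u t := Nat.one_le_two_pow
  nlinarith

theorem two_pow_δ (h : Admissible A B u r t k w) :
    2 ^ (par w u r t k).δ ≤ 2 ^ 12 * (64 * B + 21) ^ 2 := by
  show 2 ^ (10 + 2 * (par w u r t k).ℓ) ≤ _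
  rw [pow_add, mul_comm 2 (par w u r t k).ℓ, pow_mul]
  have := Nat.pow_le_pow_left (h.two_pow_ℓ.trans (show _ ≤ 2 * (64 * B + 21) by omega)) 2
  rw [mul_pow] at this
  refine (Nat.mul_le_mul_left _ this).trans_eq ?_
  ring

/-- Either `s = 1`, which costs a factor 8, or `16 * t * s ≤ log u`, so that `3 * s` is below `log u
/ t`. The remaining factors are `2 * k` and `2 ^ 17`. -/
theorem two_pow_M (h : Admissible A B u r t k w) : (2 : ℝ) ^ (par w u r t k).M ≤
    2 ^ 21 * (k * (u : ℝ) ^ (1 / (t : ℝ))) := by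
  show (2 : ℝ) ^ (Nat.size k + 3 * 2 ^ chr w u t + 17) ≤ _
  have ht : (0 : ℝ) < t := by exact_mod_cast h.t0
  have h1 : (2 : ℝ) ^ Nat.size k ≤ 2 * k := by exact_mod_cast two_pow_size_le h.k0
  have h2 : (2 : ℝ) ^ (3 * 2 ^ chr w u t) ≤ 8 * (u : ℝ) ^ (1 / (t : ℝ)) := by
    rcases chr_le w u t with h5 | h5
    · rw [h5]
      have := h.U1
      rw [mul_one]
      linarith [show (2 : ℝ) ^ 3 = 8 by norm_num]
    · have h6 : (16 * t * 2 ^ chr w u t : ℝ) ≤ Real.logb 2 u :=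
        le_trans (by exact_mod_cast h5) h.lam_le
      have h7 : (3 * 2 ^ chr w u t : ℝ) ≤ 1 * Real.logb 2 u / t := by
        rw [le_div_iff₀ ht]
        have : (0 : ℝ) ≤ t * 2 ^ chr w u t := by positivity
        linarith
      have h8 : (2 : ℝ) ^ (3 * 2 ^ chr w u t) ≤ (u : ℝ) ^ (1 / (t : ℝ)) := by
        rw [h.U_eq, ← Real.rpow_natCast]
        refine Real.rpow_le_rpow_of_exponent_le (by norm_num) ?_
        push_cast
        exact h7
      have := h.U1
      linarith
  have h3 := h.U1
  calc (2 : ℝ) ^ (Nat.size k + 3 * 2 ^ chr w u t + 17)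
      = 2 ^ Nat.size k * 2 ^ (3 * 2 ^ chr w u t) * 2 ^ 17 := by rw [pow_add, pow_add]
    _ ≤ 2 * k * (8 * (u : ℝ) ^ (1 / (t : ℝ))) * 2 ^ 17 := by gcongr
    _ = _ := by ring

theorem log_r (h : Admissible A B u r t k w) : Real.logb 2 r ≤ A * Real.logb 2 u := by
  have hr : (0 : ℝ) < r := by exact_mod_cast h.r0
  rw [← Real.logb_pow]
  exact Real.logb_le_logb_of_le (by norm_num) hr (by exact_mod_cast h.rA)

theorem nr_le (h : Admissible A B u r t k w) : (wordLen w r - 1 : ℝ) * w ≤ A * Real.logb 2 u := by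
  obtain ⟨h1, h2, -⟩ := wordLen_spec h.w0 h.r0
  have h3 := (le_logb h2).trans h.log_r
  push_cast [Nat.cast_sub h1] at h3
  linarith

theorem bounds (h : Admissible A B u r t k w) :
    ParBounds (par w u r t k) (parConst A B) (Real.logb 2 u) t (k * (u : ℝ) ^ (1 / (t : ℝ))) := by
  obtain ⟨c1, c2, c3, c4⟩ := parConst_ge A B
  have c4' : (4 * (A + 1) : ℝ) ≤ parConst A B := by exact_mod_cast c4
  have hw : (0 : ℝ) < w := by exact_mod_cast h.w0
  have hΛ := h.Λ1
  have hnr := wordLen_spec h.w0 h.r0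
  have h1 : ((2 : ℝ) ^ clg (wordLen w r)) ≤ 2 * wordLen w r := by exact_mod_cast two_pow_clg_le hnr.1
  have h2 := h.nr_le
  refine ⟨K1 A B, hΛ, by exact_mod_cast h.t0, h.V1, hw, by exact_mod_cast h.two_pow_τ_le, ?_, ?_, ?_,
    ?_, ?_, ?_, ?_, ?_⟩
  · have h3 : ((2 ^ (par w u r t k).τ * 2 ^ chr w u t : ℕ) : ℝ) ≤ (16 * lam w (wordLen w u) u : ℕ) :=
      Nat.cast_le.2 h.two_pow_τ
    show (2 : ℝ) ^ (par w u r t k).τ * (2 ^ chr w u t : ℕ) ≤ _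
    push_cast at h3 ⊢
    linarith [h.lam_le]
  · exact_mod_cast h.two_pow_δ.trans c3
  · show _ ≤ (parConst A B : ℝ) * (2 ^ chr w u t : ℕ)
    exact_mod_cast h.M_le.trans (Nat.mul_le_mul_right _ c2)
  · refine h.two_pow_M.trans (mul_le_mul_of_nonneg_right (by exact_mod_cast c1) (by linarith [h.V1]))
  · have h3 := le_two_pow_packed w (clg (par w u r t k).M)
    have h4 := two_pow_clg_le (show 0 < (par w u r t k).M from Nat.succ_pos _)
    have h5 : w ≤ 4 * (par w u r t k).M * 2 ^ (par w u r t k).g :=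
      h3.trans (Nat.mul_le_mul_right _ (by omega))
    exact_mod_cast h5
  · show (2 : ℝ) ^ clg (wordLen w r) * w ≤ parConst A B * Real.logb 2 u * 2 ^ (Nat.size w - 1 -
      (if wordLen w r = 1 then clg (Nat.size (r - 1)) else clg w))
    split_ifs with h3
    · rw [h3, show clg 1 = 0 from rfl, pow_zero, one_mul]
      have h4 : (w : ℝ) ≤ 2 * 2 ^ clg (Nat.size (r - 1)) * 2 ^ (Nat.size w - 1 - clg (Nat.size (r - 1))) := by
        exact_mod_cast le_two_pow_packed w (clg (Nat.size (r - 1)))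
      refine h4.trans (mul_le_mul_of_nonneg_right ?_ (by positivity))
      have h5 : (2 : ℝ) ^ clg (Nat.size (r - 1)) ≤ 2 * ((A + 1) * Real.logb 2 u) := by
        rcases Nat.eq_zero_or_pos (r - 1) with h6 | h6
        · rw [h6, show clg (Nat.size 0) = 0 by simp [clg]]
          have : 0 ≤ A * Real.logb 2 u := by positivity
          norm_num
          linarith
        · have h7 : 0 < Nat.size (r - 1) := Nat.size_pos.2 h6
          have h8 : (2 : ℝ) ^ clg (Nat.size (r - 1)) ≤ 2 * Nat.size (r - 1) := by
            exact_mod_cast two_pow_clg_le h7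
          have h9 : 2 ^ (Nat.size (r - 1) - 1) ≤ r := (Nat.lt_size.1 (show Nat.size (r - 1) - 1 < _ by omega)).trans
            (Nat.sub_le r 1)
          have h10 := (le_logb h9).trans h.log_r
          push_cast [Nat.cast_sub (show 1 ≤ Nat.size (r - 1) from h7)] at h10
          linarith
      have h6 := mul_le_mul_of_nonneg_right c4' (show 0 ≤ Real.logb 2 u by linarith)
      linarith
    · have h4 : (2 : ℝ) ≤ wordLen w r := by
        exact_mod_cast (show 2 ≤ wordLen w r by omega)
      have h5 : (2 : ℝ) ^ clg (wordLen w r) * w ≤ 4 * ((wordLen w r - 1) * w) := by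
        have := mul_le_mul_of_nonneg_right (h1.trans (show _ ≤ 4 * ((wordLen w r : ℝ) - 1) by linarith)) hw.le
        linarith
      have h6 : parConst A B * Real.logb 2 u ≤ parConst A B * Real.logb 2 u * 2 ^ (Nat.size w - 1 - clg w) :=
        le_mul_of_one_le_right (by positivity) (one_le_pow₀ (by norm_num))
      have h7 := mul_le_mul_of_nonneg_right c4' (show 0 ≤ Real.logb 2 u by linarith)
      linarith
  · show (2 : ℝ) ^ clg (wordLen w r) ≤ parConst A B * (1 + Real.logb 2 u / w)
    have h3 : (wordLen w r - 1 : ℝ) ≤ A * (Real.logb 2 u / w) := by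
      rw [← mul_div_assoc, le_div_iff₀ hw]; exact h2
    have h4 : 0 ≤ Real.logb 2 u / w := by positivity
    have h5 := mul_le_mul_of_nonneg_right c4' h4
    have h6 := Nat.cast_nonneg (α := ℝ) A
    have h7 : 0 ≤ A * (Real.logb 2 u / w) := by positivity
    linarith
  · show (wordLen w r : ℝ) ≤ 2 ^ clg (wordLen w r)
    exact_mod_cast le_two_pow_clg _

end Admissible

end WordRAM

/-! ### Validity of the parameters and the error bound. -/

namespace WordRAM

namespace Admissible

variable {A B u r t k w : ℕ}

/-- For short words, `w = O(log u)`, there are not many more table entries than words of space, so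
entry numbers are addressable. For longer words the exponents themselves are `O(log u)` and smaller
than `w`. -/
theorem index_lt (h : Admissible A B u r t k w) :
    (par w u r t k).τ + (par w u r t k).δ + (par w u r t k).M < w := by
  have hb := h.bounds
  have hK := hb.K1
  have hw : (0 : ℝ) < w := by exact_mod_cast h.w0
  have hΛ := hb.Λ1
  have htV := hb.one_le_tV
  have hsp := h.space'
  set p := par w u r t k
  set K : ℝ := ((parConst A B : ℕ) : ℝ)
  set Λ := Real.logb 2 u
  set V := (k : ℝ) * (u : ℝ) ^ (1 / (t : ℝ))
  rcases le_or_gt (w : ℝ) (33 * K * Λ) with h1 | h1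
  · have h2 := hb.XDE
    have h3 : t * V ≤ 33 * K * (t * V * (Λ / w)) := by
      have : t * V * w ≤ t * V * (33 * K * Λ) := mul_le_mul_of_nonneg_left h1 (by linarith)
      rw [← mul_div_assoc, ← mul_div_assoc, le_div_iff₀ hw]
      linarith
    set y := t * V * (Λ / w)
    have hy : 0 ≤ y := by positivity
    have h4 : (2 : ℝ) ^ (p.τ + p.δ + p.M) < 2 ^ w := calc
      (2 : ℝ) ^ (p.τ + p.δ + p.M) ≤ 512 * K ^ 2 * (33 * K * y) :=
        h2.trans (mul_le_mul_of_nonneg_left h3 (by positivity))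
      _ = 16896 * (K ^ 3 * y) := by ring
      _ ≤ 16896 * (K ^ 4 * y) := by
        have := mul_le_mul_of_nonneg_right (pow_le_pow_right₀ hK (show 3 ≤ 4 by norm_num)) hy
        linarith
      _ < 10 ^ 8 * K ^ 4 * (1 + y) := by
        have h5 : 0 < K ^ 4 := by positivity
        have h6 : 0 ≤ K ^ 4 * y := by positivity
        linarith
      _ ≤ 2 ^ w := hsp
    exact (pow_lt_pow_iff_right₀ (by norm_num)).1 h4
  · have hs : (1 : ℝ) ≤ p.s := by exact_mod_cast Nat.one_le_two_pow (n := p.α)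
    have hX := ParBounds.one_le_X p
    have h2 : (p.τ : ℝ) ≤ 2 ^ p.τ := by exact_mod_cast Nat.lt_two_pow_self.le
    have h3 : (p.δ : ℝ) ≤ 2 ^ p.δ := by exact_mod_cast Nat.lt_two_pow_self.le
    have h4 : (2 : ℝ) ^ p.τ ≤ 2 ^ p.τ * p.s := le_mul_of_one_le_right (by positivity) hs
    have h5 : (p.s : ℝ) ≤ 2 ^ p.τ * p.s := le_mul_of_one_le_left (by positivity) hX
    have h6 : (p.M : ℝ) ≤ K * (16 * Λ) :=
      hb.M.trans (mul_le_mul_of_nonneg_left (h5.trans hb.Xs) (by linarith))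
    have h7 : Λ ≤ K * Λ := le_mul_of_one_le_left (by linarith) hK
    have h8 : K ≤ K * Λ := le_mul_of_one_le_right (by linarith) hΛ
    have h9 : ((p.τ + p.δ + p.M : ℕ) : ℝ) < w := by
      push_cast
      linarith [hb.Xs, hb.D]
    exact_mod_cast h9

theorem τ_pos (w u r t k : ℕ) : 1 ≤ (par w u r t k).τ := by
  show 1 ≤ 1 + _ + _
  omega

theorem S_le (h : Admissible A B u r t k w) : (par w u r t k).S ≤ 2 ^ w := by
  have h1 := h.bounds.S (τ_pos w u r t k)
  have h2 := h.space'
  have h3 : ((par w u r t k).S : ℝ) ≤ 2 ^ w := by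
    refine h1.trans (le_trans (mul_le_mul_of_nonneg_right ?_ ?_) h2)
    · have : (0 : ℝ) ≤ (parConst A B : ℝ) ^ 4 := by positivity
      linarith
    · have := h.bounds.one_le_tV
      have := h.Λ1
      have : (0 : ℝ) ≤ Real.logb 2 u / w := by positivity
      positivity
  exact_mod_cast h3

theorem valid (h : Admissible A B u r t k w) : (par w u r t k).Valid := by
  have hw := h.w7
  have hidx := h.index_lt
  have hS := h.S_le
  have hM : (par w u r t k).M = Nat.size k + 3 * 2 ^ chr w u t + 17 := rfl
  have hα : 1 ≤ 2 ^ chr w u t := Nat.one_le_two_pow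
  have hM1 : 1 ≤ (par w u r t k).M := by omega
  have hwl := wordLen_spec h.w0 h.r0
  have hlt : ∀ x, clg x < w → 2 ^ clg x < 2 ^ w := fun x hx => Nat.pow_lt_pow_right (by norm_num) hx
  have hr1 := h.r0
  refine ⟨hS, hw, (τ_pos w u r t k), (show (par w u r t k).M ≤ w by omega), hM1, le_two_pow_clg _, hlt _ ?_,
    two_pow_packed_le, hidx, (show 2 ^ chr w u t < (par w u r t k).M by omega), ?_, ?_, ?_, two_pow_packed_le,
    ?_, hwl.1, le_two_pow_clg _, ?_, ?_, ?_, ?_, ?_⟩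
  · exact (clg_le _).trans_lt (show (par w u r t k).M - 1 < w by omega)
  · show 8 + 2 * 2 ^ chr w u t + 2 ^ chr w u t * 2 ^ (Nat.size (Nat.size k) - chr w u t) < 2 ^ w
    have h1 : 2 ^ chr w u t * 2 ^ (Nat.size (Nat.size k) - chr w u t) ≤
        2 ^ chr w u t + 2 * Nat.size k := by
      rcases le_total (Nat.size (Nat.size k)) (chr w u t) with h1 | h1
      · rw [Nat.sub_eq_zero_of_le h1]; omega
      · rw [← pow_add, Nat.add_sub_cancel' h1]
        exact (two_pow_size_le (Nat.size_pos.2 h.k0)).trans (by omega)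
    have h2 : 2 * w < 2 ^ w := by
      obtain ⟨v, rfl⟩ := Nat.exists_eq_add_of_le' hw
      have := Nat.lt_two_pow_self (n := v)
      rw [pow_add]
      omega
    omega
  · show _ - _ < 1 + _ + _
    omega
  · show 2 ^ (if wordLen w r = 1 then clg (Nat.size (r - 1)) else clg w) < 2 ^ w
    split_ifs with h1
    · refine hlt _ ((clg_le _).trans_lt ?_)
      rw [h1, mul_one] at hwl
      have := Nat.size_le.2 (show r - 1 < 2 ^ w by omega)
      omega
    · have := clg_le w
      exact hlt _ (by omega)
  · show 0 < clg (wordLen w r) → Nat.size w - 1 - (if wordLen w r = 1 then _ else clg w) = 0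
    intro h1
    rw [if_neg (fun h2 => by rw [h2] at h1; simp [clg] at h1)]
    have h2 : Nat.size w ≤ clg w + 1 := by
      refine Nat.size_le.2 ?_
      have := le_two_pow_clg w
      rw [pow_succ]
      have := Nat.two_pow_pos (clg w)
      omega
    omega
  · show 2 ^ ((par w u r t k).τ + (par w u r t k).δ + (par w u r t k).M + clg (wordLen w r) - 1) < 2 ^ w
    rcases Nat.eq_zero_or_pos (clg (wordLen w r)) with h1 | h1
    · rw [h1]
      exact Nat.pow_lt_pow_right (by norm_num) (by omega)
    -- Values of several words are not packed, so each digit takes a word of memory and `NV` is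
    -- bounded by the space.
    · have h2 : (par w u r t k).gr = 0 := by
        show Nat.size w - 1 - (if wordLen w r = 1 then _ else clg w) = 0
        rw [if_neg (fun h2 => by rw [h2] at h1; simp [clg] at h1)]
        have h2 : Nat.size w ≤ clg w + 1 := by
          refine Nat.size_le.2 ?_
          have := le_two_pow_clg w
          rw [pow_succ]
          have := Nat.two_pow_pos (clg w)
          omega
        omega
      have h3 : (par w u r t k).VW = 2 ^ ((par w u r t k).τ + (par w u r t k).δ + (par w u r t k).M +
          clg (wordLen w r) - 1) := by
        unfold Par.VW
        rw [h2]
        rfl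
      have h4 : (par w u r t k).S = (par w u r t k).bV + (par w u r t k).VW := rfl
      have h5 : 24 ≤ (par w u r t k).bV := by
        have := Nat.two_pow_pos (par w u r t k).q
        unfold Par.bV Par.bT Par.b1 Par.b0 Par.bA Par.bR
        omega
      omega
  · show r - 1 < 2 ^ (w * wordLen w r)
    omega
  · show 2 ^ (w * (wordLen w r - 1)) ≤ r - 1 + 1
    omega
  · show wordLen w r = 1 → r - 1 < 2 ^ 2 ^ (if wordLen w r = 1 then clg (Nat.size (r - 1)) else clg w)
    intro h1
    rw [if_pos h1]
    exact (Nat.lt_size_self _).trans_le (Nat.pow_le_pow_right (by norm_num) (le_two_pow_clg _))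
  · show wordLen w r ≠ 1 → w ≤ 2 ^ (if wordLen w r = 1 then clg (Nat.size (r - 1)) else clg w)
    intro h1
    rw [if_neg h1]
    exact le_two_pow_clg w

theorem wordLen_u_le (h : Admissible A B u r t k w) :
    (wordLen w u : ℝ) ≤ 1 + Real.logb 2 u / w := by
  have hw : (0 : ℝ) < w := by exact_mod_cast h.w0
  obtain ⟨h1, h2, -⟩ := wordLen_spec (x := u) h.w0 (by have := h.u2; omega)
  have h3 := le_logb h2
  push_cast [Nat.cast_sub h1] at h3
  have : (wordLen w u : ℝ) - 1 ≤ Real.logb 2 u / w := by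
    rw [le_div_iff₀ hw]
    linarith
  linarith

theorem sel (h : Admissible A B u r t k w) :
    Sel (par w u r t k) (fun i => [u, r, t, k].getD i 0) (wordLen w u) (wordLen w t) := by
  have hw := h.w7
  have hu := wordLen_spec (x := u) h.w0 (by have := h.u2; omega)
  have ht := wordLen_spec h.w0 h.t0
  refine ⟨h.valid, h.u2, h.r0, h.t0, h.k0, ?_, hu.1, ?_, fun h1 => ?_, ?_, fun h1 => ?_, h.lam_lt, rfl,
    rfl, rfl, rfl, rfl, rfl, rfl, rfl, rfl, rfl, rfl, rfl⟩
  · show k < 2 ^ w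
    have h1 := h.index_lt
    have h2 : (par w u r t k).M = Nat.size k + 3 * 2 ^ chr w u t + 17 := rfl
    exact (Nat.lt_size_self k).trans_le (Nat.pow_le_pow_right (by norm_num) (by omega))
  · show wordLen w u < 2 ^ w
    have h1 := h.wordLen_u_le
    have h2 := h.space'
    have h3 : (1 : ℝ) ≤ parConst A B ^ 4 := one_le_pow₀ (K1 A B)
    have h4 := h.bounds.one_le_tV
    have h5 : 0 < Real.logb 2 u / (w : ℝ) := h.bounds.L0
    have h6 : Real.logb 2 u / w ≤ t * (k * (u : ℝ) ^ (1 / (t : ℝ))) * (Real.logb 2 u / w) :=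
      le_mul_of_one_le_left h5.le h4
    have h8 := le_mul_of_one_le_left (show 0 ≤ 1 + t * (k * (u : ℝ) ^ (1 / (t : ℝ))) *
      (Real.logb 2 u / w) by linarith) h3
    have h7 : (wordLen w u : ℝ) < 2 ^ w := by linarith
    exact_mod_cast h7
  · show u < 2 ^ w
    have := hu.2.2
    rwa [h1, mul_one] at this
  · show wordLen w t < 2 ^ w
    have h1 := h.t_Λ
    have h2 : (t : ℝ) < 2 ^ (w * 2) := by
      have h3 : (t : ℝ) ≤ t * Real.logb 2 u := le_mul_of_one_le_right (by positivity) h.Λ1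
      have h4 : (w : ℝ) < 2 ^ w := by exact_mod_cast Nat.lt_two_pow_self
      rw [mul_two, pow_add]
      exact (h3.trans h1).trans_lt (mul_lt_mul_of_pos_left h4 (by positivity))
    have h3 : t < 2 ^ (w * 2) := by exact_mod_cast h2
    have h4 := (Nat.pow_lt_pow_iff_right (a := 2) (by norm_num)).1 (ht.2.1.trans_lt h3)
    have h5 : wordLen w t - 1 < 2 := lt_of_mul_lt_mul_left h4 (Nat.zero_le w)
    have := Nat.lt_two_pow_self (n := w)
    omega
  · show t < 2 ^ w
    have := ht.2.2
    rwa [h1, mul_one] at this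

theorem size_k_lt (w u r t k : ℕ) :
    Nat.size k < (par w u r t k).s * 2 ^ (par w u r t k).ℓ := by
  show Nat.size k < 2 ^ chr w u t * 2 ^ (Nat.size (Nat.size k) - chr w u t)
  rw [← pow_add]
  exact (Nat.lt_size_self _).trans_le (Nat.pow_le_pow_right (by norm_num) (by omega))

/-- The lower bound on the length of a character: `64 * s ≥ log u / t`. -/
theorem error_le (h : Admissible A B u r t k w) :
    ((2 : ℝ) ^ (64 * (par w u r t k).s))⁻¹ ≤ (u : ℝ) ^ (-(1 / (t : ℝ))) := by
  rw [Real.rpow_neg (Nat.cast_nonneg _)]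
  have h0 := h.U1
  refine inv_anti₀ (by linarith) ?_
  rw [h.U_eq, one_mul, ← Real.rpow_natCast]
  refine Real.rpow_le_rpow_of_exponent_le (by norm_num) (h.Λ_le_chr.trans_eq ?_)
  show (64 * 2 ^ chr w u t : ℝ) = ((64 * 2 ^ chr w u t : ℕ) : ℝ)
  push_cast
  rfl

/-- If `r < 2 ^ w`, it has a single word and the divisor is 1. Otherwise `r` is a power of two that
is at least as large as the divisor. -/
theorem dvd_r (h : Admissible A B u r t k w) (hr : r ≤ 2 ^ w ∨ ∃ j : ℕ, r = 2 ^ j) :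
    2 ^ (w * (wordLen w r - 1)) ∣ r := by
  obtain ⟨h1, h2, h3⟩ := wordLen_spec h.w0 h.r0
  have h4 : ∃ j, r = 2 ^ j ∨ wordLen w r = 1 := by
    rcases hr with hr | ⟨j, hj⟩
    · rcases hr.eq_or_lt with hr | hr
      · exact ⟨w, .inl hr⟩
      · refine ⟨0, .inr ?_⟩
        have h4 := (Nat.pow_lt_pow_iff_right (a := 2) (by norm_num)).1 (h2.trans_lt hr)
        have h5 : wordLen w r - 1 < 1 := lt_of_mul_lt_mul_left (h4.trans_eq (mul_one w).symm) (Nat.zero_le w)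
        omega
    · exact ⟨j, .inl hj⟩
  rcases h4 with ⟨j, hj | hj⟩
  · exact (Nat.pow_dvd_pow 2 ((Nat.pow_le_pow_iff_right (by norm_num)).1 (h2.trans_eq hj))).trans
      hj.symm.dvd
  · rw [hj]; simp

end Admissible

end WordRAM

/-! ### Assembly of the main theorem. -/

theorem corollary3 :
    ∃ D : WordRAM.HashProgram, ∀ A B : ℕ, ∃ C : ℝ,
      ∀ u r t k w : ℕ, 2 ≤ u → 0 < r → 0 < t → 0 < k → 0 < w →
        r ≤ u ^ A → (k : ℝ) ≤ (u : ℝ) ^ ((B : ℝ) / (t : ℝ)) →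
        C * spaceBound u t k w ≤ (2 : ℝ) ^ w →
        ∃ S Tinit Teval : ℕ,
          (S : ℝ) ≤ C * spaceBound u t k w ∧
          (Teval : ℝ) ≤ C * evalBound u t w ∧
          (Tinit : ℝ) ≤ C * initBound u t k w ∧
          WordRAM.AlwaysHalted (D.runSelect w S u r t k Tinit) ∧
          (∀ m ∈ (WordRAM.memLaw (D.runSelect w S u r t k Tinit)).support,
            WordRAM.AlwaysHalted (D.runSample m Tinit) ∧
            (∀ m' ∈ (WordRAM.memLaw (D.runSample m Tinit)).support,
              ∃ f : Fin u → Fin r, D.Represents Teval m' f) ∧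
            ((r ≤ 2 ^ w ∨ ∃ j : ℕ, r = 2 ^ j) →
              ∀ f ∈ D.family Tinit Teval u r m,
                (WordRAM.memLaw (D.runSample m Tinit)).toOuterMeasure
                    {m' | D.Represents Teval m' f} =
                  ((D.family Tinit Teval u r m).ncard : ENNReal)⁻¹)) ∧
          ENNReal.ofReal (1 - (u : ℝ) ^ (-(1 / (t : ℝ)))) ≤
            (WordRAM.memLaw (D.runSelect w S u r t k Tinit)).toOuterMeasure
              {m | KIndependent k (D.family Tinit Teval u r m)} := by
  -- A single constant serves for space, times and word size; `10 ^ 8` comes from the evaluation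
  -- time, the largest of the bounds.
  refine ⟨WordRAM.hashProgram, fun A B => ⟨10 ^ 8 * (WordRAM.parConst A B : ℝ) ^ 4, ?_⟩⟩
  intro u r t k w hu hr ht hk hw hrA hkB hsp
  have h : WordRAM.Admissible A B u r t k w := ⟨hu, hr, ht, hk, hw, hrA, hkB, hsp⟩
  have hb := h.bounds
  have hsel := h.sel
  have hp := h.valid
  have : NeZero r := ⟨hr.ne'⟩
  set p := WordRAM.par w u r t k with hpdef
  -- Halted configurations do not change, so both initialization programs can be run for the larger
  -- of the two times.
  set T := max (p.selectTime (WordRAM.wordLen w u)) p.sampleTime with hT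
  have hT₁ : p.selectTime (WordRAM.wordLen w u) ≤ T := le_max_left _ _
  have hT₂ : p.sampleTime ≤ T := le_max_right _ _
  have hR : p.R + 1 = r := Nat.sub_add_cancel hr
  obtain ⟨hhalt, G, hG, hfam⟩ := WordRAM.select_law hsel rfl hT₁
  have hK : (0 : ℝ) ≤ (WordRAM.parConst A B : ℝ) ^ 4 := by positivity
  have htV := hb.one_le_tV
  have hL := hb.L0
  have hlog := hb.Λ1
  refine ⟨p.S, T, p.evalTime, ?_, ?_, ?_, hhalt, fun m hm => ?_, ?_⟩
  · refine (hb.S (WordRAM.Admissible.τ_pos w u r t k)).trans ?_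
    have h1 : spaceBound u t k w = 1 + t * (k * (u : ℝ) ^ (1 / (t : ℝ))) * (Real.logb 2 u / p.w) := by
      show spaceBound u t k w = 1 + t * (k * (u : ℝ) ^ (1 / (t : ℝ))) * (Real.logb 2 u / w)
      unfold spaceBound
      ring
    rw [h1]
    exact mul_le_mul_of_nonneg_right (by linarith) (by positivity)
  · exact hb.eval
  · rw [hT, Nat.cast_max]
    refine (hb.init (WordRAM.Admissible.τ_pos w u r t k) h.wordLen_u_le).trans ?_
    have h1 : initBound u t k w =
        t * (k * (u : ℝ) ^ (1 / (t : ℝ))) * (1 + Real.logb 2 u / p.w) + p.w := by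
      show initBound u t k w = t * (k * (u : ℝ) ^ (1 / (t : ℝ))) * (1 + Real.logb 2 u / w) + w
      unfold initBound
      ring
    rw [h1]
    exact mul_le_mul_of_nonneg_right (by linarith) (by positivity)
  · have hm1 : WordRAM.Fam p (WordRAM.natMem (w := p.w) (S := p.S) m) := by
      -- The type ascription uses that `p.w` unfolds to `w`.
      have hm' : (m : WordRAM.Mem p.w p.S) ∈ ((PMF.uniformOfFintype _).map G).support := hG ▸ hm
      obtain ⟨ω, -, hω⟩ := (PMF.mem_support_map_iff _ _ _).1 hm'
      rw [← hω]
      exact (hfam ω).1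
    exact ⟨WordRAM.alwaysHalted_sample hp hm1 hT₂,
      WordRAM.exists_represents hp hm1 hT₂ le_rfl hR,
      fun hr' f hf => WordRAM.uniform_sample hp hm1 hT₂ le_rfl hR (h.dvd_r hr') hf⟩
  · refine le_trans (ENNReal.ofReal_le_ofReal ?_)
      (WordRAM.kIndependent_select hsel rfl hT₁ hT₂ le_rfl (WordRAM.Admissible.size_k_lt w u r t k))
    linarith [h.error_le]
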